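/- Manifolds are smooth, Hausdorff and second countable; indices run over $1,2,3$, repeated indices are summed, $\delta^i_j$ is the Kronecker symbol, and $\epsilon_{ijk}=\epsilon^{ijk}$ is totally skew with $\epsilon_{123}=1$. **Setting.** Let $M$ be a $6$-manifold and $D\subset TM$ a smooth $3$-plane field with $D+[D,D]=TM$, i.e. every point has a neighborhood on which $D$ is spanned by smooth vector fields $X_1,X_2,X_3$ such that $X_1,X_2,X_3,[X_2,X_3],[X_3,X_1],[X_1,X_2]$ are everywhere linearly independent. On $\mathbb R^7=\mathbb R^3\oplus\mathbb R\oplus\mathbb R^3$ let $$Q=\begin{pmatrix}0&0&I_3\\0&2&0\\I_3&0&0\end{pmatrix},$$ a symmetric matrix of type $(4,3)$; let $\mathrm{SO}(4,3)=\{g: {}^tgQg=Q,\ \det g=1\}$, with Lie algebra $\mathfrak{so}(4,3)=\{a: Qa+{}^taQ=0\}$, and let $H\subset\mathrm{SO}(4,3)$ be the stabilizer of the null $3$-plane spanned by the first three basis vectors. An *adapted bundle* for $(M,D)$ is a smooth principal right $H$-bundle $\pi:B\to M$ ($\dim B=21$) with a smooth coframing by $21$ one-forms $\theta_i,\omega^i,\alpha^i_j,\beta_i,\tau^i$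 such that: (i) $d\pi(v)\in D$ if and only if $\theta_1(v)=\theta_2(v)=\theta_3(v)=0$, for all tangent vectors $v$ of $B$; (ii) the $\mathfrak{so}(4,3)$-valued $1$-form $$\gamma=\begin{pmatrix}-{}^t\alpha&2\beta&-[\tau]\\ {}^t\omega&0&-{}^t\beta\\ [\theta]&-2\omega&\alpha\end{pmatrix},\qquad \alpha=(\alpha^i_j),\quad [\theta]_{ij}=\epsilon_{ijk}\theta_k,\quad [\tau]_{ij}=\epsilon_{ijk}\tau^k,$$ is a Cartan connection: $\gamma_b:T_bB\to\mathfrak{so}(4,3)$ is bijective for every $b$, $R_h^*\gamma=h^{-1}\gamma h$ for $h\in H$, and $\gamma$ sends the fundamental vertical vector field of each element $X$ of the Lie algebra of $H$ to $X$; (iii) the structure equations $$\begin{aligned} d\theta_i&=-\alpha^k_k\wedge\theta_i+\alpha^j_i\wedge\theta_j+\epsilon_{ijk}\,\omega^j\wedge\omega^k,\\ d\omega^i&=-\epsilon^{ikj}\beta_k\wedge\theta_j-\alpha^i_j\wedge\omega^j,\\ d\alpha^i_j&=-\alpha^i_k\wedge\alpha^k_j-2\,\omega^i\wedge\beta_j+\delta^i_j\,\tau^k\wedge\theta_k-\tau^i\wedge\theta_j+S^i_{jk}\epsilon^{klm}\theta_l\wedge\theta_m+S^{ik}_{jl}\,\theta_k\wedge\omega^l,\\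 d\beta_i&=\alpha^j_i\wedge\beta_j+\epsilon_{ijk}\,\tau^j\wedge\omega^k-2S^j_{ik}\,\theta_j\wedge\omega^k+\epsilon^{jkl}S_{ij}\,\theta_k\wedge\theta_l \end{aligned}$$ hold for some smooth functions $S$ on $B$ satisfying $$S_{ij}=S_{ji},\quad S^i_{jk}=S^i_{kj},\quad S^i_{ik}=0,\quad S^{ik}_{jl}=S^{ki}_{jl}=S^{ik}_{lj},\quad S^{ik}_{ij}=0.$$ **Theorem.** Let $(M,D)$ and $(M',D')$ be two such manifolds with plane fields (for instance the same one twice). 1. $(M,D)$ has an adapted bundle $B_3\to M$. 2. Let $B\to M$ and $B'\to M'$ be adapted bundles for $(M,D)$ and $(M',D')$. Every diffeomorphism $\phi:M\to M'$ with $d\phi(D)=D'$ has a lift $\hat\phi:B\to B'$, a diffeomorphism that covers $\phi$ and pulls the coframing of $B'$ back to the coframing of $B$. This $\hat\phi$ is the only diffeomorphism with these two properties, and it is $H$-equivariant. (With $\phi=\mathrm{id}_M$ this says that $B_3$ with its coframing is unique up to a unique isomorphism over $M$, i.e. canonical.) 3. Conversely, every $H$-equivariant diffeomorphism $\Phi:B\to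 B'$ that pulls the coframing of $B'$ back to that of $B$ covers a unique diffeomorphism $\phi:M\to M'$ with $d\phi(D)=D'$; thus $\Phi=\hat\phi$. -/

import Mathlib

open scoped Manifold ContDiff
open Set

universe u

noncomputable section

namespace ThreePlane

/-! ### Plane fields on `6`-manifolds -/

section PlaneFields

variable {M M' : Type*}
  [TopologicalSpace M] [ChartedSpace (EuclideanSpace ℝ (Fin 6)) M] [IsManifold (𝓡 6) ∞ M]
  [TopologicalSpace M'] [ChartedSpace (EuclideanSpace ℝ (Fin 6)) M']

/-- `D` is a smooth `3`-plane field with `D + [D, D] = TM`: near every point, `D` is spanned by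
smooth vector fields `X₀, X₁, X₂` for which the six fields
`X₀, X₁, X₂, [X₁, X₂], [X₂, X₀], [X₀, X₁]` are pointwise linearly independent. -/
def IsMaximallyNonintegrable (D : ∀ x : M, Submodule ℝ (TangentSpace (𝓡 6) x)) : Prop :=
  ∀ x : M, ∃ U : Set M, IsOpen U ∧ x ∈ U ∧
    ∃ X : Fin 3 → ∀ y : M, TangentSpace (𝓡 6) y,
      (∀ i, ContMDiffOn (𝓡 6) (𝓡 6).tangent ∞
        (fun y => (⟨y, X i y⟩ : TangentBundle (𝓡 6) M)) U) ∧
      ∀ y ∈ U, D y = Submodule.span ℝ (range fun i => X i y) ∧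
        LinearIndependent ℝ ![X 0 y, X 1 y, X 2 y,
          VectorField.mlieBracket (𝓡 6) (X 1) (X 2) y,
          VectorField.mlieBracket (𝓡 6) (X 2) (X 0) y,
          VectorField.mlieBracket (𝓡 6) (X 0) (X 1) y]

/-- The differential of `φ` carries `D` onto `D'`. -/
def PreservesPlanes (D : ∀ x : M, Submodule ℝ (TangentSpace (𝓡 6) x))
    (D' : ∀ x : M', Submodule ℝ (TangentSpace (𝓡 6) x)) (φ : M → M') : Prop :=
  ∀ x : M, (D x).map (mfderiv (𝓡 6) (𝓡 6) φ x).toLinearMap = D' (φ x)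

end PlaneFields

/-! ### Differential forms on a manifold -/

section Forms

variable {n : ℕ} {B B' : Type*}
  [TopologicalSpace B] [ChartedSpace (EuclideanSpace ℝ (Fin n)) B]
  [TopologicalSpace B'] [ChartedSpace (EuclideanSpace ℝ (Fin n)) B']

variable (n B) in
/-- (Not necessarily smooth) `1`-forms. -/
abbrev OneForm : Type _ := ∀ b : B, TangentSpace (𝓡 n) b →L[ℝ] ℝ

variable (n B) in
/-- Functions of a point and two tangent vectors there; `2`-forms are regarded as such. -/
abbrev TwoForm : Type _ := ∀ b : B, TangentSpace (𝓡 n) b → TangentSpace (𝓡 n) b → ℝ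

/-- The expression of a `1`-form in the preferred chart at `b₀`, i.e. its pullback by the inverse
of that chart. -/
def OneForm.inChart (η : OneForm n B) (b₀ : B) (y : EuclideanSpace ℝ (Fin n)) :
    EuclideanSpace ℝ (Fin n) →L[ℝ] ℝ :=
  (η ((extChartAt (𝓡 n) b₀).symm y)).comp
    (mfderiv 𝓘(ℝ, EuclideanSpace ℝ (Fin n)) (𝓡 n) (extChartAt (𝓡 n) b₀).symm y)

/-- Smoothness of a `1`-form: smoothness of its chart expressions. -/
def OneForm.IsSmooth (η : OneForm n B) : Prop :=
  ∀ b₀ : B, ContDiffOn ℝ ∞ (η.inChart b₀) (extChartAt (𝓡 n) b₀).target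

/-- The exterior derivative `dη (v, w)` at `b`, computed in the preferred chart at `b`;
normalized by `dη (V, W) = V (η W) - W (η V) - η [V, W]`. -/
def OneForm.d (η : OneForm n B) : TwoForm n B := fun b v w =>
  extDeriv
    (fun y => ContinuousAlternatingMap.ofSubsingleton ℝ (EuclideanSpace ℝ (Fin n)) ℝ (0 : Fin 1)
      (η.inChart b y))
    (extChartAt (𝓡 n) b b)
    ![mfderiv (𝓡 n) 𝓘(ℝ, EuclideanSpace ℝ (Fin n)) (extChartAt (𝓡 n) b) b v,
      mfderiv (𝓡 n) 𝓘(ℝ, EuclideanSpace ℝ (Fin n)) (extChartAt (𝓡 n) b) b w]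

/-- The wedge product of two `1`-forms. -/
def OneForm.wedge (η ζ : OneForm n B) : TwoForm n B := fun b v w =>
  η b v * ζ b w - η b w * ζ b v

/-- The pullback of a `1`-form. -/
def OneForm.pullback (Φ : B → B') (η : OneForm n B') : OneForm n B := fun b =>
  (η (Φ b)).comp (mfderiv (𝓡 n) (𝓡 n) Φ b)

end Forms

local infixl:72 " ⋏ " => OneForm.wedge

/-- The totally skew symbol `ε` on three indices, with `ε 0 1 2 = 1`. -/
def ε (i j k : Fin 3) : ℝ :=
  (((j : ℕ) : ℝ) - ((i : ℕ) : ℝ)) * (((k : ℕ) : ℝ) - ((i : ℕ) : ℝ)) *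
    (((k : ℕ) : ℝ) - ((j : ℕ) : ℝ)) / 2

/-- The Kronecker symbol. -/
def δ (i j : Fin 3) : ℝ := if i = j then 1 else 0

/-! ### The group `SO(4,3)`, its Lie algebra and the stabilizer of a null `3`-plane -/

/-- The index set of the standard basis of `ℝ⁷ = ℝ³ ⊕ ℝ ⊕ ℝ³`. -/
abbrev Idx : Type := Fin 3 ⊕ Fin 1 ⊕ Fin 3

/-- Real `7 × 7` matrices. -/
abbrev Mat : Type := Matrix Idx Idx ℝ

/-- The symmetric matrix, of type `(4,3)`, with rows `(0, 0, I₃)`, `(0, 2, 0)`, `(I₃, 0, 0)`. -/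
def Q : Mat := Matrix.of fun
  | .inl i, .inr (.inr j) => δ i j
  | .inr (.inl _), .inr (.inl _) => 2
  | .inr (.inr i), .inl j => δ i j
  | _, _ => 0

/-- `SO(4,3)`. -/
def SO43 : Subgroup (Matrix.SpecialLinearGroup Idx ℝ) where
  carrier := {g | (g : Mat).transpose * Q * (g : Mat) = Q}
  one_mem' := by simp
  mul_mem' := by
    intro g h hg hh
    simp only [mem_ofPred_eq, Matrix.SpecialLinearGroup.coe_mul, Matrix.transpose_mul] at *
    calc (h : Mat).transpose * (g : Mat).transpose * Q * ((g : Mat) * (h : Mat))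
        = (h : Mat).transpose * ((g : Mat).transpose * Q * (g : Mat)) * (h : Mat) := by
          simp only [Matrix.mul_assoc]
      _ = Q := by rw [hg, hh]
  inv_mem' := by
    intro g hg
    simp only [mem_ofPred_eq] at *
    have h1 : (g : Mat) * ((g⁻¹ : Matrix.SpecialLinearGroup Idx ℝ) : Mat) = 1 := by
      rw [← Matrix.SpecialLinearGroup.coe_mul, mul_inv_cancel, Matrix.SpecialLinearGroup.coe_one]
    have h2 : ((g⁻¹ : Matrix.SpecialLinearGroup Idx ℝ) : Mat).transpose * (g : Mat).transpose
        = 1 := by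
      rw [← Matrix.transpose_mul, h1, Matrix.transpose_one]
    set k := ((g⁻¹ : Matrix.SpecialLinearGroup Idx ℝ) : Mat)
    calc k.transpose * Q * k
        = k.transpose * ((g : Mat).transpose * Q * (g : Mat)) * k := by rw [hg]
      _ = (k.transpose * (g : Mat).transpose) * Q * ((g : Mat) * k) := by
          simp only [Matrix.mul_assoc]
      _ = Q := by rw [h1, h2]; simp

/-- The Lie algebra `so(4,3)`: the matrices `a` with `aᵀ Q = - Q a`. -/
def so43 : Submodule ℝ Mat := skewAdjointMatricesSubmodule Q

/-- The null `3`-plane spanned by the first three basis vectors. -/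
def nullPlane : Submodule ℝ (Idx → ℝ) where
  carrier := {v | ∀ x, v (.inr x) = 0}
  zero_mem' := by simp
  add_mem' := by intro v w hv hw x; simp [hv x, hw x]
  smul_mem' := by intro c v hv x; simp [hv x]

/-- The subgroup of `SO(4,3)` that stabilizes the null `3`-plane. -/
def H : Subgroup (Matrix.SpecialLinearGroup Idx ℝ) where
  carrier := {g | g ∈ SO43 ∧ ∀ v, (g : Mat).mulVec v ∈ nullPlane ↔ v ∈ nullPlane}
  one_mem' := ⟨SO43.one_mem, by simp⟩
  mul_mem' := by
    rintro g h ⟨hg, hg'⟩ ⟨hh, hh'⟩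
    refine ⟨SO43.mul_mem hg hh, fun v => ?_⟩
    rw [Matrix.SpecialLinearGroup.coe_mul, ← Matrix.mulVec_mulVec, hg', hh']
  inv_mem' := by
    rintro g ⟨hg, hg'⟩
    refine ⟨SO43.inv_mem hg, fun v => ?_⟩
    rw [← hg', Matrix.mulVec_mulVec, ← Matrix.SpecialLinearGroup.coe_mul, mul_inv_cancel,
      Matrix.SpecialLinearGroup.coe_one, Matrix.one_mulVec]

/-- The matrix of an element of `H`. -/
def H.mat (h : H) : Mat := ((h : Matrix.SpecialLinearGroup Idx ℝ) : Mat)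

/-- The `49` matrix entries of an element of `H`, as a point of a normed space. -/
def H.entries (h : H) : Idx → Idx → ℝ := fun i j => H.mat h i j

/-- The `so(4,3)`-matrix with components `(θ, ω, α, β, τ)`; here `alpha i j` stands for `α^i_j`. -/
def gammaMatrix (theta omega : Fin 3 → ℝ) (alpha : Fin 3 → Fin 3 → ℝ) (beta tau : Fin 3 → ℝ) : Mat :=
  Matrix.of fun
  | .inl i, .inl j => - alpha j i
  | .inl i, .inr (.inl _) => 2 * beta i
  | .inl i, .inr (.inr j) => - ∑ k, ε i j k * tau k
  | .inr (.inl _), .inl j => omega j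
  | .inr (.inl _), .inr (.inl _) => 0
  | .inr (.inl _), .inr (.inr j) => - beta j
  | .inr (.inr i), .inl j => ∑ k, ε i j k * theta k
  | .inr (.inr i), .inr (.inl _) => -2 * omega i
  | .inr (.inr i), .inr (.inr j) => alpha i j

/-! ### Principal `H`-bundles, coframings and Cartan connections -/

section Bundles

variable {M : Type*} [TopologicalSpace M] [ChartedSpace (EuclideanSpace ℝ (Fin 6)) M]
  {B B' : Type*}
  [TopologicalSpace B] [ChartedSpace (EuclideanSpace ℝ (Fin 21)) B]
  [TopologicalSpace B'] [ChartedSpace (EuclideanSpace ℝ (Fin 21)) B']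

/-- `proj : B → M` with the right action `act` is a smooth principal right `H`-bundle.
The closed subgroup `H` carries the smooth structure of a submanifold of the space of matrices: a
map into `H` is smooth if its matrix entries are, and a map on `B × H` is smooth if it is smooth on
that subset of the product of `B` with the space of matrices. Local triviality: there are local sections `s` such that
every `b` over the domain of `s` is `s (proj b) · g b` with `g b ∈ H` depending smoothly on `b`. -/
structure IsPrincipalBundle (proj : B → M) (act : B → H → B) : Prop where
  smooth_proj : ContMDiff (𝓡 21) (𝓡 6) ∞ proj
  act_one : ∀ b, act b 1 = b
  act_mul : ∀ b g h, act (act b g) h = act b (g * h)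
  proj_act : ∀ b h, proj (act b h) = proj b
  free : ∀ b h, act b h = b → h = 1
  smooth_act : ∃ F : B × (Idx → Idx → ℝ) → B,
    ContMDiffOn ((𝓡 21).prod 𝓘(ℝ, Idx → Idx → ℝ)) (𝓡 21) ∞ F (univ ×ˢ range H.entries) ∧
    ∀ b h, F (b, H.entries h) = act b h
  locally_trivial : ∀ x : M, ∃ U : Set M, IsOpen U ∧ x ∈ U ∧ ∃ (s : M → B) (g : B → H),
    ContMDiffOn (𝓡 6) (𝓡 21) ∞ s U ∧ (∀ y ∈ U, proj (s y) = y) ∧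
    ContMDiffOn (𝓡 21) 𝓘(ℝ, Idx → Idx → ℝ) ∞ (fun b => H.entries (g b)) (proj ⁻¹' U) ∧
    ∀ b ∈ proj ⁻¹' U, act (s (proj b)) (g b) = b

variable (B) in
/-- `21` one-forms `θ_i`, `ω^i`, `α^i_j` (written `alpha i j`), `β_i`, `τ^i` on `B`. -/
structure FormSystem where
  theta : Fin 3 → OneForm 21 B
  omega : Fin 3 → OneForm 21 B
  alpha : Fin 3 → Fin 3 → OneForm 21 B
  beta : Fin 3 → OneForm 21 B
  tau : Fin 3 → OneForm 21 B

namespace FormSystem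

variable (c : FormSystem B)

/-- The forms constitute a smooth coframing: they are smooth and together identify each tangent
space with `ℝ²¹`. -/
structure IsCoframing : Prop where
  smooth_theta : ∀ i, (c.theta i).IsSmooth
  smooth_omega : ∀ i, (c.omega i).IsSmooth
  smooth_alpha : ∀ i j, (c.alpha i j).IsSmooth
  smooth_beta : ∀ i, (c.beta i).IsSmooth
  smooth_tau : ∀ i, (c.tau i).IsSmooth
  bijective : ∀ b, Function.Bijective fun v : TangentSpace (𝓡 21) b =>
    ((fun i => c.theta i b v, fun i => c.omega i b v, fun i j => c.alpha i j b v, fun i => c.beta i b v,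
      fun i => c.tau i b v) :
      (Fin 3 → ℝ) × (Fin 3 → ℝ) × (Fin 3 → Fin 3 → ℝ) × (Fin 3 → ℝ) × (Fin 3 → ℝ))

/-- The matrix-valued `1`-form `γ` assembled from the forms. -/
def gamma (b : B) (v : TangentSpace (𝓡 21) b) : Mat :=
  gammaMatrix (fun i => c.theta i b v) (fun i => c.omega i b v) (fun i j => c.alpha i j b v)
    (fun i => c.beta i b v) (fun i => c.tau i b v)

/-- `γ` is an `so(4,3)`-valued Cartan connection for the right action `act` of `H`: it identifies
each tangent space with `so(4,3)`, satisfies `R_h^* γ = h⁻¹ γ h`, and takes the value `k' 0` on the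
velocity at `t = 0` of `t ↦ b · k t`, for every smooth curve `k` in `H` with `k 0 = 1`. -/
structure IsCartanConnection (act : B → H → B) : Prop where
  bijOn : ∀ b, BijOn (c.gamma b) univ (so43 : Set Mat)
  equivariant : ∀ (h : H) (b : B) (v : TangentSpace (𝓡 21) b),
    c.gamma (act b h) (mfderiv (𝓡 21) (𝓡 21) (fun b' => act b' h) b v) =
      H.mat h⁻¹ * c.gamma b v * H.mat h
  vertical : ∀ (b : B) (k : ℝ → H), k 0 = 1 → ContDiff ℝ ∞ (fun t => H.entries (k t)) →
    c.gamma (act b (k 0)) (mfderiv 𝓘(ℝ, ℝ) (𝓡 21) (fun t => act b (k t)) 0 (1 : ℝ)) =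
      Matrix.of (deriv (fun t => H.entries (k t)) 0)

/-- The structure equations. The functions are written `S2 i j` for `S_{ij}`, `S3 i j k` for
`S^i_{jk}` and `S4 i k j l` for `S^{ik}_{jl}`. -/
def StructureEquations : Prop :=
  ∃ (S2 : Fin 3 → Fin 3 → B → ℝ) (S3 : Fin 3 → Fin 3 → Fin 3 → B → ℝ)
    (S4 : Fin 3 → Fin 3 → Fin 3 → Fin 3 → B → ℝ),
    (∀ i j, ContMDiff (𝓡 21) 𝓘(ℝ, ℝ) ∞ (S2 i j)) ∧
    (∀ i j k, ContMDiff (𝓡 21) 𝓘(ℝ, ℝ) ∞ (S3 i j k)) ∧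
    (∀ i k j l, ContMDiff (𝓡 21) 𝓘(ℝ, ℝ) ∞ (S4 i k j l)) ∧
    (∀ i j, S2 i j = S2 j i) ∧
    (∀ i j k, S3 i j k = S3 i k j) ∧
    (∀ k, ∑ i, S3 i i k = 0) ∧
    (∀ i k j l, S4 i k j l = S4 k i j l) ∧
    (∀ i k j l, S4 i k j l = S4 i k l j) ∧
    (∀ k j, ∑ i, S4 i k i j = 0) ∧
    ∀ (b : B) (v w : TangentSpace (𝓡 21) b),
      (∀ i, (c.theta i).d b v w =
        - ∑ k, (c.alpha k k ⋏ c.theta i) b v w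
        + ∑ j, (c.alpha j i ⋏ c.theta j) b v w
        + ∑ j, ∑ k, ε i j k * (c.omega j ⋏ c.omega k) b v w) ∧
      (∀ i, (c.omega i).d b v w =
        - ∑ k, ∑ j, ε i k j * (c.beta k ⋏ c.theta j) b v w
        - ∑ j, (c.alpha i j ⋏ c.omega j) b v w) ∧
      (∀ i j, (c.alpha i j).d b v w =
        - ∑ k, (c.alpha i k ⋏ c.alpha k j) b v w
        - 2 * (c.omega i ⋏ c.beta j) b v w
        + δ i j * ∑ k, (c.tau k ⋏ c.theta k) b v w
        - (c.tau i ⋏ c.theta j) b v w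
        + ∑ k, ∑ l, ∑ m, S3 i j k b * ε k l m * (c.theta l ⋏ c.theta m) b v w
        + ∑ k, ∑ l, S4 i k j l b * (c.theta k ⋏ c.omega l) b v w) ∧
      (∀ i, (c.beta i).d b v w =
        ∑ j, (c.alpha j i ⋏ c.beta j) b v w
        + ∑ j, ∑ k, ε i j k * (c.tau j ⋏ c.omega k) b v w
        - 2 * ∑ j, ∑ k, S3 j i k b * (c.theta j ⋏ c.omega k) b v w
        + ∑ j, ∑ k, ∑ l, ε j k l * S2 i j b * (c.theta k ⋏ c.theta l) b v w)

/-- `Φ` pulls the forms of `c'` back to the corresponding forms of `c`. -/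
def PreservedBy (c' : FormSystem B') (Φ : B → B') : Prop :=
  (∀ i, OneForm.pullback Φ (c'.theta i) = c.theta i) ∧
  (∀ i, OneForm.pullback Φ (c'.omega i) = c.omega i) ∧
  (∀ i j, OneForm.pullback Φ (c'.alpha i j) = c.alpha i j) ∧
  (∀ i, OneForm.pullback Φ (c'.beta i) = c.beta i) ∧
  (∀ i, OneForm.pullback Φ (c'.tau i) = c.tau i)

end FormSystem

end Bundles

/-- A principal right `H`-bundle over `M` with a coframing `(θ, ω, α, β, τ)` that is a Cartan
connection, satisfies the structure equations, and is adapted to `D` in that the tangent vectors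
annihilated by the `θ_i` are exactly those that project into `D`. -/
structure AdaptedBundle {M : Type u} [TopologicalSpace M]
    [ChartedSpace (EuclideanSpace ℝ (Fin 6)) M]
    (D : ∀ x : M, Submodule ℝ (TangentSpace (𝓡 6) x)) where
  carrier : Type u
  [topology : TopologicalSpace carrier]
  [charted : ChartedSpace (EuclideanSpace ℝ (Fin 21)) carrier]
  [manifold : IsManifold (𝓡 21) ∞ carrier]
  [t2 : T2Space carrier]
  [secondCountable : SecondCountableTopology carrier]
  proj : carrier → M
  act : carrier → H → carrier
  forms : FormSystem carrier
  principal : IsPrincipalBundle proj act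
  coframing : forms.IsCoframing
  cartan : forms.IsCartanConnection act
  structureEquations : forms.StructureEquations
  adapted : ∀ (b : carrier) (v : TangentSpace (𝓡 21) b),
    mfderiv (𝓡 21) (𝓡 6) proj b v ∈ D (proj b) ↔ ∀ i, forms.theta i b v = 0

attribute [instance] AdaptedBundle.topology AdaptedBundle.charted AdaptedBundle.manifold
  AdaptedBundle.t2 AdaptedBundle.secondCountable

end ThreePlane

end

open scoped Matrix Topology

noncomputable section

namespace ThreePlane

/-! ### Components of matrices in `so(4,3)` -/

/-! The objects compared throughout are gauges: `so(4,3)`-valued 1-forms `A` on open subsets of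
`ℝ⁶`, which arise as pullbacks of `γ` by local sections of an adapted bundle. Moving the section by
a map `h` into `H` replaces `A` by `h⁻¹Ah + h⁻¹dh` (`gaugeH`) and conjugates the curvature `dA + A ∧
A` (`curv_gaugeTransform`). The Maurer–Cartan term `h⁻¹dh` has no `θ`- or `ω`-component.

The structure equations say that the curvature has no `θ`- and `ω`-components and that its `α`- and
`β`-components are built from the functions `S`. For gauges this amounts to a frame-free condition,
`NormalAt`: besides the vanishing of the two torsion components, the `α`-component is trace-free
when one argument lies in `D`, and the `β`-component is symmetric on `D` in a suitable sense. All
other symmetries of the coefficients follow from the algebraic Bianchi identity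
(`NormalAt.curvSymm`, `NormalAt.al_eq`, `NormalAt.be_eq`). The condition is invariant under `H`
(`NormalAt.conj`).

The theorem then rests on two local facts, as in Cartan's equivalence method.

Existence (`exists_isGauge`): since `D + [D, D]` is everything, there is a coframe with `dθ_i ≡
ε_ijk ω^j ∧ ω^k` modulo `θ`. The rest of the `θ`-torsion is absorbed by `α`; the `ω`-torsion on `D`
is killed by adding symmetric multiples of `θ` to `ω`; what is left of it is absorbed by `α` and
`β`; finally `τ` is chosen to normalize the curvature. The Bianchi identity supplies the symmetry
and trace relations without which these absorptions would fail.

Uniqueness (`exists_gauge_eq`, `eq_one_of_gaugeH_eq`): two normal gauges of the same plane field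
differ by exactly one map into `H`. An element of `H` has coordinates `g ∈ GL(3)`, `b ∈ ℝ³`, `t ∈
ℝ³`. The coordinate `g` matches `ω` on `D`, after which `θ` agrees because it is determined by the
bracket `Λ²D → TM/D`; `b` removes the skew part of `ω` modulo `θ`; `t` matches `α`; then `β` is
forced by the equation for `dω` and `τ` by the normalization.

For part 1, uniqueness turns the transition functions of local normal gauges into a cocycle
(`GaugeAtlas.T_mul`) and makes the local connection forms agree, so the bundle and its coframing
exist; the functions `S` are smooth because the curvature determines them. For part 2, sections `ρ`,
`ρ'` with the same gauge define the local lift `ρ·h ↦ ρ'·h`. Two lifts that preserve the forms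
differ by a map into `H` that fixes a gauge, hence agree, so local lifts glue. For part 3, an
equivariant map descends, and it respects the plane fields because the `θ_i` detect them. -/

@[simp] theorem ε_left (i j : Fin 3) : ε i i j = 0 := by simp [ε]
@[simp] theorem ε_outer (i j : Fin 3) : ε i j i = 0 := by simp [ε]
@[simp] theorem ε_right (i j : Fin 3) : ε i j j = 0 := by simp [ε]
@[simp] theorem ε_012 : ε 0 1 2 = 1 := by norm_num [ε]
@[simp] theorem ε_120 : ε 1 2 0 = 1 := by norm_num [ε]
@[simp] theorem ε_201 : ε 2 0 1 = 1 := by norm_num [ε]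
@[simp] theorem ε_021 : ε 0 2 1 = -1 := by norm_num [ε]
@[simp] theorem ε_102 : ε 1 0 2 = -1 := by norm_num [ε]
@[simp] theorem ε_210 : ε 2 1 0 = -1 := by norm_num [ε]

@[simp] theorem δ_self (i : Fin 3) : δ i i = 1 := by simp [δ]
theorem δ_of_ne {i j : Fin 3} (h : i ≠ j) : δ i j = 0 := by simp [δ, h]
@[simp] theorem δ_01 : δ 0 1 = 0 := δ_of_ne (by decide)
@[simp] theorem δ_02 : δ 0 2 = 0 := δ_of_ne (by decide)
@[simp] theorem δ_10 : δ 1 0 = 0 := δ_of_ne (by decide)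
@[simp] theorem δ_12 : δ 1 2 = 0 := δ_of_ne (by decide)
@[simp] theorem δ_20 : δ 2 0 = 0 := δ_of_ne (by decide)
@[simp] theorem δ_21 : δ 2 1 = 0 := δ_of_ne (by decide)

theorem forall_fin_three {p : Fin 3 → Prop} : (∀ i, p i) ↔ p 0 ∧ p 1 ∧ p 2 := by
  simp [Fin.forall_fin_succ]

theorem forall_idx {p : Idx → Prop} : (∀ i, p i) ↔ (∀ i, p (.inl i)) ∧ p (.inr (.inl 0)) ∧
    ∀ i, p (.inr (.inr i)) := by
  simp [Sum.forall, Fin.forall_fin_succ]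

theorem sum_idx {R : Type*} [AddCommMonoid R] (f : Idx → R) : ∑ i, f i =
    ∑ i, f (.inl i) + (f (.inr (.inl 0)) + ∑ i, f (.inr (.inr i))) := by
  simp [Fintype.sum_sum_type]

/-- Addition in `Fin 3` is modulo 3, so `ε (k + 1) (k + 2) k = 1`, and a single entry of the skew
block `[θ]` recovers `θ_k`; the same holds for `ta` and `[τ]`. -/
def th (m : Mat) (k : Fin 3) : ℝ := m (.inr (.inr (k + 1))) (.inl (k + 2))
def om (m : Mat) (k : Fin 3) : ℝ := m (.inr (.inl 0)) (.inl k)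
def al (m : Mat) (i j : Fin 3) : ℝ := m (.inr (.inr i)) (.inr (.inr j))
def be (m : Mat) (k : Fin 3) : ℝ := -m (.inr (.inl 0)) (.inr (.inr k))
def ta (m : Mat) (k : Fin 3) : ℝ := -m (.inl (k + 1)) (.inr (.inr (k + 2)))

section
variable (p q : Fin 3 → ℝ) (r : Fin 3 → Fin 3 → ℝ) (s t : Fin 3 → ℝ)
@[simp] theorem th_gammaMatrix : th (gammaMatrix p q r s t) = p := by
  ext k; fin_cases k <;> simp [th, gammaMatrix, Fin.sum_univ_three]
@[simp] theorem om_gammaMatrix : om (gammaMatrix p q r s t) = q := by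
  ext k; simp [om, gammaMatrix]
@[simp] theorem al_gammaMatrix : al (gammaMatrix p q r s t) = r := by
  ext k; simp [al, gammaMatrix]
@[simp] theorem be_gammaMatrix : be (gammaMatrix p q r s t) = s := by
  ext k; simp [be, gammaMatrix]
@[simp] theorem ta_gammaMatrix : ta (gammaMatrix p q r s t) = t := by
  ext k; fin_cases k <;> simp [ta, gammaMatrix, Fin.sum_univ_three]

theorem gammaMatrix_mem_so43 : gammaMatrix p q r s t ∈ so43 := by
  rw [so43, mem_skewAdjointMatricesSubmodule, Matrix.IsSkewAdjoint, Matrix.IsAdjointPair]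
  ext i j
  revert i j
  simp only [forall_idx, forall_fin_three, Matrix.mul_apply, sum_idx, Fin.sum_univ_three]
  simp [Q, gammaMatrix, Matrix.transpose_apply, Fin.sum_univ_three, mul_comm]
end

/-- Skewness relative to `Q` makes the two off-diagonal `3 × 3` blocks skew, makes the diagonal ones
negative transposes of each other, and ties the central column to the central row with the factor 2
of `Q`. The 21 entries read off by the component functions are then all the freedom there is. -/
theorem eq_gammaMatrix {m : Mat} (hm : m ∈ so43) :
    m = gammaMatrix (th m) (om m) (al m) (be m) (ta m) := by
  rw [so43, mem_skewAdjointMatricesSubmodule, Matrix.IsSkewAdjoint, Matrix.IsAdjointPair] at hm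
  have h : ∀ i j, (m.transpose * Q) i j = (Q * -m) i j := fun i j => by rw [hm]
  simp only [forall_idx, forall_fin_three, Matrix.mul_apply, sum_idx, Fin.sum_univ_three] at h
  simp [Q, Matrix.transpose_apply] at h
  ext i j
  revert i j
  simp only [forall_idx, forall_fin_three]
  simp [gammaMatrix, th, om, al, be, ta, Fin.sum_univ_three]
  grind

theorem so43_ext {a b : Mat} (ha : a ∈ so43) (hb : b ∈ so43) (h1 : th a = th b) (h2 : om a = om b)
    (h3 : al a = al b) (h4 : be a = be b) (h5 : ta a = ta b) : a = b := by
  rw [eq_gammaMatrix ha, eq_gammaMatrix hb, h1, h2, h3, h4, h5]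

theorem exists_eq_gammaMatrix {m : Mat} (hm : m ∈ so43) : ∃ p q r s t, m = gammaMatrix p q r s t :=
  ⟨_, _, _, _, _, eq_gammaMatrix hm⟩

/-- This formula and the next three are the quadratic terms of the four structure equations, so that
those become conditions on the components of `dγ + γ ∧ γ`. No formula for the `τ`-component is
needed, as no equation for `dτ` is imposed. -/
theorem th_comm {a b : Mat} (ha : a ∈ so43) (hb : b ∈ so43) (i : Fin 3) :
    th (a * b - b * a) i =
      ∑ k, (al a k k * th b i - al b k k * th a i) - ∑ j, (al a j i * th b j - al b j i * th a j)
        - ∑ j, ∑ k, ε i j k * (om a j * om b k - om b j * om a k) := by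
  obtain ⟨p, q, r, s, t, rfl⟩ := exists_eq_gammaMatrix ha
  obtain ⟨p', q', r', s', t', rfl⟩ := exists_eq_gammaMatrix hb
  simp only [th_gammaMatrix, om_gammaMatrix, al_gammaMatrix, be_gammaMatrix, ta_gammaMatrix]
  revert i
  simp only [forall_fin_three, th, Matrix.sub_apply, Matrix.mul_apply, sum_idx, Fin.sum_univ_three]
  simp [gammaMatrix, Fin.sum_univ_three]
  refine ⟨?_, ?_, ?_⟩ <;> ring

theorem om_comm {a b : Mat} (ha : a ∈ so43) (hb : b ∈ so43) (i : Fin 3) :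
    om (a * b - b * a) i =
      ∑ k, ∑ j, ε i k j * (be a k * th b j - be b k * th a j)
        + ∑ j, (al a i j * om b j - al b i j * om a j) := by
  obtain ⟨p, q, r, s, t, rfl⟩ := exists_eq_gammaMatrix ha
  obtain ⟨p', q', r', s', t', rfl⟩ := exists_eq_gammaMatrix hb
  simp only [th_gammaMatrix, om_gammaMatrix, al_gammaMatrix, be_gammaMatrix, ta_gammaMatrix]
  revert i
  simp only [forall_fin_three, om, Matrix.sub_apply, Matrix.mul_apply, sum_idx, Fin.sum_univ_three]
  simp [gammaMatrix, Fin.sum_univ_three]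
  refine ⟨?_, ?_, ?_⟩ <;> ring

theorem al_comm {a b : Mat} (ha : a ∈ so43) (hb : b ∈ so43) (i j : Fin 3) :
    al (a * b - b * a) i j =
      ∑ k, (al a i k * al b k j - al b i k * al a k j)
        + 2 * (om a i * be b j - om b i * be a j)
        - δ i j * ∑ k, (ta a k * th b k - ta b k * th a k) + (ta a i * th b j - ta b i * th a j) := by
  obtain ⟨p, q, r, s, t, rfl⟩ := exists_eq_gammaMatrix ha
  obtain ⟨p', q', r', s', t', rfl⟩ := exists_eq_gammaMatrix hb
  simp only [th_gammaMatrix, om_gammaMatrix, al_gammaMatrix, be_gammaMatrix, ta_gammaMatrix]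
  revert i j
  simp only [forall_fin_three, al, Matrix.sub_apply, Matrix.mul_apply, sum_idx, Fin.sum_univ_three]
  simp [gammaMatrix, Fin.sum_univ_three]
  refine ⟨⟨?_, ?_, ?_⟩, ⟨?_, ?_, ?_⟩, ?_, ?_, ?_⟩ <;> ring

theorem be_comm {a b : Mat} (ha : a ∈ so43) (hb : b ∈ so43) (i : Fin 3) :
    be (a * b - b * a) i =
      - ∑ j, (al a j i * be b j - al b j i * be a j)
        - ∑ j, ∑ k, ε i j k * (ta a j * om b k - ta b j * om a k) := by
  obtain ⟨p, q, r, s, t, rfl⟩ := exists_eq_gammaMatrix ha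
  obtain ⟨p', q', r', s', t', rfl⟩ := exists_eq_gammaMatrix hb
  simp only [th_gammaMatrix, om_gammaMatrix, al_gammaMatrix, be_gammaMatrix, ta_gammaMatrix]
  revert i
  simp only [forall_fin_three, be, Matrix.sub_apply, Matrix.mul_apply, sum_idx, Fin.sum_univ_three]
  simp [gammaMatrix, Fin.sum_univ_three]
  refine ⟨?_, ?_, ?_⟩ <;> ring

theorem mem_so43_iff {m : Mat} : m ∈ so43 ↔ m.transpose * Q = -(Q * m) := by
  rw [so43, mem_skewAdjointMatricesSubmodule, Matrix.IsSkewAdjoint, Matrix.IsAdjointPair, mul_neg]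

theorem comm_mem_so43 {a b : Mat} (ha : a ∈ so43) (hb : b ∈ so43) : a * b - b * a ∈ so43 := by
  rw [mem_so43_iff] at *
  have h (x y : Mat) (hx : x.transpose * Q = -(Q * x)) (hy : y.transpose * Q = -(Q * y)) :
      x.transpose * y.transpose * Q = Q * x * y := by
    rw [mul_assoc, hy, mul_neg, ← mul_assoc, hx]; simp
  rw [Matrix.transpose_sub, Matrix.transpose_mul, Matrix.transpose_mul, sub_mul, h b a hb ha,
    h a b ha hb, mul_sub]
  noncomm_ring

/-! ### The group `H` -/

@[simp] theorem H.mat_one : H.mat 1 = 1 := rfl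
@[simp] theorem H.mat_mul (a b : H) : H.mat (a * b) = H.mat a * H.mat b := by simp [H.mat]
@[simp] theorem H.mat_inv_mul (h : H) : H.mat h⁻¹ * H.mat h = 1 := by
  rw [← H.mat_mul, inv_mul_cancel, H.mat_one]
@[simp] theorem H.mat_mul_inv (h : H) : H.mat h * H.mat h⁻¹ = 1 := by
  rw [← H.mat_mul, mul_inv_cancel, H.mat_one]

theorem H.mat_injective : Function.Injective H.mat := fun _ _ h =>
  Subtype.ext (Subtype.ext h)

theorem H.transpose_mul_Q_mul (h : H) : (H.mat h).transpose * Q * H.mat h = Q := h.2.1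

theorem H.mat_lower_left (h : H) (x : Fin 1 ⊕ Fin 3) (j : Fin 3) : H.mat h (.inr x) (.inl j) = 0 := by
  have := (h.2.2 (Pi.single (.inl j) 1)).2 (fun x => by simp) x
  simpa [Matrix.mulVec_single, H.mat] using this

abbrev Mat3 : Type := Matrix (Fin 3) (Fin 3) ℝ

/-- The `GL(3)`-component of an element of `H`. -/
def gH (h : H) : Mat3 := Matrix.of (al (H.mat h))

/-- The third component of the parametrization of `H`. -/
def tc (m : Mat) (k : Fin 3) : ℝ :=
  (∑ p, m (.inr (.inr p)) (.inr (.inr (k + 2))) * m (.inl p) (.inr (.inr (k + 1)))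
    - ∑ p, m (.inr (.inr p)) (.inr (.inr (k + 1))) * m (.inl p) (.inr (.inr (k + 2)))) / 2

/-- The parametrization of `H`; `g'` is the inverse of `g`. -/
def hmat (g g' : Mat3) (b t : Fin 3 → ℝ) : Mat := Matrix.of fun
  | .inl i, .inl j => g' j i
  | .inl i, .inr (.inl _) => 2 * ∑ k, g' k i * b k
  | .inl i, .inr (.inr j) => - ∑ k, g' k i * (∑ m, ε k j m * t m + b k * b j)
  | .inr (.inl _), .inl _ => 0
  | .inr (.inl _), .inr (.inl _) => 1
  | .inr (.inl _), .inr (.inr j) => - b j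
  | .inr (.inr _), .inl _ => 0
  | .inr (.inr _), .inr (.inl _) => 0
  | .inr (.inr i), .inr (.inr j) => g i j

section
variable (g g' : Mat3) (b t : Fin 3 → ℝ)
@[simp] theorem al_hmat : al (hmat g g' b t) = g := by ext; simp [al, hmat]
@[simp] theorem be_hmat : be (hmat g g' b t) = b := by ext; simp [be, hmat]

theorem sum_mul_sum_inv {g g' : Mat3} (hg : g * g' = 1) (f : Fin 3 → ℝ) (j : Fin 3) :
    ∑ p, g p j * ∑ k, g' k p * f k = f j := by
  have h : ∀ k, ∑ p, g' k p * g p j = if k = j then 1 else 0 := fun k => by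
    rw [← Matrix.mul_apply, mul_eq_one_comm.1 hg, Matrix.one_apply]
  simp only [Finset.mul_sum]
  rw [Finset.sum_comm]
  calc ∑ k, ∑ p, g p j * (g' k p * f k) = ∑ k, (∑ p, g' k p * g p j) * f k := by
        simp only [Finset.sum_mul]
        exact Finset.sum_congr rfl fun _ _ => Finset.sum_congr rfl fun _ _ => by ring
    _ = f j := by simp [h]

theorem tc_hmat (hg : g * g' = 1) : tc (hmat g g' b t) = t := by
  ext k
  simp only [tc, hmat, Matrix.of_apply, mul_neg, Finset.sum_neg_distrib, sum_mul_sum_inv hg]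
  revert k
  simp only [forall_fin_three]
  simp [Fin.sum_univ_three]
  refine ⟨?_, ?_, ?_⟩ <;> ring

theorem transpose_mul_Q_mul_apply (m : Mat) (i j : Idx) : (m.transpose * Q * m) i j =
    ∑ p, m (.inr (.inr p)) i * m (.inl p) j + ∑ p, m (.inr (.inr p)) j * m (.inl p) i
      + 2 * m (.inr (.inl 0)) i * m (.inr (.inl 0)) j := by
  simp only [Matrix.mul_apply, sum_idx, Fin.sum_univ_three, Matrix.transpose_apply]
  simp [Q]
  ring

theorem transpose_hmat_mul (hg : g * g' = 1) : (hmat g g' b t).transpose * Q * hmat g g' b t = Q := by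
  have h1 : ∀ k j, ∑ p, g' k p * g p j = if k = j then 1 else 0 := fun k j => by
    rw [← Matrix.mul_apply, mul_eq_one_comm.1 hg, Matrix.one_apply]
  have h2 : ∀ k j, ∑ p, g p j * g' k p = if k = j then 1 else 0 := fun k j => by
    rw [← h1]; exact Finset.sum_congr rfl fun _ _ => mul_comm _ _
  have h3 : ∀ (f : Fin 3 → ℝ) j, ∑ p, g p j * (2 * ∑ k, g' k p * f k) = 2 * f j := fun f j => by
    rw [← sum_mul_sum_inv hg f j, Finset.mul_sum]
    exact Finset.sum_congr rfl fun _ _ => by ring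
  ext i j
  rw [transpose_mul_Q_mul_apply]
  rcases i with i | i | i <;> rcases j with j | j | j <;>
    simp [hmat, Q, sum_mul_sum_inv hg, h2, h3, δ, eq_comm]
  revert i j
  simp only [forall_fin_three]
  simp [Fin.sum_univ_three]
  ring_nf
  simp

theorem det_hmat (hg : g * g' = 1) : (hmat g g' b t).det = 1 := by
  have h1 : hmat g g' b t = Matrix.fromBlocks g'.transpose
      (Matrix.of fun i x => hmat g g' b t (.inl i) (.inr x)) 0
      (Matrix.fromBlocks 1 (Matrix.of fun _ j => -b j) 0 g) := by
    ext i j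
    rcases i with i | i | i <;> rcases j with j | j | j <;> simp [hmat]
    rw [Subsingleton.elim i j, Matrix.one_apply_eq]
  rw [h1, Matrix.det_fromBlocks_zero₂₁, Matrix.det_fromBlocks_zero₂₁, Matrix.det_transpose,
    Matrix.det_one, one_mul, ← Matrix.det_mul, mul_eq_one_comm.1 hg, Matrix.det_one]

/-- The element of `H` with parameters `g`, `b`, `t`. -/
def mkH (hg : g * g' = 1) : H :=
  ⟨⟨hmat g g' b t, det_hmat g g' b t hg⟩, transpose_hmat_mul g g' b t hg, fun v => by
    have key : ∀ w : Idx → ℝ, (∀ x, w (.inr x) = 0) ↔ w (.inr (.inl 0)) = 0 ∧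
        (fun i => w (.inr (.inr i))) = 0 := fun w => by
      simp [Sum.forall, funext_iff, Fin.forall_fin_succ]
    have h3 : (fun i => (hmat g g' b t).mulVec v (.inr (.inr i))) =
        g.mulVec fun i => v (.inr (.inr i)) := by
      ext i; simp [Matrix.mulVec, dotProduct, hmat]
    have h2 : (hmat g g' b t).mulVec v (.inr (.inl 0)) =
        v (.inr (.inl 0)) - ∑ i, b i * v (.inr (.inr i)) := by
      simp [Matrix.mulVec, dotProduct, hmat, sub_eq_add_neg]
    change (∀ x, (hmat g g' b t).mulVec v (.inr x) = 0) ↔ ∀ x, v (.inr x) = 0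
    rw [key, key, h3, h2]
    have hinj : g.mulVec (fun i => v (.inr (.inr i))) = 0 ↔ (fun i => v (.inr (.inr i))) = 0 := by
      constructor
      · intro h
        have := congrArg g'.mulVec h
        rwa [Matrix.mulVec_mulVec, mul_eq_one_comm.1 hg, Matrix.one_mulVec, Matrix.mulVec_zero] at this
      · intro h; rw [h, Matrix.mulVec_zero]
    rw [hinj]
    constructor
    · rintro ⟨h1, h0⟩
      refine ⟨?_, h0⟩
      have h4 : ∀ i, v (.inr (.inr i)) = 0 := fun i => congrFun h0 i
      simpa [h4] using h1
    · rintro ⟨h1, h0⟩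
      have h4 : ∀ i, v (.inr (.inr i)) = 0 := fun i => congrFun h0 i
      exact ⟨by simp [h4, h1], h0⟩⟩

@[simp] theorem mat_mkH (hg : g * g' = 1) : H.mat (mkH g g' b t hg) = hmat g g' b t := rfl
end

theorem H.entry_relation (h : H) (i j : Idx) :
    ∑ p, H.mat h (.inr (.inr p)) i * H.mat h (.inl p) j
      + ∑ p, H.mat h (.inr (.inr p)) j * H.mat h (.inl p) i
      + 2 * H.mat h (.inr (.inl 0)) i * H.mat h (.inr (.inl 0)) j = Q i j := by
  rw [← transpose_mul_Q_mul_apply, H.transpose_mul_Q_mul]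

/-- `Q` pairs the null plane with the last three coordinates, so invariance of `Q` makes the two `3
× 3` diagonal blocks inverse transposes of each other. -/
theorem H.gH_mul_ll (h : H) :
    gH h * Matrix.of (fun i j => H.mat h (.inl j) (.inl i)) = 1 := by
  rw [mul_eq_one_comm]
  ext i j
  have := H.entry_relation h (.inr (.inr j)) (.inl i)
  simp [H.mat_lower_left, Q, δ] at this
  simp only [gH, al, Matrix.mul_apply, Matrix.of_apply, Matrix.one_apply]
  simp only [mul_comm] at this ⊢
  simpa [eq_comm] using this

/-- Together with the null plane its orthogonal complement is preserved. Concretely, the column in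
question is orthogonal to all columns of the upper left block, which is invertible. -/
theorem H.mat_rc (h : H) (i : Fin 3) : H.mat h (.inr (.inr i)) (.inr (.inl 0)) = 0 := by
  have h1 : ∀ j, ∑ p, H.mat h (.inl p) (.inl j) * H.mat h (.inr (.inr p)) (.inr (.inl 0)) = 0 := by
    intro j
    have := H.entry_relation h (.inr (.inl 0)) (.inl j)
    simp [H.mat_lower_left, Q] at this
    simpa only [mul_comm] using this
  have h2 := congrArg (gH h).mulVec (funext h1 : (Matrix.of fun i j => H.mat h (.inl j) (.inl i)).mulVec
    (fun p => H.mat h (.inr (.inr p)) (.inr (.inl 0))) = 0)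
  rw [Matrix.mulVec_mulVec, H.gH_mul_ll, Matrix.one_mulVec, Matrix.mulVec_zero] at h2
  exact congrFun h2 i

/-- The determinant of the block triangular matrix is the product of the determinants of the outer
blocks, which cancel, and of the central entry. This is where `det = 1` is used: orthogonality alone
would leave a sign. -/
theorem H.mat_cc (h : H) : H.mat h (.inr (.inl 0)) (.inr (.inl 0)) = 1 := by
  have h1 : H.mat h = Matrix.fromBlocks (Matrix.of fun i j => H.mat h (.inl i) (.inl j))
      (Matrix.of fun i x => H.mat h (.inl i) (.inr x)) 0
      (Matrix.fromBlocks (Matrix.of fun i j => H.mat h (.inr (.inl i)) (.inr (.inl j)))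
        (Matrix.of fun i j => H.mat h (.inr (.inl i)) (.inr (.inr j))) 0 (gH h)) := by
    ext i j
    rcases i with i | i | i <;> rcases j with j | j | j <;>
      simp [gH, al, H.mat_lower_left]
    rw [Subsingleton.elim j 0, H.mat_rc]
  have h2 : (H.mat h).det = 1 := h.1.2
  have h3 := congrArg Matrix.det (H.gH_mul_ll h)
  have h4 : (Matrix.of fun i j => H.mat h (.inl j) (.inl i)).det
      = (Matrix.of fun i j => H.mat h (.inl i) (.inl j)).det := by
    rw [← Matrix.det_transpose]; rfl
  rw [h1, Matrix.det_fromBlocks_zero₂₁, Matrix.det_fromBlocks_zero₂₁, Matrix.det_fin_one] at h2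
  rw [Matrix.det_mul, Matrix.det_one, h4] at h3
  simp only [Matrix.of_apply] at h2
  linear_combination h2 - H.mat h (.inr (.inl 0)) (.inr (.inl 0)) * h3

theorem gH_mul (a b : H) : gH (a * b) = gH a * gH b := by
  ext i j
  simp [gH, al, Matrix.mul_apply, H.mat_lower_left, H.mat_rc]

theorem gH_one : gH 1 = 1 := by
  ext i j; simp [gH, al, Matrix.one_apply]

theorem gH_mul_inv (a : H) : gH a * gH a⁻¹ = 1 := by rw [← gH_mul, mul_inv_cancel, gH_one]

theorem gH_inv_mul (a : H) : gH a⁻¹ * gH a = 1 := by rw [← gH_mul, inv_mul_cancel, gH_one]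

theorem H.mat_ll (h : H) (i j : Fin 3) : H.mat h (.inl i) (.inl j) = gH h⁻¹ j i := by
  have h1 : gH h⁻¹ = Matrix.of (fun i j => H.mat h (.inl j) (.inl i)) := by
    rw [← mul_one (gH h⁻¹), ← H.gH_mul_ll h, ← mul_assoc, gH_inv_mul, one_mul]
  rw [h1]; rfl

/-- After multiplication by the transpose of `g`, invariance of `Q` determines the upper central
column from `b`, and the symmetric part of the upper right block as `-b ⊗ b`. The skew part of that
block is free; it is the coordinate `t` extracted by `tc`. -/
theorem H.mat_eq_hmat (h : H) :
    H.mat h = hmat (gH h) (gH h⁻¹) (be (H.mat h)) (tc (H.mat h)) := by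
  have key : ∀ f f' : Fin 3 → ℝ, (∀ j, ∑ p, gH h p j * f p = ∑ p, gH h p j * f' p) → f = f' := by
    intro f f' hf
    have h1 : (gH h).transpose.mulVec f = (gH h).transpose.mulVec f' := funext hf
    have h2 := congrArg (gH h⁻¹).transpose.mulVec h1
    rwa [Matrix.mulVec_mulVec, Matrix.mulVec_mulVec, ← Matrix.transpose_mul, gH_mul_inv,
      Matrix.transpose_one, Matrix.one_mulVec, Matrix.one_mulVec] at h2
  have hg := gH_mul_inv h
  have h3 : ∀ (f : Fin 3 → ℝ) j, ∑ p, gH h p j * (2 * ∑ k, gH h⁻¹ k p * f k) = 2 * f j := fun f j => by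
    rw [← sum_mul_sum_inv hg f j, Finset.mul_sum]
    exact Finset.sum_congr rfl fun _ _ => by ring
  have hlc : (fun i => H.mat h (.inl i) (.inr (.inl 0))) =
      fun i => 2 * ∑ k, gH h⁻¹ k i * be (H.mat h) k := by
    refine key _ _ fun j => ?_
    rw [h3]
    have := H.entry_relation h (.inr (.inr j)) (.inr (.inl 0))
    simp [H.mat_rc, H.mat_cc, Q] at this
    simp only [gH, al, be, Matrix.of_apply]
    linarith
  have hlr : ∀ j, (fun i => H.mat h (.inl i) (.inr (.inr j))) = fun i => - ∑ k, gH h⁻¹ k i *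
      (∑ m, ε k j m * tc (H.mat h) m + be (H.mat h) k * be (H.mat h) j) := by
    intro j
    refine key _ _ fun i => ?_
    simp only [mul_neg, Finset.sum_neg_distrib, sum_mul_sum_inv hg]
    have h1 := H.entry_relation h (.inr (.inr i)) (.inr (.inr j))
    simp only [Q, Matrix.of_apply] at h1
    simp only [gH, al, be, tc, Matrix.of_apply]
    revert h1
    revert i j
    simp only [forall_fin_three]
    simp [Fin.sum_univ_three]
    refine ⟨⟨?_, ?_, ?_⟩, ⟨?_, ?_, ?_⟩, ?_, ?_, ?_⟩ <;> intro h1 <;> linarith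
  ext i j
  rcases i with i | i | i <;> rcases j with j | j | j
  · simp [hmat, H.mat_ll]
  · simpa [hmat, Subsingleton.elim j 0] using congrFun hlc i
  · simpa [hmat] using congrFun (hlr j) i
  · simp [hmat, H.mat_lower_left]
  · simp [hmat, H.mat_cc, Subsingleton.elim j 0, Subsingleton.elim i 0]
  · simp [hmat, be, Subsingleton.elim i 0]
  · simp [hmat, H.mat_lower_left]
  · simp [hmat, H.mat_rc, Subsingleton.elim j 0]
  · simp [hmat, gH, al]

theorem H.ext_coord {h k : H} (h1 : gH h = gH k) (h2 : be (H.mat h) = be (H.mat k))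
    (h3 : tc (H.mat h) = tc (H.mat k)) : h = k := by
  apply H.mat_injective
  have h4 : gH h⁻¹ = gH k⁻¹ := by
    rw [← mul_one (gH h⁻¹), ← gH_mul_inv k, ← mul_assoc, ← h1, gH_inv_mul, one_mul]
  rw [H.mat_eq_hmat h, H.mat_eq_hmat k, h1, h2, h3, h4]

/-! ### Conjugation by elements of `H` -/

section
variable (h : H) (m : Mat)

theorem conj_rl (i j : Fin 3) : (H.mat h⁻¹ * m * H.mat h) (.inr (.inr i)) (.inl j) =
    ∑ p, ∑ q, gH h⁻¹ i p * m (.inr (.inr p)) (.inl q) * gH h⁻¹ j q := by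
  simp [Matrix.mul_apply, H.mat_lower_left, H.mat_rc, H.mat_ll, Finset.sum_mul, gH, al]
  rw [Finset.sum_comm]

theorem om_conj (j : Fin 3) : om (H.mat h⁻¹ * m * H.mat h) j =
    ∑ q, (om m q - ∑ p, be (H.mat h⁻¹) p * m (.inr (.inr p)) (.inl q)) * gH h⁻¹ j q := by
  simp [om, be, Matrix.mul_apply, H.mat_lower_left, H.mat_ll, H.mat_cc]

/-- The hypotheses hold for values of a curvature without `θ`- and `ω`-components. For these `α` is
simply conjugated by `g`, while `be_conj` shows that `β` picks up multiples of `α`. -/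
theorem al_conj {m : Mat} (h1 : ∀ i j, m (.inr (.inr i)) (.inl j) = 0)
    (h2 : ∀ i, m (.inr (.inr i)) (.inr (.inl 0)) = 0) :
    Matrix.of (al (H.mat h⁻¹ * m * H.mat h)) = gH h⁻¹ * Matrix.of (al m) * gH h := by
  ext i j
  simp [al, gH, Matrix.mul_apply, H.mat_lower_left, H.mat_rc, h1, h2]

theorem be_conj {m : Mat} (h1 : ∀ i j, m (.inr (.inr i)) (.inl j) = 0)
    (h2 : ∀ i, m (.inr (.inr i)) (.inr (.inl 0)) = 0) (h3 : ∀ j, m (.inr (.inl 0)) (.inl j) = 0)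
    (h4 : m (.inr (.inl 0)) (.inr (.inl 0)) = 0) (j : Fin 3) :
    be (H.mat h⁻¹ * m * H.mat h) j = ∑ k, be m k * gH h k j
      + ∑ p, ∑ k, be (H.mat h⁻¹) p * al m p k * gH h k j := by
  simp [al, gH, be, Matrix.mul_apply, H.mat_lower_left, H.mat_cc, h1, h2, h3, h4]
  rw [Finset.sum_comm (s := Finset.univ) (t := Finset.univ), ← neg_add, ← Finset.sum_add_distrib]
  simp only [add_mul, Finset.sum_mul]

theorem conj_mem_so43 (hm : m ∈ so43) : H.mat h⁻¹ * m * H.mat h ∈ so43 := by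
  rw [mem_so43_iff] at *
  have h1 : (H.mat h).transpose * Q = Q * H.mat h⁻¹ := by
    conv_rhs => rw [← H.transpose_mul_Q_mul h]
    rw [mul_assoc, H.mat_mul_inv, mul_one]
  have h2 : (H.mat h⁻¹).transpose * Q = Q * H.mat h := by
    conv_rhs => rw [← H.transpose_mul_Q_mul h⁻¹]
    rw [mul_assoc, H.mat_inv_mul, mul_one]
  rw [Matrix.transpose_mul, Matrix.transpose_mul, mul_assoc, mul_assoc, h2, ← mul_assoc m.transpose, hm]
  rw [neg_mul, mul_neg, ← mul_assoc, ← mul_assoc, h1]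
  noncomm_ring

end

/-! ### Alternating bilinear functions and frames -/

section
variable {V F G : Type*} [AddCommGroup V] [Module ℝ V] [AddCommGroup F] [Module ℝ F]
  [AddCommGroup G] [Module ℝ G]

/-- Alternating bilinear functions. -/
structure IsAltBilin (B : V → V → F) : Prop where
  add_left : ∀ u v w, B (u + v) w = B u w + B v w
  smul_left : ∀ (c : ℝ) v w, B (c • v) w = c • B v w
  skew : ∀ v w, B v w = -B w v

namespace IsAltBilin
variable {B C : V → V → F}

theorem comp (h : IsAltBilin B) (L : F →ₗ[ℝ] G) : IsAltBilin fun v w => L (B v w) where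
  add_left u v w := by rw [h.add_left, map_add]
  smul_left c v w := by rw [h.smul_left, map_smul]
  skew v w := by rw [h.skew, map_neg]

theorem comp_dom {V' : Type*} [AddCommGroup V'] [Module ℝ V'] (h : IsAltBilin B) (L : V' →ₗ[ℝ] V) :
    IsAltBilin fun v w => B (L v) (L w) where
  add_left u v w := by rw [map_add, h.add_left]
  smul_left c v w := by rw [map_smul, h.smul_left]
  skew v w := h.skew _ _

theorem add (h : IsAltBilin B) (h' : IsAltBilin C) : IsAltBilin fun v w => B v w + C v w where
  add_left u v w := by rw [h.add_left, h'.add_left]; abel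
  smul_left c v w := by rw [h.smul_left, h'.smul_left, smul_add]
  skew v w := by rw [h.skew, h'.skew]; abel

theorem neg (h : IsAltBilin B) : IsAltBilin fun v w => -B v w := h.comp (-LinearMap.id)

theorem sub (h : IsAltBilin B) (h' : IsAltBilin C) : IsAltBilin fun v w => B v w - C v w := by
  simpa only [sub_eq_add_neg] using h.add h'.neg

theorem sum {ι : Type*} [Fintype ι] {B : ι → V → V → F} (h : ∀ i, IsAltBilin (B i)) :
    IsAltBilin fun v w => ∑ i, B i v w where
  add_left u v w := by simp only [(h _).add_left, Finset.sum_add_distrib]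
  smul_left c v w := by simp only [(h _).smul_left, Finset.smul_sum]
  skew v w := by rw [← Finset.sum_neg_distrib]; exact Finset.sum_congr rfl fun i _ => (h i).skew v w

theorem const_mul {B : V → V → ℝ} (c : ℝ) (h : IsAltBilin B) : IsAltBilin fun v w => c * B v w :=
  h.comp (c • LinearMap.id)

theorem wedge (p q : V →ₗ[ℝ] ℝ) : IsAltBilin fun v w => p v * q w - p w * q v where
  add_left u v w := by simp only [map_add]; ring
  smul_left c v w := by simp only [map_smul, smul_eq_mul]; ring
  skew v w := by ring

theorem add_right (h : IsAltBilin B) (u v w : V) : B u (v + w) = B u v + B u w := by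
  rw [h.skew, h.add_left, neg_add, ← h.skew, ← h.skew]

theorem smul_right (h : IsAltBilin B) (c : ℝ) (v w : V) : B v (c • w) = c • B v w := by
  rw [h.skew, h.smul_left, ← smul_neg, ← h.skew]

theorem self (h : IsAltBilin B) (v : V) : B v v = 0 := by
  have h1 := h.skew v v
  have h2 : (2 : ℝ) • B v v = 0 := by rw [two_smul]; nth_rewrite 1 [h1]; abel
  simpa using h2

theorem zero_left (h : IsAltBilin B) (v : V) : B 0 v = 0 := by
  simpa using h.smul_left 0 0 v

theorem sum_left (h : IsAltBilin B) {ι : Type*} (s : Finset ι) (f : ι → V) (w : V) :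
    B (∑ i ∈ s, f i) w = ∑ i ∈ s, B (f i) w := by
  classical
  induction s using Finset.induction_on with
  | empty => simpa using h.zero_left w
  | insert i s hi ih => rw [Finset.sum_insert hi, Finset.sum_insert hi, h.add_left, ih]

theorem sum_right (h : IsAltBilin B) {ι : Type*} (s : Finset ι) (f : ι → V) (w : V) :
    B w (∑ i ∈ s, f i) = ∑ i ∈ s, B w (f i) := by
  rw [h.skew, h.sum_left, ← Finset.sum_neg_distrib]
  exact Finset.sum_congr rfl fun i _ => (h.skew _ _).symm

end IsAltBilin
end

def thₗ (k : Fin 3) : Mat →ₗ[ℝ] ℝ := Matrix.entryLinearMap ℝ ℝ (.inr (.inr (k + 1))) (.inl (k + 2))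
def omₗ (k : Fin 3) : Mat →ₗ[ℝ] ℝ := Matrix.entryLinearMap ℝ ℝ (.inr (.inl 0)) (.inl k)
def alₗ (i j : Fin 3) : Mat →ₗ[ℝ] ℝ := Matrix.entryLinearMap ℝ ℝ (.inr (.inr i)) (.inr (.inr j))
def beₗ (k : Fin 3) : Mat →ₗ[ℝ] ℝ := -Matrix.entryLinearMap ℝ ℝ (.inr (.inl 0)) (.inr (.inr k))
def taₗ (k : Fin 3) : Mat →ₗ[ℝ] ℝ := -Matrix.entryLinearMap ℝ ℝ (.inl (k + 1)) (.inr (.inr (k + 2)))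

section
variable (m : Mat) (i j : Fin 3)
@[simp] theorem thₗ_apply : thₗ i m = th m i := rfl
@[simp] theorem omₗ_apply : omₗ i m = om m i := rfl
@[simp] theorem alₗ_apply : alₗ i j m = al m i j := rfl
@[simp] theorem beₗ_apply : beₗ i m = be m i := rfl
@[simp] theorem taₗ_apply : taₗ i m = ta m i := rfl
end

section
variable (m n : Mat) (c : ℝ)
@[simp] theorem th_add : th (m + n) = th m + th n := rfl
@[simp] theorem om_add : om (m + n) = om m + om n := rfl
@[simp] theorem al_add : al (m + n) = al m + al n := rfl
@[simp] theorem be_add : be (m + n) = be m + be n := by ext i; exact map_add (beₗ i) m n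
@[simp] theorem ta_add : ta (m + n) = ta m + ta n := by ext i; exact map_add (taₗ i) m n
@[simp] theorem th_smul : th (c • m) = c • th m := rfl
@[simp] theorem om_smul : om (c • m) = c • om m := rfl
@[simp] theorem al_smul : al (c • m) = c • al m := rfl
@[simp] theorem be_smul : be (c • m) = c • be m := by ext i; exact map_smul (beₗ i) c m
@[simp] theorem ta_smul : ta (c • m) = c • ta m := by ext i; exact map_smul (taₗ i) c m
@[simp] theorem th_zero : th 0 = 0 := rfl
@[simp] theorem om_zero : om 0 = 0 := rfl
@[simp] theorem al_zero : al 0 = 0 := rfl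
@[simp] theorem be_zero : be 0 = 0 := by ext i; exact map_zero (beₗ i)
@[simp] theorem ta_zero : ta 0 = 0 := by ext i; exact map_zero (taₗ i)
theorem th_sum {ι : Type*} (s : Finset ι) (x : ι → Mat) (k : Fin 3) :
    th (∑ i ∈ s, x i) k = ∑ i ∈ s, th (x i) k := map_sum (thₗ k) x s
theorem om_sum {ι : Type*} (s : Finset ι) (x : ι → Mat) (k : Fin 3) :
    om (∑ i ∈ s, x i) k = ∑ i ∈ s, om (x i) k := map_sum (omₗ k) x s
@[simp] theorem th_neg : th (-m) = -th m := rfl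
@[simp] theorem om_neg : om (-m) = -om m := rfl
@[simp] theorem al_neg : al (-m) = -al m := rfl
@[simp] theorem be_neg : be (-m) = -be m := by ext i; exact map_neg (beₗ i) m
@[simp] theorem ta_neg : ta (-m) = -ta m := by ext i; exact map_neg (taₗ i) m
@[simp] theorem th_sub : th (m - n) = th m - th n := rfl
@[simp] theorem om_sub : om (m - n) = om m - om n := rfl
@[simp] theorem al_sub : al (m - n) = al m - al n := rfl
@[simp] theorem be_sub : be (m - n) = be m - be n := by ext i; exact map_sub (beₗ i) m n
@[simp] theorem ta_sub : ta (m - n) = ta m - ta n := by ext i; exact map_sub (taₗ i) m n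
end

/-! ### Normal curvature at a point -/

/-- Here `R` stands for the `β`-curvature on `(e_l, f_p)` and `T` for the `α`-curvature on `(e_l,
e_n)`. The `ω`-Bianchi identity `hT` solves for `T` in terms of `R`; inserted into the `θ`-Bianchi
identity `hB` it kills the trace of `R`; contracting the two `ε`s then inverts the relation. -/
theorem trace_aux {R : Fin 3 → Fin 3 → Fin 3 → ℝ} {T : Fin 3 → Fin 3 → Fin 3 → Fin 3 → ℝ}
    (hR : ∀ l p q, R l p q = R l q p)
    (hT : ∀ l n i p, ∑ m, ε i m l * R n p m - ∑ m, ε i m n * R l p m + T l n i p = 0)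
    (hB : ∀ i, (T 1 2 0 i - (∑ j, T 1 2 j j) * δ 0 i) + (T 2 0 1 i - (∑ j, T 2 0 j j) * δ 1 i)
      + (T 0 1 2 i - (∑ j, T 0 1 j j) * δ 2 i) = 0) :
    (∀ p, ∑ l, R l l p = 0) ∧ ∀ i j m, R j m i = - T (m + 1) (m + 2) j i := by
  have hT' : ∀ l n i p, T l n i p = ∑ m, ε i m n * R l p m - ∑ m, ε i m l * R n p m := fun l n i p => by
    linear_combination hT l n i p
  have h0 := fun l => hR l 1 0
  have h1 := fun l => hR l 2 0
  have h2 := fun l => hR l 2 1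
  have key : ∀ p, ∑ l, R l l p = 0 := by
    simp only [forall_fin_three] at hB ⊢
    simp only [hT', Fin.sum_univ_three] at hB ⊢
    simp [h0, h1, h2] at hB ⊢
    obtain ⟨b1, b2, b3⟩ := hB
    refine ⟨?_, ?_, ?_⟩ <;> linarith
  refine ⟨key, ?_⟩
  simp only [forall_fin_three, hT', Fin.sum_univ_three] at key ⊢
  simp [h0, h1, h2] at key ⊢
  obtain ⟨b1, b2, b3⟩ := key
  constructorm* _ ∧ _ <;> linarith
section
variable {V : Type*} [AddCommGroup V] [Module ℝ V]

/-- `e`, `f` is the frame dual to the `θ`- and `ω`-components of `a`. -/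
structure IsFrame (a : V →ₗ[ℝ] Mat) (e f : Fin 3 → V) : Prop where
  th_e : ∀ l m, th (a (e l)) m = δ l m
  om_e : ∀ l, om (a (e l)) = 0
  th_f : ∀ p, th (a (f p)) = 0
  om_f : ∀ p q, om (a (f p)) q = δ p q
  expand : ∀ v, v = ∑ l, th (a v) l • e l + ∑ p, om (a v) p • f p

theorem IsFrame.ext {F : Type*} [AddCommGroup F] [Module ℝ F] {a : V →ₗ[ℝ] Mat} {e f : Fin 3 → V}
    (h : IsFrame a e f) {B : V → V → F} (hB : IsAltBilin B) (h1 : ∀ l m, B (e l) (e m) = 0)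
    (h2 : ∀ l p, B (e l) (f p) = 0) (h3 : ∀ p q, B (f p) (f q) = 0) (v w : V) : B v w = 0 := by
  have h4 : ∀ l p, B (f p) (e l) = 0 := fun l p => by rw [hB.skew, h2, neg_zero]
  rw [h.expand v, h.expand w]
  simp [hB.add_left, hB.add_right, hB.sum_left, hB.sum_right, hB.smul_left, hB.smul_right,
    h1, h2, h3, h4]

theorem exists_isFrame (a : V →ₗ[ℝ] Mat)
    (h : Function.Bijective fun v => (th (a v), om (a v))) : ∃ e f, IsFrame a e f := by
  choose e he using fun l => h.2 (δ l, 0)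
  choose f hf using fun p => h.2 (0, δ p)
  simp only [Prod.mk.injEq] at he hf
  refine ⟨e, f, fun l m => by rw [(he l).1], fun l => (he l).2, fun p => (hf p).1,
    fun p q => by rw [(hf p).2], fun v => h.1 ?_⟩
  simp only [Prod.mk.injEq, map_add, map_sum, map_smul]
  constructor
  · ext i
    simp [th_sum, he, hf]
    simp [δ]
  · ext i
    simp [om_sum, he, hf]
    simp [δ]

/-- A curvature `k` without `θ`- and `ω`-components that satisfies the algebraic Bianchi identity
with respect to the gauge `a`. -/
structure BianchiAt (a : V →ₗ[ℝ] Mat) (k : V → V → Mat) : Prop where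
  alt : IsAltBilin k
  mem_gauge : ∀ v, a v ∈ so43
  mem : ∀ v w, k v w ∈ so43
  th_eq : ∀ v w, th (k v w) = 0
  om_eq : ∀ v w, om (k v w) = 0
  bianchi_th : ∀ u v w, th ((a u * k v w - k v w * a u) + (a v * k w u - k w u * a v)
    + (a w * k u v - k u v * a w)) = 0
  bianchi_om : ∀ u v w, om ((a u * k v w - k v w * a u) + (a v * k w u - k w u * a v)
    + (a w * k u v - k u v * a w)) = 0

/-- The first normalization of the curvature. -/
structure TraceFreeAt (a : V →ₗ[ℝ] Mat) (k : V → V → Mat) : Prop extends BianchiAt a k where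
  trace : ∀ u w, th (a u) = 0 → ∑ i, al (k u w) i i = 0

/-- The normalization of the curvature `k` with respect to the gauge `a`. -/
structure NormalAt (a : V →ₗ[ℝ] Mat) (k : V → V → Mat) : Prop extends TraceFreeAt a k where
  symm : ∀ u v w, th (a u) = 0 → th (a v) = 0 →
    ∑ j, be (k w u) j * om (a v) j = ∑ j, be (k w v) j * om (a u) j

/-- The symmetries of the curvature coefficients. -/
structure CurvSymm (S2 : Fin 3 → Fin 3 → ℝ) (S3 : Fin 3 → Fin 3 → Fin 3 → ℝ)
    (S4 : Fin 3 → Fin 3 → Fin 3 → Fin 3 → ℝ) : Prop where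
  s2 : ∀ i j, S2 i j = S2 j i
  s3 : ∀ i j k, S3 i j k = S3 i k j
  s3_trace : ∀ k, ∑ i, S3 i i k = 0
  s4_left : ∀ i k j l, S4 i k j l = S4 k i j l
  s4_right : ∀ i k j l, S4 i k j l = S4 i k l j
  s4_trace : ∀ k j, ∑ i, S4 i k i j = 0

/-- The `α`-component of the curvature with given coefficients. -/
def curvAl (S3 : Fin 3 → Fin 3 → Fin 3 → ℝ) (S4 : Fin 3 → Fin 3 → Fin 3 → Fin 3 → ℝ)
    (x y : Mat) (i j : Fin 3) : ℝ :=
  ∑ k, ∑ l, ∑ m, S3 i j k * ε k l m * (th x l * th y m - th y l * th x m)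
    + ∑ k, ∑ l, S4 i k j l * (th x k * om y l - th y k * om x l)

/-- The `β`-component of the curvature with given coefficients. -/
def curvBe (S2 : Fin 3 → Fin 3 → ℝ) (S3 : Fin 3 → Fin 3 → Fin 3 → ℝ) (x y : Mat) (i : Fin 3) : ℝ :=
  - 2 * ∑ j, ∑ k, S3 j i k * (th x j * om y k - th y j * om x k)
    + ∑ j, ∑ k, ∑ l, ε j k l * S2 i j * (th x k * th y l - th y k * th x l)

theorem isAltBilin_wedge_th (a : V →ₗ[ℝ] Mat) (i j : Fin 3) :
    IsAltBilin fun v w => th (a v) i * th (a w) j - th (a w) i * th (a v) j :=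
  IsAltBilin.wedge (thₗ i ∘ₗ a) (thₗ j ∘ₗ a)

theorem isAltBilin_wedge_th_om (a : V →ₗ[ℝ] Mat) (i j : Fin 3) :
    IsAltBilin fun v w => th (a v) i * om (a w) j - th (a w) i * om (a v) j :=
  IsAltBilin.wedge (thₗ i ∘ₗ a) (omₗ j ∘ₗ a)

theorem isAltBilin_curvAl (a : V →ₗ[ℝ] Mat) (S3 S4) (i j : Fin 3) :
    IsAltBilin fun v w => curvAl S3 S4 (a v) (a w) i j :=
  (IsAltBilin.sum fun _ => .sum fun _ => .sum fun _ => (isAltBilin_wedge_th a _ _).const_mul _).add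
    (.sum fun _ => .sum fun _ => (isAltBilin_wedge_th_om a _ _).const_mul _)

theorem isAltBilin_curvBe (a : V →ₗ[ℝ] Mat) (S2 S3) (i : Fin 3) :
    IsAltBilin fun v w => curvBe S2 S3 (a v) (a w) i :=
  (IsAltBilin.const_mul _ (.sum fun _ => .sum fun _ =>
    (isAltBilin_wedge_th_om a _ _).const_mul _)).add
    (.sum fun _ => .sum fun _ => .sum fun _ => (isAltBilin_wedge_th a _ _).const_mul _)

variable {a : V →ₗ[ℝ] Mat} {k : V → V → Mat} {e f : Fin 3 → V}

theorem BianchiAt.bianchi_th' (h : BianchiAt a k) (u v w : V) (i : Fin 3) :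
    ((∑ j, al (k v w) j i * th (a u) j) - (∑ j, al (k v w) j j) * th (a u) i)
    + ((∑ j, al (k w u) j i * th (a v) j) - (∑ j, al (k w u) j j) * th (a v) i)
    + ((∑ j, al (k u v) j i * th (a w) j) - (∑ j, al (k u v) j j) * th (a w) i) = 0 := by
  have := congrFun (h.bianchi_th u v w) i
  simp only [th_add, Pi.add_apply, th_comm (h.mem_gauge _) (h.mem _ _), h.th_eq, h.om_eq,
    Pi.zero_apply] at this
  simp only [Fin.sum_univ_three] at this ⊢
  linear_combination this

theorem BianchiAt.bianchi_om' (h : BianchiAt a k) (u v w : V) (i : Fin 3) :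
    (∑ m, ∑ j, ε i m j * (be (k v w) m * th (a u) j) + ∑ j, al (k v w) i j * om (a u) j)
    + (∑ m, ∑ j, ε i m j * (be (k w u) m * th (a v) j) + ∑ j, al (k w u) i j * om (a v) j)
    + (∑ m, ∑ j, ε i m j * (be (k u v) m * th (a w) j) + ∑ j, al (k u v) i j * om (a w) j) = 0 := by
  have := congrFun (h.bianchi_om u v w) i
  simp only [om_add, Pi.add_apply, om_comm (h.mem_gauge _) (h.mem _ _), h.th_eq, h.om_eq,
    Pi.zero_apply] at this
  simp only [Fin.sum_univ_three] at this ⊢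
  linear_combination -this

/-- The `θ`-Bianchi identity on `e_l, f_p, f_q` says that the `α`-curvature equals its trace times
the identity. Taking the trace gives `tr = 3 tr`, so both vanish. -/
theorem BianchiAt.al_ff (h : BianchiAt a k) (hf : IsFrame a e f) (p q i j : Fin 3) :
    al (k (f p) (f q)) i j = 0 := by
  have h1 := fun l i => h.bianchi_th' (e l) (f p) (f q) i
  simp only [hf.th_e, hf.th_f, Pi.zero_apply, mul_zero, Finset.sum_const_zero, sub_zero, add_zero,
    forall_fin_three, Fin.sum_univ_three] at h1
  simp at h1
  revert i j
  simp only [forall_fin_three]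
  refine ⟨⟨?_, ?_, ?_⟩, ⟨?_, ?_, ?_⟩, ?_, ?_, ?_⟩ <;> linarith

/-- This is the `θ`-Bianchi identity on `e_l, e_m, f_p`, whose trace terms drop out by the first
normalization. -/
theorem TraceFreeAt.al_ef (h : TraceFreeAt a k) (hf : IsFrame a e f) (l m p i : Fin 3) :
    al (k (e m) (f p)) l i = al (k (e l) (f p)) m i := by
  have h1 := h.bianchi_th' (e l) (e m) (f p) i
  have h2 := h.trace (f p) (e m) (hf.th_f p)
  have h3 := h.trace (f p) (e l) (hf.th_f p)
  rw [h.alt.skew (f p) (e m)] at h2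
  rw [h.alt.skew (f p) (e l)] at h1 h3
  simp only [hf.th_e, hf.th_f, Pi.zero_apply, mul_zero, Finset.sum_const_zero, sub_zero, add_zero,
    al_neg, Pi.neg_apply, Finset.sum_neg_distrib, neg_eq_zero] at h1 h2 h3
  simp only [h2, h3] at h1
  simp [δ] at h1
  linarith

theorem TraceFreeAt.be_ff_aux (h : TraceFreeAt a k) (hf : IsFrame a e f) (l p q i : Fin 3) :
    ∑ m, ε i m l * be (k (f p) (f q)) m + al (k (e l) (f p)) i q - al (k (e l) (f q)) i p = 0 := by
  have h1 := h.bianchi_om' (e l) (f p) (f q) i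
  rw [h.alt.skew (f q) (e l)] at h1
  simp only [hf.th_e, hf.om_e, hf.om_f, hf.th_f, h.al_ff hf, Pi.zero_apply, mul_zero, 
    Finset.sum_const_zero, zero_add, add_zero, al_neg, Pi.neg_apply] at h1
  simp [δ] at h1
  linarith

/-- In the `ω`-Bianchi identity on `e_l, f_p, f_q` the `β`-term is skew in `i, l`, while the
`α`-terms are symmetric in them by `al_ef`. Hence each part vanishes separately; the other part is
`al_ef'`. -/
theorem TraceFreeAt.be_ff (h : TraceFreeAt a k) (hf : IsFrame a e f) (p q i : Fin 3) :
    be (k (f p) (f q)) i = 0 := by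
  have h1 := fun l i => h.be_ff_aux hf l p q i
  have h2 := fun i l => h.al_ef hf l i p q
  have h3 := fun i l => h.al_ef hf l i q p
  simp only [forall_fin_three, Fin.sum_univ_three] at h1 h2 h3
  simp at h1
  revert i
  simp only [forall_fin_three]
  refine ⟨?_, ?_, ?_⟩ <;> linarith

theorem TraceFreeAt.al_ef' (h : TraceFreeAt a k) (hf : IsFrame a e f) (l p q i : Fin 3) :
    al (k (e l) (f p)) i q = al (k (e l) (f q)) i p := by
  have h1 := h.be_ff_aux hf l p q i
  simp only [h.be_ff hf, mul_zero, Finset.sum_const_zero] at h1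
  linarith

theorem TraceFreeAt.al_ee_aux (h : TraceFreeAt a k) (hf : IsFrame a e f) (l n p i : Fin 3) :
    ∑ m, ε i m l * be (k (e n) (f p)) m - ∑ m, ε i m n * be (k (e l) (f p)) m
      + al (k (e l) (e n)) i p = 0 := by
  have h1 := h.bianchi_om' (e l) (e n) (f p) i
  rw [h.alt.skew (f p) (e l)] at h1
  simp only [hf.th_e, hf.om_e, hf.om_f, hf.th_f, Pi.zero_apply, mul_zero,
    Finset.sum_const_zero, zero_add, add_zero, be_neg, Pi.neg_apply] at h1
  simp [δ] at h1
  linarith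

theorem NormalAt.be_ef (h : NormalAt a k) (hf : IsFrame a e f) (l p q : Fin 3) :
    be (k (e l) (f p)) q = be (k (e l) (f q)) p := by
  have h1 := h.symm (f p) (f q) (e l) (hf.th_f p) (hf.th_f q)
  simp only [hf.om_f] at h1
  simpa [δ] using h1

/-- The `ω`-Bianchi identity on `e_0, e_1, e_2`; it will say that `S_ij` is symmetric. -/
theorem NormalAt.be_ee (h : NormalAt a k) (hf : IsFrame a e f) :
    ∀ i, ∑ m, ∑ j, ε i m j * be (k (e (j + 1)) (e (j + 2))) m = 0 := by
  intro i
  have h1 := h.bianchi_om' (e 0) (e 1) (e 2) i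
  simp only [hf.th_e, hf.om_e, Pi.zero_apply, mul_zero,
    Finset.sum_const_zero, add_zero] at h1
  simp [δ] at h1
  simp [Fin.sum_univ_three]
  simp [Fin.sum_univ_three] at h1
  linarith

/-- The coefficients of a normal curvature in terms of a frame. -/
def coeff4 (k : V → V → Mat) (e f : Fin 3 → V) (i m j l : Fin 3) : ℝ := al (k (e m) (f l)) i j
-- The sum over `l, m` of `ε_klm θ_l ∧ θ_m` counts each pair twice, whence the halves here and in
-- `coeff2`.
def coeff3 (k : V → V → Mat) (e : Fin 3 → V) (i j m : Fin 3) : ℝ :=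
  al (k (e (m + 1)) (e (m + 2))) i j / 2
def coeff2 (k : V → V → Mat) (e : Fin 3 → V) (i j : Fin 3) : ℝ :=
  be (k (e (j + 1)) (e (j + 2))) i / 2

/-- The Bianchi identities tie the `α`-curvature on pairs of `e`s to the `β`-curvature on `(e, f)`.
This is why the same functions `S^i_jk` appear in the equations for `dα` and `dβ`; their symmetry in
`j, k` is the second normalization, and their trace vanishes by `trace_aux`. -/
theorem NormalAt.coeff3_eq (h : NormalAt a k) (hf : IsFrame a e f) (i j m : Fin 3) :
    be (k (e j) (f m)) i = - 2 * coeff3 k e j i m ∧ coeff3 k e i j m = coeff3 k e i m j ∧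
      ∑ i, coeff3 k e i i m = 0 := by
  have hB : ∀ i, (al (k (e 1) (e 2)) 0 i - (∑ j, al (k (e 1) (e 2)) j j) * δ 0 i)
      + (al (k (e 2) (e 0)) 1 i - (∑ j, al (k (e 2) (e 0)) j j) * δ 1 i)
      + (al (k (e 0) (e 1)) 2 i - (∑ j, al (k (e 0) (e 1)) j j) * δ 2 i) = 0 := fun i => by
    rw [← h.bianchi_th' (e 0) (e 1) (e 2) i]
    simp only [hf.th_e]
    simp [δ]
  obtain ⟨h1, h2⟩ := trace_aux (R := fun l p q => be (k (e l) (f p)) q)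
    (T := fun l n i p => al (k (e l) (e n)) i p) (fun l p q => h.be_ef hf l p q)
    (fun l n i p => h.al_ee_aux hf l n p i) hB
  have h3 : ∀ i j m, be (k (e j) (f m)) i = - 2 * coeff3 k e j i m := fun i j m => by
    rw [h2]; simp only [coeff3]; ring
  refine ⟨h3 i j m, ?_, ?_⟩
  · have := h.be_ef hf i m j
    rw [h3, h3] at this
    linarith
  · have h4 := h1 m
    simp only [h.be_ef hf _ _ m, h3, ← Finset.mul_sum] at h4
    linarith

theorem NormalAt.curvSymm (h : NormalAt a k) (hf : IsFrame a e f) :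
    CurvSymm (coeff2 k e) (coeff3 k e) (coeff4 k e f) where
  s2 i j := by
    have h1 := h.be_ee hf
    simp only [coeff2]
    revert i j
    simp only [forall_fin_three, Fin.sum_univ_three] at h1 ⊢
    simp at h1 ⊢
    refine ⟨⟨?_, ?_⟩, ⟨?_, ?_⟩, ?_, ?_⟩ <;> linarith
  s3 i j m := (h.coeff3_eq hf i j m).2.1
  s3_trace m := (h.coeff3_eq hf 0 0 m).2.2
  s4_left i m j l := h.al_ef hf i m l j
  s4_right i m j l := h.al_ef' hf m l j i
  s4_trace m j := by
    have h3 := h.trace (f j) (e m) (hf.th_f j)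
    rw [h.alt.skew] at h3
    simp only [al_neg, Pi.neg_apply, Finset.sum_neg_distrib, neg_eq_zero] at h3
    exact h3

theorem NormalAt.al_eq (h : NormalAt a k) (hf : IsFrame a e f) (v w : V) (i j : Fin 3) :
    al (k v w) i j = curvAl (coeff3 k e) (coeff4 k e f) (a v) (a w) i j := by
  rw [← sub_eq_zero]
  refine hf.ext (B := fun v w => al (k v w) i j - curvAl (coeff3 k e) (coeff4 k e f) (a v) (a w) i j)
    ((h.alt.comp (alₗ i j)).sub (isAltBilin_curvAl a _ _ i j)) ?_ ?_ ?_ v w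
  · intro l m
    have h1 := fun l m => congrFun (congrFun (congrArg al (h.alt.skew (e l) (e m))) i) j
    have h2 := fun l => congrFun (congrFun (congrArg al (h.alt.self (e l))) i) j
    simp only [curvAl, coeff3, hf.th_e, hf.om_e]
    revert l m
    simp only [forall_fin_three, Fin.sum_univ_three] at h1 h2 ⊢
    simp at h1 h2 ⊢
    constructorm* _ ∧ _ <;> linarith
  · intro l p
    simp only [curvAl, coeff4, hf.th_e, hf.om_e, hf.th_f, hf.om_f]
    simp [δ]
  · intro p q
    simp only [curvAl, hf.th_f, h.al_ff hf]
    simp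

theorem NormalAt.be_eq (h : NormalAt a k) (hf : IsFrame a e f) (v w : V) (i : Fin 3) :
    be (k v w) i = curvBe (coeff2 k e) (coeff3 k e) (a v) (a w) i := by
  rw [← sub_eq_zero]
  refine hf.ext (B := fun v w => be (k v w) i - curvBe (coeff2 k e) (coeff3 k e) (a v) (a w) i)
    ((h.alt.comp (beₗ i)).sub (isAltBilin_curvBe a _ _ i)) ?_ ?_ ?_ v w
  · intro l m
    have h1 := fun l m => congrFun (congrArg be (h.alt.skew (e l) (e m))) i
    have h2 := fun l => congrFun (congrArg be (h.alt.self (e l))) i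
    simp only [curvBe, coeff2, hf.th_e, hf.om_e]
    revert l m
    simp only [forall_fin_three, Fin.sum_univ_three] at h1 h2 ⊢
    simp at h1 h2 ⊢
    constructorm* _ ∧ _ <;> linarith
  · intro l p
    simp only [curvBe, (h.coeff3_eq hf i l p).1, hf.th_e, hf.om_e, hf.th_f, hf.om_f]
    simp [δ]
  · intro p q
    simp only [curvBe, hf.th_f, h.be_ff hf]
    simp

/-- A frame-free form of `S^ik_jl = S^ik_lj`. It is needed because conjugation adds multiples of the
`α`-curvature to the `β`-curvature, whose symmetry has to survive. -/
theorem NormalAt.al_symm (h : NormalAt a k) (hf : IsFrame a e f) (u : V) {v w : V}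
    (hv : th (a v) = 0) (hw : th (a w) = 0) (i : Fin 3) :
    ∑ j, al (k u v) i j * om (a w) j = ∑ j, al (k u w) i j * om (a v) j := by
  have key : ∀ x y : Fin 3 → ℝ,
      ∑ j, (∑ m, ∑ l, coeff4 k e f i m j l * (th (a u) m * x l)) * y j =
      ∑ m, ∑ j, ∑ l, coeff4 k e f i m j l * (th (a u) m * x l) * y j := fun x y => by
    simp only [Finset.sum_mul]
    rw [Finset.sum_comm]
  simp only [h.al_eq hf, curvAl, hv, hw]
  simp only [Pi.zero_apply, zero_mul, mul_zero, sub_zero, Finset.sum_const_zero, zero_add, key]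
  refine Finset.sum_congr rfl fun m _ => ?_
  rw [Finset.sum_comm]
  refine Finset.sum_congr rfl fun l _ => Finset.sum_congr rfl fun j _ => ?_
  rw [(h.curvSymm hf).s4_right]
  ring

/-- `NormalAt` depends only on the `θ`- and `ω`-components of the gauge. -/
theorem NormalAt.congr (h : NormalAt a k) {a' : V →ₗ[ℝ] Mat} (hm : ∀ v, a' v ∈ so43)
    (h1 : ∀ v, th (a' v) = th (a v)) (h2 : ∀ v, om (a' v) = om (a v)) : NormalAt a' k where
  alt := h.alt
  mem_gauge := hm
  mem := h.mem
  th_eq := h.th_eq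
  om_eq := h.om_eq
  bianchi_th u v w := by
    ext i
    have := h.bianchi_th' u v w i
    simp only [th_add, Pi.add_apply, th_comm (hm _) (h.mem _ _), h.th_eq, h.om_eq, h1, h2,
      Pi.zero_apply]
    simp only [Fin.sum_univ_three] at this ⊢
    linear_combination this
  bianchi_om u v w := by
    ext i
    have := h.bianchi_om' u v w i
    simp only [om_add, Pi.add_apply, om_comm (hm _) (h.mem _ _), h.th_eq, h.om_eq, h1, h2,
      Pi.zero_apply]
    simp only [Fin.sum_univ_three] at this ⊢
    linear_combination -this
  trace u w hu := h.trace u w (by rw [← h1, hu])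
  symm u v w hu hv := by
    rw [h2, h2]
    exact h.symm u v w (by rw [← h1, hu]) (by rw [← h1, hv])

theorem NormalAt.comp {V' : Type*} [AddCommGroup V'] [Module ℝ V'] (h : NormalAt a k)
    (L : V' →ₗ[ℝ] V) : NormalAt (a ∘ₗ L) fun v w => k (L v) (L w) where
  alt := h.alt.comp_dom L
  mem_gauge _ := h.mem_gauge _
  mem _ _ := h.mem _ _
  th_eq _ _ := h.th_eq _ _
  om_eq _ _ := h.om_eq _ _
  bianchi_th _ _ _ := h.bianchi_th _ _ _
  bianchi_om _ _ _ := h.bianchi_om _ _ _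
  trace _ _ hu := h.trace _ _ hu
  symm _ _ _ hu hv := h.symm _ _ _ hu hv

theorem entry_rl {m : Mat} (hm : m ∈ so43) (i j : Fin 3) :
    m (.inr (.inr i)) (.inl j) = ∑ k, ε i j k * th m k := by
  conv_lhs => rw [eq_gammaMatrix hm]
  rfl

theorem entry_rc {m : Mat} (hm : m ∈ so43) (i : Fin 3) :
    m (.inr (.inr i)) (.inr (.inl 0)) = -2 * om m i := by
  conv_lhs => rw [eq_gammaMatrix hm]
  rfl

theorem entry_cc {m : Mat} (hm : m ∈ so43) : m (.inr (.inl 0)) (.inr (.inl 0)) = 0 := by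
  rw [eq_gammaMatrix hm]
  rfl

theorem th_conj_eq_zero (h : H) {m : Mat} (hm : m ∈ so43) (h0 : th m = 0) :
    th (H.mat h⁻¹ * m * H.mat h) = 0 := by
  ext k
  have h1 : ∀ i j, m (.inr (.inr i)) (.inl j) = 0 := fun i j => by simp [entry_rl hm, h0]
  simp [th, conj_rl, h1]

theorem om_conj_eq (h : H) {m : Mat} (hm : m ∈ so43) (h0 : th m = 0) :
    om (H.mat h⁻¹ * m * H.mat h) = (gH h⁻¹).mulVec (om m) := by
  ext k
  simp [om_conj, entry_rl hm, h0, Matrix.mulVec, dotProduct]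
  exact Finset.sum_congr rfl fun _ _ => mul_comm _ _

theorem om_conj_eq_zero (h : H) {m : Mat} (hm : m ∈ so43) (h0 : th m = 0) (h1 : om m = 0) :
    om (H.mat h⁻¹ * m * H.mat h) = 0 := by
  rw [om_conj_eq h hm h0, h1, Matrix.mulVec_zero]

theorem conj_conj (h : H) (m : Mat) : H.mat h * (H.mat h⁻¹ * m * H.mat h) * H.mat h⁻¹ = m := by
  calc _ = (H.mat h * H.mat h⁻¹) * m * (H.mat h * H.mat h⁻¹) := by noncomm_ring
    _ = m := by simp

theorem th_conj_eq_zero_iff (h : H) {m : Mat} (hm : m ∈ so43) :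
    th (H.mat h⁻¹ * m * H.mat h) = 0 ↔ th m = 0 := by
  refine ⟨fun h0 => ?_, th_conj_eq_zero h hm⟩
  have := th_conj_eq_zero h⁻¹ (conj_mem_so43 h m hm) h0
  rwa [inv_inv, conj_conj] at this

/-- Conjugation as a linear map. -/
def conjₗ (h : H) : Mat →ₗ[ℝ] Mat where
  toFun m := H.mat h⁻¹ * m * H.mat h
  map_add' := by intros; noncomm_ring
  map_smul' := by intros; simp

theorem conjₗ_apply (h : H) (m : Mat) : conjₗ h m = H.mat h⁻¹ * m * H.mat h := rfl

theorem conjₗ_mul (h : H) (m n : Mat) : conjₗ h m * conjₗ h n = conjₗ h (m * n) := by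
  simp only [conjₗ_apply]
  calc _ = H.mat h⁻¹ * m * (H.mat h * H.mat h⁻¹) * n * H.mat h := by noncomm_ring
    _ = _ := by rw [H.mat_mul_inv]; noncomm_ring

/-- The Bianchi identities and the vanishing of the torsion are preserved because conjugation by `H`
respects the filtration by `θ`, then `ω`. The trace condition is conjugation invariant. In the
symmetry condition the factors of `g` cancel, and the additional term in `β` is symmetric by
`al_symm`. -/
theorem NormalAt.conj (hk : NormalAt a k) (hf : IsFrame a e f) (h : H) :
    NormalAt (conjₗ h ∘ₗ a) fun v w => conjₗ h (k v w) := by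
  have hal : ∀ v w, Matrix.of (al (conjₗ h (k v w))) =
      gH h⁻¹ * Matrix.of (al (k v w)) * gH h := fun v w =>
    al_conj h (fun i j => by simp [entry_rl (hk.mem v w), hk.th_eq])
      (fun i => by simp [entry_rc (hk.mem v w), hk.om_eq])
  have hbe : ∀ v w, be (conjₗ h (k v w)) = (be (k v w)) ᵥ* gH h
      + (be (H.mat h⁻¹)) ᵥ* (Matrix.of (al (k v w)) * gH h) := fun v w => by
    ext j
    rw [conjₗ_apply, be_conj h (fun i j => by simp [entry_rl (hk.mem v w), hk.th_eq])
      (fun i => by simp [entry_rc (hk.mem v w), hk.om_eq]) (fun j => congrFun (hk.om_eq v w) j)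
      (entry_cc (hk.mem v w))]
    simp [Matrix.vecMul, dotProduct, Matrix.mul_apply, Finset.mul_sum, mul_assoc]
  have hbi : ∀ u v w, (conjₗ h (a u) * conjₗ h (k v w) - conjₗ h (k v w) * conjₗ h (a u))
      + (conjₗ h (a v) * conjₗ h (k w u) - conjₗ h (k w u) * conjₗ h (a v))
      + (conjₗ h (a w) * conjₗ h (k u v) - conjₗ h (k u v) * conjₗ h (a w))
      = conjₗ h ((a u * k v w - k v w * a u) + (a v * k w u - k w u * a v)
        + (a w * k u v - k u v * a w)) := fun u v w => by
    simp only [conjₗ_mul, map_add, map_sub]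
  have hmem : ∀ u v w, (a u * k v w - k v w * a u) + (a v * k w u - k w u * a v)
        + (a w * k u v - k u v * a w) ∈ so43 := fun u v w =>
    add_mem (add_mem (comm_mem_so43 (hk.mem_gauge _) (hk.mem _ _))
      (comm_mem_so43 (hk.mem_gauge _) (hk.mem _ _))) (comm_mem_so43 (hk.mem_gauge _) (hk.mem _ _))
  refine ⟨⟨⟨hk.alt.comp _, fun v => conj_mem_so43 h _ (hk.mem_gauge v),
    fun v w => conj_mem_so43 h _ (hk.mem v w),
    fun v w => th_conj_eq_zero h (hk.mem v w) (hk.th_eq v w),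
    fun v w => om_conj_eq_zero h (hk.mem v w) (hk.th_eq v w) (hk.om_eq v w),
    fun u v w => ?_, fun u v w => ?_⟩, fun u w hu => ?_⟩, fun u v w hu hv => ?_⟩
  · simp only [LinearMap.comp_apply, hbi]
    exact th_conj_eq_zero h (hmem u v w) (hk.bianchi_th u v w)
  · simp only [LinearMap.comp_apply, hbi]
    exact om_conj_eq_zero h (hmem u v w) (hk.bianchi_th u v w) (hk.bianchi_om u v w)
  · have h1 := hk.trace u w ((th_conj_eq_zero_iff h (hk.mem_gauge u)).1 hu)
    change (Matrix.of (al (conjₗ h (k u w)))).trace = 0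
    rw [hal, Matrix.trace_mul_comm, ← mul_assoc, gH_mul_inv, one_mul]
    exact h1
  · have hu' := (th_conj_eq_zero_iff h (hk.mem_gauge u)).1 hu
    have hv' := (th_conj_eq_zero_iff h (hk.mem_gauge v)).1 hv
    change be (conjₗ h (k w u)) ⬝ᵥ om (conjₗ h (a v)) = be (conjₗ h (k w v)) ⬝ᵥ om (conjₗ h (a u))
    rw [hbe, hbe]
    simp only [conjₗ_apply, om_conj_eq h (hk.mem_gauge _) hu', om_conj_eq h (hk.mem_gauge _) hv']
    have h2 : ∀ (x y : Fin 3 → ℝ), (x ᵥ* gH h) ⬝ᵥ ((gH h⁻¹).mulVec y) = x ⬝ᵥ y := fun x y => by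
      rw [← Matrix.dotProduct_mulVec, Matrix.mulVec_mulVec, gH_mul_inv, Matrix.one_mulVec]
    simp only [add_dotProduct, ← Matrix.vecMul_vecMul, h2]
    rw [← Matrix.dotProduct_mulVec, ← Matrix.dotProduct_mulVec]
    congr 1
    · exact hk.symm u v w hu' hv'
    · congr 1
      ext i
      exact hk.al_symm hf w hu' hv' i

end

-- An operator norm makes `Mat` a normed algebra, so that the product rule applies to matrix-valued
-- maps; in finite dimension the choice of norm does not affect smoothness.
attribute [local instance] Matrix.linftyOpNormedAddCommGroup Matrix.linftyOpNormedSpace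
  Matrix.linftyOpNormedRing Matrix.linftyOpNormedAlgebra

@[reducible] local instance matTopology : TopologicalSpace Mat :=
  PseudoMetricSpace.toUniformSpace.toTopologicalSpace

theorem two_le_smooth : minSmoothness ℝ 2 ≤ (∞ : ℕ∞ω) := by
  simp only [minSmoothness_of_isRCLikeNormedField]
  exact WithTop.coe_le_coe.2 (le_top : (2 : ℕ∞) ≤ ⊤)

/-! ### Exterior derivatives of vector-valued `1`-forms on a normed space -/

section Calculus
variable {E E' F G R : Type*} [NormedAddCommGroup E] [NormedSpace ℝ E]
  [NormedAddCommGroup E'] [NormedSpace ℝ E'] [NormedAddCommGroup F] [NormedSpace ℝ F]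
  [NormedAddCommGroup G] [NormedSpace ℝ G] [NormedRing R] [NormedAlgebra ℝ R]

/-- The exterior derivative of a `1`-form. -/
def dd (A : E → E →L[ℝ] F) (y v w : E) : F := fderiv ℝ A y v w - fderiv ℝ A y w v

theorem isAltBilin_dd (A : E → E →L[ℝ] F) (y : E) : IsAltBilin (dd A y) where
  add_left u v w := by simp [dd]; abel
  smul_left c v w := by simp [dd, smul_sub]
  skew v w := by simp [dd]

theorem dd_congr {A B : E → E →L[ℝ] F} {y : E} (h : A =ᶠ[𝓝 y] B) : dd A y = dd B y := by
  ext v w; rw [dd, dd, h.fderiv_eq]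

theorem fderiv_apply_const {A : E → E' →L[ℝ] F} {y : E} (hA : DifferentiableAt ℝ A y) (u : E) (v : E') :
    fderiv ℝ (fun z => A z v) y u = fderiv ℝ A y u v := by
  rw [fderiv_clm_apply hA (differentiableAt_const v)]
  simp

theorem dd_clm_comp {A : E → E →L[ℝ] F} {y : E} (hA : DifferentiableAt ℝ A y) (L : F →L[ℝ] G)
    (v w : E) : dd (fun z => L.comp (A z)) y v w = L (dd A y v w) := by
  have h : HasFDerivAt (fun z => L.comp (A z)) ((L.postcomp E).comp (fderiv ℝ A y)) y :=
    HasFDerivAt.comp (g := L.postcomp E) y (L.postcomp E).hasFDerivAt hA.hasFDerivAt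
  simp [dd, h.fderiv]

theorem dd_add {A B : E → E →L[ℝ] F} {y : E} (hA : DifferentiableAt ℝ A y)
    (hB : DifferentiableAt ℝ B y) (v w : E) :
    dd (fun z => A z + B z) y v w = dd A y v w + dd B y v w := by
  simp only [dd, fderiv_fun_add hA hB, _root_.add_apply]; abel

theorem dd_sum {ι : Type*} [Fintype ι] {A : ι → E → E →L[ℝ] F} {y : E}
    (hA : ∀ i, DifferentiableAt ℝ (A i) y) (v w : E) :
    dd (fun z => ∑ i, A i z) y v w = ∑ i, dd (A i) y v w := by
  simp only [dd, fderiv_fun_sum fun i _ => hA i, _root_.sum_apply,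
    Finset.sum_sub_distrib]

theorem dd_smul {c : E → ℝ} {A : E → E →L[ℝ] F} {y : E} (hc : DifferentiableAt ℝ c y)
    (hA : DifferentiableAt ℝ A y) (v w : E) :
    dd (fun z => c z • A z) y v w =
      c y • dd A y v w + (fderiv ℝ c y v • A y w - fderiv ℝ c y w • A y v) := by
  simp only [dd, fderiv_fun_smul hc hA]
  simp [smul_sub]
  abel

/-- This is `d² = 0` for 1-forms, i.e. the symmetry of second derivatives. -/
theorem cyclic_fderiv_dd {A : E → E →L[ℝ] F} {y : E} (hA : ContDiffAt ℝ ∞ A y) (u v w : E) :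
    fderiv ℝ (fun z => dd A z v w) y u + fderiv ℝ (fun z => dd A z w u) y v
      + fderiv ℝ (fun z => dd A z u v) y w = 0 := by
  have hs := hA.isSymmSndFDerivAt two_le_smooth
  have hd : DifferentiableAt ℝ (fderiv ℝ A) y :=
    (hA.fderiv_right (m := ∞) (by simp)).differentiableAt (by simp)
  have h1 : ∀ a b c, fderiv ℝ (fun z => dd A z a b) y c =
      fderiv ℝ (fderiv ℝ A) y c a b - fderiv ℝ (fderiv ℝ A) y c b a := fun a b c => by
    have h2 : ∀ a, DifferentiableAt ℝ (fun z => fderiv ℝ A z a) y := fun a =>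
      hd.clm_apply (differentiableAt_const a)
    have h3 : ∀ a b, DifferentiableAt ℝ (fun z => fderiv ℝ A z a b) y := fun a b =>
      (h2 a).clm_apply (differentiableAt_const b)
    simp only [dd]
    rw [fderiv_fun_sub (h3 a b) (h3 b a)]
    simp only [_root_.sub_apply, fderiv_apply_const (h2 _), fderiv_apply_const hd]
  rw [h1, h1, h1, hs.eq u v, hs.eq v w, hs.eq w u]
  abel

/-- Exterior differentiation commutes with pullback: the second derivative of `f` is symmetric and
cancels. -/
theorem dd_pullback {A : E → E →L[ℝ] F} {f : E' → E} {y : E'}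
    (hA : DifferentiableAt ℝ A (f y)) (hf : ContDiffAt ℝ ∞ f y) (v w : E') :
    dd (fun z => (A (f z)).comp (fderiv ℝ f z)) y v w =
      dd A (f y) (fderiv ℝ f y v) (fderiv ℝ f y w) := by
  have hs := hf.isSymmSndFDerivAt two_le_smooth
  have hd : DifferentiableAt ℝ (fderiv ℝ f) y :=
    (hf.fderiv_right (m := ∞) (by simp)).differentiableAt (by simp)
  have hf' : DifferentiableAt ℝ f y := hf.differentiableAt (by simp)
  have h1 : HasFDerivAt (fun z => A (f z)) ((fderiv ℝ A (f y)).comp (fderiv ℝ f y)) y :=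
    hA.hasFDerivAt.comp y hf'.hasFDerivAt
  have h2 := (h1.clm_comp hd.hasFDerivAt).fderiv
  simp only [dd, h2]
  simp [hs.eq v w]

/-- The curvature `dA + A ∧ A`. -/
def curv (A : E → E →L[ℝ] R) (y v w : E) : R := dd A y v w + (A y v * A y w - A y w * A y v)

theorem isAltBilin_curv (A : E → E →L[ℝ] R) (y : E) : IsAltBilin (curv A y) where
  add_left u v w := by simp [curv, (isAltBilin_dd A y).add_left, add_mul, mul_add]; abel
  smul_left c v w := by simp [curv, (isAltBilin_dd A y).smul_left, smul_sub]
  skew v w := by rw [curv, curv, (isAltBilin_dd A y).skew]; abel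

theorem curv_congr {A B : E → E →L[ℝ] R} {y : E} (h : A =ᶠ[𝓝 y] B) : curv A y = curv B y := by
  ext v w; rw [curv, curv, dd_congr h, h.eq_of_nhds]

/-- By `d² = 0`, only the derivatives of the quadratic term `A ∧ A` remain, and these recombine into
brackets of `A` with the curvature, the cubic terms cancelling. -/
theorem bianchi {A : E → E →L[ℝ] R} {y : E} (hA : ContDiffAt ℝ ∞ A y) (u v w : E) :
    fderiv ℝ (fun z => curv A z v w) y u + fderiv ℝ (fun z => curv A z w u) y v
      + fderiv ℝ (fun z => curv A z u v) y w
      + ((A y u * curv A y v w - curv A y v w * A y u)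
        + (A y v * curv A y w u - curv A y w u * A y v)
        + (A y w * curv A y u v - curv A y u v * A y w)) = 0 := by
  have h0 := cyclic_fderiv_dd hA u v w
  have hA' := hA.differentiableAt (by simp)
  have hd : DifferentiableAt ℝ (fderiv ℝ A) y :=
    (hA.fderiv_right (m := ∞) (by simp)).differentiableAt (by simp)
  have h3 : ∀ a b, DifferentiableAt ℝ (fun z => dd A z a b) y := fun a b =>
    (((hd.clm_apply (differentiableAt_const a))).clm_apply (differentiableAt_const b)).sub
      (((hd.clm_apply (differentiableAt_const b))).clm_apply (differentiableAt_const a))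
  have h4 : ∀ a, DifferentiableAt ℝ (fun z => A z a) y := fun a =>
    hA'.clm_apply (differentiableAt_const a)
  have h5 : ∀ a b c, fderiv ℝ (fun z => curv A z a b) y c = fderiv ℝ (fun z => dd A z a b) y c
      + ((A y a * fderiv ℝ A y c b + fderiv ℝ A y c a * A y b)
        - (A y b * fderiv ℝ A y c a + fderiv ℝ A y c b * A y a)) := fun a b c => by
    simp only [curv]
    rw [fderiv_fun_add (h3 a b) (((h4 a).fun_mul (h4 b)).fun_sub ((h4 b).fun_mul (h4 a))),
      fderiv_fun_sub ((h4 a).fun_mul (h4 b)) ((h4 b).fun_mul (h4 a)), fderiv_fun_mul' (h4 a) (h4 b),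
      fderiv_fun_mul' (h4 b) (h4 a)]
    simp [fderiv_apply_const hA']
  rw [h5, h5, h5]
  rw [← sub_eq_zero] at h0
  calc _ = (fderiv ℝ (fun z => dd A z v w) y u + fderiv ℝ (fun z => dd A z w u) y v
      + fderiv ℝ (fun z => dd A z u v) y w - 0) := by
        simp only [curv, dd]; noncomm_ring
    _ = 0 := h0

/-- The gauge transform of `A` by `m`, with inverse `n`. -/
def gaugeTransform (A : E → E →L[ℝ] R) (m n : E → R) (y : E) : E →L[ℝ] R :=
  ((ContinuousLinearMap.mul ℝ R (n y)).comp ((ContinuousLinearMap.mul ℝ R).flip (m y))).comp (A y)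
    + (ContinuousLinearMap.mul ℝ R (n y)).comp (fderiv ℝ m y)

theorem gaugeTransform_apply (A : E → E →L[ℝ] R) (m n : E → R) (y v : E) :
    gaugeTransform A m n y v = n y * A y v * m y + n y * fderiv ℝ m y v := by
  simp [gaugeTransform, mul_assoc]

theorem curv_gaugeTransform {A : E → E →L[ℝ] R} {m n : E → R} {y : E}
    (hA : DifferentiableAt ℝ A y) (hm : ContDiffAt ℝ ∞ m y) (hn : DifferentiableAt ℝ n y)
    (h : ∀ᶠ z in 𝓝 y, n z * m z = 1) (h' : m y * n y = 1) (v w : E) :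
    curv (gaugeTransform A m n) y v w = n y * curv A y v w * m y := by
  have hs := hm.isSymmSndFDerivAt two_le_smooth
  have hd : DifferentiableAt ℝ (fderiv ℝ m) y :=
    (hm.fderiv_right (m := ∞) (by simp)).differentiableAt (by simp)
  have hm' : DifferentiableAt ℝ m y := hm.differentiableAt (by simp)
  -- The derivative of the inverse, obtained by differentiating `n m = 1` near `y`.
  have hn' : ∀ u, fderiv ℝ n y u = -(n y * fderiv ℝ m y u * n y) := fun u => by
    have h1 : fderiv ℝ (fun z => n z * m z) y = 0 := by
      rw [Filter.EventuallyEq.fderiv_eq (f := fun _ => (1 : R)) h]; simp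
    have h2 := congrArg (fun L => L u * n y) h1
    rw [fderiv_fun_mul' hn hm'] at h2
    simp [add_mul, mul_assoc, h'] at h2
    rw [mul_assoc]
    exact eq_neg_of_add_eq_zero_right h2
  have hAv : ∀ v, DifferentiableAt ℝ (fun z => A z v) y := fun v =>
    hA.clm_apply (differentiableAt_const v)
  have hmv : ∀ v, DifferentiableAt ℝ (fun z => fderiv ℝ m z v) y := fun v =>
    hd.clm_apply (differentiableAt_const v)
  have hB : DifferentiableAt ℝ (gaugeTransform A m n) y := by
    unfold gaugeTransform
    fun_prop
  have key : ∀ u v, fderiv ℝ (gaugeTransform A m n) y u v =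
      fderiv ℝ n y u * A y v * m y + n y * fderiv ℝ A y u v * m y + n y * A y v * fderiv ℝ m y u
      + fderiv ℝ n y u * fderiv ℝ m y v + n y * fderiv ℝ (fderiv ℝ m) y u v := fun u v => by
    rw [← fderiv_apply_const hB]
    simp only [gaugeTransform_apply]
    rw [fderiv_fun_add ((hn.fun_mul (hAv v)).fun_mul hm') (hn.fun_mul (hmv v)), fderiv_fun_mul' (hn.fun_mul (hAv v)) hm',
      fderiv_fun_mul' hn (hmv v)]
    rw [fderiv_fun_mul' hn (hAv v)]
    simp [fderiv_apply_const hA, fderiv_apply_const hd]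
    noncomm_ring
  have hmn : ∀ x, m y * (n y * x) = x := fun x => by rw [← mul_assoc, h', one_mul]
  simp only [curv, dd, key, gaugeTransform_apply, hn', hs.eq v w]
  simp only [mul_add, add_mul, mul_sub, sub_mul, neg_mul, mul_assoc, hmn]
  abel

theorem curv_pullback {A : E → E →L[ℝ] R} {f : E' → E} {y : E'}
    (hA : DifferentiableAt ℝ A (f y)) (hf : ContDiffAt ℝ ∞ f y) (v w : E') :
    curv (fun z => (A (f z)).comp (fderiv ℝ f z)) y v w =
      curv A (f y) (fderiv ℝ f y v) (fderiv ℝ f y w) := by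
  simp [curv, dd_pullback hA hf]

end Calculus

/-! ### Smooth matrix-valued and `H`-valued maps -/

def thL (k : Fin 3) : Mat →L[ℝ] ℝ := (thₗ k).toContinuousLinearMap
def omL (k : Fin 3) : Mat →L[ℝ] ℝ := (omₗ k).toContinuousLinearMap
def alL (i j : Fin 3) : Mat →L[ℝ] ℝ := (alₗ i j).toContinuousLinearMap
def beL (k : Fin 3) : Mat →L[ℝ] ℝ := (beₗ k).toContinuousLinearMap
def taL (k : Fin 3) : Mat →L[ℝ] ℝ := (taₗ k).toContinuousLinearMap
def entryL (i j : Idx) : Mat →L[ℝ] ℝ := (Matrix.entryLinearMap ℝ ℝ i j).toContinuousLinearMap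

section
variable (m : Mat) (i j : Fin 3)
@[simp] theorem thL_apply : thL i m = th m i := rfl
@[simp] theorem omL_apply : omL i m = om m i := rfl
@[simp] theorem alL_apply : alL i j m = al m i j := rfl
@[simp] theorem beL_apply : beL i m = be m i := rfl
@[simp] theorem taL_apply : taL i m = ta m i := rfl
@[simp] theorem entryL_apply (i j : Idx) : entryL i j m = m i j := rfl
end

/-- Matrices and families of entries. -/
def matEntries : Mat ≃L[ℝ] (Idx → Idx → ℝ) :=
  (LinearEquiv.refl ℝ (Idx → Idx → ℝ) : Mat ≃ₗ[ℝ] (Idx → Idx → ℝ)).toContinuousLinearEquiv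

theorem matEntries_apply (m : Mat) : matEntries m = fun i j => m i j := rfl
theorem matEntries_mat (h : H) : matEntries (H.mat h) = H.entries h := rfl

section
variable {X V F : Type*} [NormedAddCommGroup X] [NormedSpace ℝ X] [NormedAddCommGroup V]
  [NormedSpace ℝ V] [NormedAddCommGroup F] [NormedSpace ℝ F] {n : ℕ∞ω}

theorem contDiffOn_mat {f : X → Mat} {s : Set X} :
    ContDiffOn ℝ n f s ↔ ∀ i j, ContDiffOn ℝ n (fun x => f x i j) s := by
  rw [← matEntries.comp_contDiffOn_iff (f := f), contDiffOn_pi]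
  exact forall_congr' fun i => contDiffOn_pi

theorem contDiffOn_gammaMatrix {p q : X → Fin 3 → ℝ} {r : X → Fin 3 → Fin 3 → ℝ}
    {t u : X → Fin 3 → ℝ} {s : Set X} (hp : ∀ i, ContDiffOn ℝ n (fun x => p x i) s)
    (hq : ∀ i, ContDiffOn ℝ n (fun x => q x i) s) (hr : ∀ i j, ContDiffOn ℝ n (fun x => r x i j) s)
    (ht : ∀ i, ContDiffOn ℝ n (fun x => t x i) s) (hu : ∀ i, ContDiffOn ℝ n (fun x => u x i) s) :
    ContDiffOn ℝ n (fun x => gammaMatrix (p x) (q x) (r x) (t x) (u x)) s := by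
  rw [contDiffOn_mat]
  rintro (i | i | i) (j | j | j) <;> simp only [gammaMatrix, Matrix.of_apply] <;> fun_prop

/-- Inversion is smooth on the open set of invertible operators. The lemma yields smooth dual frames
of a coframe, and smooth fields with prescribed values under a connection. -/
theorem exists_smooth_preimage [CompleteSpace V] [CompleteSpace F] {P : X → V →L[ℝ] F} {W : Set X}
    (hP : ContDiffOn ℝ n P W) (hb : ∀ x ∈ W, Function.Bijective (P x)) (w : F) :
    ∃ s : X → V, ContDiffOn ℝ n s W ∧ ∀ x ∈ W, P x (s x) = w := by
  have he : ∀ x ∈ W, ∃ e : V ≃L[ℝ] F, (e : V →L[ℝ] F) = P x := fun x hx =>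
    ⟨ContinuousLinearEquiv.ofBijective (P x) (LinearMap.ker_eq_bot.2 (hb x hx).1)
      (LinearMap.range_eq_top.2 (hb x hx).2), by ext; rfl⟩
  refine ⟨fun x => (P x).inverse w, ?_, fun x hx => ?_⟩
  · refine ContDiffOn.clm_apply (fun x hx => ?_) contDiffOn_const
    obtain ⟨e, he⟩ := he x hx
    have h1 : ContDiffAt ℝ n ContinuousLinearMap.inverse (P x) := by
      rw [← he]; exact contDiffAt_map_inverse e
    exact h1.comp_contDiffWithinAt x (hP x hx)
  · obtain ⟨e, he⟩ := he x hx
    simp [← he]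
end

/-- The inverse of `Q`. -/
def Qinv : Mat := Matrix.of fun
  | .inl i, .inr (.inr j) => δ i j
  | .inr (.inl _), .inr (.inl _) => 1 / 2
  | .inr (.inr i), .inl j => δ i j
  | _, _ => 0

theorem Qinv_mul_Q : Qinv * Q = 1 := by
  ext i j
  rw [Matrix.mul_apply, sum_idx]
  rcases i with i | i | i <;> rcases j with j | j | j <;>
    simp [Qinv, Q, δ, Matrix.one_apply]
  exact Subsingleton.elim _ _

theorem H.transpose_mul_Q (h : H) : (H.mat h).transpose * Q = Q * H.mat h⁻¹ := by
  conv_rhs => rw [← H.transpose_mul_Q_mul h]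
  rw [mul_assoc, H.mat_mul_inv, mul_one]

theorem H.transpose_inv_mul_Q (h : H) : (H.mat h⁻¹).transpose * Q = Q * H.mat h := by
  rw [H.transpose_mul_Q, inv_inv]

/-- This exhibits inversion in `H` as linear in the matrix entries, so that smoothness of inverses
is immediate. -/
theorem H.mat_inv_eq (h : H) : H.mat h⁻¹ = Qinv * ((H.mat h).transpose * Q) := by
  rw [H.transpose_mul_Q, ← mul_assoc, Qinv_mul_Q, one_mul]

section
variable {X : Type*} [NormedAddCommGroup X] [NormedSpace ℝ X] {W : Set X}

/-- Smoothness of a map into `H`. -/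
def SmoothH (h : X → H) (W : Set X) : Prop := ContDiffOn ℝ ∞ (fun x => H.mat (h x)) W

theorem smoothH_iff_entries {h : X → H} : SmoothH h W ↔ ContDiffOn ℝ ∞ (fun x => H.entries (h x)) W :=
  (matEntries.comp_contDiffOn_iff (f := fun x => H.mat (h x))).symm

theorem SmoothH.mono {h : X → H} {W' : Set X} (hh : SmoothH h W) (hs : W' ⊆ W) : SmoothH h W' :=
  ContDiffOn.mono hh hs

theorem SmoothH.congr {h h' : X → H} (hh : SmoothH h W) (he : ∀ x ∈ W, h' x = h x) : SmoothH h' W :=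
  ContDiffOn.congr hh fun x hx => by rw [he x hx]

theorem SmoothH.const (h : H) : SmoothH (fun _ : X => h) W := contDiffOn_const

theorem SmoothH.mul {h k : X → H} (hh : SmoothH h W) (hk : SmoothH k W) :
    SmoothH (fun x => h x * k x) W := by
  simp only [SmoothH, H.mat_mul]; exact ContDiffOn.mul hh hk

theorem SmoothH.inv {h : X → H} (hh : SmoothH h W) : SmoothH (fun x => (h x)⁻¹) W := by
  simp only [SmoothH, H.mat_inv_eq]
  refine contDiffOn_const.mul (ContDiffOn.mul ?_ contDiffOn_const)
  rw [contDiffOn_mat]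
  exact fun i j => contDiffOn_mat.1 hh j i

theorem SmoothH.comp {Y : Type*} [NormedAddCommGroup Y] [NormedSpace ℝ Y] {V : Set Y} {h : X → H}
    (hh : SmoothH h W) {f : Y → X} (hf : ContDiffOn ℝ ∞ f V) (hm : MapsTo f V W) :
    SmoothH (fun y => h (f y)) V :=
  ContDiffOn.comp (g := fun x => H.mat (h x)) hh hf hm

theorem contDiffOn_hmat {g g' : X → Mat3} {b t : X → Fin 3 → ℝ}
    (h1 : ∀ i j, ContDiffOn ℝ ∞ (fun x => g x i j) W) (h2 : ∀ i j, ContDiffOn ℝ ∞ (fun x => g' x i j) W)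
    (h3 : ∀ i, ContDiffOn ℝ ∞ (fun x => b x i) W) (h4 : ∀ i, ContDiffOn ℝ ∞ (fun x => t x i) W) :
    ContDiffOn ℝ ∞ (fun x => hmat (g x) (g' x) (b x) (t x)) W := by
  rw [contDiffOn_mat]
  rintro (i | i | i) (j | j | j) <;> simp only [hmat, Matrix.of_apply] <;> fun_prop

theorem SmoothH.differentiableAt {h : X → H} (hh : SmoothH h W) (hW : IsOpen W) {x : X} (hx : x ∈ W) :
    DifferentiableAt ℝ (fun x => H.mat (h x)) x :=
  (ContDiffOn.contDiffAt hh (hW.mem_nhds hx)).differentiableAt (by simp)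

/-- The Maurer–Cartan form of a map into `H`. -/
def maurerCartan (h : X → H) (x v : X) : Mat :=
  H.mat (h x)⁻¹ * fderiv ℝ (fun z => H.mat (h z)) x v

theorem fderiv_clm_comp_apply {F G : Type*} [NormedAddCommGroup F] [NormedSpace ℝ F]
    [NormedAddCommGroup G] [NormedSpace ℝ G] {f : X → F} {x : X} (hf : DifferentiableAt ℝ f x)
    (L : F →L[ℝ] G) (v : X) : fderiv ℝ (fun z => L (f z)) x v = L (fderiv ℝ f x v) := by
  have h : HasFDerivAt (fun z => L (f z)) (L.comp (fderiv ℝ f x)) x :=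
    HasFDerivAt.comp (g := L) x L.hasFDerivAt hf.hasFDerivAt
  rw [h.fderiv]; rfl

variable {h : X → H} {x : X}

theorem fderiv_mat_lower_left (hd : DifferentiableAt ℝ (fun z => H.mat (h z)) x) (v : X)
    (i : Fin 1 ⊕ Fin 3) (j : Fin 3) : fderiv ℝ (fun z => H.mat (h z)) x v (.inr i) (.inl j) = 0 := by
  have := fderiv_clm_comp_apply hd (entryL (.inr i) (.inl j)) v
  simp only [entryL_apply, H.mat_lower_left] at this
  rw [← this, fderiv_fun_const]
  rfl

/-- Differentiating `hᵀ Q h = Q` gives the skewness of `h⁻¹dh` relative to `Q`. -/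
theorem maurerCartan_mem (hd : DifferentiableAt ℝ (fun z => H.mat (h z)) x) (v : X) :
    maurerCartan h x v ∈ so43 := by
  set T : Mat →L[ℝ] Mat := (Matrix.transposeLinearEquiv Idx Idx ℝ ℝ).toLinearMap.toContinuousLinearMap
  have hT : ∀ m, T m = m.transpose := fun _ => rfl
  have hd' : DifferentiableAt ℝ (fun z => T (H.mat (h z))) x := T.differentiableAt.comp x hd
  have h1 : fderiv ℝ (fun z => T (H.mat (h z)) * (Q * H.mat (h z))) x = 0 := by
    have : (fun z => T (H.mat (h z)) * (Q * H.mat (h z))) = fun _ => Q := by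
      ext1 z; rw [hT, ← mul_assoc, H.transpose_mul_Q_mul]
    rw [this]; simp
  have h2 := (HasFDerivAt.mul' hd'.hasFDerivAt
    ((hasFDerivAt_const Q x).mul' hd.hasFDerivAt)).fderiv
  have h3 := congrArg (fun L : X →L[ℝ] Mat => L v) (h2.symm.trans h1)
  have h4 : (H.mat (h x)).transpose * (Q * fderiv ℝ (fun z => H.mat (h z)) x v)
      + (fderiv ℝ (fun z => H.mat (h z)) x v).transpose * (Q * H.mat (h x)) = 0 := by
    have h5 := fderiv_clm_comp_apply hd T v
    simp only [hT] at h5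
    rw [← h5]
    simpa [hT] using h3
  rw [mem_so43_iff, maurerCartan, Matrix.transpose_mul, mul_assoc, H.transpose_inv_mul_Q, ← mul_assoc Q,
    ← H.transpose_mul_Q, mul_assoc _ Q]
  exact eq_neg_of_add_eq_zero_right h4

/-- The lower left entries of elements of `H` vanish identically. Consequently a gauge
transformation acts on `θ` and `ω` by pointwise conjugation alone. -/
theorem th_maurerCartan (hd : DifferentiableAt ℝ (fun z => H.mat (h z)) x) (v : X) :
    th (maurerCartan h x v) = 0 := by
  ext k
  simp [maurerCartan, th, Matrix.mul_apply, H.mat_lower_left, fderiv_mat_lower_left hd]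

theorem om_maurerCartan (hd : DifferentiableAt ℝ (fun z => H.mat (h z)) x) (v : X) :
    om (maurerCartan h x v) = 0 := by
  ext k
  simp [maurerCartan, om, Matrix.mul_apply, H.mat_lower_left, fderiv_mat_lower_left hd]

end

/-! ### Normal gauges -/

abbrev E6 : Type := EuclideanSpace ℝ (Fin 6)

/-- The transform of the gauge `A` by a map into `H`. -/
def gaugeH {X : Type*} [NormedAddCommGroup X] [NormedSpace ℝ X] (A : X → X →L[ℝ] Mat) (h : X → H) :
    X → X →L[ℝ] Mat :=
  gaugeTransform A (fun y => H.mat (h y)) (fun y => H.mat (h y)⁻¹)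

theorem gaugeH_apply {X : Type*} [NormedAddCommGroup X] [NormedSpace ℝ X] (A : X → X →L[ℝ] Mat)
    (h : X → H) (y v : X) : gaugeH A h y v = conjₗ (h y) (A y v) + maurerCartan h y v :=
  gaugeTransform_apply _ _ _ _ _

/-- Normal gauges on `W`. -/
structure IsGauge (W : Set E6) (A : E6 → E6 →L[ℝ] Mat) : Prop where
  smooth : ContDiffOn ℝ ∞ A W
  inj : ∀ y ∈ W, ∀ v, th (A y v) = 0 → om (A y v) = 0 → v = 0
  normal : ∀ y ∈ W, NormalAt (A y : E6 →ₗ[ℝ] Mat) (curv A y)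

theorem bijective_of_inj {a : E6 →ₗ[ℝ] Mat} (h : ∀ v, th (a v) = 0 → om (a v) = 0 → v = 0) :
    Function.Bijective fun v => (th (a v), om (a v)) := by
  let L : E6 →ₗ[ℝ] (Fin 3 → ℝ) × (Fin 3 → ℝ) :=
    { toFun := fun v => (th (a v), om (a v))
      map_add' := fun u v => by simp
      map_smul' := fun c v => by simp }
  have h1 : Function.Injective L := by
    rw [injective_iff_map_eq_zero]
    intro v hv
    exact h v (congrArg Prod.fst hv) (congrArg Prod.snd hv)
  exact ⟨h1, (LinearMap.injective_iff_surjective_of_finrank_eq_finrank (by simp)).1 h1⟩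

theorem exists_isFrame_of_inj {a : E6 →ₗ[ℝ] Mat} (h : ∀ v, th (a v) = 0 → om (a v) = 0 → v = 0) :
    ∃ e f, IsFrame a e f := exists_isFrame a (bijective_of_inj h)

section
variable {W : Set E6} {A : E6 → E6 →L[ℝ] Mat}

theorem contDiffOn_apply (hA : ContDiffOn ℝ ∞ A W) {s : E6 → E6} (hs : ContDiffOn ℝ ∞ s W) :
    ContDiffOn ℝ ∞ (fun y => A y (s y)) W := hA.clm_apply hs

theorem exists_smooth_frame (hA : ContDiffOn ℝ ∞ A W)
    (h : ∀ y ∈ W, ∀ v, th (A y v) = 0 → om (A y v) = 0 → v = 0) :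
    ∃ e f : Fin 3 → E6 → E6, (∀ l, ContDiffOn ℝ ∞ (e l) W) ∧ (∀ p, ContDiffOn ℝ ∞ (f p) W) ∧
      ∀ y ∈ W, IsFrame (A y : E6 →ₗ[ℝ] Mat) (fun l => e l y) (fun p => f p y) := by
  let P : E6 → E6 →L[ℝ] (Fin 3 → ℝ) × (Fin 3 → ℝ) := fun y =>
    ((ContinuousLinearMap.pi thL).prod (ContinuousLinearMap.pi omL)).comp (A y)
  have hP : ContDiffOn ℝ ∞ P W := contDiffOn_const.clm_comp hA
  have hPv : ∀ y v, P y v = (th (A y v), om (A y v)) := fun y v => rfl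
  have hb : ∀ y ∈ W, Function.Bijective (P y) := fun y hy =>
    bijective_of_inj (a := (A y : E6 →ₗ[ℝ] Mat)) (h y hy)
  choose e he1 he2 using fun l => exists_smooth_preimage hP hb (δ l, 0)
  choose f hf1 hf2 using fun p => exists_smooth_preimage hP hb (0, δ p)
  refine ⟨e, f, he1, hf1, fun y hy => ?_⟩
  simp only [hPv, Prod.mk.injEq] at he2 hf2
  refine ⟨fun l m => by simp [(he2 l y hy).1], fun l => (he2 l y hy).2, fun p => (hf2 p y hy).1,
    fun p q => by simp [(hf2 p y hy).2], fun v => ?_⟩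
  have h1 := h y hy (v - (∑ l, th (A y v) l • e l y + ∑ p, om (A y v) p • f p y))
  rw [← sub_eq_zero]
  apply h1
  · ext i
    have h2 := fun l => (he2 l y hy).1
    have h3 := fun l => (hf2 l y hy).1
    simp [th_sum, h2, h3]
    simp [δ]
  · ext i
    have h2 := fun l => (he2 l y hy).2
    have h3 := fun l => (hf2 l y hy).2
    simp [om_sum, h2, h3]
    simp [δ]

theorem dd_mem_so43 {X : Type*} [NormedAddCommGroup X] [NormedSpace ℝ X] {W : Set X}
    {A : X → X →L[ℝ] Mat} (hW : IsOpen W) (smooth : ContDiffOn ℝ ∞ A W)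
    (mem : ∀ y ∈ W, ∀ v, A y v ∈ so43) {y : X} (hy : y ∈ W) (v w : X) : dd A y v w ∈ so43 := by
  have hnh := hW.mem_nhds hy
  have hA : DifferentiableAt ℝ A y := (smooth.contDiffAt hnh).differentiableAt (by simp)
  let L : Mat →L[ℝ] Mat := LinearMap.toContinuousLinearMap
    { toFun := fun m => m.transpose * Q + Q * m
      map_add' := fun m n => by rw [Matrix.transpose_add]; noncomm_ring
      map_smul' := fun c m => by simp [Matrix.transpose_smul] }
  have hL : ∀ m, L m = 0 ↔ m ∈ so43 := fun m => by
    rw [mem_so43_iff]; exact add_eq_zero_iff_eq_neg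
  rw [← hL, ← dd_clm_comp hA]
  have : (fun z => L.comp (A z)) =ᶠ[𝓝 y] fun _ => 0 := by
    filter_upwards [hnh] with z hz
    ext1 u
    exact (hL _).2 (mem z hz u)
  rw [dd_congr this]
  simp [dd]

theorem differentiableAt_curv {y : E6} (hA : ContDiffAt ℝ ∞ A y) (v w : E6) :
    DifferentiableAt ℝ (fun z => curv A z v w) y := by
  have hA' := hA.differentiableAt (by simp)
  have hd : DifferentiableAt ℝ (fderiv ℝ A) y :=
    (hA.fderiv_right (m := ∞) (by simp)).differentiableAt (by simp)
  have h3 : ∀ a b, DifferentiableAt ℝ (fun z => fderiv ℝ A z a b) y := fun a b =>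
    (hd.clm_apply (differentiableAt_const a)).clm_apply (differentiableAt_const b)
  have h4 : ∀ a, DifferentiableAt ℝ (fun z => A z a) y := fun a =>
    hA'.clm_apply (differentiableAt_const a)
  exact ((h3 v w).sub (h3 w v)).add (((h4 v).mul (h4 w)).sub ((h4 w).mul (h4 v)))

theorem fderiv_curv_eq_zero (hW : IsOpen W) (smooth : ContDiffOn ℝ ∞ A W) (L : Mat →L[ℝ] ℝ)
    (hL : ∀ z ∈ W, ∀ v w, L (curv A z v w) = 0) {y : E6} (hy : y ∈ W) (u v w : E6) :
    L (fderiv ℝ (fun z => curv A z v w) y u) = 0 := by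
  have hnh := hW.mem_nhds hy
  rw [← fderiv_clm_comp_apply (differentiableAt_curv (smooth.contDiffAt hnh) v w)]
  have : (fun z => L (curv A z v w)) =ᶠ[𝓝 y] fun _ => (0 : ℝ) := by
    filter_upwards [hnh] with z hz using hL z hz v w
  rw [this.fderiv_eq, fderiv_fun_const]; rfl

theorem curv_mem_so43 (hW : IsOpen W) (smooth : ContDiffOn ℝ ∞ A W)
    (mem : ∀ y ∈ W, ∀ v, A y v ∈ so43) {y : E6} (hy : y ∈ W) (v w : E6) : curv A y v w ∈ so43 :=
  add_mem (dd_mem_so43 hW smooth mem hy v w) (comm_mem_so43 (mem y hy v) (mem y hy w))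

/-- When a component of the curvature vanishes identically, its derivatives drop out of the
differential Bianchi identity, and an algebraic identity in that component is left. This is the only
source of the algebraic Bianchi identities. -/
theorem bianchi_of_component_eq_zero (hW : IsOpen W) (smooth : ContDiffOn ℝ ∞ A W) (L : Mat →L[ℝ] ℝ)
    (hL : ∀ z ∈ W, ∀ v w, L (curv A z v w) = 0) {y : E6} (hy : y ∈ W) (u v w : E6) :
    L ((A y u * curv A y v w - curv A y v w * A y u) + (A y v * curv A y w u - curv A y w u * A y v)
      + (A y w * curv A y u v - curv A y u v * A y w)) = 0 := by
  have h1 := congrArg L (bianchi (smooth.contDiffAt (hW.mem_nhds hy)) u v w)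
  rwa [map_add, map_add, map_add, fderiv_curv_eq_zero hW smooth L hL hy,
    fderiv_curv_eq_zero hW smooth L hL hy, fderiv_curv_eq_zero hW smooth L hL hy, map_zero, zero_add,
    zero_add, zero_add] at h1

theorem bianchiAt_curv (hW : IsOpen W) (smooth : ContDiffOn ℝ ∞ A W)
    (mem : ∀ y ∈ W, ∀ v, A y v ∈ so43)
    (hth : ∀ y ∈ W, ∀ v w, th (curv A y v w) = 0) (hom : ∀ y ∈ W, ∀ v w, om (curv A y v w) = 0)
    {y : E6} (hy : y ∈ W) : BianchiAt (A y : E6 →ₗ[ℝ] Mat) (curv A y) where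
  alt := isAltBilin_curv A y
  mem_gauge := mem y hy
  mem := curv_mem_so43 hW smooth mem hy
  th_eq := hth y hy
  om_eq := hom y hy
  bianchi_th u v w := funext fun i => bianchi_of_component_eq_zero hW smooth (thL i)
    (fun z hz v w => congrFun (hth z hz v w) i) hy u v w
  bianchi_om u v w := funext fun i => bianchi_of_component_eq_zero hW smooth (omL i)
    (fun z hz v w => congrFun (hom z hz v w) i) hy u v w

theorem isGauge_of_components (hW : IsOpen W) (smooth : ContDiffOn ℝ ∞ A W)
    (mem : ∀ y ∈ W, ∀ v, A y v ∈ so43)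
    (inj : ∀ y ∈ W, ∀ v, th (A y v) = 0 → om (A y v) = 0 → v = 0)
    (hth : ∀ y ∈ W, ∀ v w, th (curv A y v w) = 0) (hom : ∀ y ∈ W, ∀ v w, om (curv A y v w) = 0)
    (trace : ∀ y ∈ W, ∀ u w, th (A y u) = 0 → ∑ i, al (curv A y u w) i i = 0)
    (symm : ∀ y ∈ W, ∀ u v w, th (A y u) = 0 → th (A y v) = 0 →
      ∑ j, be (curv A y w u) j * om (A y v) j = ∑ j, be (curv A y w v) j * om (A y u) j) :
    IsGauge W A :=
  ⟨smooth, inj, fun y hy => ⟨⟨bianchiAt_curv hW smooth mem hth hom hy, trace y hy⟩, symm y hy⟩⟩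

theorem IsGauge.mono (h : IsGauge W A) {W' : Set E6} (hs : W' ⊆ W) : IsGauge W' A :=
  ⟨h.smooth.mono hs, fun y hy => h.inj y (hs hy), fun y hy => h.normal y (hs hy)⟩

theorem contDiffOn_gaugeH {V : Type*} [NormedAddCommGroup V] [NormedSpace ℝ V] [FiniteDimensional ℝ V]
    {W : Set V} {A : V → V →L[ℝ] Mat} (hW : IsOpen W) (hA : ContDiffOn ℝ ∞ A W) {h : V → H}
    (hh : SmoothH h W) : ContDiffOn ℝ ∞ (gaugeH A h) W := by
  rw [contDiffOn_clm_apply]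
  intro v
  have h1 : ContDiffOn ℝ ∞ (fun y => fderiv ℝ (fun z => H.mat (h z)) y v) W :=
    (ContDiffOn.fderiv_of_isOpen hh hW (m := ∞) (by simp)).clm_apply contDiffOn_const
  simp only [gaugeH, gaugeTransform_apply]
  exact ((ContDiffOn.mul hh.inv (hA.clm_apply contDiffOn_const)).mul hh).add
    (ContDiffOn.mul hh.inv h1)

theorem curv_gaugeH {V : Type*} [NormedAddCommGroup V] [NormedSpace ℝ V]
    {W : Set V} {A : V → V →L[ℝ] Mat} (hW : IsOpen W) (hA : ContDiffOn ℝ ∞ A W) {h : V → H}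
    (hh : SmoothH h W) {y : V} (hy : y ∈ W) (v w : V) :
    curv (gaugeH A h) y v w = conjₗ (h y) (curv A y v w) :=
  curv_gaugeTransform ((hA.contDiffAt (hW.mem_nhds hy)).differentiableAt (by simp))
    (ContDiffOn.contDiffAt hh (hW.mem_nhds hy)) (hh.inv.differentiableAt hW hy)
    (Filter.Eventually.of_forall fun z => H.mat_inv_mul (h z)) (H.mat_mul_inv (h y)) v w

theorem th_gaugeH_eq_zero_iff {V : Type*} [NormedAddCommGroup V] [NormedSpace ℝ V]
    {A : V → V →L[ℝ] Mat} {h : V → H} {y v : V} (hm : A y v ∈ so43)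
    (hd : DifferentiableAt ℝ (fun z => H.mat (h z)) y) :
    th (gaugeH A h y v) = 0 ↔ th (A y v) = 0 := by
  rw [gaugeH_apply, th_add, th_maurerCartan hd, add_zero, conjₗ_apply, th_conj_eq_zero_iff (h y) hm]

theorem gaugeH_mem {V : Type*} [NormedAddCommGroup V] [NormedSpace ℝ V]
    {A : V → V →L[ℝ] Mat} {h : V → H} {y v : V} (hm : A y v ∈ so43)
    (hd : DifferentiableAt ℝ (fun z => H.mat (h z)) y) : gaugeH A h y v ∈ so43 := by
  rw [gaugeH_apply]
  exact add_mem (conj_mem_so43 _ _ hm) (maurerCartan_mem hd v)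

theorem om_conj_eq_zero_imp (h : H) {m : Mat} (hm : m ∈ so43) (h0 : th m = 0)
    (h1 : om (H.mat h⁻¹ * m * H.mat h) = 0) : om m = 0 := by
  rw [om_conj_eq h hm h0] at h1
  have := congrArg (gH h).mulVec h1
  rwa [Matrix.mulVec_mulVec, gH_mul_inv, Matrix.one_mulVec, Matrix.mulVec_zero] at this

/-- The curvature is conjugated, and so are the `θ`- and `ω`-components of the gauge, the
Maurer–Cartan form having none. As `NormalAt` sees no other components of the gauge, `NormalAt.conj`
applies. -/
theorem IsGauge.gaugeH (hA : IsGauge W A) (hW : IsOpen W) {h : E6 → H} (hh : SmoothH h W) :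
    IsGauge W (gaugeH A h) := by
  refine ⟨contDiffOn_gaugeH hW hA.smooth hh, fun y hy v h0 h1 => ?_, fun y hy => ?_⟩
  · have hd := hh.differentiableAt hW hy
    have hm := (hA.normal y hy).mem_gauge v
    have h2 := (th_gaugeH_eq_zero_iff hm hd).1 h0
    refine hA.inj y hy v h2 ?_
    rw [gaugeH_apply, om_add, om_maurerCartan hd, add_zero] at h1
    exact om_conj_eq_zero_imp (h y) hm h2 h1
  · have hd := hh.differentiableAt hW hy
    obtain ⟨e, f, hf⟩ := exists_isFrame_of_inj (a := (A y : E6 →ₗ[ℝ] Mat)) (hA.inj y hy)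
    have h1 := (hA.normal y hy).conj hf (h y)
    have h2 : curv (ThreePlane.gaugeH A h) y = fun v w => conjₗ (h y) (curv A y v w) := by
      ext1 v; ext1 w; exact curv_gaugeH hW hA.smooth hh hy v w
    rw [h2]
    refine h1.congr (fun v => gaugeH_mem ((hA.normal y hy).mem_gauge v) hd) (fun v => ?_) fun v => ?_
    · change th (ThreePlane.gaugeH A h y v) = _
      rw [gaugeH_apply, th_add, th_maurerCartan hd, add_zero]; rfl
    · change om (ThreePlane.gaugeH A h y v) = _
      rw [gaugeH_apply, om_add, om_maurerCartan hd, add_zero]; rfl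

end

/-! ### Linear algebra for the comparison of gauges -/

theorem sum_ε_δ (i p : Fin 3) (x : Fin 3 → ℝ) :
    ∑ j, ∑ k, ε i j k * (δ p j * x k - x j * δ p k) = 2 * ∑ k, ε i p k * x k := by
  revert i p
  simp only [forall_fin_three, Fin.sum_univ_three]
  simp
  constructorm* _ ∧ _ <;> ring

/-- `X` is the difference of the `α`s on the `f_p`, and `a` is the symmetric matrix of the
difference of the `ω`s on the `e_l`. Tracing `hX` kills the trace of `X` because `a` is symmetric,
so `X` is an `ε`-contraction of `a`; inserted into `hO`, this gives `6 a = 0`. -/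
theorem comparison_om {X : Fin 3 → Fin 3 → Fin 3 → ℝ} {a : Fin 3 → Fin 3 → ℝ}
    (hX : ∀ p l i, (∑ k, X p k k) * δ l i - X p l i - 2 * ∑ k, ε i p k * a k l = 0)
    (hO : ∀ p q j, 2 * ∑ k, a j k * ε k p q = -X p j q + X q j p) (hs : ∀ j l, a j l = a l j) :
    (∀ j l, a j l = 0) ∧ ∀ p l i, X p l i = 0 := by
  have h1 := hs 1 0
  have h2 := hs 2 0
  have h3 := hs 2 1
  have htr : ∀ p, ∑ k, X p k k = 0 := fun p => by
    have := fun i => hX p i i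
    revert p
    simp only [forall_fin_three, Fin.sum_univ_three]
    simp [h1, h2, h3]
    constructorm* _ ∧ _ <;> intros <;> linarith
  have hX' : ∀ p l i, X p l i = - 2 * ∑ k, ε i p k * a k l := fun p l i => by
    have := hX p l i
    rw [htr p] at this
    linarith
  have ha : ∀ j l, a j l = 0 := by
    have h4 := fun j => hO 0 1 j
    have h5 := fun j => hO 1 2 j
    have h6 := fun j => hO 2 0 j
    simp only [hX', forall_fin_three, Fin.sum_univ_three] at h4 h5 h6 ⊢
    simp [h1, h2, h3] at h4 h5 h6 ⊢
    constructorm* _ ∧ _ <;> linarith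
  exact ⟨ha, fun p l i => by simp [hX', ha]⟩

/-- The equation for `dω` makes the difference `X` of the `α`s skew in its first two indices; the
equation for `dθ` then determines it from its traces. These traces are the three parameters that the
coordinate `t` of `H` can adjust. -/
theorem comparison_al {X : Fin 3 → Fin 3 → Fin 3 → ℝ} {Y : Fin 3 → Fin 3 → ℝ}
    (h1 : ∀ m l i, (∑ k, X m k k) * δ l i - (∑ k, X l k k) * δ m i - X m l i + X l m i = 0)
    (h2 : ∀ m p i, X m i p = ∑ k, ε i k m * Y p k) (m l i : Fin 3) :
    X m l i = ((∑ k, X m k k) * δ l i - (∑ k, X l k k) * δ m i) / 2 := by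
  have h3 : X m l i = - X l m i := by
    rw [h2, h2, ← Finset.sum_neg_distrib]
    refine Finset.sum_congr rfl fun k _ => ?_
    simp only [ε]; ring
  linarith [h1 m l i]

theorem comparison_be {Y : Fin 3 → Fin 3 → ℝ}
    (h : ∀ m l i, ∑ k, ε i k l * Y m k - ∑ k, ε i k m * Y l k = 0) (m k : Fin 3) : Y m k = 0 := by
  revert m k
  simp only [forall_fin_three, Fin.sum_univ_three] at h ⊢
  simp at h ⊢
  constructorm* _ ∧ _ <;> linarith

/-- As `ε` is skew, the two sides are negatives of each other, so all contractions of `Z` with `ε`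
vanish. -/
theorem comparison_ta {Z : Fin 3 → ℝ} (h : ∀ p q, ∑ j, ε q j p * Z j = ∑ j, ε p j q * Z j)
    (k : Fin 3) : Z k = 0 := by
  have h1 := h 0 1
  have h2 := h 1 2
  have h3 := h 2 0
  simp only [Fin.sum_univ_three] at h1 h2 h3
  simp at h1 h2 h3
  revert k
  simp only [forall_fin_three]
  refine ⟨?_, ?_, ?_⟩ <;> linarith

/-! ### Equivalence of gauges -/

section
variable {W : Set E6} {A B C : E6 → E6 →L[ℝ] Mat}

theorem clm_dd_congr (hW : IsOpen W) (hA : ContDiffOn ℝ ∞ A W) (hB : ContDiffOn ℝ ∞ B W)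
    (L : Mat →L[ℝ] ℝ) (h : ∀ z ∈ W, ∀ v, L (B z v) = L (A z v)) {y : E6} (hy : y ∈ W) (v w : E6) :
    L (dd B y v w) = L (dd A y v w) := by
  have hn := hW.mem_nhds hy
  rw [← dd_clm_comp ((hA.contDiffAt hn).differentiableAt (by simp)),
    ← dd_clm_comp ((hB.contDiffAt hn).differentiableAt (by simp))]
  have : (fun z => L.comp (B z)) =ᶠ[𝓝 y] fun z => L.comp (A z) := by
    filter_upwards [hn] with z hz
    ext1 u
    exact h z hz u
  rw [dd_congr this]

/-- In `d(c θ) = dc ∧ θ + c dθ` the first term vanishes on pairs of horizontal vectors, i.e. vectors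
annihilated by `θ`. -/
theorem clm_dd_of_eq_sum (hW : IsOpen W) (hA : ContDiffOn ℝ ∞ A W) (hB : ContDiffOn ℝ ∞ B W)
    (L : Mat →L[ℝ] ℝ) {c : Fin 3 → E6 → ℝ} (hc : ∀ l, ContDiffOn ℝ ∞ (c l) W)
    (h : ∀ z ∈ W, ∀ v, L (B z v) = L (A z v) + ∑ l, c l z * th (A z v) l) {y : E6} (hy : y ∈ W)
    {v w : E6} (hv : th (A y v) = 0) (hw : th (A y w) = 0) :
    L (dd B y v w) = L (dd A y v w) + ∑ l, c l y * th (dd A y v w) l := by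
  have hn := hW.mem_nhds hy
  have hAd := (hA.contDiffAt hn).differentiableAt (by simp)
  have hcd := fun l => ((hc l).contDiffAt hn).differentiableAt (by simp)
  have hLd : ∀ (L : Mat →L[ℝ] ℝ), DifferentiableAt ℝ (fun z => L.comp (A z)) y := fun L =>
    (differentiableAt_const L).clm_comp hAd
  have : (fun z => L.comp (B z)) =ᶠ[𝓝 y]
      fun z => L.comp (A z) + ∑ l, c l z • (thL l).comp (A z) := by
    filter_upwards [hn] with z hz
    ext1 u
    simpa using h z hz u
  rw [← dd_clm_comp ((hB.contDiffAt hn).differentiableAt (by simp)), dd_congr this,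
    dd_add (hLd L) (DifferentiableAt.fun_sum fun l _ => (hcd l).fun_smul (hLd _)),
    dd_sum (fun l => (hcd l).fun_smul (hLd _)), dd_clm_comp hAd]
  congr 1
  refine Finset.sum_congr rfl fun l _ => ?_
  rw [dd_smul (hcd l) (hLd _), dd_clm_comp hAd]
  simp [hv, hw]

theorem th_dd (hA : IsGauge W A) {y : E6} (hy : y ∈ W) (v w : E6) (i : Fin 3) :
    th (dd A y v w) i = - th (A y v * A y w - A y w * A y v) i := by
  have := congrFun ((hA.normal y hy).th_eq v w) i
  simp only [curv, th_add, Pi.add_apply, Pi.zero_apply] at this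
  linarith

theorem om_dd (hA : IsGauge W A) {y : E6} (hy : y ∈ W) (v w : E6) (i : Fin 3) :
    om (dd A y v w) i = - om (A y v * A y w - A y w * A y v) i := by
  have := congrFun ((hA.normal y hy).om_eq v w) i
  simp only [curv, om_add, Pi.add_apply, Pi.zero_apply] at this
  linarith

/-- On horizontal vectors only the term `ε_ijk ω^j ∧ ω^k` of `dθ_i` survives. This encodes the
bracket `Λ²D → TM/D`. -/
theorem th_dd_of_horizontal (hA : IsGauge W A) {y : E6} (hy : y ∈ W) {v w : E6} (hv : th (A y v) = 0)
    (hw : th (A y w) = 0) {p q : Fin 3} (hv' : om (A y v) = δ p) (hw' : om (A y w) = δ q) (i : Fin 3) :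
    th (dd A y v w) i = 2 * ε i p q := by
  have mA : ∀ v, A y v ∈ so43 := (hA.normal y hy).mem_gauge
  rw [th_dd hA hy, th_comm (mA v) (mA w)]
  simp only [hv, hw, hv', hw', Pi.zero_apply, mul_zero, sub_zero, Finset.sum_const_zero, zero_sub,
    neg_neg]
  have := sum_ε_δ i p (δ q)
  rw [show (∑ j, ∑ k, ε i j k * (δ p j * δ q k - δ q j * δ p k)) = _ from this]
  simp [δ]

/-- The frame identities, with the gauge as a continuous linear map. -/
theorem IsFrame.values {a : E6 →L[ℝ] Mat} {e f : Fin 3 → E6} (h : IsFrame (a : E6 →ₗ[ℝ] Mat) e f) :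
    (∀ l, th (a (e l)) = δ l) ∧ (∀ l, om (a (e l)) = 0) ∧ (∀ p, th (a (f p)) = 0) ∧
      ∀ p, om (a (f p)) = δ p :=
  ⟨fun l => funext (h.th_e l), h.om_e, h.th_f, fun p => funext (h.om_f p)⟩

theorem IsFrame.clm_eq {a : E6 →L[ℝ] Mat} {e f : Fin 3 → E6} (h : IsFrame (a : E6 →ₗ[ℝ] Mat) e f)
    {F : Type*} [AddCommGroup F] [Module ℝ F] (L : E6 →ₗ[ℝ] F) (v : E6) :
    L v = ∑ l, th (a v) l • L (e l) + ∑ p, om (a v) p • L (f p) := by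
  conv_lhs => rw [h.expand v]
  simp

/-- Two gauges with the same `θ` and `ω`-components that agree to first order agree in `θ`, `ω`, and
in the `α`-component on horizontal vectors. -/
theorem om_eq_of_symm (hW : IsOpen W) (hA : IsGauge W A) (hC : IsGauge W C) {e f : Fin 3 → E6 → E6}
    (he : ∀ l, ContDiffOn ℝ ∞ (e l) W)
    (hf : ∀ y ∈ W, IsFrame (A y : E6 →ₗ[ℝ] Mat) (fun l => e l y) (fun p => f p y))
    (hth : ∀ y ∈ W, ∀ v, th (C y v) = th (A y v)) (hom : ∀ y ∈ W, ∀ p, om (C y (f p y)) = δ p)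
    (hs : ∀ y ∈ W, ∀ j l, om (C y (e l y)) j = om (C y (e j y)) l) {y : E6} (hy : y ∈ W) :
    (∀ v, om (C y v) = om (A y v)) ∧ ∀ p, al (C y (f p y)) = al (A y (f p y)) := by
  have hexp : ∀ z ∈ W, ∀ v j, om (C z v) j = om (A z v) j + ∑ l, om (C z (e l z)) j * th (A z v) l := by
    intro z hz v j
    have := (hf z hz).clm_eq (omₗ j ∘ₗ (C z : E6 →ₗ[ℝ] Mat)) v
    simp [hom z hz] at this
    rw [this, add_comm]
    congr 1
    · simp [δ]
    · exact Finset.sum_congr rfl fun _ _ => mul_comm _ _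
  obtain ⟨te, oe, tf, of⟩ := (hf y hy).values
  have mA : ∀ v, A y v ∈ so43 := (hA.normal y hy).mem_gauge
  have mC : ∀ v, C y v ∈ so43 := (hC.normal y hy).mem_gauge
  have h1 : ∀ v w i, th (C y v * C y w - C y w * C y v) i = th (A y v * A y w - A y w * A y v) i := by
    intro v w i
    have := clm_dd_congr hW hA.smooth hC.smooth (thL i) (fun z hz v => by simp [hth z hz]) hy v w
    simp only [thL_apply, th_dd hC hy, th_dd hA hy, neg_inj] at this
    exact this
  have hc : _ ∧ _ := comparison_om (X := fun p l i => al (C y (f p y)) l i - al (A y (f p y)) l i)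
    (a := fun j l => om (C y (e l y)) j) ?_ ?_ (hs y hy)
  · obtain ⟨ha, hX⟩ := hc
    refine ⟨fun v => ?_, fun p => ?_⟩
    · ext j
      rw [hexp y hy]
      simp [ha]
    · ext l i
      exact sub_eq_zero.1 (hX p l i)
  · intro p l i
    have h2 := h1 (f p y) (e l y) i
    rw [th_comm (mC _) (mC _), th_comm (mA _) (mA _)] at h2
    have h3 := sum_ε_δ i p (om (C y (e l y)))
    simp only [hth y hy, te, oe, tf, of, hom y hy, Pi.zero_apply, mul_zero, sub_zero, h3, zero_mul,
      Finset.sum_const_zero, ← Finset.sum_mul, Finset.sum_sub_distrib] at h2 ⊢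
    simp [δ] at h2 ⊢
    split_ifs at h2 ⊢ <;> linarith
  · intro p q j
    have h2 := clm_dd_of_eq_sum hW hA.smooth hC.smooth (omL j)
      (c := fun l z => om (C z (e l z)) j)
      (fun l => (omL j).contDiff.comp_contDiffOn (contDiffOn_apply hC.smooth (he l)))
      (fun z hz v => hexp z hz v j) hy (tf p) (tf q)
    simp only [omL_apply, om_dd hC hy, om_dd hA hy, om_comm (mC _) (mC _), om_comm (mA _) (mA _),
      th_dd_of_horizontal hA hy (tf p) (tf q) (of p) (of q)] at h2
    simp only [hth y hy, tf, of, hom y hy, Pi.zero_apply, mul_zero, sub_zero,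
      Finset.sum_const_zero] at h2
    simp [δ] at h2
    rw [Finset.mul_sum]
    have h4 : ∀ k, om (C y (e k y)) j * (2 * ε k p q) = 2 * (om (C y (e k y)) j * ε k p q) :=
      fun k => by ring
    simp only [h4] at h2
    linarith

end

/-! ### Normalizing gauge transformations -/

theorem gaugeH_gaugeH {X : Type*} [NormedAddCommGroup X] [NormedSpace ℝ X] (A : X → X →L[ℝ] Mat)
    {h k : X → H} {y : X} (hh : DifferentiableAt ℝ (fun z => H.mat (h z)) y)
    (hk : DifferentiableAt ℝ (fun z => H.mat (k z)) y) :
    gaugeH (gaugeH A h) k y = gaugeH A (fun z => h z * k z) y := by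
  ext1 v
  have h1 : fderiv ℝ (fun z => H.mat (h z * k z)) y v =
      H.mat (h y) * fderiv ℝ (fun z => H.mat (k z)) y v
        + fderiv ℝ (fun z => H.mat (h z)) y v * H.mat (k y) := by
    simp only [H.mat_mul]
    have h2 : fderiv ℝ (fun z => H.mat (h z) * H.mat (k z)) y = _ :=
      (hh.hasFDerivAt.mul' hk.hasFDerivAt).fderiv
    rw [h2]
    simp
  simp only [gaugeH_apply, maurerCartan, conjₗ_apply, mul_inv_rev, H.mat_mul]
  simp only [H.mat_mul] at h1
  rw [h1]
  have h2 : ∀ a b c d : Mat, a * H.mat (h y)⁻¹ * (H.mat (h y) * b + c * d) =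
      a * b + a * H.mat (h y)⁻¹ * c * d := fun a b c d => by
    rw [mul_add, show a * H.mat (h y)⁻¹ * (H.mat (h y) * b) = a * (H.mat (h y)⁻¹ * H.mat (h y)) * b by
      noncomm_ring, H.mat_inv_mul]
    noncomm_ring
  rw [h2]
  noncomm_ring

theorem be_mul (h k : H) (j : Fin 3) :
    be (H.mat (h * k)) j = be (H.mat k) j + ∑ p, be (H.mat h) p * gH k p j := by
  simp [be, gH, al, Matrix.mul_apply, H.mat_cc, H.mat_lower_left, add_comm]

theorem be_inv_of_gH_eq_one {h : H} (hg : gH h = 1) : be (H.mat h⁻¹) = -be (H.mat h) := by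
  ext j
  have := be_mul h⁻¹ h j
  rw [inv_mul_cancel, hg] at this
  simp [be, Matrix.one_apply] at this
  simp [be]
  linarith

theorem gH_inv_of_gH_eq_one {h : H} (hg : gH h = 1) : gH h⁻¹ = 1 := by
  simpa [hg] using gH_inv_mul h

theorem gH_of_mat {h : H} {g g' : Mat3} {b t : Fin 3 → ℝ} (hh : H.mat h = hmat g g' b t) :
    gH h = g := by simp [gH, hh]; rfl

/-! ### Conjugation by elements of `H` with trivial `GL(3)`-component. -/

section unipotent
variable {h : H} (hg : gH h = 1) {m : Mat} (hm : m ∈ so43)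
include hg

theorem th_conj_of_gH_eq_one : th (H.mat h⁻¹ * m * H.mat h) = th m := by
  ext k
  simp [th, conj_rl, gH_inv_of_gH_eq_one hg, Matrix.one_apply]

include hm

/-- Thus `b` shifts the values of `ω` on the vectors `e_l` by a skew matrix, and `exists_gauge_symm`
uses it to make those values symmetric. -/
theorem om_conj_of_gH_eq_one (j : Fin 3) : om (H.mat h⁻¹ * m * H.mat h) j =
    om m j + ∑ p, be (H.mat h) p * ∑ k, ε p j k * th m k := by
  rw [om_conj]
  simp [gH_inv_of_gH_eq_one hg, Matrix.one_apply, be_inv_of_gH_eq_one hg, entry_rl hm]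

theorem al_conj_of_gH_eq_one (hb : be (H.mat h) = 0) (i j : Fin 3) :
    al (H.mat h⁻¹ * m * H.mat h) i j =
      al m i j - ∑ p, (∑ k, ε i p k * th m k) * ∑ n, ε p j n * tc (H.mat h) n := by
  have h1 : ∀ i j, H.mat h⁻¹ (.inr (.inr i)) (.inr (.inr j)) = (1 : Mat3) i j := fun i j =>
    congrFun (congrFun (gH_inv_of_gH_eq_one hg) i) j
  have h2 : ∀ i j, H.mat h (.inr (.inr i)) (.inr (.inr j)) = (1 : Mat3) i j := fun i j =>
    congrFun (congrFun hg i) j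
  have h3 : ∀ j, H.mat h (.inr (.inl 0)) (.inr (.inr j)) = 0 := fun j => by
    have := congrFun hb j
    simpa [be] using this
  have h4 : ∀ p j, H.mat h (.inl p) (.inr (.inr j)) = - ∑ n, ε p j n * tc (H.mat h) n := fun p j => by
    conv_lhs => rw [H.mat_eq_hmat]
    simp [hmat, gH_inv_of_gH_eq_one hg, hb, Matrix.one_apply]
  simp [al, Matrix.mul_apply, H.mat_lower_left, H.mat_rc, h1, h2, h3, h4, Matrix.one_apply, entry_rl hm]
  ring

end unipotent

section
variable {W : Set E6} {A B C : E6 → E6 →L[ℝ] Mat}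

theorem exists_smoothH {X : Type*} [NormedAddCommGroup X] [NormedSpace ℝ X] {W : Set X}
    {g g' : X → Mat3} {b t : X → Fin 3 → ℝ} (hg : ∀ x ∈ W, g x * g' x = 1)
    (h1 : ∀ i j, ContDiffOn ℝ ∞ (fun x => g x i j) W) (h2 : ∀ i j, ContDiffOn ℝ ∞ (fun x => g' x i j) W)
    (h3 : ∀ i, ContDiffOn ℝ ∞ (fun x => b x i) W) (h4 : ∀ i, ContDiffOn ℝ ∞ (fun x => t x i) W) :
    ∃ h : X → H, SmoothH h W ∧ ∀ x ∈ W, H.mat (h x) = hmat (g x) (g' x) (b x) (t x) := by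
  classical
  -- Outside `W` the parameters need not be invertible; the value `1` there is immaterial.
  refine ⟨fun x => if hx : x ∈ W then mkH (g x) (g' x) (b x) (t x) (hg x hx) else 1, ?_,
    fun x hx => by simp [hx]⟩
  have : ∀ x ∈ W, H.mat (if hx : x ∈ W then mkH (g x) (g' x) (b x) (t x) (hg x hx) else 1) =
      hmat (g x) (g' x) (b x) (t x) := fun x hx => by simp [hx]
  refine ContDiffOn.congr (f := fun x => hmat (g x) (g' x) (b x) (t x)) ?_ this
  rw [contDiffOn_mat]
  rintro (i | i | i) (j | j | j) <;> simp only [hmat, Matrix.of_apply] <;> fun_prop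

theorem IsGauge.mem (hA : IsGauge W A) {y : E6} (hy : y ∈ W) (v : E6) : A y v ∈ so43 :=
  (hA.normal y hy).mem_gauge v

theorem contDiffOn_component (hA : ContDiffOn ℝ ∞ A W) {s : E6 → E6} (hs : ContDiffOn ℝ ∞ s W)
    (L : Mat →L[ℝ] ℝ) : ContDiffOn ℝ ∞ (fun y => L (A y (s y))) W :=
  L.contDiff.comp_contDiffOn (contDiffOn_apply hA hs)

/-- The coordinate `g` of the transformation is the matrix of the `ω`-values of `B` on the
horizontal frame of `A`. Its inverse has the same description with `A` and `B` exchanged, so it is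
smooth as well. -/
theorem exists_gauge_om (hW : IsOpen W) (hA : IsGauge W A) (hB : IsGauge W B)
    (hAB : ∀ y ∈ W, ∀ v, th (A y v) = 0 ↔ th (B y v) = 0) {f : Fin 3 → E6 → E6} {e : Fin 3 → E6 → E6}
    (hf1 : ∀ p, ContDiffOn ℝ ∞ (f p) W)
    (hf : ∀ y ∈ W, IsFrame (A y : E6 →ₗ[ℝ] Mat) (fun l => e l y) (fun p => f p y)) :
    ∃ h, SmoothH h W ∧ ∀ y ∈ W, ∀ p, om (gaugeH B h y (f p y)) = δ p := by
  obtain ⟨e', f', -, hf1', hf'⟩ := exists_smooth_frame hB.smooth hB.inj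
  have hg : ∀ y ∈ W, (Matrix.of fun i p => om (B y (f p y)) i) *
      (Matrix.of fun q p => om (A y (f' p y)) q) = (1 : Mat3) := fun y hy => by
    ext i p
    have h0 : th (A y (f' p y)) = 0 := (hAB y hy _).2 ((hf' y hy).values.2.2.1 p)
    have h1 := (hf y hy).clm_eq (omₗ i ∘ₗ (B y : E6 →ₗ[ℝ] Mat)) (f' p y)
    simp [h0, (hf' y hy).values.2.2.2 p] at h1
    simp only [Matrix.mul_apply, Matrix.of_apply, Matrix.one_apply]
    simp only [mul_comm (om (B y _) i), ← h1, δ, eq_comm]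
  obtain ⟨h, hh, hm⟩ := exists_smoothH (W := W) (g := fun y => Matrix.of fun i p => om (B y (f p y)) i)
    (g' := fun y => Matrix.of fun q p => om (A y (f' p y)) q) (b := fun _ => 0) (t := fun _ => 0)
    hg (fun i j => contDiffOn_component hB.smooth (hf1 j) (omL i))
    (fun i j => contDiffOn_component hA.smooth (hf1' j) (omL i)) (fun _ => contDiffOn_const)
    (fun _ => contDiffOn_const)
  · refine ⟨h, hh, fun y hy p => ?_⟩
    have h0 : th (B y (f p y)) = 0 := (hAB y hy _).1 ((hf y hy).values.2.2.1 p)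
    rw [gaugeH_apply, om_add, om_maurerCartan (hh.differentiableAt hW hy), add_zero, conjₗ_apply,
      om_conj_eq _ (hB.mem hy _) h0]
    have h1 := gH_inv_mul (h y)
    ext i
    have h2 := congrFun (congrFun h1 i) p
    rw [gH_of_mat (hm y hy)] at h2
    simpa [Matrix.mul_apply, Matrix.mulVec, dotProduct, Matrix.one_apply, δ, eq_comm] using h2

/-- Both `θ`s have the same horizontal kernel and, once the `ω`s agree on it, the same value `2
ε_ipq` of `dθ_i` on it. Since these values span, the matrix relating the two `θ`s is the identity.
-/
theorem th_eq_of_om_eq (hW : IsOpen W) (hA : IsGauge W A) (hB : IsGauge W B)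
    (hAB : ∀ y ∈ W, ∀ v, th (A y v) = 0 → th (B y v) = 0) {e f : Fin 3 → E6 → E6}
    (he : ∀ l, ContDiffOn ℝ ∞ (e l) W)
    (hf : ∀ y ∈ W, IsFrame (A y : E6 →ₗ[ℝ] Mat) (fun l => e l y) (fun p => f p y))
    (hom : ∀ y ∈ W, ∀ p, om (B y (f p y)) = δ p) {y : E6} (hy : y ∈ W) (v : E6) :
    th (B y v) = th (A y v) := by
  ext i
  have hexp : ∀ z ∈ W, ∀ v, th (B z v) i = th (A z v) i
      + ∑ l, (th (B z (e l z)) i - δ l i) * th (A z v) l := by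
    intro z hz v
    have := (hf z hz).clm_eq (thₗ i ∘ₗ (B z : E6 →ₗ[ℝ] Mat)) v
    have h0 : ∀ p, th (B z (f p z)) = 0 := fun p => hAB z hz _ ((hf z hz).values.2.2.1 p)
    simp [h0] at this
    rw [this]
    simp only [sub_mul, Finset.sum_sub_distrib, mul_comm (th (A z v) _)]
    simp [δ]
  obtain ⟨-, -, tf, of⟩ := (hf y hy).values
  have tf' := fun p => hAB y hy _ (tf p)
  have hc : ∀ l, th (B y (e l y)) i - δ l i = 0 := by
    have h1 := fun p q => clm_dd_of_eq_sum hW hA.smooth hB.smooth (thL i)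
      (c := fun l z => th (B z (e l z)) i - δ l i)
      (fun l => (contDiffOn_component hB.smooth (he l) (thL i)).sub contDiffOn_const)
      hexp hy (tf p) (tf q)
    simp only [thL_apply, th_dd_of_horizontal hA hy (tf _) (tf _) (of _) (of _),
      th_dd_of_horizontal hB hy (tf' _) (tf' _) (hom y hy _) (hom y hy _)] at h1
    have h2 := h1 0 1
    have h3 := h1 1 2
    have h4 := h1 2 0
    simp only [Fin.sum_univ_three, forall_fin_three] at h2 h3 h4 ⊢
    simp at h2 h3 h4
    exact ⟨h3, h4, h2⟩
  rw [hexp y hy]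
  simp [hc]

theorem exists_gauge_symm (hW : IsOpen W) (hB : IsGauge W B)
    {e f : Fin 3 → E6 → E6} (he : ∀ l, ContDiffOn ℝ ∞ (e l) W)
    (hf : ∀ y ∈ W, IsFrame (A y : E6 →ₗ[ℝ] Mat) (fun l => e l y) (fun p => f p y))
    (hth : ∀ y ∈ W, ∀ v, th (B y v) = th (A y v)) (hom : ∀ y ∈ W, ∀ p, om (B y (f p y)) = δ p) :
    ∃ h, SmoothH h W ∧ (∀ y ∈ W, ∀ v, th (gaugeH B h y v) = th (A y v)) ∧
      (∀ y ∈ W, ∀ p, om (gaugeH B h y (f p y)) = δ p) ∧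
      ∀ y ∈ W, ∀ j l, om (gaugeH B h y (e l y)) j = om (gaugeH B h y (e j y)) l := by
  obtain ⟨h, hh, hm⟩ := exists_smoothH (W := W) (g := fun y => 1) (g' := fun y => 1)
    -- Minus the skew part of the matrix of values of `ω` on the `e_l`, written as a vector.
    (b := fun y p => -(om (B y (e (p + 2) y)) (p + 1) - om (B y (e (p + 1) y)) (p + 2)) / 2)
    (t := fun _ => 0) (fun y hy => one_mul 1) (fun _ _ => contDiffOn_const) (fun _ _ => contDiffOn_const)
    (fun p => ((contDiffOn_component hB.smooth (he (p + 2)) (omL (p + 1))).sub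
      (contDiffOn_component hB.smooth (he (p + 1)) (omL (p + 2)))).neg.div_const 2)
    (fun _ => contDiffOn_const)
  have hth' : ∀ y ∈ W, ∀ v, th (gaugeH B h y v) = th (A y v) := fun y hy v => by
    rw [gaugeH_apply, th_add, th_maurerCartan (hh.differentiableAt hW hy), add_zero, conjₗ_apply,
      th_conj_of_gH_eq_one (gH_of_mat (hm y hy)), hth y hy]
  have hom' : ∀ y ∈ W, ∀ v j, om (gaugeH B h y v) j = om (B y v) j
      + ∑ p, be (H.mat (h y)) p * ∑ k, ε p j k * th (A y v) k := fun y hy v j => by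
    rw [gaugeH_apply, om_add, om_maurerCartan (hh.differentiableAt hW hy), add_zero, conjₗ_apply,
      om_conj_of_gH_eq_one (gH_of_mat (hm y hy)) (hB.mem hy _), hth y hy]
  refine ⟨h, hh, hth', fun y hy p => ?_, fun y hy j l => ?_⟩
  · ext j
    rw [hom' y hy, hom y hy, (hf y hy).values.2.2.1]
    simp
  · rw [hom' y hy, hom' y hy, (hf y hy).values.1, (hf y hy).values.1, hm y hy, be_hmat]
    revert j l
    simp only [forall_fin_three, Fin.sum_univ_three]
    simp [δ]
    constructorm* _ ∧ _ <;> ring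

/-- The lower right block of `h` is constantly the identity, so its derivative vanishes, and nothing
else contributes to this block of `h⁻¹dh`. -/
theorem al_maurerCartan_of_gH_eq_one (hW : IsOpen W) {h : E6 → H} (hh : SmoothH h W)
    (hg : ∀ z ∈ W, gH (h z) = 1) {y : E6} (hy : y ∈ W) (v : E6) : al (maurerCartan h y v) = 0 := by
  ext i j
  have h1 : ∀ i j, H.mat (h y)⁻¹ (.inr (.inr i)) (.inr (.inr j)) = (1 : Mat3) i j := fun i j =>
    congrFun (congrFun (gH_inv_of_gH_eq_one (hg y hy)) i) j
  have h2 := fderiv_clm_comp_apply (hh.differentiableAt hW hy) (alL i j) v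
  have h3 : (fun z => alL i j (H.mat (h z))) =ᶠ[𝓝 y] fun _ => (1 : Mat3) i j := by
    filter_upwards [hW.mem_nhds hy] with z hz
    exact congrFun (congrFun (hg z hz) i) j
  rw [h3.fderiv_eq, fderiv_fun_const] at h2
  simpa [maurerCartan, al, Matrix.mul_apply, H.mat_lower_left, H.mat_rc, h1, Matrix.one_apply]
    using h2.symm

/-- Confirms that `t = -T / 2` cancels a difference of `α`s of the form found in `comparison_al`
with traces `T`. -/
theorem al_correction (T s : Fin 3 → ℝ) (i j : Fin 3) :
    ∑ l, s l * ((T l * δ i j - T i * δ l j) / 2)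
      - ∑ p, (∑ k, ε i p k * s k) * ∑ n, ε p j n * (-T n / 2) = 0 := by
  revert i j
  simp only [forall_fin_three, Fin.sum_univ_three]
  simp [δ]
  constructorm* _ ∧ _ <;> ring

theorem exists_gauge_al (hW : IsOpen W) (hA : IsGauge W A) (hB : IsGauge W B)
    {e f : Fin 3 → E6 → E6} (he : ∀ l, ContDiffOn ℝ ∞ (e l) W)
    (hf : ∀ y ∈ W, IsFrame (A y : E6 →ₗ[ℝ] Mat) (fun l => e l y) (fun p => f p y))
    (hth : ∀ y ∈ W, ∀ v, th (B y v) = th (A y v)) (hom : ∀ y ∈ W, ∀ v, om (B y v) = om (A y v))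
    (hal : ∀ y ∈ W, ∀ p, al (B y (f p y)) = al (A y (f p y))) :
    ∃ h, SmoothH h W ∧ (∀ y ∈ W, ∀ v, th (gaugeH B h y v) = th (A y v)) ∧
      (∀ y ∈ W, ∀ v, om (gaugeH B h y v) = om (A y v)) ∧
      ∀ y ∈ W, ∀ v, al (gaugeH B h y v) = al (A y v) := by
  obtain ⟨h, hh, hm⟩ := exists_smoothH (W := W) (g := fun y => 1) (g' := fun y => 1)
    (t := fun y m => -(∑ k, (al (B y (e m y)) k k - al (A y (e m y)) k k)) / 2)
    (b := fun _ => 0) (fun y hy => one_mul 1) (fun _ _ => contDiffOn_const) (fun _ _ => contDiffOn_const)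
    (fun _ => contDiffOn_const)
    (fun p => (ContDiffOn.sum fun k _ => (contDiffOn_component hB.smooth (he p) (alL k k)).sub
      (contDiffOn_component hA.smooth (he p) (alL k k))).neg.div_const 2)
  have hd := fun y (hy : y ∈ W) => hh.differentiableAt hW hy
  refine ⟨h, hh, fun y hy v => ?_, fun y hy v => ?_, fun y hy v => ?_⟩
  · rw [gaugeH_apply, th_add, th_maurerCartan (hd y hy), add_zero, conjₗ_apply,
      th_conj_of_gH_eq_one (gH_of_mat (hm y hy)), hth y hy]
  · ext j
    rw [gaugeH_apply, om_add, om_maurerCartan (hd y hy), add_zero, conjₗ_apply,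
      om_conj_of_gH_eq_one (gH_of_mat (hm y hy)) (hB.mem hy _), hth y hy, hom y hy,
      hm y hy]
    simp
  · have mA := hA.mem hy
    have mB := hB.mem hy
    obtain ⟨te, oe, tf, of⟩ := (hf y hy).values
    have hX := comparison_al (X := fun m l i => al (B y (e m y)) l i - al (A y (e m y)) l i)
      (Y := fun p k => be (B y (f p y)) k - be (A y (f p y)) k) ?_ ?_
    · have hmc : al (maurerCartan h y v) = 0 :=
        al_maurerCartan_of_gH_eq_one hW hh (fun z hz => gH_of_mat (hm z hz)) hy v
      have hal' : ∀ i j, al (gaugeH B h y v) i j = al (B y v) i j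
          - ∑ p, (∑ k, ε i p k * th (A y v) k) * ∑ n, ε p j n * tc (H.mat (h y)) n := fun i j => by
        rw [gaugeH_apply, al_add, hmc, add_zero, conjₗ_apply,
          al_conj_of_gH_eq_one (gH_of_mat (hm y hy)) (mB v) (by simp [hm y hy]), hth y hy]
      have htc : tc (H.mat (h y)) = fun m => -(∑ k, (al (B y (e m y)) k k - al (A y (e m y)) k k)) / 2 := by
        rw [hm y hy, tc_hmat _ _ _ _ (one_mul 1)]
      ext i j
      have h5 := (hf y hy).clm_eq (alₗ i j ∘ₗ ((B y - A y : E6 →L[ℝ] Mat) : E6 →ₗ[ℝ] Mat)) v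
      simp only [LinearMap.comp_apply, ContinuousLinearMap.coe_coe, _root_.sub_apply,
        alₗ_apply, al_sub, Pi.sub_apply, hal y hy, sub_self, smul_zero, Finset.sum_const_zero,
        add_zero, smul_eq_mul, Pi.zero_apply, mul_zero] at h5
      rw [Finset.sum_congr rfl fun l _ => congrArg (th (A y v) l * ·) (hX l i j)] at h5
      rw [hal', htc, eq_add_of_sub_eq' h5, add_sub_assoc,
        al_correction (fun m => ∑ k, (al (B y (e m y)) k k - al (A y (e m y)) k k)), add_zero]
    · intro m l i
      have h1 := clm_dd_congr hW hA.smooth hB.smooth (thL i) (fun z hz v => by simp [hth z hz]) hy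
        (e m y) (e l y)
      simp only [thL_apply, th_dd hA hy, th_dd hB hy, th_comm (mA _) (mA _), th_comm (mB _) (mB _),
        hth y hy, hom y hy, te, oe, Pi.zero_apply, mul_zero, sub_zero, zero_mul,
        Finset.sum_const_zero, ← Finset.sum_mul, Finset.sum_sub_distrib] at h1 ⊢
      simp [δ] at h1 ⊢
      split_ifs at h1 ⊢ <;> linarith
    · intro m p i
      have h1 := clm_dd_congr hW hA.smooth hB.smooth (omL i) (fun z hz v => by simp [hom z hz]) hy
        (f p y) (e m y)
      simp only [omL_apply, om_dd hA hy, om_dd hB hy, om_comm (mA _) (mA _), om_comm (mB _) (mB _),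
        hth y hy, hom y hy, te, oe, tf, of, Pi.zero_apply, mul_zero, sub_zero, zero_sub, 
        Finset.sum_const_zero, mul_sub, Finset.sum_sub_distrib] at h1 ⊢
      simp [δ] at h1 ⊢
      linarith

/-- With `θ`, `ω`, `α` equal, the equation for `dω` contains no unknown but the difference of the
`β`s, and forces it to vanish. The difference of the `τ`s enters the curvature algebraically, and
the two normalizations force it to vanish too. -/
theorem eq_of_al_eq (hW : IsOpen W) (hA : IsGauge W A) (hB : IsGauge W B)
    (hth : ∀ y ∈ W, ∀ v, th (B y v) = th (A y v)) (hom : ∀ y ∈ W, ∀ v, om (B y v) = om (A y v))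
    (hal : ∀ y ∈ W, ∀ v, al (B y v) = al (A y v)) {y : E6} (hy : y ∈ W) : B y = A y := by
  obtain ⟨e, f, -, -, hf⟩ := exists_smooth_frame hA.smooth hA.inj
  have hbe : ∀ y ∈ W, ∀ v, be (B y v) = be (A y v) := by
    intro y hy v
    have mA := hA.mem hy
    have mB := hB.mem hy
    obtain ⟨te, oe, tf, of⟩ := (hf y hy).values
    have h1 := fun v w i => clm_dd_congr hW hA.smooth hB.smooth (omL i)
      (fun z hz v => by simp [hom z hz]) hy v w
    simp only [omL_apply, om_dd hA hy, om_dd hB hy, om_comm (mA _) (mA _), om_comm (mB _) (mB _),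
        hth y hy, hom y hy, hal y hy] at h1
    have hee := comparison_be (Y := fun m k => be (B y (e m y)) k - be (A y (e m y)) k)
      (fun m l i => by
        have h2 := h1 (e m y) (e l y) i
        simp [te, oe, mul_sub, Finset.sum_sub_distrib] at h2 ⊢
        simp [δ] at h2
        linarith)
    have hfe : ∀ p k, be (B y (f p y)) k - be (A y (f p y)) k = 0 := fun p => by
      have h2 : ∀ m i, ∑ k, ε i k m * (be (B y (f p y)) k - be (A y (f p y)) k) = 0 := fun m i => by
        have h2 := h1 (f p y) (e m y) i
        simp [te, oe, tf, of] at h2 ⊢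
        simp [δ, mul_sub] at h2 ⊢
        linarith
      have h3 := h2 2 0
      have h4 := h2 0 1
      have h5 := h2 1 2
      simp only [forall_fin_three, Fin.sum_univ_three] at h3 h4 h5 ⊢
      simp at h3 h4 h5
      exact ⟨h5, h3, h4⟩
    ext k
    have h5 := (hf y hy).clm_eq (beₗ k ∘ₗ ((B y - A y : E6 →L[ℝ] Mat) : E6 →ₗ[ℝ] Mat)) v
    simp only [LinearMap.comp_apply, ContinuousLinearMap.coe_coe, _root_.sub_apply,
        beₗ_apply, be_sub, Pi.sub_apply, hee, hfe, smul_zero, Finset.sum_const_zero, add_zero] at h5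
    exact sub_eq_zero.1 h5
  have mA := hA.mem hy
  have mB := hB.mem hy
  obtain ⟨te, oe, tf, of⟩ := (hf y hy).values
  have hcal : ∀ v w i j, al (curv B y v w) i j - al (curv A y v w) i j =
      - δ i j * ∑ k, ((ta (B y v) k - ta (A y v) k) * th (A y w) k
        - (ta (B y w) k - ta (A y w) k) * th (A y v) k)
        + ((ta (B y v) i - ta (A y v) i) * th (A y w) j
        - (ta (B y w) i - ta (A y w) i) * th (A y v) j) := fun v w i j => by
    have h1 := clm_dd_congr hW hA.smooth hB.smooth (alL i j)
      (fun z hz v => by simp [hal z hz]) hy v w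
    simp only [curv, al_add, Pi.add_apply, al_comm (mA _) (mA _), al_comm (mB _) (mB _),
      hth y hy, hom y hy, hal y hy, hbe y hy, sub_mul, Finset.sum_sub_distrib]
    simp only [alL_apply] at h1
    rw [h1]
    ring
  have hcbe : ∀ v w i, be (curv B y v w) i - be (curv A y v w) i =
      - ∑ j, ∑ k, ε i j k * ((ta (B y v) j - ta (A y v) j) * om (A y w) k
        - (ta (B y w) j - ta (A y w) j) * om (A y v) k) := fun v w i => by
    have h1 := clm_dd_congr hW hA.smooth hB.smooth (beL i)
      (fun z hz v => by simp [hbe z hz]) hy v w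
    simp only [curv, be_add, Pi.add_apply, be_comm (mA _) (mA _), be_comm (mB _) (mB _),
      hth y hy, hom y hy, hal y hy, hbe y hy, sub_mul, mul_sub, Finset.sum_sub_distrib]
    simp only [beL_apply] at h1
    rw [h1]
    ring
  -- On `(f_p, e_l)` the trace of the `α`-curvature changes by `-3 + 1 = -2` times the difference of
  -- the `τ_l` on `f_p`.
  have hfz : ∀ p l, ta (B y (f p y)) l - ta (A y (f p y)) l = 0 := fun p l => by
    have h1 := (hA.normal y hy).trace (f p y) (e l y) (tf p)
    have h2 := (hB.normal y hy).trace (f p y) (e l y) ((hth y hy _).trans (tf p))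
    have h3 : ∑ i, (al (curv B y (f p y) (e l y)) i i - al (curv A y (f p y) (e l y)) i i) = 0 := by
      rw [Finset.sum_sub_distrib, h1, h2, sub_zero]
    simp only [hcal, te, tf] at h3
    simp [δ] at h3
    simp [Finset.sum_add_distrib] at h3
    linarith
  -- On `(e_l, f_p)` the `β`-curvature changes by an `ε`-contraction of the difference of the `τ`s,
  -- which is skew in the frame indices and hence incompatible with the symmetry normalization
  -- unless it vanishes.
  have hez : ∀ l k, ta (B y (e l y)) k - ta (A y (e l y)) k = 0 := fun l => by
    refine comparison_ta fun p q => ?_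
    have h1 := (hA.normal y hy).symm (f p y) (f q y) (e l y) (tf p) (tf q)
    have h2 := (hB.normal y hy).symm (f p y) (f q y) (e l y) ((hth y hy _).trans (tf p))
      ((hth y hy _).trans (tf q))
    simp only [ContinuousLinearMap.coe_coe, hom y hy, of] at h1 h2
    simp [δ] at h1 h2
    have h3 := hcbe (e l y) (f p y) q
    have h4 := hcbe (e l y) (f q y) p
    rw [h1, h2, h4] at h3
    simp only [of, oe] at h3
    simp [δ] at h3
    exact h3.symm
  ext1 v
  refine so43_ext (mB v) (mA v) (hth y hy v) (hom y hy v) (hal y hy v) (hbe y hy v) ?_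
  ext k
  have h5 := (hf y hy).clm_eq (taₗ k ∘ₗ ((B y - A y : E6 →L[ℝ] Mat) : E6 →ₗ[ℝ] Mat)) v
  simp only [LinearMap.comp_apply, ContinuousLinearMap.coe_coe, _root_.sub_apply,
    taₗ_apply, ta_sub, Pi.sub_apply, hfz, hez, smul_zero, Finset.sum_const_zero, add_zero] at h5
  exact sub_eq_zero.1 h5

/-- Two normal gauges adapted to the same plane field differ by a gauge transformation. -/
theorem exists_gauge_eq (hW : IsOpen W) (hA : IsGauge W A) (hB : IsGauge W B)
    (hAB : ∀ y ∈ W, ∀ v, th (A y v) = 0 ↔ th (B y v) = 0) :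
    ∃ h, SmoothH h W ∧ ∀ y ∈ W, gaugeH B h y = A y := by
  obtain ⟨e, f, he, hf1, hf⟩ := exists_smooth_frame hA.smooth hA.inj
  obtain ⟨h1, s1, om1⟩ := exists_gauge_om hW hA hB hAB hf1 hf
  have g1 := hB.gaugeH hW s1
  -- The order matters: matching `ω` on `D` with `g` yields equality of `θ`; symmetrizing `ω` with
  -- `b` yields equality of `ω`, and of `α` on `D`; matching traces with `t` yields equality of `α`,
  -- and then of everything.
  have th1 := fun y (hy : y ∈ W) v => th_eq_of_om_eq hW hA g1 (fun y hy v h0 =>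
    (th_gaugeH_eq_zero_iff (hB.mem hy v) (s1.differentiableAt hW hy)).2 ((hAB y hy v).1 h0)) he hf om1
    hy v
  obtain ⟨h2, s2, th2, om2, symm2⟩ := exists_gauge_symm hW g1 he hf th1 om1
  have g2 := g1.gaugeH hW s2
  have h := fun y (hy : y ∈ W) => om_eq_of_symm hW hA g2 he hf th2 om2 symm2 hy
  obtain ⟨h3, s3, th3, om3, al3⟩ := exists_gauge_al hW hA g2 he hf th2 (fun y hy => (h y hy).1)
    fun y hy => (h y hy).2
  have g3 := g2.gaugeH hW s3
  refine ⟨fun y => h1 y * (h2 y * h3 y), s1.mul (s2.mul s3), fun y hy => ?_⟩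
  have h4 := eq_of_al_eq hW hA g3 th3 om3 al3 hy
  rw [gaugeH_gaugeH _ (s2.differentiableAt hW hy) (s3.differentiableAt hW hy),
    gaugeH_gaugeH _ (s1.differentiableAt hW hy) ((s2.mul s3).differentiableAt hW hy)] at h4
  exact h4

/-- The coordinates of `h` are detected one after the other: `g` by `ω` on the `f_p`, then `b` by
`ω` on the `e_l`, then `t` by `α` on the `e_l`. -/
theorem eq_one_of_gaugeH_eq (hW : IsOpen W) (hA : IsGauge W A) {h : E6 → H} (hh : SmoothH h W)
    (he : ∀ y ∈ W, gaugeH A h y = A y) {y : E6} (hy : y ∈ W) : h y = 1 := by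
  obtain ⟨e, f, -, -, hf⟩ := exists_smooth_frame hA.smooth hA.inj
  have hd := fun y (hy : y ∈ W) => hh.differentiableAt hW hy
  have hg : ∀ z ∈ W, gH (h z) = 1 := fun z hz => by
    have h1 : gH (h z)⁻¹ = 1 := by
      ext i p
      have h2 := congrArg (fun L : E6 →L[ℝ] Mat => om (L (f p z)) i) (he z hz)
      obtain ⟨te, oe, tf, of⟩ := (hf z hz).values
      simp only [gaugeH_apply, om_add, om_maurerCartan (hd z hz), add_zero, conjₗ_apply,
        om_conj_eq _ (hA.mem hz _) (tf p), of] at h2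
      simpa [Matrix.mulVec, dotProduct, δ, Matrix.one_apply, eq_comm] using h2
    simpa [h1] using gH_mul_inv (h z)
  have hb : be (H.mat (h y)) = 0 := by
    have h2 := fun l i => congrArg (fun L : E6 →L[ℝ] Mat => om (L (e l y)) i) (he y hy)
    obtain ⟨te, oe, tf, of⟩ := (hf y hy).values
    simp only [gaugeH_apply, om_add, om_maurerCartan (hd y hy), add_zero, conjₗ_apply,
      om_conj_of_gH_eq_one (hg y hy) (hA.mem hy _), oe, te] at h2
    simp only [forall_fin_three, Fin.sum_univ_three] at h2
    simp [δ] at h2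
    ext k
    revert k
    simp only [forall_fin_three]
    simp
    tauto
  have ht : tc (H.mat (h y)) = 0 := by
    have hmc : ∀ v, al (maurerCartan h y v) = 0 := fun v => al_maurerCartan_of_gH_eq_one hW hh hg hy v
    have h2 := fun l i j => congrArg (fun L : E6 →L[ℝ] Mat => al (L (e l y)) i j) (he y hy)
    obtain ⟨te, oe, tf, of⟩ := (hf y hy).values
    simp only [gaugeH_apply, al_add, hmc, add_zero, conjₗ_apply,
      al_conj_of_gH_eq_one (hg y hy) (hA.mem hy _) hb, te] at h2
    simp only [forall_fin_three, Fin.sum_univ_three] at h2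
    simp [δ] at h2
    ext k
    revert k
    simp only [forall_fin_three]
    simp
    tauto
  refine H.ext_coord ?_ ?_ ?_
  · rw [hg y hy, gH_one]
  · rw [hb]; ext k; simp [be, Matrix.one_apply]
  · rw [ht]; ext k; simp [tc, Matrix.one_apply]

end

/-! ### Local existence of normal gauges -/

theorem IsFrame.ext_horizontal {V F : Type*} [AddCommGroup V] [Module ℝ V] [AddCommGroup F] [Module ℝ F]
    {a : V →ₗ[ℝ] Mat} {e f : Fin 3 → V} (h : IsFrame a e f) {B : V → V → F} (hB : IsAltBilin B)
    (h3 : ∀ p q, B (f p) (f q) = 0) {v w : V} (hv : th (a v) = 0) (hw : th (a w) = 0) :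
    B v w = 0 := by
  rw [h.expand v, h.expand w, hv, hw]
  simp [hB.sum_left, hB.sum_right, hB.smul_left, hB.smul_right, h3]

theorem IsFrame.ext_horizontal_left {V F : Type*} [AddCommGroup V] [Module ℝ V] [AddCommGroup F]
    [Module ℝ F] {a : V →ₗ[ℝ] Mat} {e f : Fin 3 → V} (h : IsFrame a e f) {B : V → V → F}
    (hB : IsAltBilin B) (h2 : ∀ p l, B (f p) (e l) = 0) (h3 : ∀ p q, B (f p) (f q) = 0) {v : V}
    (hv : th (a v) = 0) (w : V) : B v w = 0 := by
  rw [h.expand v, h.expand w, hv]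
  simp [hB.sum_left, hB.sum_right, hB.add_right, hB.smul_left, hB.smul_right, h2, h3]

/-- The frame at a point, in terms of values of a continuous linear map. -/
theorem isFrame_of_values {a a' : E6 →L[ℝ] Mat} {e f : Fin 3 → E6}
    (h : IsFrame (a : E6 →ₗ[ℝ] Mat) e f) (hth : ∀ v, th (a' v) = th (a v))
    (hom : ∀ v, om (a' v) = om (a v)) : IsFrame (a' : E6 →ₗ[ℝ] Mat) e f where
  th_e l m := by simpa [hth] using h.th_e l m
  om_e l := by simpa [hom] using h.om_e l
  th_f p := by simpa [hth] using h.th_f p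
  om_f p q := by simpa [hom] using h.om_f p q
  expand v := by simpa [hth, hom] using h.expand v

/-- The modification of a gauge by multiples of its `θ`- and `ω`-components. -/
def modify (A : E6 → E6 →L[ℝ] Mat) (M N : Fin 3 → E6 → Mat) (y : E6) : E6 →L[ℝ] Mat :=
  A y + ∑ l, ((thL l).comp (A y)).smulRight (M l y) + ∑ p, ((omL p).comp (A y)).smulRight (N p y)

theorem modify_apply (A : E6 → E6 →L[ℝ] Mat) (M N : Fin 3 → E6 → Mat) (y v : E6) :
    modify A M N y v = A y v + ∑ l, th (A y v) l • M l y + ∑ p, om (A y v) p • N p y := by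
  simp [modify]

/-- Coframings on `W` whose structure equations are not yet normalized. -/
structure PreGauge (W : Set E6) (A : E6 → E6 →L[ℝ] Mat) : Prop where
  smooth : ContDiffOn ℝ ∞ A W
  mem : ∀ y ∈ W, ∀ v, A y v ∈ so43
  inj : ∀ y ∈ W, ∀ v, th (A y v) = 0 → om (A y v) = 0 → v = 0

section
variable {W : Set E6} {A : E6 → E6 →L[ℝ] Mat} {M N : Fin 3 → E6 → Mat}

theorem th_modify (hM : ∀ l, th (M l y) = 0) (hN : ∀ l, th (N l y) = 0) (v : E6) :
    th (modify A M N y v) = th (A y v) := by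
  ext i
  simp [modify_apply, th_sum, hM, hN]

theorem om_modify (hN : ∀ l, om (N l y) = 0) (v : E6) (i : Fin 3) :
    om (modify A M N y v) i = om (A y v) i + ∑ l, th (A y v) l * om (M l y) i := by
  simp [modify_apply, om_sum, hN]

theorem modify_e {y : E6} {e f : Fin 3 → E6} (h : IsFrame (A y : E6 →ₗ[ℝ] Mat) e f) (l : Fin 3) :
    modify A M N y (e l) = A y (e l) + M l y := by
  simp [modify_apply, h.values.1, h.values.2.1]
  simp [δ]

theorem modify_f {y : E6} {e f : Fin 3 → E6} (h : IsFrame (A y : E6 →ₗ[ℝ] Mat) e f) (p : Fin 3) :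
    modify A M N y (f p) = A y (f p) + N p y := by
  simp [modify_apply, h.values.2.2.1, h.values.2.2.2]
  simp [δ]

theorem PreGauge.modify (hA : PreGauge W A) (hMs : ∀ l, ContDiffOn ℝ ∞ (M l) W)
    (hNs : ∀ l, ContDiffOn ℝ ∞ (N l) W) (hM : ∀ l y, M l y ∈ so43) (hN : ∀ l y, N l y ∈ so43)
    (hMth : ∀ l y, th (M l y) = 0) (hNth : ∀ l y, th (N l y) = 0) (hNom : ∀ l y, om (N l y) = 0) :
    PreGauge W (modify A M N) := by
  refine ⟨?_, fun y hy v => ?_, fun y hy v h1 h2 => ?_⟩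
  · rw [contDiffOn_clm_apply]
    intro v
    simp only [modify_apply]
    refine ContDiffOn.add (ContDiffOn.add (hA.smooth.clm_apply contDiffOn_const)
      (ContDiffOn.sum fun l _ => ?_)) (ContDiffOn.sum fun l _ => ?_)
    · exact (contDiffOn_component hA.smooth contDiffOn_const (thL l)).smul (hMs l)
    · exact (contDiffOn_component hA.smooth contDiffOn_const (omL l)).smul (hNs l)
  · rw [modify_apply]
    exact add_mem (add_mem (hA.mem y hy v) (sum_mem fun l _ => so43.smul_mem _ (hM l y)))
      (sum_mem fun l _ => so43.smul_mem _ (hN l y))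
  · rw [th_modify (fun l => hMth l y) (fun l => hNth l y)] at h1
    refine hA.inj y hy v h1 ?_
    ext i
    have := congrFun h2 i
    rw [om_modify (fun l => hNom l y), h1] at this
    simpa using this

theorem contDiffOn_curv {X : Type*} [NormedAddCommGroup X] [NormedSpace ℝ X] {A : X → X →L[ℝ] Mat}
    {W : Set X} (hW : IsOpen W) (hA : ContDiffOn ℝ ∞ A W) {s t : X → X}
    (hs : ContDiffOn ℝ ∞ s W) (ht : ContDiffOn ℝ ∞ t W) :
    ContDiffOn ℝ ∞ (fun y => curv A y (s y) (t y)) W := by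
  have h1 : ContDiffOn ℝ ∞ (fderiv ℝ A) W := hA.fderiv_of_isOpen hW (m := ∞) (by simp)
  have h2 := fun {s t : X → X} (hs : ContDiffOn ℝ ∞ s W) (ht : ContDiffOn ℝ ∞ t W) =>
    ContDiffOn.clm_apply (ContDiffOn.clm_apply h1 hs) ht
  exact ((h2 hs ht).sub (h2 ht hs)).add
    (((hA.clm_apply hs).mul (hA.clm_apply ht)).sub ((hA.clm_apply ht).mul (hA.clm_apply hs)))

theorem contDiffOn_curv_component {X : Type*} [NormedAddCommGroup X] [NormedSpace ℝ X]
    {A : X → X →L[ℝ] Mat} {W : Set X} (hW : IsOpen W) (hA : ContDiffOn ℝ ∞ A W) {s t : X → X}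
    (hs : ContDiffOn ℝ ∞ s W) (ht : ContDiffOn ℝ ∞ t W) (L : Mat →L[ℝ] ℝ) :
    ContDiffOn ℝ ∞ (fun y => L (curv A y (s y) (t y))) W :=
  L.contDiff.comp_contDiffOn (contDiffOn_curv hW hA hs ht)

/-! The change of the components of the curvature -/

variable {A' : E6 → E6 →L[ℝ] Mat}

theorem th_curv_sub (hW : IsOpen W) (hA : PreGauge W A) (hA' : PreGauge W A')
    (hth : ∀ z ∈ W, ∀ v, th (A' z v) = th (A z v)) (hom : ∀ z ∈ W, ∀ v, om (A' z v) = om (A z v))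
    {y : E6} (hy : y ∈ W) (v w : E6) (i : Fin 3) : th (curv A' y v w) i = th (curv A y v w) i
      + (∑ k, ((al (A' y v) k k - al (A y v) k k) * th (A y w) i
        - (al (A' y w) k k - al (A y w) k k) * th (A y v) i)
      - ∑ j, ((al (A' y v) j i - al (A y v) j i) * th (A y w) j
        - (al (A' y w) j i - al (A y w) j i) * th (A y v) j)) := by
  have h1 := clm_dd_congr hW hA.smooth hA'.smooth (thL i) (fun z hz v => by simp [hth z hz]) hy v w
  simp only [thL_apply] at h1
  simp only [curv, th_add, Pi.add_apply, h1, th_comm (hA.mem y hy _) (hA.mem y hy _),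
    th_comm (hA'.mem y hy _) (hA'.mem y hy _), hth y hy, hom y hy, sub_mul, Finset.sum_sub_distrib]
  ring

theorem om_curv_sub (hW : IsOpen W) (hA : PreGauge W A) (hA' : PreGauge W A')
    (hth : ∀ z ∈ W, ∀ v, th (A' z v) = th (A z v)) (hom : ∀ z ∈ W, ∀ v, om (A' z v) = om (A z v))
    {y : E6} (hy : y ∈ W) (v w : E6) (i : Fin 3) : om (curv A' y v w) i = om (curv A y v w) i
      + (∑ k, ∑ j, ε i k j * ((be (A' y v) k - be (A y v) k) * th (A y w) j
        - (be (A' y w) k - be (A y w) k) * th (A y v) j)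
      + ∑ j, ((al (A' y v) i j - al (A y v) i j) * om (A y w) j
        - (al (A' y w) i j - al (A y w) i j) * om (A y v) j)) := by
  have h1 := clm_dd_congr hW hA.smooth hA'.smooth (omL i) (fun z hz v => by simp [hom z hz]) hy v w
  simp only [omL_apply] at h1
  simp only [curv, om_add, Pi.add_apply, h1, om_comm (hA.mem y hy _) (hA.mem y hy _),
    om_comm (hA'.mem y hy _) (hA'.mem y hy _), hth y hy, hom y hy, sub_mul, mul_sub,
    Finset.sum_sub_distrib]
  ring

/-- The first torsion can be absorbed in the `α`-component. -/
theorem exists_th_curv_eq_zero (hW : IsOpen W) (hA : PreGauge W A)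
    (h0 : ∀ y ∈ W, ∀ v w, th (A y v) = 0 → th (A y w) = 0 → th (curv A y v w) = 0) :
    ∃ A', PreGauge W A' ∧ (∀ y ∈ W, ∀ v, th (A' y v) = th (A y v)) ∧
      (∀ y ∈ W, ∀ v, om (A' y v) = om (A y v)) ∧ ∀ y ∈ W, ∀ v w, th (curv A' y v w) = 0 := by
  obtain ⟨e, f, he, hf, hfr⟩ := exists_smooth_frame hA.smooth hA.inj
  -- On `(e_m, e_l)` a change `X` of `α` changes the `θ_i`-torsion by `tr X_m δ_li - tr X_l δ_mi -
  -- X_m l i + X_l m i`. Being skew in `m, l`, the torsion is cancelled by half of itself up to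
  -- trace terms, and the `δ`-correction removes those.
  set M : Fin 3 → E6 → Mat := fun m y => gammaMatrix 0 0 (fun l i => th (curv A y (e m y) (e l y)) i / 2
    - δ l i * (∑ k, th (curv A y (e m y) (e k y)) k / 2) / 2) 0 0 with hM
  -- On `(f_p, e_l)` only the change of `α` on `f_p` enters, hence no factor `1 / 2` in front of the
  -- torsion.
  set N : Fin 3 → E6 → Mat := fun p y => gammaMatrix 0 0 (fun l i => th (curv A y (f p y) (e l y)) i
    - δ l i * (∑ k, th (curv A y (f p y) (e k y)) k) / 2) 0 0 with hN
  have hA' : PreGauge W (modify A M N) := hA.modify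
    (fun m => contDiffOn_gammaMatrix (fun _ => contDiffOn_const) (fun _ => contDiffOn_const)
      (fun l i => ((contDiffOn_curv_component hW hA.smooth (he m) (he l) (thL i)).div_const 2).sub
        ((contDiffOn_const.mul (ContDiffOn.sum fun k _ =>
          (contDiffOn_curv_component hW hA.smooth (he m) (he k) (thL k)).div_const 2)).div_const 2))
      (fun _ => contDiffOn_const) (fun _ => contDiffOn_const))
    (fun p => contDiffOn_gammaMatrix (fun _ => contDiffOn_const) (fun _ => contDiffOn_const)
      (fun l i => (contDiffOn_curv_component hW hA.smooth (hf p) (he l) (thL i)).sub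
        ((contDiffOn_const.mul (ContDiffOn.sum fun k _ =>
          contDiffOn_curv_component hW hA.smooth (hf p) (he k) (thL k))).div_const 2))
      (fun _ => contDiffOn_const) (fun _ => contDiffOn_const))
    (fun _ _ => gammaMatrix_mem_so43 _ _ _ _ _) (fun _ _ => gammaMatrix_mem_so43 _ _ _ _ _)
    (fun _ _ => by simp [hM]) (fun _ _ => by simp [hN]) (fun _ _ => by simp [hN])
  have hth : ∀ y ∈ W, ∀ v, th (modify A M N y v) = th (A y v) := fun y _ v =>
    th_modify (fun _ => by simp [hM]) (fun _ => by simp [hN]) v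
  have hom : ∀ y ∈ W, ∀ v, om (modify A M N y v) = om (A y v) := fun y _ v => by
    ext i
    rw [om_modify (fun _ => by simp [hN])]
    simp [hM]
  refine ⟨_, hA', hth, hom, fun y hy v w => ?_⟩
  ext i
  obtain ⟨te, oe, tf, of⟩ := (hfr y hy).values
  refine (hfr y hy).ext (B := fun v w => th (curv (modify A M N) y v w) i)
    ((isAltBilin_curv _ y).comp (thₗ i)) ?_ ?_ ?_ v w
  · intro l m
    have h1 := congrFun (congrArg th ((isAltBilin_curv A y).skew (e l y) (e m y))) i
    simp only [th_curv_sub hW hA hA' hth hom hy, modify_e (hfr y hy), te, al_add]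
    simp only [hM, al_gammaMatrix]
    simp [δ, Finset.sum_sub_distrib] at h1 ⊢
    rw [h1]
    split_ifs <;> ring
  · intro l p
    have hs := congrArg th ((isAltBilin_curv A y).skew (e l y) (f p y))
    simp only [th_curv_sub hW hA hA' hth hom hy, modify_e (hfr y hy), modify_f (hfr y hy), te, tf, al_add]
    simp only [hM, hN, al_gammaMatrix, hs, th_neg]
    simp [δ, Finset.sum_sub_distrib]
    split_ifs <;> ring
  · intro p q
    simp only [th_curv_sub hW hA hA' hth hom hy, modify_f (hfr y hy), tf, h0 y hy _ _ (tf p) (tf q)]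
    simp

end

/-- The computation of `comparison_om`, keeping the result: a symmetric change `a` of `ω` modulo
`θ`, followed by the readjustment of `α` that it enforces, changes the horizontal `ω`-torsion by `6
a ε`. Two of the six come from `dθ`, four from `α`. -/
theorem torsion_aux {X : Fin 3 → Fin 3 → Fin 3 → ℝ} {a : Fin 3 → Fin 3 → ℝ} (hs : ∀ j l, a j l = a l j)
    (hX : ∀ p l i, (∑ k, X p k k) * δ l i - X p l i - 2 * ∑ k, ε i p k * a k l = 0) (p q j : Fin 3) :
    2 * ∑ k, a j k * ε k p q + X p j q - X q j p = 6 * ∑ k, a j k * ε k p q := by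
  have h1 := hs 1 0
  have h2 := hs 2 0
  have h3 := hs 2 1
  have htr : ∀ p, ∑ k, X p k k = 0 := fun p => by
    have := fun i => hX p i i
    revert p
    simp only [forall_fin_three, Fin.sum_univ_three]
    simp [h1, h2, h3]
    constructorm* _ ∧ _ <;> intros <;> linarith
  have hX' : ∀ p l i, X p l i = - 2 * ∑ k, ε i p k * a k l := fun p l i => by
    have := hX p l i
    rw [htr p] at this
    linarith
  simp only [hX']
  revert p q j
  simp only [forall_fin_three, Fin.sum_univ_three]
  simp [h1, h2, h3]
  constructorm* _ ∧ _ <;> ring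

/-- A skew form on `ℝ³` is a vector; the component `k` sits at `(k + 1, k + 2)`. -/
theorem eq_sum_ε {F : Fin 3 → Fin 3 → ℝ} (h : ∀ p q, F p q = - F q p) (p q : Fin 3) :
    F p q = ∑ k, F (k + 1) (k + 2) * ε k p q := by
  have h1 := h 0 1
  have h2 := h 0 2
  have h3 := h 1 2
  have h4 := h 0 0
  have h5 := h 1 1
  have h6 := h 2 2
  revert p q
  simp only [forall_fin_three, Fin.sum_univ_three]
  simp
  constructorm* _ ∧ _ <;> linarith

section
variable {W : Set E6} {A A' : E6 → E6 →L[ℝ] Mat}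

/-- The second torsion can be made to vanish on the plane field. -/
theorem exists_om_curv_horizontal_eq_zero (hW : IsOpen W) (hA : PreGauge W A)
    (h0 : ∀ y ∈ W, ∀ v w, th (curv A y v w) = 0) :
    ∃ A', PreGauge W A' ∧ (∀ y ∈ W, ∀ v, th (A' y v) = th (A y v)) ∧
      (∀ y ∈ W, ∀ v w, th (curv A' y v w) = 0) ∧
      ∀ y ∈ W, ∀ v w, th (A y v) = 0 → th (A y w) = 0 → om (curv A' y v w) = 0 := by
  obtain ⟨e, f, he, hf, hfr⟩ := exists_smooth_frame hA.smooth hA.inj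
  -- The factor `6` is that of `torsion_aux`.
  set a : E6 → Fin 3 → Fin 3 → ℝ := fun y j l => -om (curv A y (f (l + 1) y) (f (l + 2) y)) j / 6 with ha
  have has : ∀ l j, ContDiffOn ℝ ∞ (fun y => a y j l) W := fun l j =>
    (contDiffOn_curv_component hW hA.smooth (hf _) (hf _) (omL j)).neg.div_const 6
  -- The `θ`-Bianchi identity on `f_0, f_1, f_2` shows that the horizontal `ω`-torsion is a
  -- symmetric matrix, so a symmetric change of `ω` can cancel it.
  have hsymm : ∀ y ∈ W, ∀ j l, a y j l = a y l j := by
    intro y hy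
    obtain ⟨te, oe, tf, of⟩ := (hfr y hy).values
    have mA := hA.mem y hy
    have mK := curv_mem_so43 hW hA.smooth hA.mem hy
    have h1 := fun i => bianchi_of_component_eq_zero hW hA.smooth (thL i)
      (fun z hz v w => congrFun (h0 z hz v w) i) hy (f 0 y) (f 1 y) (f 2 y)
    simp only [thL_apply, th_add, Pi.add_apply, th_comm (mA _) (mK _ _), h0 y hy, tf, of,
      forall_fin_three, Fin.sum_univ_three] at h1
    simp [δ] at h1
    simp only [ha, forall_fin_three]
    simp
    constructorm* _ ∧ _ <;> linarith
  set M : Fin 3 → E6 → Mat := fun l y => gammaMatrix 0 (fun j => a y j l) 0 0 0 with hM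
  have hA1 : PreGauge W (modify A M 0) := hA.modify
    (fun l => contDiffOn_gammaMatrix (fun _ => contDiffOn_const) (has l)
      (fun _ _ => contDiffOn_const) (fun _ => contDiffOn_const) (fun _ => contDiffOn_const))
    (fun _ => contDiffOn_const) (fun _ _ => gammaMatrix_mem_so43 _ _ _ _ _) (fun _ _ => zero_mem _)
    (fun _ _ => by simp [hM]) (fun _ _ => rfl) (fun _ _ => rfl)
  have hth1 : ∀ y ∈ W, ∀ v, th (modify A M 0 y v) = th (A y v) := fun y _ v =>
    th_modify (fun _ => by simp [hM]) (fun _ => rfl) v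
  have hom1 : ∀ y ∈ W, ∀ v i, om (modify A M 0 y v) i = om (A y v) i + ∑ l, a y i l * th (A y v) l :=
    fun y _ v i => by
      rw [om_modify (fun _ => rfl)]
      simp [hM, mul_comm]
  -- Changing `ω` by multiples of `θ` spoils the `θ`-equation, but not on pairs of horizontal
  -- vectors, so `α` can absorb the error again.
  obtain ⟨A2, hA2, hth2, hom2, hK2⟩ := exists_th_curv_eq_zero hW hA1 (fun y hy v w hv hw => by
    rw [hth1 y hy] at hv hw
    ext i
    have h1 := clm_dd_congr hW hA.smooth hA1.smooth (thL i) (fun z hz v => by simp [hth1 z hz]) hy v w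
    have h2 := congrFun (h0 y hy v w) i
    simp only [thL_apply] at h1
    simp only [curv, th_add, Pi.add_apply, h1, th_comm (hA.mem y hy _) (hA.mem y hy _),
      th_comm (hA1.mem y hy _) (hA1.mem y hy _), hth1 y hy, hom1 y hy, hv, hw] at h2 ⊢
    simpa using h2)
  have hth : ∀ y ∈ W, ∀ v, th (A2 y v) = th (A y v) := fun y hy v =>
    (hth2 y hy v).trans (hth1 y hy v)
  have hom : ∀ y ∈ W, ∀ v i, om (A2 y v) i = om (A y v) i + ∑ l, a y i l * th (A y v) l :=
    fun y hy v i => by rw [hom2 y hy, hom1 y hy]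
  refine ⟨A2, hA2, hth, hK2, fun y hy v w hv hw => ?_⟩
  ext j
  refine (hfr y hy).ext_horizontal (B := fun v w => om (curv A2 y v w) j)
    ((isAltBilin_curv _ y).comp (omₗ j)) (fun p q => ?_) hv hw
  obtain ⟨te, oe, tf, of⟩ := (hfr y hy).values
  have mA := hA.mem y hy
  have mA2 := hA2.mem y hy
  have hd := clm_dd_of_eq_sum hW hA.smooth hA2.smooth (omL j) (fun l => has l j)
    (fun z hz v => hom z hz v j) hy (tf p) (tf q)
  have hdth : ∀ i, th (dd A y (f p y) (f q y)) i = 2 * ε i p q := fun i => by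
    have h1 := congrFun (h0 y hy (f p y) (f q y)) i
    have h2 := sum_ε_δ i p (δ q)
    simp only [curv, th_add, Pi.add_apply, th_comm (mA _) (mA _), tf, of, h2] at h1
    simp [δ] at h1
    linarith
  have hX : ∀ p l i, (∑ k, (al (A2 y (f p y)) k k - al (A y (f p y)) k k)) * δ l i
      - (al (A2 y (f p y)) l i - al (A y (f p y)) l i) - 2 * ∑ k, ε i p k * a y k l = 0 := fun p l i => by
    have h1 := clm_dd_congr hW hA.smooth hA2.smooth (thL i) (fun z hz v => by simp [hth z hz]) hy
      (f p y) (e l y)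
    have h2 := congrFun (h0 y hy (f p y) (e l y)) i
    have h3 := congrFun (hK2 y hy (f p y) (e l y)) i
    have h4 : om (A2 y (e l y)) = fun k => a y k l := by
      ext k; rw [hom y hy, oe, te]; simp [δ]
    have h5 : om (A2 y (f p y)) = δ p := by
      ext k; rw [hom y hy, of, tf]; simp
    have h6 := sum_ε_δ i p (fun k => a y k l)
    simp only [thL_apply] at h1
    simp only [curv, th_add, Pi.add_apply, h1, th_comm (mA _) (mA _), th_comm (mA2 _) (mA2 _),
      hth y hy, te, oe, tf, of, h4, h5, h6] at h2 h3
    simp [← Finset.sum_mul] at h2 h3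
    simp [δ] at h2 h3 ⊢
    split_ifs at h2 h3 ⊢ <;> linarith
  have h5 : ∀ p, om (A2 y (f p y)) = δ p := fun p => by
    ext k; rw [hom y hy, of, tf]; simp
  have h6 := torsion_aux (X := fun p l i => al (A2 y (f p y)) l i - al (A y (f p y)) l i) (hsymm y hy) hX p q j
  have h7 := eq_sum_ε (F := fun p q => om (curv A y (f p y) (f q y)) j) (fun p q => by
    rw [(isAltBilin_curv A y).skew]; rfl) p q
  have h8 : ∑ k, om (curv A y (f (k + 1) y) (f (k + 2) y)) j * ε k p q
      = -6 * ∑ k, a y j k * ε k p q := by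
    rw [Finset.mul_sum]
    exact Finset.sum_congr rfl fun k _ => by simp only [ha]; ring
  rw [h8] at h7
  simp only [omL_apply, hdth] at hd
  have h9 : ∑ l, a y j l * (2 * ε l p q) = 2 * ∑ k, a y j k * ε k p q := by
    rw [Finset.mul_sum]
    exact Finset.sum_congr rfl fun k _ => by ring
  rw [h9] at hd
  simp only [curv, om_add, Pi.add_apply, om_comm (mA _) (mA _), tf, of] at h7
  simp only [curv, om_add, Pi.add_apply, hd, om_comm (mA2 _) (mA2 _), hth y hy, tf, h5]
  simp [δ] at h7 ⊢
  linarith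

/-! The second torsion -/

/-- `B i p m` stands for the `ω^i`-torsion on `(f_p, e_m)` and `L` for the `α`-curvature on pairs of
`f`s. The `θ`-Bianchi identity `h1` expresses `L` through `B`, and the `ω`-Bianchi identity `h2`
then becomes a relation between traces of `B`. -/
theorem second_torsion_aux {B : Fin 3 → Fin 3 → Fin 3 → ℝ} {L : Fin 3 → Fin 3 → Fin 3 → ℝ}
    (h1 : ∀ n m i, -(∑ k, L n k k) * δ m i + L n m i - 2 * ∑ k, ε i (n + 1) k * B k (n + 2) m
      + 2 * ∑ k, ε i (n + 2) k * B k (n + 1) m = 0)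
    (h2 : ∀ i, ∑ p, L p i p = - 2 * ∑ p, B i p p) (m : Fin 3) : ∑ i, (B i i m + B m i i) = 0 := by
  revert m
  simp only [forall_fin_three, Fin.sum_univ_three] at h1 h2 ⊢
  simp [δ] at h1 h2 ⊢
  constructorm* _ ∧ _ <;> linarith

theorem fderiv_mul_of_eq_zero {c d : E6 → ℝ} {y : E6} (hc : DifferentiableAt ℝ c y)
    (hd : DifferentiableAt ℝ d y) (h : d y = 0) (u : E6) :
    fderiv ℝ (fun z => c z * d z) y u = c y * fderiv ℝ d y u := by
  rw [fderiv_fun_mul hc hd, h]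
  simp

theorem fderiv_wedge_of_eq_zero {a b c d : E6 → ℝ} {y : E6} (ha : DifferentiableAt ℝ a y)
    (hb : DifferentiableAt ℝ b y) (hc : DifferentiableAt ℝ c y) (hd : DifferentiableAt ℝ d y)
    (hb0 : b y = 0) (hd0 : d y = 0) (u : E6) :
    fderiv ℝ (fun z => a z * b z - c z * d z) y u = a y * fderiv ℝ b y u - c y * fderiv ℝ d y u := by
  rw [fderiv_fun_sub (ha.fun_mul hb) (hc.fun_mul hd), _root_.sub_apply, fderiv_mul_of_eq_zero ha hb hb0,
    fderiv_mul_of_eq_zero hc hd hd0]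

theorem fderiv_sum_sum {F : Fin 3 → Fin 3 → E6 → ℝ} {y : E6}
    (h : ∀ p j, DifferentiableAt ℝ (F p j) y) (u : E6) :
    fderiv ℝ (fun z => ∑ p, ∑ j, F p j z) y u = ∑ p, ∑ j, fderiv ℝ (F p j) y u := by
  rw [fderiv_fun_sum fun p _ => .fun_sum fun j _ => h p j, ContinuousLinearMap.sum_apply]
  refine Finset.sum_congr rfl fun p _ => ?_
  rw [fderiv_fun_sum fun j _ => h p j, ContinuousLinearMap.sum_apply]

theorem om_curv_expand (hA : PreGauge W A)
    (h1 : ∀ y ∈ W, ∀ v w, th (A y v) = 0 → th (A y w) = 0 → om (curv A y v w) = 0)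
    {e f : Fin 3 → E6} {y : E6} (hy : y ∈ W) (hfr : IsFrame (A y : E6 →ₗ[ℝ] Mat) e f) (v w : E6)
    (i : Fin 3) : om (curv A y v w) i =
      ∑ p, ∑ j, om (curv A y (f p) (e j)) i * (om (A y v) p * th (A y w) j - om (A y w) p * th (A y v) j)
      + ∑ l, ∑ j, om (curv A y (e l) (e j)) i / 2 *
        (th (A y v) l * th (A y w) j - th (A y w) l * th (A y v) j) := by
  rw [← sub_eq_zero]
  obtain ⟨te, oe, tf, of⟩ := hfr.values
  refine hfr.ext (B := fun v w => om (curv A y v w) i - (∑ p, ∑ j, om (curv A y (f p) (e j)) i *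
      (om (A y v) p * th (A y w) j - om (A y w) p * th (A y v) j)
      + ∑ l, ∑ j, om (curv A y (e l) (e j)) i / 2 *
        (th (A y v) l * th (A y w) j - th (A y w) l * th (A y v) j)))
    (((isAltBilin_curv A y).comp (omₗ i)).sub (.add (.sum fun p => .sum fun j => .const_mul _
      (IsAltBilin.wedge (omₗ p ∘ₗ (A y : E6 →ₗ[ℝ] Mat)) (thₗ j ∘ₗ (A y : E6 →ₗ[ℝ] Mat))))
      (.sum fun p => .sum fun j => .const_mul _ (isAltBilin_wedge_th _ p j)))) ?_ ?_ ?_ v w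
  · intro l m
    have h2 := fun l m => congrFun (congrArg om ((isAltBilin_curv A y).skew (e l) (e m))) i
    simp only [te, oe]
    simp [δ, mul_sub, Finset.sum_sub_distrib]
    rw [h2 m l]
    simp
    ring
  · intro l p
    have h2 := congrFun (congrArg om ((isAltBilin_curv A y).skew (e l) (f p))) i
    simp only [te, oe, tf, of]
    simp [δ, h2]
  · intro p q
    simp only [tf, of, h1 y hy _ _ (tf p) (tf q)]
    simp

/-- The `ω`-torsion is not yet zero, so its derivatives enter the Bianchi identity. But every term
of `om_curv_expand` has a factor `θ`; on vectors horizontal at `y`, frozen there, the derivative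
must hit this factor, and the cyclic sum collects the values `dθ_j (f_p, f_q) = 2 ε_jpq`. -/
theorem cyclic_second_torsion (hW : IsOpen W) (hA : PreGauge W A)
    (h0 : ∀ y ∈ W, ∀ v w, th (curv A y v w) = 0)
    (h1 : ∀ y ∈ W, ∀ v w, th (A y v) = 0 → th (A y w) = 0 → om (curv A y v w) = 0)
    {e f : Fin 3 → E6 → E6} (he : ∀ l, ContDiffOn ℝ ∞ (e l) W) (hf : ∀ p, ContDiffOn ℝ ∞ (f p) W)
    (hfr : ∀ y ∈ W, IsFrame (A y : E6 →ₗ[ℝ] Mat) (fun l => e l y) (fun p => f p y)) {y : E6} (hy : y ∈ W)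
    (i : Fin 3) : om (fderiv ℝ (fun z => curv A z (f 1 y) (f 2 y)) y (f 0 y)
      + fderiv ℝ (fun z => curv A z (f 2 y) (f 0 y)) y (f 1 y)
      + fderiv ℝ (fun z => curv A z (f 0 y) (f 1 y)) y (f 2 y)) i =
      - 2 * ∑ p, om (curv A y (f p y) (e p y)) i := by
  have hn := hW.mem_nhds hy
  have hAd := (hA.smooth.contDiffAt hn).differentiableAt (by simp)
  obtain ⟨te, oe, tf, of⟩ := (hfr y hy).values
  have hBd : ∀ p j, DifferentiableAt ℝ (fun z => om (curv A z (f p z) (e j z)) i) y := fun p j =>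
    ((contDiffOn_curv_component hW hA.smooth (hf p) (he j) (omL i)).contDiffAt hn).differentiableAt
      (by simp)
  have hCd : ∀ p j, DifferentiableAt ℝ (fun z => om (curv A z (e p z) (e j z)) i / 2) y := fun p j =>
    (((contDiffOn_curv_component hW hA.smooth (he p) (he j) (omL i)).div_const 2).contDiffAt
      hn).differentiableAt (by simp)
  have hL : ∀ (L : Mat →L[ℝ] ℝ) (v : E6), DifferentiableAt ℝ (fun z => L (A z v)) y := fun L v =>
    L.differentiableAt.comp y (hAd.clm_apply (differentiableAt_const v))
  have ht : ∀ j v, DifferentiableAt ℝ (fun z => th (A z v) j) y := fun j => hL (thL j)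
  have ho : ∀ j v, DifferentiableAt ℝ (fun z => om (A z v) j) y := fun j => hL (omL j)
  have hD : ∀ j v u, fderiv ℝ (fun z => th (A z v) j) y u = th (fderiv ℝ A y u v) j := fun j v u => by
    have := fderiv_clm_comp_apply (hAd.clm_apply (differentiableAt_const v)) (thL j) u
    rw [fderiv_apply_const hAd] at this
    exact this
  have key : ∀ u v w, th (A y v) = 0 → th (A y w) = 0 → om (fderiv ℝ (fun z => curv A z v w) y u) i =
      ∑ p, ∑ j, om (curv A y (f p y) (e j y)) i * (om (A y v) p * th (fderiv ℝ A y u w) j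
        - om (A y w) p * th (fderiv ℝ A y u v) j) := fun u v w hv hw => by
    have h2 := fderiv_clm_comp_apply (differentiableAt_curv (hA.smooth.contDiffAt hn) v w) (omL i) u
    have h3 : (fun z => omL i (curv A z v w)) =ᶠ[𝓝 y] fun z =>
        ∑ p, ∑ j, om (curv A z (f p z) (e j z)) i *
          (om (A z v) p * th (A z w) j - om (A z w) p * th (A z v) j)
        + ∑ l, ∑ j, om (curv A z (e l z) (e j z)) i / 2 *
          (th (A z v) l * th (A z w) j - th (A z w) l * th (A z v) j) := by
      filter_upwards [hn] with z hz
      exact om_curv_expand hA h1 hz (hfr z hz) v w i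
    have w1 : ∀ p j, DifferentiableAt ℝ
        (fun z => om (A z v) p * th (A z w) j - om (A z w) p * th (A z v) j) y := fun p j =>
      ((ho p v).fun_mul (ht j w)).fun_sub ((ho p w).fun_mul (ht j v))
    have w2 : ∀ l j, DifferentiableAt ℝ
        (fun z => th (A z v) l * th (A z w) j - th (A z w) l * th (A z v) j) y := fun l j =>
      ((ht l v).fun_mul (ht j w)).fun_sub ((ht l w).fun_mul (ht j v))
    rw [h3.fderiv_eq, fderiv_fun_add (.fun_sum fun p _ => .fun_sum fun j _ => (hBd p j).fun_mul (w1 p j))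
      (.fun_sum fun p _ => .fun_sum fun j _ => (hCd p j).fun_mul (w2 p j)), _root_.add_apply,
      fderiv_sum_sum (fun p j => (hBd p j).fun_mul (w1 p j)),
      fderiv_sum_sum (fun p j => (hCd p j).fun_mul (w2 p j))] at h2
    simp only [omL_apply] at h2
    rw [← h2]
    have e1 : ∀ p j, fderiv ℝ (fun z => om (curv A z (f p z) (e j z)) i *
        (om (A z v) p * th (A z w) j - om (A z w) p * th (A z v) j)) y u =
        om (curv A y (f p y) (e j y)) i * (om (A y v) p * th (fderiv ℝ A y u w) j
        - om (A y w) p * th (fderiv ℝ A y u v) j) := fun p j => by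
      rw [fderiv_mul_of_eq_zero (hBd p j) (w1 p j) (by simp [hv, hw]),
        fderiv_wedge_of_eq_zero (ho p v) (ht j w) (ho p w) (ht j v)
          (by simp [hw]) (by simp [hv])]
      simp only [hD]
    have e2 : ∀ l j, fderiv ℝ (fun z => om (curv A z (e l z) (e j z)) i / 2 *
        (th (A z v) l * th (A z w) j - th (A z w) l * th (A z v) j)) y u = 0 := fun l j => by
      rw [fderiv_mul_of_eq_zero (hCd l j) (w2 l j) (by simp [hv, hw]),
        fderiv_wedge_of_eq_zero (ht l v) (ht j w) (ht l w) (ht j v)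
          (by simp [hw]) (by simp [hv])]
      simp [hv, hw]
    simp only [e1, e2]
    simp
  have hdth : ∀ j p q, th (fderiv ℝ A y (f p y) (f q y)) j - th (fderiv ℝ A y (f q y) (f p y)) j =
      2 * ε j p q := fun j p q => by
    have h1 := congrFun (h0 y hy (f p y) (f q y)) j
    have h2 := sum_ε_δ j p (δ q)
    simp only [curv, th_add, Pi.add_apply, tf, of, h2, th_comm (hA.mem y hy _) (hA.mem y hy _)] at h1
    simp only [dd, th_sub, Pi.sub_apply] at h1
    simp [δ] at h1
    linarith
  simp only [om_add, Pi.add_apply, key _ _ _ (tf _) (tf _), of]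
  have a1 := fun j => hdth j 0 1
  have a2 := fun j => hdth j 1 2
  have a3 := fun j => hdth j 2 0
  simp only [forall_fin_three] at a1 a2 a3
  simp only [Fin.sum_univ_three]
  generalize th (fderiv ℝ A y (f 0 y) (f 1 y)) = D01 at *
  generalize th (fderiv ℝ A y (f 1 y) (f 0 y)) = D10 at *
  generalize th (fderiv ℝ A y (f 0 y) (f 2 y)) = D02 at *
  generalize th (fderiv ℝ A y (f 2 y) (f 0 y)) = D20 at *
  generalize th (fderiv ℝ A y (f 1 y) (f 2 y)) = D12 at *
  generalize th (fderiv ℝ A y (f 2 y) (f 1 y)) = D21 at *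
  simp [δ] at a1 a2 a3 ⊢
  simp only [sub_eq_iff_eq_add] at a1 a2 a3
  obtain ⟨b1, b2, b3⟩ := a1
  obtain ⟨b4, b5, b6⟩ := a2
  obtain ⟨b7, b8, b9⟩ := a3
  simp only [b1, b2, b3, b4, b5, b6, b7, b8, b9]
  ring

/-- This trace is the obstruction to absorbing the second torsion in `α` without disturbing the
first; the Bianchi identity removes it. -/
theorem second_torsion_trace (hW : IsOpen W) (hA : PreGauge W A)
    (h0 : ∀ y ∈ W, ∀ v w, th (curv A y v w) = 0)
    (h1 : ∀ y ∈ W, ∀ v w, th (A y v) = 0 → th (A y w) = 0 → om (curv A y v w) = 0)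
    {e f : Fin 3 → E6 → E6} (he : ∀ l, ContDiffOn ℝ ∞ (e l) W) (hf : ∀ p, ContDiffOn ℝ ∞ (f p) W)
    (hfr : ∀ y ∈ W, IsFrame (A y : E6 →ₗ[ℝ] Mat) (fun l => e l y) (fun p => f p y)) {y : E6} (hy : y ∈ W)
    (m : Fin 3) :
    ∑ i, (om (curv A y (f i y) (e m y)) i + om (curv A y (f i y) (e i y)) m) = 0 := by
  obtain ⟨te, oe, tf, of⟩ := (hfr y hy).values
  have mA := hA.mem y hy
  have mK := curv_mem_so43 hW hA.smooth hA.mem hy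
  refine second_torsion_aux (B := fun i p m => om (curv A y (f p y) (e m y)) i)
    (L := fun n i j => al (curv A y (f (n + 1) y) (f (n + 2) y)) i j) (fun n m i => ?_) (fun i => ?_) m
  · have h2 := bianchi_of_component_eq_zero hW hA.smooth (thL i)
      (fun z hz v w => congrFun (h0 z hz v w) i) hy (e m y) (f (n + 1) y) (f (n + 2) y)
    have h3 := congrArg om ((isAltBilin_curv A y).skew (e m y) (f (n + 1) y))
    simp only [thL_apply, th_add, Pi.add_apply, th_comm (mA _) (mK _ _), h0 y hy, tf, of, te, oe,
      h1 y hy _ _ (tf _) (tf _), h3, sum_ε_δ] at h2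
    simp [δ] at h2 ⊢
    split_ifs at h2 ⊢ <;> linarith
  · have h2 := congrArg om (bianchi (hA.smooth.contDiffAt (hW.mem_nhds hy)) (f 0 y) (f 1 y) (f 2 y))
    have h3 := congrFun h2 i
    rw [om_add, Pi.add_apply, cyclic_second_torsion hW hA h0 h1 he hf hfr hy] at h3
    simp only [om_add, Pi.add_apply, om_comm (mA _) (mK _ _), h0 y hy, tf, of,
      h1 y hy _ _ (tf _) (tf _), Fin.sum_univ_three] at h3 ⊢
    simp [δ] at h3 ⊢
    linarith

theorem sum_ε_half (B : Fin 3 → Fin 3 → ℝ) (i m : Fin 3) :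
    ∑ k, ε i k m * ((B (k + 2) (k + 1) - B (k + 1) (k + 2)) / 2) = (B i m - B m i) / 2 := by
  revert i m
  simp only [forall_fin_three, Fin.sum_univ_three]
  simp
  constructorm* _ ∧ _ <;> ring

theorem sum_ε_trace (K : Fin 3 → Fin 3 → Fin 3 → ℝ) (hK : ∀ i m l, K m l i = - K l m i) (m l i : Fin 3) :
    K m l i + ∑ k, ε i k l * (K (k + 1) (k + 2) m - δ m k * (∑ n, K (n + 1) (n + 2) n) / 2)
      - ∑ k, ε i k m * (K (k + 1) (k + 2) l - δ l k * (∑ n, K (n + 1) (n + 2) n) / 2) = 0 := by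
  have h1 := fun i => hK i 0 0
  have h2 := fun i => hK i 1 1
  have h3 := fun i => hK i 2 2
  have h4 := fun i => hK i 0 1
  have h5 := fun i => hK i 1 2
  have h6 := fun i => hK i 2 0
  revert m l i
  simp only [forall_fin_three, Fin.sum_univ_three] at h1 h2 h3 h4 h5 h6 ⊢
  simp [δ] at h1 h2 h3 h4 h5 h6 ⊢
  constructorm* _ ∧ _ <;> linarith

/-- The second torsion can be absorbed in the `α`- and `β`-components. -/
theorem exists_om_curv_eq_zero (hW : IsOpen W) (hA : PreGauge W A)
    (h0 : ∀ y ∈ W, ∀ v w, th (curv A y v w) = 0)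
    (h1 : ∀ y ∈ W, ∀ v w, th (A y v) = 0 → th (A y w) = 0 → om (curv A y v w) = 0) :
    ∃ A', PreGauge W A' ∧ (∀ y ∈ W, ∀ v, th (A' y v) = th (A y v)) ∧
      (∀ y ∈ W, ∀ v w, th (curv A' y v w) = 0) ∧ ∀ y ∈ W, ∀ v w, om (curv A' y v w) = 0 := by
  obtain ⟨e, f, he, hf, hfr⟩ := exists_smooth_frame hA.smooth hA.inj
  set B : E6 → Fin 3 → Fin 3 → Fin 3 → ℝ := fun y i p m => om (curv A y (f p y) (e m y)) i with hB
  set K : E6 → Fin 3 → Fin 3 → Fin 3 → ℝ := fun y m l i => om (curv A y (e m y) (e l y)) i with hK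
  have hBs : ∀ i p m, ContDiffOn ℝ ∞ (fun y => B y i p m) W := fun i p m =>
    contDiffOn_curv_component hW hA.smooth (hf p) (he m) (omL i)
  have hKs : ∀ m l i, ContDiffOn ℝ ∞ (fun y => K y m l i) W := fun m l i =>
    contDiffOn_curv_component hW hA.smooth (he m) (he l) (omL i)
  -- The torsion `B` is split with respect to its first and last index. The symmetric part goes into
  -- `α` on the `e_m`; being symmetric, and trace-free by `htr`, it leaves the `θ`-torsion equal to
  -- zero. The `β`-part of `M` removes the torsion on pairs of `e`s, by `sum_ε_trace`.
  set M : Fin 3 → E6 → Mat := fun m y => gammaMatrix 0 0 (fun i p => (B y i p m + B y m p i) / 2)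
    (fun k => K y (k + 1) (k + 2) m - δ m k * (∑ n, K y (n + 1) (n + 2) n) / 2) 0 with hM
  -- The skew part of `B`, absorbed by `β` on the `f_p`.
  set N : Fin 3 → E6 → Mat := fun p y => gammaMatrix 0 0 0
    (fun k => -((B y (k + 2) p (k + 1) - B y (k + 1) p (k + 2)) / 2)) 0 with hN
  have hA' : PreGauge W (modify A M N) := hA.modify
    (fun m => contDiffOn_gammaMatrix (fun _ => contDiffOn_const) (fun _ => contDiffOn_const)
      (fun i p => ((hBs i p m).add (hBs m p i)).div_const 2)
      (fun k => (hKs _ _ m).sub ((contDiffOn_const.mul (ContDiffOn.sum fun n _ => hKs _ _ n)).div_const 2))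
      (fun _ => contDiffOn_const))
    (fun p => contDiffOn_gammaMatrix (fun _ => contDiffOn_const) (fun _ => contDiffOn_const)
      (fun _ _ => contDiffOn_const) (fun k => (((hBs _ p _).sub (hBs _ p _)).div_const 2).neg)
      (fun _ => contDiffOn_const))
    (fun _ _ => gammaMatrix_mem_so43 _ _ _ _ _) (fun _ _ => gammaMatrix_mem_so43 _ _ _ _ _)
    (fun _ _ => by simp [hM]) (fun _ _ => by simp [hN]) (fun _ _ => by simp [hN])
  have hth : ∀ y ∈ W, ∀ v, th (modify A M N y v) = th (A y v) := fun y _ v =>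
    th_modify (fun _ => by simp [hM]) (fun _ => by simp [hN]) v
  have hom : ∀ y ∈ W, ∀ v, om (modify A M N y v) = om (A y v) := fun y _ v => by
    ext i
    rw [om_modify (fun _ => by simp [hN])]
    simp [hM]
  have htr : ∀ y ∈ W, ∀ m, ∑ i, (B y i i m + B y m i i) / 2 = 0 := fun y hy m => by
    rw [← Finset.sum_div, second_torsion_trace hW hA h0 h1 he hf hfr hy, zero_div]
  refine ⟨_, hA', hth, fun y hy v w => ?_, fun y hy v w => ?_⟩
  · ext i
    obtain ⟨te, oe, tf, of⟩ := (hfr y hy).values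
    refine (hfr y hy).ext (B := fun v w => th (curv (modify A M N) y v w) i)
      ((isAltBilin_curv _ y).comp (thₗ i)) ?_ ?_ ?_ v w
    · intro l m
      simp only [th_curv_sub hW hA hA' hth hom hy, modify_e (hfr y hy), te, al_add, h0 y hy]
      simp only [hM, al_gammaMatrix]
      simp only [Pi.add_apply, add_sub_cancel_left, Finset.sum_sub_distrib, ← Finset.sum_mul, htr y hy]
      simp [δ]
      ring
    · intro l p
      simp only [th_curv_sub hW hA hA' hth hom hy, modify_e (hfr y hy), modify_f (hfr y hy), te, tf,
        al_add, h0 y hy]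
      simp only [hM, hN, al_gammaMatrix]
      simp
    · intro p q
      simp only [th_curv_sub hW hA hA' hth hom hy, modify_f (hfr y hy), tf, h0 y hy]
      simp
  · ext i
    obtain ⟨te, oe, tf, of⟩ := (hfr y hy).values
    refine (hfr y hy).ext (B := fun v w => om (curv (modify A M N) y v w) i)
      ((isAltBilin_curv _ y).comp (omₗ i)) ?_ ?_ ?_ v w
    · intro l m
      simp only [om_curv_sub hW hA hA' hth hom hy, modify_e (hfr y hy), te, oe, be_add]
      simp only [hM, be_gammaMatrix]
      have h2 := sum_ε_trace (K y) (fun i m l => by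
        simp only [hK]; rw [(isAltBilin_curv A y).skew]; rfl) l m i
      rw [show om (curv A y (e l y) (e m y)) i = K y l m i from rfl]
      simp [mul_sub, Finset.sum_sub_distrib] at h2 ⊢
      simp [δ, mul_sub, Finset.sum_sub_distrib] at h2 ⊢
      linarith
    · intro l p
      have hs := congrFun (congrArg om ((isAltBilin_curv A y).skew (e l y) (f p y))) i
      have h2 := sum_ε_half (fun i m => B y i p m) i l
      simp only [om_curv_sub hW hA hA' hth hom hy, modify_e (hfr y hy), modify_f (hfr y hy), te, tf, oe,
        of, be_add, al_add]
      simp only [hM, hN, be_gammaMatrix, al_gammaMatrix, hs]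
      simp [mul_sub, Finset.sum_sub_distrib] at h2 ⊢
      simp [δ] at h2 ⊢
      linarith
    · intro p q
      simp only [om_curv_sub hW hA hA' hth hom hy, modify_f (hfr y hy), tf, of, al_add, be_add,
        h1 y hy _ _ (tf _) (tf _)]
      simp only [hN, al_gammaMatrix]
      simp

theorem be_sum {ι : Type*} (s : Finset ι) (x : ι → Mat) (k : Fin 3) :
    be (∑ i ∈ s, x i) k = ∑ i ∈ s, be (x i) k := map_sum (beₗ k) x s

/-- The curvature can be normalized by a choice of the `τ`-component. -/
theorem exists_isGauge_of_torsionFree (hW : IsOpen W) (hA : PreGauge W A)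
    (h0 : ∀ y ∈ W, ∀ v w, th (curv A y v w) = 0) (h1 : ∀ y ∈ W, ∀ v w, om (curv A y v w) = 0) :
    ∃ A', IsGauge W A' ∧ ∀ y ∈ W, ∀ v, th (A' y v) = th (A y v) := by
  obtain ⟨e, f, he, hf, hfr⟩ := exists_smooth_frame hA.smooth hA.inj
  -- Adding `z` to `τ` on `f_p` changes the trace of the `α`-curvature on `(f_p, e_l)` by `-2 z_l`.
  set z : E6 → Fin 3 → Fin 3 → ℝ := fun y p l => (∑ i, al (curv A y (f p y) (e l y)) i i) / 2 with hz
  -- Adding `t` to `τ` on `e_l` changes the `β`-curvature on `(e_l, f_p)` by the skew matrix of `t`,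
  -- so `t` is chosen to cancel its skew part.
  set t : E6 → Fin 3 → Fin 3 → ℝ := fun y l j => (be (curv A y (e l y) (f (j + 1) y)) (j + 2)
    - be (curv A y (e l y) (f (j + 2) y)) (j + 1)) / 2 with ht
  set M : Fin 3 → E6 → Mat := fun m y => gammaMatrix 0 0 0 0 (t y m) with hM
  set N : Fin 3 → E6 → Mat := fun p y => gammaMatrix 0 0 0 0 (z y p) with hN
  have hA' : PreGauge W (modify A M N) := hA.modify
    (fun m => contDiffOn_gammaMatrix (fun _ => contDiffOn_const) (fun _ => contDiffOn_const)
      (fun _ _ => contDiffOn_const) (fun _ => contDiffOn_const)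
      (fun j => ((contDiffOn_curv_component hW hA.smooth (he m) (hf (j + 1)) (beL (j + 2))).sub
        (contDiffOn_curv_component hW hA.smooth (he m) (hf (j + 2)) (beL (j + 1)))).div_const 2))
    (fun p => contDiffOn_gammaMatrix (fun _ => contDiffOn_const) (fun _ => contDiffOn_const)
      (fun _ _ => contDiffOn_const) (fun _ => contDiffOn_const)
      (fun l => (ContDiffOn.sum fun i _ =>
        contDiffOn_curv_component hW hA.smooth (hf p) (he l) (alL i i)).div_const 2))
    (fun _ _ => gammaMatrix_mem_so43 _ _ _ _ _) (fun _ _ => gammaMatrix_mem_so43 _ _ _ _ _)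
    (fun _ _ => by simp [hM]) (fun _ _ => by simp [hN]) (fun _ _ => by simp [hN])
  have hth : ∀ y ∈ W, ∀ v, th (modify A M N y v) = th (A y v) := fun y _ v =>
    th_modify (fun _ => by simp [hM]) (fun _ => by simp [hN]) v
  have hom : ∀ y ∈ W, ∀ v, om (modify A M N y v) = om (A y v) := fun y _ v => by
    ext i
    rw [om_modify (fun _ => by simp [hN])]
    simp [hM]
  have hal : ∀ y ∈ W, ∀ v, al (modify A M N y v) = al (A y v) := fun y _ v => by
    ext i j
    change alₗ i j _ = _
    simp [modify_apply, hM, hN, -alₗ_apply]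
    simp
  have hbe : ∀ y ∈ W, ∀ v, be (modify A M N y v) = be (A y v) := fun y _ v => by
    ext i
    change beₗ i _ = _
    simp [modify_apply, hM, hN, -beₗ_apply]
    simp
  have hcal : ∀ y ∈ W, ∀ v w i j, al (curv (modify A M N) y v w) i j = al (curv A y v w) i j +
      (- δ i j * ∑ k, ((ta (modify A M N y v) k - ta (A y v) k) * th (A y w) k
        - (ta (modify A M N y w) k - ta (A y w) k) * th (A y v) k)
        + ((ta (modify A M N y v) i - ta (A y v) i) * th (A y w) j
        - (ta (modify A M N y w) i - ta (A y w) i) * th (A y v) j)) := fun y hy v w i j => by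
    have h1 := clm_dd_congr hW hA.smooth hA'.smooth (alL i j)
      (fun z hz v => by simp [hal z hz]) hy v w
    simp only [curv, al_add, Pi.add_apply, al_comm (hA.mem y hy _) (hA.mem y hy _),
      al_comm (hA'.mem y hy _) (hA'.mem y hy _), hth y hy, hom y hy, hal y hy, hbe y hy, sub_mul,
      Finset.sum_sub_distrib]
    simp only [alL_apply] at h1
    rw [h1]
    ring
  have hcbe : ∀ y ∈ W, ∀ v w i, be (curv (modify A M N) y v w) i = be (curv A y v w) i
      - ∑ j, ∑ k, ε i j k * ((ta (modify A M N y v) j - ta (A y v) j) * om (A y w) k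
        - (ta (modify A M N y w) j - ta (A y w) j) * om (A y v) k) := fun y hy v w i => by
    have h1 := clm_dd_congr hW hA.smooth hA'.smooth (beL i)
      (fun z hz v => by simp [hbe z hz]) hy v w
    simp only [curv, be_add, Pi.add_apply, be_comm (hA.mem y hy _) (hA.mem y hy _),
      be_comm (hA'.mem y hy _) (hA'.mem y hy _), hth y hy, hom y hy, hal y hy, hbe y hy, sub_mul,
      mul_sub, Finset.sum_sub_distrib]
    simp only [beL_apply] at h1
    rw [h1]
    ring
  have h0' : ∀ y ∈ W, ∀ v w, th (curv (modify A M N) y v w) = 0 := fun y hy v w => by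
    ext i; rw [th_curv_sub hW hA hA' hth hom hy, h0 y hy, hal y hy, hal y hy]; simp
  have h1' : ∀ y ∈ W, ∀ v w, om (curv (modify A M N) y v w) = 0 := fun y hy v w => by
    ext i; rw [om_curv_sub hW hA hA' hth hom hy, h1 y hy, hal y hy, hal y hy, hbe y hy, hbe y hy]; simp
  have htaf : ∀ y ∈ W, ∀ p k, ta (modify A M N y (f p y)) k - ta (A y (f p y)) k = z y p k :=
    fun y hy p k => by rw [modify_f (hfr y hy), ta_add]; simp [hN]
  have htae : ∀ y ∈ W, ∀ p k, ta (modify A M N y (e p y)) k - ta (A y (e p y)) k = t y p k :=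
    fun y hy p k => by rw [modify_e (hfr y hy), ta_add]; simp [hM]
  have trace : ∀ y ∈ W, ∀ u w, th (modify A M N y u) = 0 →
      ∑ i, al (curv (modify A M N) y u w) i i = 0 := fun y hy u w hu => by
    obtain ⟨te, oe, tf, of⟩ := (hfr y hy).values
    have hb := bianchiAt_curv hW hA'.smooth hA'.mem h0' h1' hy
    refine (hfr y hy).ext_horizontal_left (B := fun u w => ∑ i, al (curv (modify A M N) y u w) i i)
      (.sum fun i => (isAltBilin_curv _ y).comp (alₗ i i)) (fun p l => ?_) (fun p q => ?_)
      ((hth y hy u).symm.trans hu) w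
    · simp only [hcal y hy, htaf y hy, htae y hy, te, tf]
      simp [δ, Finset.sum_add_distrib, hz]
      ring
    · simp only [hb.al_ff (isFrame_of_values (hfr y hy) (hth y hy) (hom y hy)), Finset.sum_const_zero]
  refine ⟨_, isGauge_of_components hW hA'.smooth hA'.mem hA'.inj h0' h1' trace
    fun y hy u v w hu hv => ?_, hth⟩
  obtain ⟨te, oe, tf, of⟩ := (hfr y hy).values
  have hfr' := isFrame_of_values (hfr y hy) (hth y hy) (hom y hy)
  have hb : TraceFreeAt (modify A M N y : E6 →ₗ[ℝ] Mat) (curv (modify A M N) y) :=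
    ⟨bianchiAt_curv hW hA'.smooth hA'.mem h0' h1' hy, trace y hy⟩
  have hee : ∀ l p q, be (curv (modify A M N) y (e l y) (f p y)) q
      = be (curv (modify A M N) y (e l y) (f q y)) p := fun l p q => by
    simp only [hcbe y hy, htaf y hy, htae y hy, oe, of]
    simp only [ht]
    revert p q
    simp only [forall_fin_three, Fin.sum_univ_three]
    simp [δ]
    constructorm* _ ∧ _ <;> intros <;> ring
  have hB := isAltBilin_curv (modify A M N) y
  have hS : ∀ w p q, be (curv (modify A M N) y w (f p y)) q = be (curv (modify A M N) y w (f q y)) p := by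
    intro w p q
    have h2 : ∀ p q, be (curv (modify A M N) y w (f p y)) q =
        ∑ l, th (modify A M N y w) l * be (curv (modify A M N) y (e l y) (f p y)) q := fun p q => by
      conv_lhs => rw [hfr'.expand w]
      have h3 : ∀ p' q', be (curv (modify A M N) y (f p' y) (f q' y)) = 0 := fun p' q' =>
        funext (hb.be_ff hfr' p' q')
      simp [hB.add_left, hB.sum_left, hB.smul_left, be_sum, h3]
    rw [h2, h2]
    simp only [hee _ p q]
  have hE : ∀ u, th (modify A M N y u) = 0 → ∀ j, be (curv (modify A M N) y w u) j =
      ∑ p, om (modify A M N y u) p * be (curv (modify A M N) y w (f p y)) j := fun u hu j => by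
    conv_lhs => rw [hfr'.expand u]
    simp [hu, hB.sum_right, hB.smul_right, be_sum]
  simp only [hE u hu, hE v hv, Finset.sum_mul]
  rw [Finset.sum_comm]
  refine Finset.sum_congr rfl fun p _ => Finset.sum_congr rfl fun q _ => ?_
  rw [hS]
  ring

end

/-! ### Normal gauges of plane fields -/

theorem eq_zero_of_linearIndependent_six {V : Type*} [AddCommGroup V] [Module ℝ V]
    {a b : Fin 3 → V} (h : LinearIndependent ℝ ![a 0, a 1, a 2, b 0, b 1, b 2]) {s t : Fin 3 → ℝ}
    (h0 : ∑ i, s i • a i + ∑ i, t i • b i = 0) : s = 0 ∧ t = 0 := by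
  have h1 := Fintype.linearIndependent_iff.1 h ![s 0, s 1, s 2, t 0, t 1, t 2] (by
    rw [← h0]
    simp [Fin.sum_univ_succ, add_assoc])
  have h2 := h1 0
  have h3 := h1 1
  have h4 := h1 2
  have h5 := h1 3
  have h6 := h1 4
  have h7 := h1 5
  simp at h2 h3 h4 h5 h6 h7
  constructor <;> ext i <;> fin_cases i <;> simp [*]

/-- The coframing with the given `θ`- and `ω`-components. -/
def coframeL : ((Fin 3 → ℝ) × (Fin 3 → ℝ)) →L[ℝ] Mat := LinearMap.toContinuousLinearMap
  { toFun := fun x => gammaMatrix x.1 x.2 0 0 0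
    map_add' := fun x y => so43_ext (gammaMatrix_mem_so43 _ _ _ _ _)
      (add_mem (gammaMatrix_mem_so43 _ _ _ _ _) (gammaMatrix_mem_so43 _ _ _ _ _))
      (by simp) (by simp) (by simp) (by simp) (by simp)
    map_smul' := fun c x => so43_ext (gammaMatrix_mem_so43 _ _ _ _ _)
      (so43.smul_mem _ (gammaMatrix_mem_so43 _ _ _ _ _))
      (by simp) (by simp) (by simp) (by simp) (by simp) }

theorem coframeL_apply (x : (Fin 3 → ℝ) × (Fin 3 → ℝ)) : coframeL x = gammaMatrix x.1 x.2 0 0 0 := rfl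

def combineL (Z Y : Fin 3 → E6) : ((Fin 3 → ℝ) × (Fin 3 → ℝ)) →L[ℝ] E6 := LinearMap.toContinuousLinearMap
  { toFun := fun x => ∑ i, x.1 i • Z i + ∑ i, x.2 i • Y i
    map_add' := fun x y => by simp [add_smul, Finset.sum_add_distrib]; abel
    map_smul' := fun c x => by simp [mul_smul, Finset.smul_sum] }

theorem combineL_apply (Z Y : Fin 3 → E6) (x : (Fin 3 → ℝ) × (Fin 3 → ℝ)) :
    combineL Z Y x = ∑ i, x.1 i • Z i + ∑ i, x.2 i • Y i := rfl

section
variable {W : Set E6}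

theorem exists_preGauge (hW : IsOpen W) {Y : Fin 3 → E6 → E6} (hY : ∀ i, ContDiffOn ℝ ∞ (Y i) W)
    (hli : ∀ y ∈ W, LinearIndependent ℝ ![Y 0 y, Y 1 y, Y 2 y, VectorField.lieBracket ℝ (Y 1) (Y 2) y,
      VectorField.lieBracket ℝ (Y 2) (Y 0) y, VectorField.lieBracket ℝ (Y 0) (Y 1) y]) :
    ∃ A, PreGauge W A ∧ (∀ y ∈ W, ∀ v, th (A y v) = 0 ↔ v ∈ Submodule.span ℝ (range fun i => Y i y)) ∧
      ∀ y ∈ W, ∀ v w, th (A y v) = 0 → th (A y w) = 0 → th (curv A y v w) = 0 := by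
  -- The frame dual to the `θ_i`. The factor comes from `dθ_i (Y_p, Y_q) = -θ_i [Y_p, Y_q]`, which
  -- has to equal `2 ε_ipq`.
  set Z : Fin 3 → E6 → E6 := fun i y =>
    (-1 / 2 : ℝ) • VectorField.lieBracket ℝ (Y (i + 1)) (Y (i + 2)) y with hZ
  have hZs : ∀ i, ContDiffOn ℝ ∞ (Z i) W := fun i => by
    have h1 := fun j => (hY j).fderiv_of_isOpen hW (m := ∞) (by simp)
    exact ContDiffOn.const_smul (-1 / 2 : ℝ) (((h1 (i + 2)).clm_apply (hY (i + 1))).sub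
      ((h1 (i + 1)).clm_apply (hY (i + 2))))
  set P : E6 → ((Fin 3 → ℝ) × (Fin 3 → ℝ)) →L[ℝ] E6 := fun y =>
    combineL (fun i => Z i y) (fun i => Y i y) with hP
  have hPs : ContDiffOn ℝ ∞ P W := by
    rw [contDiffOn_clm_apply]
    intro x
    simp only [hP, combineL_apply]
    exact (ContDiffOn.sum fun l _ => (hZs l).const_smul (x.1 l)).add
      (ContDiffOn.sum fun l _ => (hY l).const_smul (x.2 l))
  have hPi : ∀ y ∈ W, Function.Injective (P y) := fun y hy => by
    rw [injective_iff_map_eq_zero]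
    intro x hx
    have h2 := eq_zero_of_linearIndependent_six (a := fun i => Y i y)
      (b := fun i => VectorField.lieBracket ℝ (Y (i + 1)) (Y (i + 2)) y) (hli y hy)
      (s := x.2) (t := (-1 / 2 : ℝ) • x.1) (by
        rw [← hx, hP, combineL_apply, add_comm]
        congr 1
        refine Finset.sum_congr rfl fun i _ => ?_
        simp [hZ, smul_smul, mul_comm])
    exact Prod.ext (by simpa using h2.2) h2.1
  have he : ∀ y ∈ W, ∃ e : ((Fin 3 → ℝ) × (Fin 3 → ℝ)) ≃L[ℝ] E6, (e : _ →L[ℝ] E6) = P y := fun y hy =>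
    ⟨(LinearEquiv.ofInjectiveOfFinrankEq (P y : _ →ₗ[ℝ] E6) (hPi y hy)
      (by simp)).toContinuousLinearEquiv, by apply ContinuousLinearMap.ext; intro x; rfl⟩
  set A : E6 → E6 →L[ℝ] Mat := fun y => coframeL.comp (P y).inverse with hA
  have hAs : ContDiffOn ℝ ∞ A W := by
    refine contDiffOn_const.clm_comp fun y hy => ?_
    obtain ⟨e, he⟩ := he y hy
    have h1 : ContDiffAt ℝ ∞ ContinuousLinearMap.inverse (P y) := by
      rw [← he]; exact contDiffAt_map_inverse e
    exact h1.comp_contDiffWithinAt y (hPs y hy)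
  have hAP : ∀ y ∈ W, ∀ x, A y (P y x) = gammaMatrix x.1 x.2 0 0 0 := fun y hy x => by
    obtain ⟨e, he⟩ := he y hy
    simp [hA, ← he, coframeL_apply]
  have hPsurj : ∀ y ∈ W, ∀ v, ∃ x, P y x = v := fun y hy v => by
    obtain ⟨e, he⟩ := he y hy
    exact ⟨e.symm v, by simp [← he]⟩
  have hPre : PreGauge W A := by
    refine ⟨hAs, fun y hy v => gammaMatrix_mem_so43 _ _ _ _ _, fun y hy v h1 h2 => ?_⟩
    obtain ⟨x, rfl⟩ := hPsurj y hy v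
    rw [hAP y hy] at h1 h2
    rw [th_gammaMatrix] at h1
    rw [om_gammaMatrix] at h2
    rw [show x = 0 from Prod.ext h1 h2, map_zero]
  have hAY : ∀ y ∈ W, ∀ p, A y (Y p y) = gammaMatrix 0 (δ p) 0 0 0 := fun y hy p => by
    rw [← hAP y hy (0, δ p), hP, combineL_apply]
    simp [δ]
  have hAZ : ∀ y ∈ W, ∀ p, A y (Z p y) = gammaMatrix (δ p) 0 0 0 0 := fun y hy p => by
    rw [← hAP y hy (δ p, 0), hP, combineL_apply]
    simp [δ]
  refine ⟨A, hPre, fun y hy v => ?_, fun y hy v w hv hw => ?_⟩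
  · obtain ⟨x, rfl⟩ := hPsurj y hy v
    rw [hAP y hy, th_gammaMatrix]
    refine ⟨fun h => ?_, fun h => ?_⟩
    · rw [hP, combineL_apply, h]
      simp only [Pi.zero_apply, zero_smul, Finset.sum_const_zero, zero_add]
      exact sum_mem fun i _ => Submodule.smul_mem _ _ (Submodule.subset_span ⟨i, rfl⟩)
    · have h1 : Submodule.span ℝ (range fun i => Y i y) ≤
          LinearMap.ker (LinearMap.pi thₗ ∘ₗ (A y : E6 →ₗ[ℝ] Mat)) := by
        rw [Submodule.span_le]
        rintro _ ⟨i, rfl⟩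
        rw [SetLike.mem_coe, LinearMap.mem_ker]
        ext j
        simp [hAY y hy]
      have h2 := LinearMap.mem_ker.1 (h1 h)
      have h3 : th (A y (P y x)) = 0 := h2
      rwa [hAP y hy, th_gammaMatrix] at h3
  · obtain ⟨e, f, -, -, hfr⟩ := exists_smooth_frame hAs hPre.inj
    have hfY : ∀ p, f p y = Y p y := fun p => by
      rw [← sub_eq_zero]
      refine hPre.inj y hy _ ?_ ?_
      · rw [map_sub, th_sub, (hfr y hy).values.2.2.1, hAY y hy]; simp
      · rw [map_sub, om_sub, (hfr y hy).values.2.2.2, hAY y hy]; simp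
    ext i
    refine (hfr y hy).ext_horizontal (B := fun v w => th (curv A y v w) i)
      ((isAltBilin_curv _ y).comp (thₗ i)) (fun p q => ?_) hv hw
    have hn := hW.mem_nhds hy
    have hAd := (hAs.contDiffAt hn).differentiableAt (by simp)
    have hYd := fun p => ((hY p).contDiffAt hn).differentiableAt (by simp)
    -- Differentiating `θ_i (Y_q) = 0`; after skew-symmetrization this gives the value of `dθ_i` on
    -- the `Y`s through their bracket.
    have h1 : ∀ u q, th (fderiv ℝ A y u (Y q y)) i = - th (A y (fderiv ℝ (Y q) y u)) i := fun u q => by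
      have h2 := fderiv_clm_comp_apply (hAd.clm_apply (hYd q)) (thL i) u
      have h3 : (fun z => thL i (A z (Y q z))) =ᶠ[𝓝 y] fun _ => 0 := by
        filter_upwards [hn] with z hz
        simp [hAY z hz]
      rw [h3.fderiv_eq, fderiv_fun_const, fderiv_clm_apply hAd (hYd q)] at h2
      simp at h2
      linarith
    have h4 : th (dd A y (Y p y) (Y q y)) i =
        - th (A y (VectorField.lieBracket ℝ (Y p) (Y q) y)) i := by
      simp only [dd, th_sub, Pi.sub_apply, h1, VectorField.lieBracket, map_sub]
      ring
    have h5 : ∀ k, A y (VectorField.lieBracket ℝ (Y (k + 1)) (Y (k + 2)) y) =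
        (-2 : ℝ) • gammaMatrix (δ k) 0 0 0 0 := fun k => by
      rw [← hAZ y hy k, ← map_smul]
      simp only [hZ, smul_smul]
      norm_num
    have h6 := eq_sum_ε (F := fun p q => th (A y (VectorField.lieBracket ℝ (Y p) (Y q) y)) i)
      (fun p q => by rw [VectorField.lieBracket_swap]; simp) p q
    simp only [h5] at h6
    simp [δ] at h6
    have h7 := sum_ε_δ i p (δ q)
    simp only [hfY, curv, th_add, Pi.add_apply, h4, h6, th_comm (hPre.mem y hy _) (hPre.mem y hy _)]
    simp only [hAY y hy, th_gammaMatrix, om_gammaMatrix, h7]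
    simp [δ]

/-- The plane field spanned by `Y` has a normal gauge. -/
theorem exists_isGauge (hW : IsOpen W) {Y : Fin 3 → E6 → E6} (hY : ∀ i, ContDiffOn ℝ ∞ (Y i) W)
    (hli : ∀ y ∈ W, LinearIndependent ℝ ![Y 0 y, Y 1 y, Y 2 y, VectorField.lieBracket ℝ (Y 1) (Y 2) y,
      VectorField.lieBracket ℝ (Y 2) (Y 0) y, VectorField.lieBracket ℝ (Y 0) (Y 1) y]) :
    ∃ A, IsGauge W A ∧ ∀ y ∈ W, ∀ v, th (A y v) = 0 ↔ v ∈ Submodule.span ℝ (range fun i => Y i y) := by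
  obtain ⟨A, hA, hD, h0⟩ := exists_preGauge hW hY hli
  obtain ⟨A1, hA1, t1, -, h1⟩ := exists_th_curv_eq_zero hW hA h0
  obtain ⟨A2, hA2, t2, h2, h2'⟩ := exists_om_curv_horizontal_eq_zero hW hA1 h1
  obtain ⟨A3, hA3, t3, h3, h3'⟩ := exists_om_curv_eq_zero hW hA2 h2 fun y hy v w hv hw =>
    h2' y hy v w (by rwa [← t2 y hy]) (by rwa [← t2 y hy])
  obtain ⟨A4, hA4, t4⟩ := exists_isGauge_of_torsionFree hW hA3 h3 h3'
  exact ⟨A4, hA4, fun y hy v => by rw [t4 y hy, t3 y hy, t2 y hy, t1 y hy, hD y hy]⟩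

end

/-! ### Pullbacks of forms to normed spaces -/

theorem extDeriv_ofSubsingleton {E : Type*} [NormedAddCommGroup E] [NormedSpace ℝ E]
    {A : E → E →L[ℝ] ℝ} {x : E} (h : DifferentiableAt ℝ A x) (v w : E) :
    extDeriv (fun y => ContinuousAlternatingMap.ofSubsingleton ℝ E ℝ (0 : Fin 1) (A y)) x ![v, w] =
      dd A x v w := by
  have h2 : DifferentiableAt ℝ (fun y => ContinuousAlternatingMap.ofSubsingleton ℝ
      E ℝ (0 : Fin 1) (A y)) x :=
    (ContinuousAlternatingMap.ofSubsingletonLIE (𝕜 := ℝ) (E := E)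
      (F := ℝ) (0 : Fin 1)).toContinuousLinearEquiv.differentiableAt.comp _ h
  rw [extDeriv_apply h2, Fin.sum_univ_two, dd, ← fderiv_apply_const h, ← fderiv_apply_const h,
    sub_eq_add_neg, ← neg_one_smul ℤ (fderiv ℝ _ _ w)]
  congr 1
  exact one_smul ℤ _

section FormPull

variable {n : ℕ} {B : Type*} [TopologicalSpace B] [ChartedSpace (EuclideanSpace ℝ (Fin n)) B]
  {X Y : Type*} [NormedAddCommGroup X] [NormedSpace ℝ X] [NormedAddCommGroup Y] [NormedSpace ℝ Y]

/-- The pullback of a `1`-form by a map from a normed space. -/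
def formPull (η : OneForm n B) (σ : X → B) (y : X) : X →L[ℝ] ℝ :=
  (η (σ y)).comp (mfderiv 𝓘(ℝ, X) (𝓡 n) σ y)

theorem formPull_apply (η : OneForm n B) (σ : X → B) (y v : X) :
    formPull η σ y v = η (σ y) (mfderiv 𝓘(ℝ, X) (𝓡 n) σ y v) := rfl

theorem formPull_congr (η : OneForm n B) {σ τ : X → B} {y : X} (h : σ =ᶠ[𝓝 y] τ) :
    formPull η σ y = formPull η τ y := by
  ext v
  have h1 : mfderiv 𝓘(ℝ, X) (𝓡 n) σ y = mfderiv 𝓘(ℝ, X) (𝓡 n) τ y := h.mfderiv_eq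
  rw [formPull_apply, formPull_apply]
  have h2 := h.eq_of_nhds
  have : ∀ (b b' : B) (hb : b = b') (v : EuclideanSpace ℝ (Fin n)), η b v = η b' v := by
    rintro b _ rfl v; rfl
  rw [h1]
  exact this _ _ h2 _

theorem formPull_comp (η : OneForm n B) {τ : X → B} {f : Y → X} {z : Y}
    (hτ : MDifferentiableAt 𝓘(ℝ, X) (𝓡 n) τ (f z)) (hf : DifferentiableAt ℝ f z) :
    formPull η (fun z => τ (f z)) z = (formPull η τ (f z)).comp (fderiv ℝ f z) := by
  ext v
  have h1 := mfderiv_comp (I := 𝓘(ℝ, Y)) (I' := 𝓘(ℝ, X)) (I'' := 𝓡 n) z hτ hf.mdifferentiableAt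
  rw [formPull_apply, ContinuousLinearMap.comp_apply, formPull_apply]
  have h2 : mfderiv 𝓘(ℝ, Y) (𝓡 n) (fun z => τ (f z)) z = mfderiv 𝓘(ℝ, Y) (𝓡 n) (τ ∘ f) z := rfl
  rw [h2, h1, mfderiv_eq_fderiv]
  rfl

variable {σ : X → B} {W : Set X}

theorem contDiffAt_chart_comp (hW : IsOpen W) (hσ : ContMDiffOn 𝓘(ℝ, X) (𝓡 n) ∞ σ W) {y : X}
    (hy : y ∈ W) : ContDiffAt ℝ ∞ (fun z => extChartAt (𝓡 n) (σ y) (σ z)) y := by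
  rw [← contMDiffAt_iff_contDiffAt]
  exact (contMDiffAt_extChartAt (I := 𝓡 n)).comp y (hσ.contMDiffAt (hW.mem_nhds hy))

theorem eventually_chart_comp (hW : IsOpen W) (hσ : ContMDiffOn 𝓘(ℝ, X) (𝓡 n) ∞ σ W) {y : X}
    (hy : y ∈ W) : ∀ᶠ z in 𝓝 y, σ z ∈ (extChartAt (𝓡 n) (σ y)).source :=
  (hσ.contMDiffAt (hW.mem_nhds hy)).continuousAt.preimage_mem_nhds (extChartAt_source_mem_nhds _)

theorem contDiffAt_inChart {η : OneForm n B} (hη : η.IsSmooth) {b b' : B}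
    (hb : b' ∈ (extChartAt (𝓡 n) b).source) :
    ContDiffAt ℝ ∞ (η.inChart b) (extChartAt (𝓡 n) b b') :=
  (hη b).contDiffAt ((isOpen_extChartAt_target b).mem_nhds ((extChartAt (𝓡 n) b).map_source hb))

variable [IsManifold (𝓡 n) ∞ B]

theorem mdifferentiableAt_chart_symm (b : B) {y : EuclideanSpace ℝ (Fin n)}
    (hy : y ∈ (extChartAt (𝓡 n) b).target) :
    MDifferentiableAt 𝓘(ℝ, EuclideanSpace ℝ (Fin n)) (𝓡 n) (extChartAt (𝓡 n) b).symm y :=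
  ((contMDiffOn_extChartAt_symm (n := ∞) b).contMDiffAt
    ((isOpen_extChartAt_target b).mem_nhds hy)).mdifferentiableAt (by simp)

theorem formPull_eq_inChart (η : OneForm n B) (hW : IsOpen W)
    (hσ : ContMDiffOn 𝓘(ℝ, X) (𝓡 n) ∞ σ W) {y : X} (hy : y ∈ W) :
    ∀ᶠ z in 𝓝 y, formPull η σ z = (η.inChart (σ y) (extChartAt (𝓡 n) (σ y) (σ z))).comp
      (fderiv ℝ (fun z => extChartAt (𝓡 n) (σ y) (σ z)) z) := by
  have h1 := (eventually_chart_comp hW hσ hy).eventually_nhds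
  have h2 := ((contDiffAt_chart_comp hW hσ hy).of_le (m := 1) (by simp)).eventually (by simp)
  filter_upwards [h1, h2] with z hz hz2
  have h3 : σ =ᶠ[𝓝 z] fun z => (extChartAt (𝓡 n) (σ y)).symm (extChartAt (𝓡 n) (σ y) (σ z)) := by
    filter_upwards [hz] with w hw
    exact ((extChartAt (𝓡 n) (σ y)).left_inv hw).symm
  rw [formPull_congr η h3, formPull_comp (τ := (extChartAt (𝓡 n) (σ y)).symm)
    (f := fun z => extChartAt (𝓡 n) (σ y) (σ z))]
  · rfl
  · exact mdifferentiableAt_chart_symm _ ((extChartAt (𝓡 n) (σ y)).map_source hz.self_of_nhds)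
  · exact hz2.differentiableAt (by simp)

theorem contDiffOn_formPull {η : OneForm n B} (hη : η.IsSmooth) (hW : IsOpen W)
    (hσ : ContMDiffOn 𝓘(ℝ, X) (𝓡 n) ∞ σ W) : ContDiffOn ℝ ∞ (formPull η σ) W := by
  intro y hy
  have hf := contDiffAt_chart_comp hW hσ hy
  have h1 : ContDiffAt ℝ ∞ (fun z => (η.inChart (σ y) (extChartAt (𝓡 n) (σ y) (σ z))).comp
      (fderiv ℝ (fun z => extChartAt (𝓡 n) (σ y) (σ z)) z)) y :=
    (ContDiffAt.comp (g := η.inChart (σ y)) (f := fun z => extChartAt (𝓡 n) (σ y) (σ z)) y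
      (contDiffAt_inChart hη (mem_extChartAt_source _)) hf).clm_comp
      (hf.fderiv_right (by simp))
  exact (h1.congr_of_eventuallyEq (formPull_eq_inChart η hW hσ hy)).contDiffWithinAt

theorem OneForm.d_eq_dd {η : OneForm n B} (hη : η.IsSmooth) (b : B) (v w : TangentSpace (𝓡 n) b) :
    η.d b v w = dd (η.inChart b) (extChartAt (𝓡 n) b b)
      (mfderiv (𝓡 n) 𝓘(ℝ, EuclideanSpace ℝ (Fin n)) (extChartAt (𝓡 n) b) b v)
      (mfderiv (𝓡 n) 𝓘(ℝ, EuclideanSpace ℝ (Fin n)) (extChartAt (𝓡 n) b) b w) :=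
  extDeriv_ofSubsingleton
    ((contDiffAt_inChart hη (mem_extChartAt_source b)).differentiableAt (by simp)) _ _

/-- Naturality of `d`. It translates exterior derivatives on the manifold, defined in preferred
charts, into calculus on normed spaces along any smooth map. -/
theorem dd_formPull {η : OneForm n B} (hη : η.IsSmooth) (hW : IsOpen W)
    (hσ : ContMDiffOn 𝓘(ℝ, X) (𝓡 n) ∞ σ W) {y : X} (hy : y ∈ W) (v w : X) :
    dd (formPull η σ) y v w = η.d (σ y) (mfderiv 𝓘(ℝ, X) (𝓡 n) σ y v) (mfderiv 𝓘(ℝ, X) (𝓡 n) σ y w) := by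
  have hf := contDiffAt_chart_comp hW hσ hy
  rw [dd_congr (formPull_eq_inChart η hW hσ hy), OneForm.d_eq_dd hη, dd_pullback
    (f := fun z => extChartAt (𝓡 n) (σ y) (σ z))
    ((contDiffAt_inChart hη (mem_extChartAt_source _)).differentiableAt (by simp)) hf]
  have h1 := mfderiv_comp (I := 𝓘(ℝ, X)) (I' := 𝓡 n) (I'' := 𝓘(ℝ, EuclideanSpace ℝ (Fin n))) y
    ((contMDiffAt_extChartAt (I := 𝓡 n) (n := ∞) (x := σ y)).mdifferentiableAt (by simp))
    ((hσ.contMDiffAt (hW.mem_nhds hy)).mdifferentiableAt (by simp))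
  have h2 : ∀ u, fderiv ℝ (fun z => extChartAt (𝓡 n) (σ y) (σ z)) y u =
      mfderiv (𝓡 n) 𝓘(ℝ, EuclideanSpace ℝ (Fin n)) (extChartAt (𝓡 n) (σ y)) (σ y)
        (mfderiv 𝓘(ℝ, X) (𝓡 n) σ y u) := by
    intro u
    rw [← mfderiv_eq_fderiv]
    exact congrArg (fun L => L u) h1
  rw [h2, h2]

end FormPull

/-! ### The gauges defined by a system of forms -/

section GaugeOf

variable {B B' : Type*} [TopologicalSpace B] [ChartedSpace (EuclideanSpace ℝ (Fin 21)) B]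
  [TopologicalSpace B'] [ChartedSpace (EuclideanSpace ℝ (Fin 21)) B']
  {X Y : Type*} [NormedAddCommGroup X] [NormedSpace ℝ X] [FiniteDimensional ℝ X]
  [NormedAddCommGroup Y] [NormedSpace ℝ Y] [FiniteDimensional ℝ Y]

theorem FormSystem.gamma_mem (c : FormSystem B) (b : B) (v : TangentSpace (𝓡 21) b) :
    c.gamma b v ∈ so43 := gammaMatrix_mem_so43 _ _ _ _ _

/-- `γ` at a point, as a linear map. -/
def FormSystem.gammaₗ (c : FormSystem B) (b : B) : TangentSpace (𝓡 21) b →ₗ[ℝ] Mat where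
  toFun := c.gamma b
  map_add' v w := so43_ext (c.gamma_mem _ _) (add_mem (c.gamma_mem _ _) (c.gamma_mem _ _))
    (by ext; simp [FormSystem.gamma]) (by ext; simp [FormSystem.gamma])
    (by ext; simp [FormSystem.gamma]) (by ext; simp [FormSystem.gamma])
    (by ext; simp [FormSystem.gamma])
  map_smul' r v := so43_ext (c.gamma_mem _ _) (so43.smul_mem _ (c.gamma_mem _ _))
    (by ext; simp [FormSystem.gamma]) (by ext; simp [FormSystem.gamma])
    (by ext; simp [FormSystem.gamma]) (by ext; simp [FormSystem.gamma])
    (by ext; simp [FormSystem.gamma])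

/-- The pullback of `γ` by a map from a normed space. -/
def gaugeOf (c : FormSystem B) (σ : X → B) (y : X) : X →L[ℝ] Mat :=
  LinearMap.toContinuousLinearMap
    (c.gammaₗ (σ y) ∘ₗ (mfderiv 𝓘(ℝ, X) (𝓡 21) σ y).toLinearMap : X →ₗ[ℝ] Mat)

variable (c : FormSystem B)

theorem gaugeOf_apply (σ : X → B) (y v : X) :
    gaugeOf c σ y v = c.gamma (σ y) (mfderiv 𝓘(ℝ, X) (𝓡 21) σ y v) := rfl

theorem gaugeOf_mem (σ : X → B) (y v : X) : gaugeOf c σ y v ∈ so43 := c.gamma_mem _ _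

theorem gaugeOf_eq_gammaMatrix (σ : X → B) (y v : X) : gaugeOf c σ y v =
    gammaMatrix (fun i => formPull (c.theta i) σ y v) (fun i => formPull (c.omega i) σ y v)
      (fun i j => formPull (c.alpha i j) σ y v) (fun i => formPull (c.beta i) σ y v)
      (fun i => formPull (c.tau i) σ y v) := rfl

theorem gaugeOf_congr {σ τ : X → B} {y : X} (h : σ =ᶠ[𝓝 y] τ) : gaugeOf c σ y = gaugeOf c τ y := by
  ext1 v
  simp only [gaugeOf_eq_gammaMatrix, formPull_congr _ h]

theorem gaugeOf_comp {τ : X → B} {f : Y → X} {z : Y}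
    (hτ : MDifferentiableAt 𝓘(ℝ, X) (𝓡 21) τ (f z)) (hf : DifferentiableAt ℝ f z) :
    gaugeOf c (fun z => τ (f z)) z = (gaugeOf c τ (f z)).comp (fderiv ℝ f z) := by
  ext1 v
  simp only [ContinuousLinearMap.comp_apply, gaugeOf_eq_gammaMatrix, formPull_comp _ hτ hf]

variable [IsManifold (𝓡 21) ∞ B] {c} {σ : X → B} {W : Set X}

theorem contDiffOn_gaugeOf (hc : c.IsCoframing) (hW : IsOpen W)
    (hσ : ContMDiffOn 𝓘(ℝ, X) (𝓡 21) ∞ σ W) : ContDiffOn ℝ ∞ (gaugeOf c σ) W := by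
  rw [contDiffOn_clm_apply]
  intro v
  simp only [gaugeOf_eq_gammaMatrix]
  refine contDiffOn_gammaMatrix ?_ ?_ ?_ ?_ ?_
  · exact fun i => (contDiffOn_formPull (hc.smooth_theta i) hW hσ).clm_apply contDiffOn_const
  · exact fun i => (contDiffOn_formPull (hc.smooth_omega i) hW hσ).clm_apply contDiffOn_const
  · exact fun i j => (contDiffOn_formPull (hc.smooth_alpha i j) hW hσ).clm_apply contDiffOn_const
  · exact fun i => (contDiffOn_formPull (hc.smooth_beta i) hW hσ).clm_apply contDiffOn_const
  · exact fun i => (contDiffOn_formPull (hc.smooth_tau i) hW hσ).clm_apply contDiffOn_const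

/-- The exterior derivative of `γ`. -/
def FormSystem.dgamma (c : FormSystem B) (b : B) (v w : TangentSpace (𝓡 21) b) : Mat :=
  gammaMatrix (fun i => (c.theta i).d b v w) (fun i => (c.omega i).d b v w)
    (fun i j => (c.alpha i j).d b v w) (fun i => (c.beta i).d b v w) (fun i => (c.tau i).d b v w)

/-- The curvature of `γ`. -/
def FormSystem.curvature (c : FormSystem B) (b : B) (v w : TangentSpace (𝓡 21) b) : Mat :=
  c.dgamma b v w + (c.gamma b v * c.gamma b w - c.gamma b w * c.gamma b v)

theorem dd_gaugeOf (hc : c.IsCoframing) (hW : IsOpen W)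
    (hσ : ContMDiffOn 𝓘(ℝ, X) (𝓡 21) ∞ σ W) {y : X} (hy : y ∈ W) (v w : X) :
    dd (gaugeOf c σ) y v w = c.dgamma (σ y) (mfderiv 𝓘(ℝ, X) (𝓡 21) σ y v)
      (mfderiv 𝓘(ℝ, X) (𝓡 21) σ y w) := by
  have hd : DifferentiableAt ℝ (gaugeOf c σ) y :=
    ((contDiffOn_gaugeOf hc hW hσ).contDiffAt (hW.mem_nhds hy)).differentiableAt (by simp)
  have key : ∀ (L : Mat →L[ℝ] ℝ) (η : OneForm 21 B), η.IsSmooth →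
      (∀ y v, L (gaugeOf c σ y v) = formPull η σ y v) →
      L (dd (gaugeOf c σ) y v w) = η.d (σ y) (mfderiv 𝓘(ℝ, X) (𝓡 21) σ y v)
      (mfderiv 𝓘(ℝ, X) (𝓡 21) σ y w) := by
    intro L η hη h
    rw [← dd_formPull hη hW hσ hy, ← dd_clm_comp hd]
    congr 2
    ext z u
    exact h z u
  refine so43_ext (dd_mem_so43 hW (contDiffOn_gaugeOf hc hW hσ)
    (fun z _ => gaugeOf_mem c σ z) hy v w) (gammaMatrix_mem_so43 _ _ _ _ _)
    ?_ ?_ ?_ ?_ ?_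
  · ext i
    simp only [th_gammaMatrix, FormSystem.dgamma]
    exact key (thL i) _ (hc.smooth_theta i) fun z u => by simp [gaugeOf_eq_gammaMatrix]
  · ext i
    simp only [om_gammaMatrix, FormSystem.dgamma]
    exact key (omL i) _ (hc.smooth_omega i) fun z u => by simp [gaugeOf_eq_gammaMatrix]
  · ext i j
    simp only [al_gammaMatrix, FormSystem.dgamma]
    exact key (alL i j) _ (hc.smooth_alpha i j) fun z u => by simp [gaugeOf_eq_gammaMatrix]
  · ext i
    simp only [be_gammaMatrix, FormSystem.dgamma]
    exact key (beL i) _ (hc.smooth_beta i) fun z u => by simp [gaugeOf_eq_gammaMatrix]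
  · ext i
    simp only [ta_gammaMatrix, FormSystem.dgamma]
    exact key (taL i) _ (hc.smooth_tau i) fun z u => by simp [gaugeOf_eq_gammaMatrix]

theorem curv_gaugeOf (hc : c.IsCoframing) (hW : IsOpen W)
    (hσ : ContMDiffOn 𝓘(ℝ, X) (𝓡 21) ∞ σ W) {y : X} (hy : y ∈ W) (v w : X) :
    curv (gaugeOf c σ) y v w = c.curvature (σ y) (mfderiv 𝓘(ℝ, X) (𝓡 21) σ y v)
      (mfderiv 𝓘(ℝ, X) (𝓡 21) σ y w) := by
  rw [curv, dd_gaugeOf hc hW hσ hy]; rfl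

end GaugeOf

/-- The curvature `k`, evaluated on vectors with values `x` and `y` under the gauge, has the given
coefficients. -/
structure HasCurvCoeff (S2 : Fin 3 → Fin 3 → ℝ) (S3 : Fin 3 → Fin 3 → Fin 3 → ℝ)
    (S4 : Fin 3 → Fin 3 → Fin 3 → Fin 3 → ℝ) (x y k : Mat) : Prop where
  th_eq : th k = 0
  om_eq : om k = 0
  al_eq : ∀ i j, al k i j = curvAl S3 S4 x y i j
  be_eq : ∀ i, be k i = curvBe S2 S3 x y i

/-! ### The structure equations as conditions on the curvature. -/

section StructureEquations

variable {B : Type*} [TopologicalSpace B] [ChartedSpace (EuclideanSpace ℝ (Fin 21)) B]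

/-- By the commutator formulas the quadratic terms of the equations are exactly those of `γ ∧ γ`, so
what remains of each equation is one component of the curvature. -/
theorem FormSystem.structureEquations_iff (c : FormSystem B) :
    c.StructureEquations ↔ ∃ (S2 : Fin 3 → Fin 3 → B → ℝ) (S3 : Fin 3 → Fin 3 → Fin 3 → B → ℝ)
      (S4 : Fin 3 → Fin 3 → Fin 3 → Fin 3 → B → ℝ),
      (∀ i j, ContMDiff (𝓡 21) 𝓘(ℝ, ℝ) ∞ (S2 i j)) ∧
      (∀ i j k, ContMDiff (𝓡 21) 𝓘(ℝ, ℝ) ∞ (S3 i j k)) ∧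
      (∀ i k j l, ContMDiff (𝓡 21) 𝓘(ℝ, ℝ) ∞ (S4 i k j l)) ∧
      (∀ b, CurvSymm (fun i j => S2 i j b) (fun i j k => S3 i j k b) (fun i k j l => S4 i k j l b)) ∧
      ∀ b v w, HasCurvCoeff (fun i j => S2 i j b) (fun i j k => S3 i j k b)
        (fun i k j l => S4 i k j l b) (c.gamma b v) (c.gamma b w) (c.curvature b v w) := by
  refine exists_congr fun S2 => exists_congr fun S3 => exists_congr fun S4 =>
    and_congr_right fun _ => and_congr_right fun _ => and_congr_right fun _ => ?_
  have h1 : (∀ b, CurvSymm (fun i j => S2 i j b) (fun i j k => S3 i j k b)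
      (fun i k j l => S4 i k j l b)) ↔ ((∀ i j, S2 i j = S2 j i) ∧
      (∀ i j k, S3 i j k = S3 i k j) ∧ (∀ k, ∑ i, S3 i i k = 0) ∧
      (∀ i k j l, S4 i k j l = S4 k i j l) ∧ (∀ i k j l, S4 i k j l = S4 i k l j) ∧
      (∀ k j, ∑ i, S4 i k i j = 0)) := by
    constructor
    · intro h
      exact ⟨fun i j => funext fun b => (h b).s2 i j, fun i j k => funext fun b => (h b).s3 i j k,
        fun k => funext fun b => by simpa using (h b).s3_trace k,
        fun i k j l => funext fun b => (h b).s4_left i k j l,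
        fun i k j l => funext fun b => (h b).s4_right i k j l,
        fun k j => funext fun b => by simpa using (h b).s4_trace k j⟩
    · rintro ⟨h1, h2, h3, h4, h5, h6⟩ b
      exact ⟨fun i j => congrFun (h1 i j) b, fun i j k => congrFun (h2 i j k) b,
        fun k => by simpa using congrFun (h3 k) b, fun i k j l => congrFun (h4 i k j l) b,
        fun i k j l => congrFun (h5 i k j l) b, fun k j => by simpa using congrFun (h6 k j) b⟩
  rw [h1]
  simp only [and_assoc]
  refine and_congr_right fun _ => and_congr_right fun _ => and_congr_right fun _ =>
    and_congr_right fun _ => and_congr_right fun _ => and_congr_right fun _ =>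
    forall_congr' fun b => forall_congr' fun v => forall_congr' fun w => ?_
  have h2 : ∀ (S2 : Fin 3 → Fin 3 → ℝ) S3 S4 (x y k : Mat), HasCurvCoeff S2 S3 S4 x y k ↔
      (∀ i, th k i = 0) ∧ (∀ i, om k i = 0) ∧ (∀ i j, al k i j = curvAl S3 S4 x y i j) ∧
      ∀ i, be k i = curvBe S2 S3 x y i := fun S2 S3 S4 x y k =>
    ⟨fun ⟨h1, h2, h3, h4⟩ => ⟨congrFun h1, congrFun h2, h3, h4⟩,
      fun ⟨h1, h2, h3, h4⟩ => ⟨funext h1, funext h2, h3, h4⟩⟩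
  rw [h2]
  have hv := c.gamma_mem b v
  have hw := c.gamma_mem b w
  simp only [FormSystem.curvature, th_add, om_add, al_add, be_add, Pi.add_apply, th_comm hv hw,
    om_comm hv hw, al_comm hv hw, be_comm hv hw, curvAl, curvBe]
  simp only [FormSystem.gamma, FormSystem.dgamma, th_gammaMatrix, om_gammaMatrix, al_gammaMatrix,
    be_gammaMatrix, ta_gammaMatrix, OneForm.wedge]
  refine and_congr ?_ (and_congr ?_ (and_congr ?_ ?_))
  · refine forall_congr' fun i => ?_
    rw [← sub_eq_zero]
    refine Eq.congr ?_ rfl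
    simp only [Finset.sum_sub_distrib]
    ring
  · refine forall_congr' fun i => ?_
    rw [← sub_eq_zero]
    refine Eq.congr ?_ rfl
    ring
  · refine forall_congr' fun i => forall_congr' fun j => ?_
    rw [← sub_eq_zero, ← sub_eq_zero (b := _ + _)]
    refine Eq.congr ?_ rfl
    ring
  · refine forall_congr' fun i => ?_
    rw [← sub_eq_zero, ← sub_eq_zero (b := _ + _)]
    refine Eq.congr ?_ rfl
    ring

end StructureEquations

/-! ### Principal bundles -/

section Principal

variable {M : Type*} [TopologicalSpace M] [ChartedSpace (EuclideanSpace ℝ (Fin 6)) M]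
  {B : Type*} [TopologicalSpace B] [ChartedSpace (EuclideanSpace ℝ (Fin 21)) B]
  {proj : B → M} {act : B → H → B}
  {E : Type*} [NormedAddCommGroup E] [NormedSpace ℝ E] {HE : Type*} [TopologicalSpace HE]
  {I : ModelWithCorners ℝ E HE} {N : Type*} [TopologicalSpace N] [ChartedSpace HE N]

theorem IsPrincipalBundle.act_injective (hP : IsPrincipalBundle proj act) {b : B} {g h : H}
    (he : act b g = act b h) : g = h := by
  have h1 : act (act b g) (g⁻¹ * h) = act b g := by
    rw [hP.act_mul, mul_inv_cancel_left, he]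
  exact (inv_mul_eq_one.1 (hP.free _ _ h1))

theorem IsPrincipalBundle.contMDiffOn_act (hP : IsPrincipalBundle proj act) {σ : N → B} {k : N → H}
    {W : Set N} (hσ : ContMDiffOn I (𝓡 21) ∞ σ W)
    (hk : ContMDiffOn I 𝓘(ℝ, Idx → Idx → ℝ) ∞ (fun y => H.entries (k y)) W) :
    ContMDiffOn I (𝓡 21) ∞ (fun y => act (σ y) (k y)) W := by
  obtain ⟨F, hF, hF'⟩ := hP.smooth_act
  have h1 := hF.comp (hσ.prodMk hk) fun y _ => ⟨mem_univ _, mem_range_self _⟩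
  exact h1.congr fun y _ => (hF' _ _).symm

theorem contMDiffAt_entries_inv_mul {g k : N → H} {y : N}
    (hg : ContMDiffAt I 𝓘(ℝ, Idx → Idx → ℝ) ∞ (fun y => H.entries (g y)) y)
    (hk : ContMDiffAt I 𝓘(ℝ, Idx → Idx → ℝ) ∞ (fun y => H.entries (k y)) y) :
    ContMDiffAt I 𝓘(ℝ, Idx → Idx → ℝ) ∞ (fun y => H.entries ((g y)⁻¹ * k y)) y := by
  have hT : ContDiff ℝ ∞ (fun p : Mat => p.transpose) :=
    (Matrix.transposeLinearEquiv Idx Idx ℝ ℝ).toLinearMap.toContinuousLinearMap.contDiff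
  have h1 : ContDiff ℝ ∞ fun p : (Idx → Idx → ℝ) × (Idx → Idx → ℝ) =>
      matEntries (Qinv * ((matEntries.symm p.1).transpose * Q) * matEntries.symm p.2) := by
    refine matEntries.contDiff.comp (ContDiff.mul (contDiff_const.mul (ContDiff.mul ?_ contDiff_const)) ?_)
    · exact hT.comp (matEntries.symm.contDiff.comp contDiff_fst)
    · exact matEntries.symm.contDiff.comp contDiff_snd
  have h2 := h1.contMDiff.contMDiffAt.comp y (hg.prodMk_space hk)
  refine h2.congr_of_eventuallyEq (Filter.Eventually.of_forall fun z => ?_)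
  simp only [Function.comp_apply, ← matEntries_mat, ContinuousLinearEquiv.symm_apply_apply, H.mat_mul,
    H.mat_inv_eq]

/-- Over a trivializing set the difference is `(g ∘ σ)⁻¹ (g ∘ τ)`. The action is free, so this does
not depend on the trivialization, and the pointwise choice is smooth. -/
theorem IsPrincipalBundle.exists_act_eq (hP : IsPrincipalBundle proj act) {σ τ : N → B} {W : Set N}
    (hW : IsOpen W) (hσ : ContMDiffOn I (𝓡 21) ∞ σ W) (hτ : ContMDiffOn I (𝓡 21) ∞ τ W)
    (he : ∀ y ∈ W, proj (σ y) = proj (τ y)) :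
    ∃ k : N → H, ContMDiffOn I 𝓘(ℝ, Idx → Idx → ℝ) ∞ (fun y => H.entries (k y)) W ∧
      ∀ y ∈ W, act (σ y) (k y) = τ y := by
  have key : ∀ {s : M → B} {g : B → H} {U : Set M}, (∀ b ∈ proj ⁻¹' U, act (s (proj b)) (g b) = b) →
      ∀ y ∈ W, proj (σ y) ∈ U → act (σ y) ((g (σ y))⁻¹ * g (τ y)) = τ y := by
    intro s g U h y hy hU
    have h1 := h _ hU
    have h2 := h (τ y) (by rwa [mem_preimage, ← he y hy])
    rw [← he y hy] at h2
    conv_lhs => rw [← h1]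
    rw [hP.act_mul, h1, mul_inv_cancel_left, h2]
  have hex : ∀ y, ∃ k, y ∈ W → act (σ y) k = τ y := by
    intro y
    by_cases hy : y ∈ W
    · obtain ⟨U, _, hU, s, g, _, _, _, h⟩ := hP.locally_trivial (proj (σ y))
      exact ⟨_, fun _ => key h y hy hU⟩
    · exact ⟨1, fun h => (hy h).elim⟩
  choose k hk using hex
  refine ⟨k, fun y hy => ContMDiffAt.contMDiffWithinAt ?_, hk⟩
  obtain ⟨U, hUo, hU, s, g, _, _, hg, h⟩ := hP.locally_trivial (proj (σ y))
  have hpU : IsOpen (proj ⁻¹' U) := hUo.preimage hP.smooth_proj.continuous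
  have hσy := hσ.contMDiffAt (hW.mem_nhds hy)
  have h1 := (hg.contMDiffAt (hpU.mem_nhds hU)).comp y hσy
  have h2 := (hg.contMDiffAt (hpU.mem_nhds (show τ y ∈ proj ⁻¹' U by
    rwa [mem_preimage, ← he y hy]))).comp y (hτ.contMDiffAt (hW.mem_nhds hy))
  refine (contMDiffAt_entries_inv_mul h1 h2).congr_of_eventuallyEq ?_
  filter_upwards [hW.mem_nhds hy, hσy.continuousAt.preimage_mem_nhds (hpU.mem_nhds hU)] with z hz hz2
  rw [hP.act_injective ((hk z hz).trans (key h z hz hz2).symm)]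

variable [IsManifold (𝓡 21) ∞ B]

/-- The two axioms of a Cartan connection combined by the Leibniz rule: varying `σ` gives the
conjugated gauge by equivariance, varying `k` gives the Maurer–Cartan form by the condition on
vertical vectors. -/
theorem gaugeOf_act {c : FormSystem B} (hP : IsPrincipalBundle proj act)
    (hK : c.IsCartanConnection act) {X : Type*} [NormedAddCommGroup X] [NormedSpace ℝ X]
    [FiniteDimensional ℝ X] {σ : X → B} {k : X → H} {W : Set X} (hW : IsOpen W)
    (hσ : ContMDiffOn 𝓘(ℝ, X) (𝓡 21) ∞ σ W) (hk : SmoothH k W) {y : X} (hy : y ∈ W) :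
    gaugeOf c (fun z => act (σ z) (k z)) y = gaugeH (gaugeOf c σ) k y := by
  have hk' : ContMDiffOn 𝓘(ℝ, X) 𝓘(ℝ, Idx → Idx → ℝ) ∞ (fun y => H.entries (k y)) W :=
    (smoothH_iff_entries.1 hk).contMDiffOn
  -- The two occurrences of the variable are separated; the derivative along the diagonal is the sum
  -- of the partial derivatives.
  have hT : ContMDiffOn 𝓘(ℝ, X × X) (𝓡 21) ∞ (fun p : X × X => act (σ p.1) (k p.2)) (W ×ˢ W) := by
    refine hP.contMDiffOn_act (hσ.comp contDiff_fst.contMDiff.contMDiffOn fun p hp => hp.1)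
      (hk'.comp contDiff_snd.contMDiff.contMDiffOn fun p hp => hp.2)
  have hTy := (hT.contMDiffAt ((hW.prod hW).mem_nhds (show (y, y) ∈ _ from ⟨hy, hy⟩))).mdifferentiableAt
    (by simp)
  have hσy := (hσ.contMDiffAt (hW.mem_nhds hy)).mdifferentiableAt (by simp)
  ext1 v
  have h1 := gaugeOf_comp c (f := fun z : X => (z, z)) (z := y) hTy (by fun_prop)
  have h2 := gaugeOf_comp c (f := fun z : X => (z, y)) (z := y) hTy (by fun_prop)
  have h3 := gaugeOf_comp c (f := fun z : X => (y, z)) (z := y) hTy (by fun_prop)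
  have e1 : fderiv ℝ (fun z : X => (z, z)) y v = (v, v) := by
    rw [HasFDerivAt.fderiv (f := fun z : X => (z, z)) ((hasFDerivAt_id y).prodMk (hasFDerivAt_id y))]; rfl
  have e2 : fderiv ℝ (fun z : X => (z, y)) y v = (v, 0) := by
    rw [HasFDerivAt.fderiv (f := fun z : X => (z, y)) ((hasFDerivAt_id y).prodMk (hasFDerivAt_const y y))]
    rfl
  have e3 : fderiv ℝ (fun z : X => (y, z)) y v = (0, v) := by
    rw [HasFDerivAt.fderiv (f := fun z : X => (y, z)) ((hasFDerivAt_const y y).prodMk (hasFDerivAt_id y))]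
    rfl
  have h4 : gaugeOf c (fun z => act (σ z) (k z)) y v = gaugeOf c (fun z => act (σ z) (k y)) y v
      + gaugeOf c (fun z => act (σ y) (k z)) y v := by
    rw [h1, h2, h3]
    simp only [ContinuousLinearMap.comp_apply, e1, e2, e3]
    rw [← map_add]
    simp
  have h5 : gaugeOf c (fun z => act (σ z) (k y)) y v = conjₗ (k y) (gaugeOf c σ y v) := by
    have ha : MDifferentiableAt (𝓡 21) (𝓡 21) (fun b => act b (k y)) (σ y) :=
      ((hP.contMDiffOn_act (I := 𝓡 21) (N := B) (W := univ) (k := fun _ => k y) contMDiffOn_id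
        contMDiffOn_const).contMDiffAt Filter.univ_mem).mdifferentiableAt (by simp)
    have h6 := mfderiv_comp (I := 𝓘(ℝ, X)) (I' := 𝓡 21) (I'' := 𝓡 21) y ha hσy
    have h7 := hK.equivariant (k y) (σ y) (mfderiv 𝓘(ℝ, X) (𝓡 21) σ y v)
    rw [gaugeOf_apply]
    have h8 : mfderiv 𝓘(ℝ, X) (𝓡 21) (fun z => act (σ z) (k y)) y =
      mfderiv 𝓘(ℝ, X) (𝓡 21) ((fun b => act b (k y)) ∘ σ) y := rfl
    rw [h8, h6]
    exact h7
  have h6 : gaugeOf c (fun z => act (σ y) (k z)) y v = maurerCartan k y v := by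
    obtain ⟨r, hr, hrW⟩ := Metric.isOpen_iff.1 hW y hy
    obtain ⟨q, hq, hqv⟩ : ∃ q : ℝ, 0 < q ∧ q * ‖v‖ < r :=
      ⟨r / (‖v‖ + 1), by positivity, by
        rw [div_mul_eq_mul_div, div_lt_iff₀ (by positivity)]; nlinarith⟩
    -- The axiom on vertical vectors concerns curves in `H` defined on all of `ℝ`. The sine keeps
    -- the curve in a ball inside `W` for all times, with velocity `v` at `0`.
    set f : ℝ → X := fun t => y + (q * Real.sin (t / q)) • v with hf
    have hf0 : f 0 = y := by simp [hf]
    have hfs : ContDiff ℝ ∞ f := by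
      refine contDiff_const.add (ContDiff.smul (contDiff_const.mul (Real.contDiff_sin.comp ?_)) contDiff_const)
      exact contDiff_id.div_const q
    have hfW : ∀ t, f t ∈ W := fun t => hrW (by
      rw [Metric.mem_ball, dist_eq_norm]
      simp only [hf, add_sub_cancel_left, norm_smul, norm_mul, Real.norm_eq_abs, abs_of_pos hq]
      refine lt_of_le_of_lt ?_ hqv
      have := Real.abs_sin_le_one (t / q)
      have h9 : q * |Real.sin (t / q)| ≤ q := by nlinarith
      exact mul_le_mul_of_nonneg_right h9 (norm_nonneg v))
    have hfd : HasDerivAt f v 0 := by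
      have h9 : HasDerivAt (fun t : ℝ => q * Real.sin (t / q)) 1 0 := by
        have := ((Real.hasDerivAt_sin (0 / q)).comp 0 ((hasDerivAt_id (0 : ℝ)).div_const q)).const_mul q
        simpa [hq.ne'] using this
      have h10 := (h9.smul_const v).const_add y
      rwa [one_smul] at h10
    set κ : ℝ → H := fun t => (k y)⁻¹ * k (f t) with hκ
    have hκs : SmoothH κ univ := (SmoothH.const _).mul (hk.comp hfs.contDiffOn fun t _ => hfW t)
    have hκ0 : κ 0 = 1 := by simp [hκ, hf0]
    have h9 := hK.vertical (act (σ y) (k y)) κ hκ0 (contDiffOn_univ.1 (smoothH_iff_entries.1 hκs))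
    have h10 : ∀ t, act (act (σ y) (k y)) (κ t) = act (σ y) (k (f t)) := fun t => by
      rw [hP.act_mul, hκ, mul_inv_cancel_left]
    have h11 : gaugeOf c (fun t => act (act (σ y) (k y)) (κ t)) 0 1 = 
      Matrix.of (deriv (fun t => H.entries (κ t)) 0) := h9
    simp only [h10] at h11
    have h12 : MDifferentiableAt 𝓘(ℝ, X) (𝓡 21) (fun z => act (σ y) (k z)) (f 0) := by
      rw [hf0]
      exact ((hP.contMDiffOn_act (σ := fun _ => σ y) contMDiffOn_const hk').contMDiffAt
        (hW.mem_nhds hy)).mdifferentiableAt (by simp)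
    rw [gaugeOf_comp c (f := f) h12 hfd.differentiableAt, hf0, ContinuousLinearMap.comp_apply] at h11
    rw [fderiv_apply_one_eq_deriv, hfd.deriv] at h11
    rw [h11]
    have hkd : HasFDerivAt (fun z => H.mat (k z)) (fderiv ℝ (fun z => H.mat (k z)) y) (f 0) := by
      rw [hf0]; exact (hk.differentiableAt hW hy).hasFDerivAt
    have h13 : HasDerivAt (fun t => H.mat (κ t)) (maurerCartan k y v) 0 := by
      have := (hkd.comp_hasDerivAt (0 : ℝ) hfd).const_mul (H.mat (k y)⁻¹)
      simp only [hκ, H.mat_mul]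
      exact this
    have h14 : HasDerivAt (fun t => H.entries (κ t)) (matEntries (maurerCartan k y v)) 0 :=
      (matEntries : Mat →L[ℝ] (Idx → Idx → ℝ)).hasFDerivAt.comp_hasDerivAt (0 : ℝ) h13
    rw [h14.deriv]
    rfl
  rw [h4, h5, h6, gaugeH_apply]

end Principal

/-! ### Local parametrizations and lifts -/

/-- `μ`, with inverse `ν`, parametrizes the open set `U` by the open set `W`. -/
structure IsParam {M : Type*} [TopologicalSpace M] [ChartedSpace (EuclideanSpace ℝ (Fin 6)) M]
    (μ : E6 → M) (ν : M → E6) (W : Set E6) (U : Set M) : Prop where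
  isOpen_dom : IsOpen W
  isOpen_im : IsOpen U
  smooth : ContMDiffOn 𝓘(ℝ, E6) (𝓡 6) ∞ μ W
  smooth_inv : ContMDiffOn (𝓡 6) 𝓘(ℝ, E6) ∞ ν U
  mapsTo : MapsTo μ W U
  mapsTo_inv : MapsTo ν U W
  left_inv : ∀ y ∈ W, ν (μ y) = y
  right_inv : ∀ x ∈ U, μ (ν x) = x

section Param

variable {M M' : Type*} [TopologicalSpace M] [ChartedSpace (EuclideanSpace ℝ (Fin 6)) M]
  [TopologicalSpace M'] [ChartedSpace (EuclideanSpace ℝ (Fin 6)) M']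
  {μ : E6 → M} {ν : M → E6} {W : Set E6} {U : Set M}

theorem IsParam.restrict (h : IsParam μ ν W U) {V : Set M} (hV : IsOpen V) :
    IsParam μ ν (W ∩ μ ⁻¹' V) (U ∩ V) where
  isOpen_dom := h.smooth.continuousOn.isOpen_inter_preimage h.isOpen_dom hV
  isOpen_im := h.isOpen_im.inter hV
  smooth := h.smooth.mono inter_subset_left
  smooth_inv := h.smooth_inv.mono inter_subset_left
  mapsTo := fun y hy => ⟨h.mapsTo hy.1, hy.2⟩
  mapsTo_inv := fun x hx => ⟨h.mapsTo_inv hx.1, by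
    rw [mem_preimage, h.right_inv x hx.1]; exact hx.2⟩
  left_inv := fun y hy => h.left_inv y hy.1
  right_inv := fun x hx => h.right_inv x hx.1

theorem IsParam.comp (h : IsParam μ ν W U) (φ : M ≃ₘ⟮𝓡 6, 𝓡 6⟯ M') :
    IsParam (fun y => φ (μ y)) (fun x => ν (φ.symm x)) W (φ.symm ⁻¹' U) where
  isOpen_dom := h.isOpen_dom
  isOpen_im := h.isOpen_im.preimage φ.symm.continuous
  smooth := φ.contMDiff.comp_contMDiffOn h.smooth
  smooth_inv := h.smooth_inv.comp φ.symm.contMDiff.contMDiffOn fun x hx => hx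
  mapsTo := fun y hy => by simpa using h.mapsTo hy
  mapsTo_inv := fun x hx => h.mapsTo_inv hx
  left_inv := fun y hy => by simpa using h.left_inv y hy
  right_inv := fun x hx => by rw [h.right_inv _ hx]; simp

theorem isParam_extChartAt [IsManifold (𝓡 6) ∞ M] (x : M) :
    IsParam (extChartAt (𝓡 6) x).symm (extChartAt (𝓡 6) x) (extChartAt (𝓡 6) x).target
      (extChartAt (𝓡 6) x).source where
  isOpen_dom := isOpen_extChartAt_target x
  isOpen_im := isOpen_extChartAt_source x
  smooth := contMDiffOn_extChartAt_symm x
  smooth_inv := by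
    have := contMDiffOn_extChartAt (I := 𝓡 6) (n := ∞) (x := x)
    rwa [extChartAt_source]
  mapsTo := fun _ hy => (extChartAt (𝓡 6) x).map_target hy
  mapsTo_inv := fun _ hy => (extChartAt (𝓡 6) x).map_source hy
  left_inv := fun y hy => (extChartAt (𝓡 6) x).right_inv hy
  right_inv := fun y hy => (extChartAt (𝓡 6) x).left_inv hy

/-- A local section can be made to pass through a given point by acting with a constant element of
`H`. -/
theorem IsPrincipalBundle.exists_lift {B : Type*} [TopologicalSpace B]
    [ChartedSpace (EuclideanSpace ℝ (Fin 21)) B] {proj : B → M} {act : B → H → B}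
    (hP : IsPrincipalBundle proj act) (hμ : IsParam μ ν W U) {b : B} (hb : proj b ∈ U) :
    ∃ V, IsOpen V ∧ proj b ∈ V ∧ ∃ ρ : E6 → B,
      ContMDiffOn 𝓘(ℝ, E6) (𝓡 21) ∞ ρ (W ∩ μ ⁻¹' V) ∧ (∀ y ∈ W ∩ μ ⁻¹' V, proj (ρ y) = μ y) ∧
      ρ (ν (proj b)) = b := by
  obtain ⟨V, hV, hbV, s, g, hs, hsp, -, hg⟩ := hP.locally_trivial (proj b)
  refine ⟨V, hV, hbV, fun y => act (s (μ y)) (g b), ?_, fun y hy => ?_, ?_⟩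
  · exact hP.contMDiffOn_act (hs.comp (hμ.smooth.mono inter_subset_left) fun y hy => hy.2)
      contMDiffOn_const
  · rw [hP.proj_act, hsp _ hy.2]
  · simp only []
    rw [hμ.right_inv _ hb, hg b hbV]

theorem surjective_mfderiv_chart_symm {n : ℕ} {B : Type*} [TopologicalSpace B]
    [ChartedSpace (EuclideanSpace ℝ (Fin n)) B] [IsManifold (𝓡 n) ∞ B] (b : B)
    {y : EuclideanSpace ℝ (Fin n)} (hy : y ∈ (extChartAt (𝓡 n) b).target) :
    Function.Surjective (mfderiv 𝓘(ℝ, EuclideanSpace ℝ (Fin n)) (𝓡 n) (extChartAt (𝓡 n) b).symm y) := by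
  have : IsManifold (𝓡 n) 1 B := IsManifold.of_le (m := 1) (n := ∞) (by simp)
  have h := isInvertible_mfderivWithin_extChartAt_symm (I := 𝓡 n) hy
  rw [ModelWithCorners.range_eq_univ, mfderivWithin_univ] at h
  obtain ⟨e, he⟩ := h
  rw [← he]
  exact e.surjective

end Param

section CurvCoeff

variable {S2 : Fin 3 → Fin 3 → ℝ} {S3 : Fin 3 → Fin 3 → Fin 3 → ℝ}
  {S4 : Fin 3 → Fin 3 → Fin 3 → Fin 3 → ℝ} {x y z k k' : Mat}

theorem HasCurvCoeff.trace (h : HasCurvCoeff S2 S3 S4 x y k) (hS : CurvSymm S2 S3 S4)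
    (hx : th x = 0) : ∑ i, al k i i = 0 := by
  simp only [h.al_eq, curvAl, hx, Pi.zero_apply, mul_zero, zero_mul, sub_zero, zero_sub,
    Finset.sum_const_zero, zero_add]
  rw [Finset.sum_comm]
  refine Finset.sum_eq_zero fun k _ => ?_
  rw [Finset.sum_comm]
  refine Finset.sum_eq_zero fun l _ => ?_
  rw [← Finset.sum_mul, hS.s4_trace, zero_mul]

theorem HasCurvCoeff.symm (h : HasCurvCoeff S2 S3 S4 z x k) (h' : HasCurvCoeff S2 S3 S4 z y k')
    (hS : CurvSymm S2 S3 S4) (hx : th x = 0) (hy : th y = 0) :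
    ∑ j, be k j * om y j = ∑ j, be k' j * om x j := by
  simp only [h.be_eq, h'.be_eq, curvBe, hx, hy, Pi.zero_apply, mul_zero, zero_mul, sub_zero,
    Finset.sum_const_zero, add_zero, Fin.sum_univ_three]
  simp only [fun i => hS.s3 i 1 0, fun i => hS.s3 i 2 0, fun i => hS.s3 i 2 1]
  ring

end CurvCoeff

/-! ### The normal gauges defined by sections of an adapted bundle. -/

section Adapted

variable {M : Type u} [TopologicalSpace M] [ChartedSpace (EuclideanSpace ℝ (Fin 6)) M]
  {D : ∀ x : M, Submodule ℝ (TangentSpace (𝓡 6) x)} (P : AdaptedBundle D)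
  {μ : E6 → M} {ν : M → E6} {W : Set E6} {U : Set M} {ρ : E6 → P.carrier}

/-- Near `ρ y` every point is `ρ · k` for a smooth `k` with value `1` at `ρ y`, so there `γ` is the
gauge plus a Maurer–Cartan term without `θ` and `ω`. As `γ` is onto `so(4,3)`, the components `θ`
and `ω` of the gauge map `ℝ⁶` onto `ℝ³ × ℝ³`, hence injectively. -/
theorem AdaptedBundle.injective_gaugeOf (hμ : IsParam μ ν W U)
    (hρ : ContMDiffOn 𝓘(ℝ, E6) (𝓡 21) ∞ ρ W) (hp : ∀ y ∈ W, P.proj (ρ y) = μ y) {y : E6} (hy : y ∈ W)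
    {v : E6} (h1 : th (gaugeOf P.forms ρ y v) = 0) (h2 : om (gaugeOf P.forms ρ y v) = 0) : v = 0 := by
  set ψ := extChartAt (𝓡 21) (ρ y) with hψ
  have hz : ψ (ρ y) ∈ ψ.target := ψ.map_source (mem_extChartAt_source _)
  have hψy : ψ.symm (ψ (ρ y)) = ρ y := ψ.left_inv (mem_extChartAt_source _)
  set W₀ := ψ.target ∩ ψ.symm ⁻¹' (P.proj ⁻¹' U)
  have hW₀ : IsOpen W₀ := (contMDiffOn_extChartAt_symm (I := 𝓡 21) (n := ∞)
    (ρ y)).continuousOn.isOpen_inter_preimage (isOpen_extChartAt_target _)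
    (hμ.isOpen_im.preimage P.principal.smooth_proj.continuous)
  have hz0 : ψ (ρ y) ∈ W₀ := ⟨hz, by
    rw [mem_preimage, hψy, mem_preimage, hp y hy]; exact hμ.mapsTo hy⟩
  have hs : ContMDiffOn 𝓘(ℝ, EuclideanSpace ℝ (Fin 21)) (𝓡 21) ∞ ψ.symm W₀ :=
    (contMDiffOn_extChartAt_symm _).mono inter_subset_left
  have hf : ContMDiffOn 𝓘(ℝ, EuclideanSpace ℝ (Fin 21)) 𝓘(ℝ, E6) ∞
      (fun z => ν (P.proj (ψ.symm z))) W₀ :=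
    hμ.smooth_inv.comp (P.principal.smooth_proj.comp_contMDiffOn hs) fun z hz => hz.2
  have hfz : ν (P.proj (ψ.symm (ψ (ρ y)))) = y := by rw [hψy, hp y hy, hμ.left_inv y hy]
  have hfW : MapsTo (fun z => ν (P.proj (ψ.symm z))) W₀ W := fun z hz => hμ.mapsTo_inv hz.2
  have hσ := hρ.comp hf hfW
  obtain ⟨k, hk, hke⟩ := P.principal.exists_act_eq hW₀ hσ hs fun z hz => by
    simp only [Function.comp_apply]
    rw [hp _ (hfW hz), hμ.right_inv _ hz.2]
  have hk' : SmoothH k W₀ := smoothH_iff_entries.2 (contMDiffOn_iff_contDiffOn.1 hk)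
  have hk1 : k (ψ (ρ y)) = 1 := by
    refine P.principal.free (ρ y) _ ?_
    have := hke _ hz0
    simp only [Function.comp_apply] at this
    rwa [hfz, hψy] at this
  have hg := gaugeOf_act P.principal P.cartan hW₀ hσ hk' hz0
  rw [gaugeOf_congr P.forms (τ := ψ.symm)
    (Filter.eventuallyEq_of_mem (hW₀.mem_nhds hz0) fun z hz => hke z hz)] at hg
  have hc : gaugeOf P.forms (ρ ∘ fun z => ν (P.proj (ψ.symm z))) (ψ (ρ y)) =
      (gaugeOf P.forms ρ y).comp (fderiv ℝ (fun z => ν (P.proj (ψ.symm z))) (ψ (ρ y))) := by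
    have h3 := gaugeOf_comp P.forms (τ := ρ) (f := fun z => ν (P.proj (ψ.symm z))) (z := ψ (ρ y))
      (by rw [hfz]; exact (hρ.contMDiffAt (hμ.isOpen_dom.mem_nhds hy)).mdifferentiableAt (by simp))
      (((contMDiffOn_iff_contDiffOn.1 hf).contDiffAt (hW₀.mem_nhds hz0)).differentiableAt (by simp))
    rw [hfz] at h3
    exact h3
  let L : E6 →ₗ[ℝ] (Fin 3 → ℝ) × (Fin 3 → ℝ) :=
    (LinearMap.pi fun i => thₗ i ∘ₗ (gaugeOf P.forms ρ y).toLinearMap).prod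
      (LinearMap.pi fun i => omₗ i ∘ₗ (gaugeOf P.forms ρ y).toLinearMap)
  have hL : Function.Surjective L := by
    rintro ⟨p, q⟩
    obtain ⟨w, -, hw⟩ := (P.cartan.bijOn (ψ.symm (ψ (ρ y)))).surjOn
      (gammaMatrix_mem_so43 (p := p) (q := q) (r := 0) (s := 0) (t := 0))
    obtain ⟨(u : EuclideanSpace ℝ (Fin 21)), rfl⟩ := surjective_mfderiv_chart_symm _ hz w
    have h3 : gaugeOf P.forms ψ.symm (ψ (ρ y)) u = gammaMatrix p q 0 0 0 := hw
    refine ⟨fderiv ℝ (fun z => ν (P.proj (ψ.symm z))) (ψ (ρ y)) u, ?_⟩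
    have hd := hk'.differentiableAt hW₀ hz0
    rw [hg, gaugeH_apply, hk1, hc] at h3
    refine Prod.ext ?_ ?_
    · have h4 := congrArg th h3
      rw [th_gammaMatrix, th_add, th_maurerCartan hd, add_zero] at h4
      simp [conjₗ] at h4
      exact h4
    · have h4 := congrArg om h3
      rw [om_gammaMatrix, om_add, om_maurerCartan hd, add_zero] at h4
      simp [conjₗ] at h4
      exact h4
  have hinj := (LinearMap.injective_iff_surjective_of_finrank_eq_finrank (f := L) (by simp)).2 hL
  refine hinj ?_
  rw [map_zero]
  exact Prod.ext h1 h2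

theorem AdaptedBundle.isGauge (hμ : IsParam μ ν W U)
    (hρ : ContMDiffOn 𝓘(ℝ, E6) (𝓡 21) ∞ ρ W) (hp : ∀ y ∈ W, P.proj (ρ y) = μ y) :
    IsGauge W (gaugeOf P.forms ρ) := by
  obtain ⟨S2, S3, S4, -, -, -, hS, hk⟩ := P.forms.structureEquations_iff.1 P.structureEquations
  have hk' : ∀ y ∈ W, ∀ v w, HasCurvCoeff (fun i j => S2 i j (ρ y)) (fun i j k => S3 i j k (ρ y))
      (fun i k j l => S4 i k j l (ρ y)) (gaugeOf P.forms ρ y v) (gaugeOf P.forms ρ y w)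
      (curv (gaugeOf P.forms ρ) y v w) := fun y hy v w => by
    rw [curv_gaugeOf P.coframing hμ.isOpen_dom hρ hy]
    exact hk _ _ _
  refine isGauge_of_components hμ.isOpen_dom (contDiffOn_gaugeOf P.coframing hμ.isOpen_dom hρ)
    (fun y _ v => gaugeOf_mem _ _ _ _) (fun y hy v => P.injective_gaugeOf hμ hρ hp hy)
    (fun y hy v w => (hk' y hy v w).th_eq) (fun y hy v w => (hk' y hy v w).om_eq)
    (fun y hy v w h => (hk' y hy v w).trace (hS _) h)
    (fun y hy u v w hu hv => (hk' y hy w u).symm (hk' y hy w v) (hS _) hu hv)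

/-- All tangent spaces are the same vector space, so a vector can be regarded as tangent at either
of two equal points; this takes care of base points that agree only propositionally. -/
theorem mem_congr_point {x x' : M} (h : x = x') (v : E6) :
    (show TangentSpace (𝓡 6) x from v) ∈ D x ↔ (show TangentSpace (𝓡 6) x' from v) ∈ D x' := by
  subst h; rfl

theorem AdaptedBundle.th_gaugeOf_eq_zero_iff (hμ : IsParam μ ν W U)
    (hρ : ContMDiffOn 𝓘(ℝ, E6) (𝓡 21) ∞ ρ W) (hp : ∀ y ∈ W, P.proj (ρ y) = μ y) {y : E6} (hy : y ∈ W)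
    (v : E6) : th (gaugeOf P.forms ρ y v) = 0 ↔ mfderiv 𝓘(ℝ, E6) (𝓡 6) μ y v ∈ D (μ y) := by
  have h1 : th (gaugeOf P.forms ρ y v) = 0 ↔
      ∀ i, P.forms.theta i (ρ y) (mfderiv 𝓘(ℝ, E6) (𝓡 21) ρ y v) = 0 := by
    rw [gaugeOf_apply, FormSystem.gamma, th_gammaMatrix, funext_iff]; rfl
  rw [h1, ← P.adapted]
  have h2 : mfderiv 𝓘(ℝ, E6) (𝓡 6) μ y = mfderiv 𝓘(ℝ, E6) (𝓡 6) (P.proj ∘ ρ) y :=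
    Filter.EventuallyEq.mfderiv_eq (Filter.eventuallyEq_of_mem (hμ.isOpen_dom.mem_nhds hy)
      fun z hz => (hp z hz).symm)
  have h3 := mfderiv_comp (I := 𝓘(ℝ, E6)) (I' := 𝓡 21) (I'' := 𝓡 6) y
    ((P.principal.smooth_proj.contMDiffAt (x := ρ y)).mdifferentiableAt (by simp))
    ((hρ.contMDiffAt (hμ.isOpen_dom.mem_nhds hy)).mdifferentiableAt (by simp))
  rw [h2, h3]
  exact mem_congr_point (hp y hy) _

end Adapted

/-! ### Maps preserving the forms -/

section Preserves

variable {B B' B'' : Type*} [TopologicalSpace B] [ChartedSpace (EuclideanSpace ℝ (Fin 21)) B]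
  [TopologicalSpace B'] [ChartedSpace (EuclideanSpace ℝ (Fin 21)) B']
  [TopologicalSpace B''] [ChartedSpace (EuclideanSpace ℝ (Fin 21)) B'']
  {c : FormSystem B} {c' : FormSystem B'} {c'' : FormSystem B''}

/-- `Φ` pulls the matrix-valued form of `c'` back to that of `c` at the point `b`. -/
def PreservesAt (c : FormSystem B) (c' : FormSystem B') (Φ : B → B') (b : B) : Prop :=
  ∀ v : TangentSpace (𝓡 21) b, c'.gamma (Φ b) (mfderiv (𝓡 21) (𝓡 21) Φ b v) = c.gamma b v

theorem preservedBy_iff {Φ : B → B'} : c.PreservedBy c' Φ ↔ ∀ b, PreservesAt c c' Φ b := by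
  constructor
  · rintro ⟨h1, h2, h3, h4, h5⟩ b v
    simp only [FormSystem.gamma, ← h1, ← h2, ← h3, ← h4, ← h5]
    rfl
  · intro h
    refine ⟨fun i => ?_, fun i => ?_, fun i j => ?_, fun i => ?_, fun i => ?_⟩ <;> ext b v
    · have := congrFun (congrArg th (h b v)) i
      simp only [FormSystem.gamma, th_gammaMatrix] at this
      exact this
    · have := congrFun (congrArg om (h b v)) i
      simp only [FormSystem.gamma, om_gammaMatrix] at this
      exact this
    · have := congrFun (congrFun (congrArg al (h b v)) i) j
      simp only [FormSystem.gamma, al_gammaMatrix] at this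
      exact this
    · have := congrFun (congrArg be (h b v)) i
      simp only [FormSystem.gamma, be_gammaMatrix] at this
      exact this
    · have := congrFun (congrArg ta (h b v)) i
      simp only [FormSystem.gamma, ta_gammaMatrix] at this
      exact this

theorem PreservesAt.comp {Φ : B → B'} {Ψ : B' → B''} {b : B} (h : PreservesAt c c' Φ b)
    (h' : PreservesAt c' c'' Ψ (Φ b)) (hΦ : MDifferentiableAt (𝓡 21) (𝓡 21) Φ b)
    (hΨ : MDifferentiableAt (𝓡 21) (𝓡 21) Ψ (Φ b)) : PreservesAt c c'' (Ψ ∘ Φ) b := by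
  intro v
  rw [mfderiv_comp b hΨ hΦ, ← h v, ← h']
  rfl

theorem preservesAt_id (b : B) : PreservesAt c c id b := by
  intro v
  rw [mfderiv_id]
  rfl

theorem PreservesAt.congr {Φ Ψ : B → B'} {b : B} (h : PreservesAt c c' Φ b) (he : Ψ =ᶠ[𝓝 b] Φ) :
    PreservesAt c c' Ψ b := by
  intro v
  rw [← h v, he.mfderiv_eq]
  have : ∀ {x y : B'} (_ : x = y) (u : EuclideanSpace ℝ (Fin 21)), c'.gamma x u = c'.gamma y u := by
    rintro x _ rfl u; rfl
  exact this he.eq_of_nhds _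

variable {X : Type*} [NormedAddCommGroup X] [NormedSpace ℝ X] [FiniteDimensional ℝ X]

theorem PreservesAt.gaugeOf_eq {Φ : B → B'} {σ : X → B} {y : X} (h : PreservesAt c c' Φ (σ y))
    (hΦ : MDifferentiableAt (𝓡 21) (𝓡 21) Φ (σ y)) (hσ : MDifferentiableAt 𝓘(ℝ, X) (𝓡 21) σ y) :
    gaugeOf c' (Φ ∘ σ) y = gaugeOf c σ y := by
  ext1 v
  rw [gaugeOf_apply, mfderiv_comp y hΦ hσ]
  exact h _

theorem preservesAt_of_gaugeOf_eq [IsManifold (𝓡 21) ∞ B] {Φ : B → B'} {b : B}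
    (hΦ : MDifferentiableAt (𝓡 21) (𝓡 21) Φ b)
    (h : gaugeOf c' (Φ ∘ (extChartAt (𝓡 21) b).symm) (extChartAt (𝓡 21) b b) =
      gaugeOf c (extChartAt (𝓡 21) b).symm (extChartAt (𝓡 21) b b)) : PreservesAt c c' Φ b := by
  have hb := mem_extChartAt_target (I := 𝓡 21) b
  -- Proved at the point `ψ.symm z`, with `ψ` the chart at `b`, so that the types match; afterwards
  -- that point is rewritten to `b`.
  have key : ∀ {z : EuclideanSpace ℝ (Fin 21)}, z ∈ (extChartAt (𝓡 21) b).target →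
      MDifferentiableAt (𝓡 21) (𝓡 21) Φ ((extChartAt (𝓡 21) b).symm z) →
      gaugeOf c' (Φ ∘ (extChartAt (𝓡 21) b).symm) z = gaugeOf c (extChartAt (𝓡 21) b).symm z →
      PreservesAt c c' Φ ((extChartAt (𝓡 21) b).symm z) := by
    intro z hz hΦ h w
    obtain ⟨(u : EuclideanSpace ℝ (Fin 21)), rfl⟩ := surjective_mfderiv_chart_symm _ hz w
    have h1 : gaugeOf c' (Φ ∘ (extChartAt (𝓡 21) b).symm) z u =
      gaugeOf c (extChartAt (𝓡 21) b).symm z u := by rw [h]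
    rw [gaugeOf_apply, mfderiv_comp z hΦ (mdifferentiableAt_chart_symm b hz)] at h1
    exact h1
  have h2 := key hb
  rw [extChartAt_to_inv] at h2
  exact h2 hΦ h

end Preserves

/-! ### Plane-preserving diffeomorphisms and uniqueness of lifts. -/

section Lifts

variable {M M' : Type u}
    [TopologicalSpace M] [ChartedSpace (EuclideanSpace ℝ (Fin 6)) M]
    [TopologicalSpace M'] [ChartedSpace (EuclideanSpace ℝ (Fin 6)) M']
    {D : ∀ x : M, Submodule ℝ (TangentSpace (𝓡 6) x)}
    {D' : ∀ x : M', Submodule ℝ (TangentSpace (𝓡 6) x)}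

theorem mfderiv_symm_mfderiv (φ : M ≃ₘ⟮𝓡 6, 𝓡 6⟯ M') (x : M) (v : TangentSpace (𝓡 6) x) :
    mfderiv (𝓡 6) (𝓡 6) φ.symm (φ x) (mfderiv (𝓡 6) (𝓡 6) φ x v) = v := by
  have h := mfderiv_comp (I := 𝓡 6) (I' := 𝓡 6) (I'' := 𝓡 6) x
    ((φ.symm.contMDiff.contMDiffAt (x := φ x)).mdifferentiableAt (by simp))
    ((φ.contMDiff.contMDiffAt (x := x)).mdifferentiableAt (by simp))
  have h1 : φ.symm ∘ φ = id := funext fun x => by simp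
  rw [h1, mfderiv_id] at h
  exact (congrArg (fun L => L v) h).symm

theorem surjective_mfderiv (φ : M ≃ₘ⟮𝓡 6, 𝓡 6⟯ M') (x : M) :
    Function.Surjective (mfderiv (𝓡 6) (𝓡 6) φ x) := by
  intro w
  have h := mfderiv_symm_mfderiv φ.symm (φ x) w
  have h1 : φ.symm (φ x) = x := by simp
  have key : ∀ {x'}, x' = x → ∀ (u : EuclideanSpace ℝ (Fin 6)),
      (mfderiv (𝓡 6) (𝓡 6) φ x' u : EuclideanSpace ℝ (Fin 6)) = mfderiv (𝓡 6) (𝓡 6) φ x u := by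
    rintro x' rfl u; rfl
  exact ⟨_, (key h1 _).symm.trans h⟩

theorem preservesPlanes_iff (φ : M ≃ₘ⟮𝓡 6, 𝓡 6⟯ M') : PreservesPlanes D D' φ ↔
    ∀ x (v : TangentSpace (𝓡 6) x), v ∈ D x ↔ mfderiv (𝓡 6) (𝓡 6) φ x v ∈ D' (φ x) := by
  refine forall_congr' fun x => ⟨fun h v => ?_, fun h => ?_⟩
  · rw [← h]
    constructor
    · exact fun hv => ⟨v, hv, rfl⟩
    · rintro ⟨w, hw, hwv⟩
      have h1 := mfderiv_symm_mfderiv φ x v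
      have h2 := mfderiv_symm_mfderiv φ x w
      have h3 : mfderiv (𝓡 6) (𝓡 6) φ x w = mfderiv (𝓡 6) (𝓡 6) φ x v := hwv
      rw [h3] at h2
      rw [← h1, h2]
      exact hw
  · refine le_antisymm ?_ fun w hw => ?_
    · rintro _ ⟨w, hw, rfl⟩
      exact (h w).1 hw
    · obtain ⟨v, rfl⟩ := surjective_mfderiv φ x w
      exact ⟨v, (h v).2 hw, rfl⟩

theorem PreservesPlanes.symm {φ : M ≃ₘ⟮𝓡 6, 𝓡 6⟯ M'} (h : PreservesPlanes D D' φ) :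
    PreservesPlanes D' D φ.symm := by
  rw [preservesPlanes_iff] at h ⊢
  intro x v
  rw [h]
  have h1 := mfderiv_symm_mfderiv φ.symm x v
  have h2 : φ (φ.symm x) = x := by simp
  refine Iff.trans ?_ (mem_congr_point h2 _).symm
  exact iff_of_eq (congrArg (fun u => u ∈ D' x) h1.symm)

theorem IsPrincipalBundle.surjective {B : Type*} [TopologicalSpace B]
    [ChartedSpace (EuclideanSpace ℝ (Fin 21)) B] {proj : B → M} {act : B → H → B}
    (hP : IsPrincipalBundle proj act) : Function.Surjective proj := by
  intro x
  obtain ⟨U, -, hx, s, -, -, hs, -⟩ := hP.locally_trivial x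
  exact ⟨s x, hs x hx⟩

theorem IsPrincipalBundle.exists_act {B : Type*} [TopologicalSpace B]
    [ChartedSpace (EuclideanSpace ℝ (Fin 21)) B] {proj : B → M} {act : B → H → B}
    (hP : IsPrincipalBundle proj act) {b b' : B} (h : proj b = proj b') : ∃ k, act b k = b' := by
  obtain ⟨U, -, hx, s, g, -, -, -, hg⟩ := hP.locally_trivial (proj b)
  refine ⟨(g b)⁻¹ * g b', ?_⟩
  have h1 := hg b hx
  have h2 := hg b' (by rwa [mem_preimage, ← h])
  rw [← h] at h2
  conv_lhs => rw [← h1]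
  rw [hP.act_mul, h1, mul_inv_cancel_left, h2]

variable (P : AdaptedBundle D) (P' : AdaptedBundle D')

theorem isOpen_proj_preimage {V : Set M} (hV : IsOpen V) : IsOpen (P.proj ⁻¹' V) :=
  hV.preimage P.principal.smooth_proj.continuous

variable [IsManifold (𝓡 6) ∞ M] {P P'}

/-- Along a section `ρ` through `b` the two maps differ by a map `k` into `H`. Both `Φ ∘ ρ` and `Ψ ∘
ρ` induce the gauge of `ρ`, so `k` fixes a normal gauge and is `1`. Equivariance is not needed. -/
theorem eq_of_preservesAt {V : Set M} (hV : IsOpen V) {Φ Ψ : P.carrier → P'.carrier}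
    (hΦ : ContMDiffOn (𝓡 21) (𝓡 21) ∞ Φ (P.proj ⁻¹' V))
    (hΨ : ContMDiffOn (𝓡 21) (𝓡 21) ∞ Ψ (P.proj ⁻¹' V))
    (hp : ∀ b ∈ P.proj ⁻¹' V, P'.proj (Φ b) = P'.proj (Ψ b))
    (hΦ' : ∀ b ∈ P.proj ⁻¹' V, PreservesAt P.forms P'.forms Φ b)
    (hΨ' : ∀ b ∈ P.proj ⁻¹' V, PreservesAt P.forms P'.forms Ψ b) {b : P.carrier}
    (hb : b ∈ P.proj ⁻¹' V) : Φ b = Ψ b := by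
  have hμ := (isParam_extChartAt (P.proj b)).restrict hV
  have hbU : P.proj b ∈ (extChartAt (𝓡 6) (P.proj b)).source ∩ V := ⟨mem_extChartAt_source _, hb⟩
  obtain ⟨V', hV', hbV', ρ, hρ, hρp, hρb⟩ := P.principal.exists_lift hμ hbU
  have hμ := hμ.restrict hV'
  have hy := hμ.mapsTo_inv ⟨hbU, hbV'⟩
  set μ := (extChartAt (𝓡 6) (P.proj b)).symm
  set W := (extChartAt (𝓡 6) (P.proj b)).target ∩ μ ⁻¹' V ∩ μ ⁻¹' V'
  have hW : IsOpen W := hμ.isOpen_dom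
  have hρV : MapsTo ρ W (P.proj ⁻¹' V) := fun y hy => by
    rw [mem_preimage, hρp y hy]; exact (hμ.mapsTo hy).1.2
  have hA := P.isGauge hμ hρ hρp
  have h1 := hΦ.comp hρ hρV
  have h2 := hΨ.comp hρ hρV
  have hg : ∀ {Φ : P.carrier → P'.carrier}, ContMDiffOn (𝓡 21) (𝓡 21) ∞ Φ (P.proj ⁻¹' V) →
      (∀ b ∈ P.proj ⁻¹' V, PreservesAt P.forms P'.forms Φ b) → ∀ y ∈ W,
      gaugeOf P'.forms (Φ ∘ ρ) y = gaugeOf P.forms ρ y := fun h h' y hy =>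
    (h' _ (hρV hy)).gaugeOf_eq ((h.contMDiffAt
      ((isOpen_proj_preimage P hV).mem_nhds (hρV hy))).mdifferentiableAt (by simp))
      ((hρ.contMDiffAt (hW.mem_nhds hy)).mdifferentiableAt (by simp))
  obtain ⟨k, hk, hke⟩ := P'.principal.exists_act_eq hW h1 h2 fun y hy => hp _ (hρV hy)
  have hk' : SmoothH k W := smoothH_iff_entries.2 (contMDiffOn_iff_contDiffOn.1 hk)
  have h3 : k (extChartAt (𝓡 6) (P.proj b) (P.proj b)) = 1 := by
    refine eq_one_of_gaugeH_eq hW hA hk' (fun y hy => ?_) hy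
    have h4 := gaugeOf_act P'.principal P'.cartan hW h1 hk' hy
    rw [gaugeOf_congr P'.forms (τ := Ψ ∘ ρ)
      (Filter.eventuallyEq_of_mem (hW.mem_nhds hy) fun z hz => hke z hz), hg hΨ hΨ' y hy] at h4
    rw [h4]
    ext1 v
    rw [gaugeH_apply, gaugeH_apply, hg hΦ hΦ' y hy]
  have h4 := hke _ hy
  rw [h3, P'.principal.act_one] at h4
  simp only [Function.comp_apply, hρb] at h4
  exact h4

end Lifts

/-! ### Lifting diffeomorphisms -/

section Lifts

variable {M M' : Type u}
    [TopologicalSpace M] [ChartedSpace (EuclideanSpace ℝ (Fin 6)) M] [IsManifold (𝓡 6) ∞ M]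
    [TopologicalSpace M'] [ChartedSpace (EuclideanSpace ℝ (Fin 6)) M']
    {D : ∀ x : M, Submodule ℝ (TangentSpace (𝓡 6) x)}
    {D' : ∀ x : M', Submodule ℝ (TangentSpace (𝓡 6) x)}
    {P : AdaptedBundle D} {P' : AdaptedBundle D'}

/-- Arbitrary sections of both bundles over corresponding sets define normal gauges of the same
plane field, because `φ` matches `D` and `D'`. By `exists_gauge_eq` the second section can be moved
by a map into `H` until the gauges coincide. -/
theorem exists_matching_lifts (P : AdaptedBundle D) (P' : AdaptedBundle D') (φ : M ≃ₘ⟮𝓡 6, 𝓡 6⟯ M')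
    (hφ : PreservesPlanes D D' φ) (x : M) : ∃ (μ : E6 → M) (ν : M → E6) (W : Set E6) (U : Set M),
      IsParam μ ν W U ∧ x ∈ U ∧ ∃ (ρ : E6 → P.carrier) (ρ' : E6 → P'.carrier),
        ContMDiffOn 𝓘(ℝ, E6) (𝓡 21) ∞ ρ W ∧ ContMDiffOn 𝓘(ℝ, E6) (𝓡 21) ∞ ρ' W ∧
        (∀ y ∈ W, P.proj (ρ y) = μ y) ∧ (∀ y ∈ W, P'.proj (ρ' y) = φ (μ y)) ∧
        ∀ y ∈ W, gaugeOf P'.forms ρ' y = gaugeOf P.forms ρ y := by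
  obtain ⟨b, hb⟩ := P.principal.surjective x
  obtain ⟨b', hb'⟩ := P'.principal.surjective (φ x)
  have hμ₀ := isParam_extChartAt x
  have hxU := mem_extChartAt_source (I := 𝓡 6) x
  obtain ⟨V, hV, hbV, ρ, hρ, hρp, -⟩ := P.principal.exists_lift hμ₀ (by rw [hb]; exact hxU)
  obtain ⟨V', hV', hbV', ρ', hρ', hρp', -⟩ := P'.principal.exists_lift (hμ₀.comp φ)
    (b := b') (by rw [hb']; simpa using hxU)
  have hμ := hμ₀.restrict (hV.inter (hV'.preimage φ.continuous))
  rw [hb] at hbV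
  rw [hb'] at hbV'
  have h1 := hρ.mono (show (extChartAt (𝓡 6) x).target ∩ (extChartAt (𝓡 6) x).symm ⁻¹'
    (V ∩ φ ⁻¹' V') ⊆ _ from fun y hy => ⟨hy.1, hy.2.1⟩)
  have h1' := hρ'.mono (show (extChartAt (𝓡 6) x).target ∩ (extChartAt (𝓡 6) x).symm ⁻¹'
    (V ∩ φ ⁻¹' V') ⊆ _ from fun y hy => ⟨hy.1, hy.2.2⟩)
  have h2 := fun y (hy : y ∈ (extChartAt (𝓡 6) x).target ∩ (extChartAt (𝓡 6) x).symm ⁻¹'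
    (V ∩ φ ⁻¹' V')) => hρp y ⟨hy.1, hy.2.1⟩
  have h2' := fun y (hy : y ∈ (extChartAt (𝓡 6) x).target ∩ (extChartAt (𝓡 6) x).symm ⁻¹'
    (V ∩ φ ⁻¹' V')) => hρp' y ⟨hy.1, hy.2.2⟩
  set W := (extChartAt (𝓡 6) x).target ∩ (extChartAt (𝓡 6) x).symm ⁻¹' (V ∩ φ ⁻¹' V')
  have hW : IsOpen W := hμ.isOpen_dom
  obtain ⟨h, hh, hhe⟩ := exists_gauge_eq hW (P.isGauge hμ h1 h2) (P'.isGauge (hμ.comp φ) h1' h2')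
    fun y hy v => by
      rw [P.th_gaugeOf_eq_zero_iff hμ h1 h2 hy, P'.th_gaugeOf_eq_zero_iff (hμ.comp φ) h1' h2' hy,
        (preservesPlanes_iff φ).1 hφ]
      have h3 := mfderiv_comp (I := 𝓘(ℝ, E6)) (I' := 𝓡 6) (I'' := 𝓡 6) y
        ((φ.contMDiff.contMDiffAt (x := (extChartAt (𝓡 6) x).symm y)).mdifferentiableAt (by simp))
        ((hμ.smooth.contMDiffAt (hW.mem_nhds hy)).mdifferentiableAt (by simp))
      exact iff_of_eq (congrArg (fun L : E6 →L[ℝ] E6 => L v ∈ D' (φ ((extChartAt (𝓡 6) x).symm y))) h3.symm)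
  have hh' : ContMDiffOn 𝓘(ℝ, E6) 𝓘(ℝ, Idx → Idx → ℝ) ∞ (fun y => H.entries (h y)) W :=
    (smoothH_iff_entries.1 hh).contMDiffOn
  refine ⟨_, _, W, _, hμ, ⟨hxU, hbV, hbV'⟩, ρ, fun y => P'.act (ρ' y) (h y), h1,
    P'.principal.contMDiffOn_act h1' hh', h2, fun y hy => ?_, fun y hy => ?_⟩
  · rw [P'.principal.proj_act, h2' y hy]
  · rw [gaugeOf_act P'.principal P'.cartan hW h1' hh hy, hhe y hy]

/-- The lift is `ρ · k ↦ ρ' · k` for sections with equal gauges. It preserves the forms because, in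
a chart of the bundle, both sides are the same gauge transformed by the same `k`. -/
theorem exists_local_lift (P : AdaptedBundle D) (P' : AdaptedBundle D') (φ : M ≃ₘ⟮𝓡 6, 𝓡 6⟯ M')
    (hφ : PreservesPlanes D D' φ) (x : M) : ∃ V, IsOpen V ∧ x ∈ V ∧ ∃ Φ : P.carrier → P'.carrier,
      ContMDiffOn (𝓡 21) (𝓡 21) ∞ Φ (P.proj ⁻¹' V) ∧
      (∀ b ∈ P.proj ⁻¹' V, P'.proj (Φ b) = φ (P.proj b)) ∧
      (∀ b ∈ P.proj ⁻¹' V, PreservesAt P.forms P'.forms Φ b) ∧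
      ∀ b ∈ P.proj ⁻¹' V, ∀ h, Φ (P.act b h) = P'.act (Φ b) h := by
  obtain ⟨μ, ν, W, U, hμ, hxU, ρ, ρ', hρ, hρ', hρp, hρp', hg⟩ := exists_matching_lifts P P' φ hφ x
  have hU := isOpen_proj_preimage P hμ.isOpen_im
  have hf : ContMDiffOn (𝓡 21) 𝓘(ℝ, E6) ∞ (fun b => ν (P.proj b)) (P.proj ⁻¹' U) :=
    hμ.smooth_inv.comp P.principal.smooth_proj.contMDiffOn fun b hb => hb
  have hfW : MapsTo (fun b => ν (P.proj b)) (P.proj ⁻¹' U) W := fun b hb => hμ.mapsTo_inv hb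
  have hσ := hρ.comp hf hfW
  have hσ' := hρ'.comp hf hfW
  obtain ⟨k, hk, hke⟩ := P.principal.exists_act_eq hU hσ contMDiffOn_id fun b hb => by
    simp only [Function.comp_apply]
    rw [hρp _ (hfW hb), hμ.right_inv _ hb, id]
  simp only [Function.comp_apply, id] at hke
  have hΦ := P'.principal.contMDiffOn_act hσ' hk
  refine ⟨U, hμ.isOpen_im, hxU, fun b => P'.act (ρ' (ν (P.proj b))) (k b), hΦ, fun b hb => ?_,
    fun b hb => ?_, fun b hb h => ?_⟩
  · rw [P'.principal.proj_act, hρp' _ (hfW hb), hμ.right_inv _ hb]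
  · refine preservesAt_of_gaugeOf_eq ((hΦ.contMDiffAt (hU.mem_nhds hb)).mdifferentiableAt (by simp)) ?_
    set ψ := extChartAt (𝓡 21) b with hψ
    have hψb : ψ.symm (ψ b) = b := extChartAt_to_inv b
    have hs : ContMDiffOn 𝓘(ℝ, EuclideanSpace ℝ (Fin 21)) (𝓡 21) ∞ ψ.symm ψ.target :=
      contMDiffOn_extChartAt_symm b
    set W₀ := ψ.target ∩ ψ.symm ⁻¹' (P.proj ⁻¹' U)
    have hW₀ : IsOpen W₀ := hs.continuousOn.isOpen_inter_preimage (isOpen_extChartAt_target _) hU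
    have hz : ψ b ∈ W₀ := ⟨mem_extChartAt_target b, by rw [mem_preimage, hψb]; exact hb⟩
    have hs := hs.mono (inter_subset_left : W₀ ⊆ _)
    have hm : MapsTo ψ.symm W₀ (P.proj ⁻¹' U) := fun z hz => hz.2
    have hk' : SmoothH (fun z => k (ψ.symm z)) W₀ :=
      smoothH_iff_entries.2 (contMDiffOn_iff_contDiffOn.1 (hk.comp hs hm))
    have hfz := hf.comp hs hm
    have hfd : DifferentiableAt ℝ (fun z => ν (P.proj (ψ.symm z))) (ψ b) :=
      ((contMDiffOn_iff_contDiffOn.1 hfz).contDiffAt (hW₀.mem_nhds hz)).differentiableAt (by simp)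
    have h1 := gaugeOf_act P.principal P.cartan hW₀ (hσ.comp hs hm) hk' hz
    have h2 := gaugeOf_act P'.principal P'.cartan hW₀ (hσ'.comp hs hm) hk' hz
    have h3 : gaugeOf P.forms (fun z => ρ (ν (P.proj (ψ.symm z)))) (ψ b) = _ :=
      gaugeOf_comp P.forms (f := fun z => ν (P.proj (ψ.symm z)))
      ((hρ.contMDiffAt (hμ.isOpen_dom.mem_nhds (hfW (hm hz)))).mdifferentiableAt (by simp)) hfd
    have h4 : gaugeOf P'.forms (fun z => ρ' (ν (P.proj (ψ.symm z)))) (ψ b) = _ :=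
      gaugeOf_comp P'.forms (f := fun z => ν (P.proj (ψ.symm z)))
      ((hρ'.contMDiffAt (hμ.isOpen_dom.mem_nhds (hfW (hm hz)))).mdifferentiableAt (by simp)) hfd
    rw [hg _ (hfW (hm hz)), ← h3] at h4
    have h5 : gaugeOf P.forms ψ.symm (ψ b) =
        gaugeOf P.forms (fun z => P.act (ρ (ν (P.proj (ψ.symm z)))) (k (ψ.symm z))) (ψ b) :=
      gaugeOf_congr _ (Filter.eventuallyEq_of_mem (hW₀.mem_nhds hz) fun z hz => (hke _ hz.2).symm)
    rw [h5]
    refine Eq.trans h2 (Eq.trans ?_ h1.symm)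
    ext1 v
    rw [gaugeH_apply, gaugeH_apply]
    exact congrArg (fun L : EuclideanSpace ℝ (Fin 21) →L[ℝ] Mat =>
      conjₗ (k (ψ.symm (ψ b))) (L v) + maurerCartan (fun z => k (ψ.symm z)) (ψ b) v) h4
  · have h1 : k (P.act b h) = k b * h := by
      have hb' : P.act b h ∈ P.proj ⁻¹' U := by rwa [mem_preimage, P.principal.proj_act]
      have h2 := hke _ hb'
      rw [P.principal.proj_act] at h2
      refine P.principal.act_injective (h2.trans ?_)
      rw [← P.principal.act_mul, hke b hb]
    simp only [P.principal.proj_act, h1]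
    rw [P'.principal.act_mul]

theorem exists_lift_map (P : AdaptedBundle D) (P' : AdaptedBundle D') (φ : M ≃ₘ⟮𝓡 6, 𝓡 6⟯ M')
    (hφ : PreservesPlanes D D' φ) : ∃ Φ : P.carrier → P'.carrier,
      ContMDiff (𝓡 21) (𝓡 21) ∞ Φ ∧ (∀ b, P'.proj (Φ b) = φ (P.proj b)) ∧
      (∀ b, PreservesAt P.forms P'.forms Φ b) ∧ ∀ b h, Φ (P.act b h) = P'.act (Φ b) h := by
  choose V hV hxV Φ hΦ hp hf he using exists_local_lift P P' φ hφ
  -- Local lifts agree on overlaps by `eq_of_preservesAt`, so following the lift attached to the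
  -- projection of `b` gives a smooth map.
  have key : ∀ x, ∀ b ∈ P.proj ⁻¹' V x, Φ (P.proj b) b = Φ x b := fun x b hb => by
    have hs1 : P.proj ⁻¹' (V (P.proj b) ∩ V x) ⊆ P.proj ⁻¹' V (P.proj b) :=
      preimage_mono inter_subset_left
    have hs2 : P.proj ⁻¹' (V (P.proj b) ∩ V x) ⊆ P.proj ⁻¹' V x :=
      preimage_mono inter_subset_right
    refine eq_of_preservesAt ((hV (P.proj b)).inter (hV x)) ((hΦ _).mono hs1) ((hΦ x).mono hs2)
      (fun b' hb' => ?_) (fun b' hb' => hf _ b' hb'.1) (fun b' hb' => hf _ b' hb'.2) ⟨hxV _, hb⟩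
    rw [hp _ _ hb'.1, hp _ _ hb'.2]
  have hloc : ∀ b, (fun b => Φ (P.proj b) b) =ᶠ[𝓝 b] Φ (P.proj b) := fun b =>
    Filter.eventuallyEq_of_mem ((isOpen_proj_preimage P (hV _)).mem_nhds (hxV (P.proj b)))
      fun b' hb' => key _ _ hb'
  refine ⟨fun b => Φ (P.proj b) b, fun b => ?_, fun b => hp _ b (hxV _), fun b => ?_, fun b h => ?_⟩
  · exact ((hΦ _).contMDiffAt ((isOpen_proj_preimage P (hV _)).mem_nhds
      (hxV (P.proj b)))).congr_of_eventuallyEq (hloc b)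
  · exact (hf _ b (hxV _)).congr (hloc b)
  · simp only [P.principal.proj_act]
    exact he _ b (hxV _) h

/-- The composite preserves the forms over the identity, and so does the identity; hence lifts of
`φ` and of its inverse are inverse to each other. -/
theorem comp_eq_id_of_preservesAt [IsManifold (𝓡 6) ∞ M'] {Φ : P.carrier → P'.carrier}
    {Ψ : P'.carrier → P.carrier} (hΦ : ContMDiff (𝓡 21) (𝓡 21) ∞ Φ) (hΨ : ContMDiff (𝓡 21) (𝓡 21) ∞ Ψ)
    (hp : ∀ b, P.proj (Ψ (Φ b)) = P.proj b) (h : ∀ b, PreservesAt P.forms P'.forms Φ b)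
    (h' : ∀ b, PreservesAt P'.forms P.forms Ψ b) (b : P.carrier) : Ψ (Φ b) = b :=
  eq_of_preservesAt (P := P) (P' := P) (Φ := Ψ ∘ Φ) (Ψ := id) isOpen_univ (hΨ.comp hΦ).contMDiffOn
    contMDiffOn_id (fun b _ => hp b) (fun b _ => (h b).comp (h' _)
      ((hΦ b).mdifferentiableAt (by simp)) ((hΨ _).mdifferentiableAt (by simp)))
    (fun b _ => preservesAt_id b) (mem_univ b)

theorem exists_lift_diffeomorph [IsManifold (𝓡 6) ∞ M'] (P : AdaptedBundle D) (P' : AdaptedBundle D')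
    (φ : M ≃ₘ⟮𝓡 6, 𝓡 6⟯ M') (hφ : PreservesPlanes D D' φ) :
    ∃ Φ : P.carrier ≃ₘ⟮𝓡 21, 𝓡 21⟯ P'.carrier,
          (∀ b, P'.proj (Φ b) = φ (P.proj b)) ∧
          P.forms.PreservedBy P'.forms Φ ∧
          (∀ b h, Φ (P.act b h) = P'.act (Φ b) h) ∧
          ∀ Ψ : P.carrier ≃ₘ⟮𝓡 21, 𝓡 21⟯ P'.carrier,
            (∀ b, P'.proj (Ψ b) = φ (P.proj b)) → P.forms.PreservedBy P'.forms Ψ → Ψ = Φ := by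
  obtain ⟨Φ, hΦ, hp, hf, he⟩ := exists_lift_map P P' φ hφ
  obtain ⟨Ψ, hΨ, hp', hf', -⟩ := exists_lift_map P' P φ.symm hφ.symm
  refine ⟨{ toFun := Φ
            invFun := Ψ
            left_inv := comp_eq_id_of_preservesAt hΦ hΨ (fun b => by rw [hp', hp]; simp) hf hf'
            right_inv := comp_eq_id_of_preservesAt hΨ hΦ (fun b => by rw [hp, hp']; simp) hf' hf
            contMDiff_toFun := hΦ
            contMDiff_invFun := hΨ }, hp, preservedBy_iff.2 hf, he, fun Θ hΘ hΘ' => ?_⟩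
  refine Diffeomorph.ext fun b => ?_
  exact eq_of_preservesAt (P := P) (P' := P') isOpen_univ Θ.contMDiff.contMDiffOn hΦ.contMDiffOn
    (fun b _ => by rw [hΘ, hp]) (fun b _ => preservedBy_iff.1 hΘ' b) (fun b _ => hf b) (mem_univ b)

/-! ### Descending equivariant diffeomorphisms -/

/-- The differential of a section through `b` is a right inverse. -/
theorem surjective_mfderiv_proj (P : AdaptedBundle D) (b : P.carrier) :
    Function.Surjective (mfderiv (𝓡 21) (𝓡 6) P.proj b) := by
  obtain ⟨U, hU, hbU, s, g, hs, hsp, -, hg⟩ := P.principal.locally_trivial (P.proj b)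
  have hs' : ContMDiffOn (𝓡 6) (𝓡 21) ∞ (fun x => P.act (s x) (g b)) U :=
    P.principal.contMDiffOn_act hs contMDiffOn_const
  have hb : P.act (s (P.proj b)) (g b) = b := hg b hbU
  have h1 : P.proj ∘ (fun x => P.act (s x) (g b)) =ᶠ[𝓝 (P.proj b)] id :=
    Filter.eventuallyEq_of_mem (hU.mem_nhds hbU) fun x hx => by
      simp only [Function.comp_apply, P.principal.proj_act, hsp x hx, id]
  have h2 := h1.mfderiv_eq (I := 𝓡 6) (I' := 𝓡 6)
  rw [mfderiv_comp (I := 𝓡 6) (I' := 𝓡 21) (I'' := 𝓡 6) _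
    ((P.principal.smooth_proj _).mdifferentiableAt (by simp))
    ((hs'.contMDiffAt (hU.mem_nhds hbU)).mdifferentiableAt (by simp)), mfderiv_id] at h2
  intro w
  have key : ∀ {b'}, b' = b → ∀ (u : EuclideanSpace ℝ (Fin 21)),
      (mfderiv (𝓡 21) (𝓡 6) P.proj b' u : E6) = mfderiv (𝓡 21) (𝓡 6) P.proj b u := by
    rintro b' rfl u; rfl
  exact ⟨_, (key hb _).symm.trans (congrArg (fun L : E6 →L[ℝ] E6 => L w) h2)⟩

theorem exists_descended_map (Φ : P.carrier → P'.carrier) (hΦ : ContMDiff (𝓡 21) (𝓡 21) ∞ Φ)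
    (he : ∀ b h, Φ (P.act b h) = P'.act (Φ b) h) : ∃ φ : M → M', ContMDiff (𝓡 6) (𝓡 6) ∞ φ ∧
      ∀ b, P'.proj (Φ b) = φ (P.proj b) := by
  choose β hβ using P.principal.surjective
  have hp : ∀ b, P'.proj (Φ b) = P'.proj (Φ (β (P.proj b))) := fun b => by
    obtain ⟨k, hk⟩ := P.principal.exists_act (hβ (P.proj b))
    conv_lhs => rw [← hk]
    rw [he, P'.principal.proj_act]
  refine ⟨fun x => P'.proj (Φ (β x)), fun x => ?_, hp⟩
  obtain ⟨U, hU, hxU, s, g, hs, hsp, -, hg⟩ := P.principal.locally_trivial x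
  have h1 := (P'.principal.smooth_proj.comp hΦ).comp_contMDiffOn hs
  refine (h1.contMDiffAt (hU.mem_nhds hxU)).congr_of_eventuallyEq ?_
  filter_upwards [hU.mem_nhds hxU] with y hy
  simp only [Function.comp_apply]
  rw [hp (s y), hsp y hy]

/-- Equivariance makes `Φ` and its inverse descend. A vector of `M` lifts to the bundle, where
membership of its image in the plane is the vanishing of the `θ_i`, and these are preserved by `Φ`.
-/
theorem existsUnique_descended_diffeomorph (Φ : P.carrier ≃ₘ⟮𝓡 21, 𝓡 21⟯ P'.carrier)
    [IsManifold (𝓡 6) ∞ M']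
    (he : ∀ b h, Φ (P.act b h) = P'.act (Φ b) h) (hf : P.forms.PreservedBy P'.forms Φ) :
    ∃! φ : M ≃ₘ⟮𝓡 6, 𝓡 6⟯ M', PreservesPlanes D D' φ ∧ ∀ b, P'.proj (Φ b) = φ (P.proj b) := by
  obtain ⟨φ, hφ, hφp⟩ := exists_descended_map Φ Φ.contMDiff he
  obtain ⟨ψ, hψ, hψp⟩ := exists_descended_map Φ.symm Φ.symm.contMDiff fun b h => by
    refine Φ.injective (Eq.trans (b := P'.act b h) (Φ.apply_symm_apply _) ?_)
    refine Eq.trans ?_ (he _ _).symm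
    rw [Φ.apply_symm_apply]
  let φ' : M ≃ₘ⟮𝓡 6, 𝓡 6⟯ M' :=
    { toFun := φ
      invFun := ψ
      left_inv := fun x => by
        obtain ⟨b, rfl⟩ := P.principal.surjective x
        rw [← hφp, ← hψp]; simp
      right_inv := fun x => by
        obtain ⟨b, rfl⟩ := P'.principal.surjective x
        rw [← hψp, ← hφp]; simp
      contMDiff_toFun := hφ
      contMDiff_invFun := hψ }
  refine ⟨φ', ⟨(preservesPlanes_iff φ').2 fun x w => ?_, hφp⟩, ?_⟩
  · obtain ⟨b, rfl⟩ := P.principal.surjective x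
    obtain ⟨v, rfl⟩ := surjective_mfderiv_proj P b w
    have h1 := mfderiv_comp (I := 𝓡 21) (I' := 𝓡 6) (I'' := 𝓡 6) b
      ((hφ (P.proj b)).mdifferentiableAt (by simp))
      ((P.principal.smooth_proj b).mdifferentiableAt (by simp))
    have h2 := mfderiv_comp (I := 𝓡 21) (I' := 𝓡 21) (I'' := 𝓡 6) b
      ((P'.principal.smooth_proj (Φ b)).mdifferentiableAt (by simp))
      ((Φ.contMDiff b).mdifferentiableAt (by simp))
    have h3 : P'.proj ∘ Φ = φ ∘ P.proj := funext hφp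
    rw [h3, h1] at h2
    rw [P.adapted]
    have h4 := P'.adapted (Φ b) (mfderiv (𝓡 21) (𝓡 21) Φ b v)
    have h5 : ∀ i, P'.forms.theta i (Φ b) (mfderiv (𝓡 21) (𝓡 21) Φ b v) = P.forms.theta i b v :=
      fun i => congrArg (fun η : OneForm 21 P.carrier => η b v) (hf.1 i)
    simp only [h5] at h4
    rw [← h4]
    refine Iff.trans (mem_congr_point (hφp b) _) (iff_of_eq ?_)
    exact congrArg (fun L : EuclideanSpace ℝ (Fin 21) →L[ℝ] E6 => L v ∈ D' (φ (P.proj b))) h2.symm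
  · rintro χ ⟨-, hχ⟩
    refine Diffeomorph.ext fun x => ?_
    obtain ⟨b, rfl⟩ := P.principal.surjective x
    rw [← hχ, hφp]
    rfl

end Lifts

/-! ### Pullbacks of gauges -/

section Pull

variable {X Y Z : Type*} [NormedAddCommGroup X] [NormedSpace ℝ X] [NormedAddCommGroup Y]
  [NormedSpace ℝ Y] [NormedAddCommGroup Z] [NormedSpace ℝ Z]

/-- The pullback of a gauge. -/
def pullGauge (A : Y → Y →L[ℝ] Mat) (f : X → Y) (x : X) : X →L[ℝ] Mat := (A (f x)).comp (fderiv ℝ f x)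

theorem pullGauge_apply (A : Y → Y →L[ℝ] Mat) (f : X → Y) (x v : X) :
    pullGauge A f x v = A (f x) (fderiv ℝ f x v) := rfl

theorem gaugeH_congr {A A' : X → X →L[ℝ] Mat} {h h' : X → H} {x : X} (hA : A x = A' x)
    (hh : h =ᶠ[𝓝 x] h') : gaugeH A h x = gaugeH A' h' x := by
  ext1 v
  have h1 : (fun z => H.mat (h z)) =ᶠ[𝓝 x] fun z => H.mat (h' z) := hh.fun_comp H.mat
  rw [gaugeH_apply, gaugeH_apply, hA, hh.eq_of_nhds, maurerCartan, maurerCartan, h1.fderiv_eq,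
    hh.eq_of_nhds]

theorem pullGauge_comp (A : Z → Z →L[ℝ] Mat) {g : Y → Z} {f : X → Y} {x : X}
    (hg : DifferentiableAt ℝ g (f x)) (hf : DifferentiableAt ℝ f x) :
    pullGauge (pullGauge A g) f x = pullGauge A (fun x => g (f x)) x := by
  ext1 v
  simp only [pullGauge_apply]
  have := fderiv_comp (g := g) x hg hf
  rw [show (fun x => g (f x)) = g ∘ f from rfl, this]
  rfl

theorem pullGauge_congr (A : Y → Y →L[ℝ] Mat) {f g : X → Y} {x : X} (h : f =ᶠ[𝓝 x] g) :
    pullGauge A f x = pullGauge A g x := by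
  rw [pullGauge, pullGauge, h.fderiv_eq, h.eq_of_nhds]

theorem maurerCartan_comp {h : Y → H} {f : X → Y} {x : X}
    (hh : DifferentiableAt ℝ (fun z => H.mat (h z)) (f x)) (hf : DifferentiableAt ℝ f x) (v : X) :
    maurerCartan (fun x => h (f x)) x v = maurerCartan h (f x) (fderiv ℝ f x v) := by
  have := fderiv_comp (g := fun z => H.mat (h z)) x hh hf
  rw [maurerCartan, show (fun x => H.mat (h (f x))) = (fun z => H.mat (h z)) ∘ f from rfl, this]
  rfl

theorem gaugeH_pullGauge (A : Y → Y →L[ℝ] Mat) {h : Y → H} {f : X → Y} {x : X}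
    (hh : DifferentiableAt ℝ (fun z => H.mat (h z)) (f x)) (hf : DifferentiableAt ℝ f x) :
    gaugeH (pullGauge A f) (fun x => h (f x)) x = pullGauge (gaugeH A h) f x := by
  ext1 v
  rw [gaugeH_apply, maurerCartan_comp hh hf, pullGauge_apply, pullGauge_apply, gaugeH_apply]

theorem contDiffOn_pullGauge {A : Y → Y →L[ℝ] Mat} {V : Set Y} {W : Set X} {f : X → Y}
    (hA : ContDiffOn ℝ ∞ A V) (hW : IsOpen W) (hf : ContDiffOn ℝ ∞ f W) (hm : MapsTo f W V) :
    ContDiffOn ℝ ∞ (pullGauge A f) W :=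
  ContDiffOn.clm_comp (ContDiffOn.comp (g := A) hA hf hm)
    (hf.fderiv_of_isOpen hW (m := ∞) (by simp))

variable {W V : Set E6} {A B : E6 → E6 →L[ℝ] Mat}

theorem IsGauge.pull (hA : IsGauge V A) (hV : IsOpen V) (hW : IsOpen W) {f : E6 → E6}
    (hf : ContDiffOn ℝ ∞ f W)
    (hm : MapsTo f W V) (hi : ∀ y ∈ W, Function.Injective (fderiv ℝ f y)) :
    IsGauge W (pullGauge A f) where
  smooth := contDiffOn_pullGauge hA.smooth hW hf hm
  inj y hy v h1 h2 := hi y hy (by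
    have h3 : fderiv ℝ f y v = 0 := hA.inj _ (hm hy) _ h1 h2
    rw [h3, map_zero])
  normal y hy := by
    have h1 := (hA.normal _ (hm hy)).comp (fderiv ℝ f y).toLinearMap
    have h2 : curv (pullGauge A f) y = fun v w => curv A (f y) (fderiv ℝ f y v) (fderiv ℝ f y w) := by
      ext1 v; ext1 w
      exact curv_pullback ((hA.smooth.contDiffAt (hV.mem_nhds (hm hy))).differentiableAt (by simp))
        (hf.contDiffAt (hW.mem_nhds hy)) v w
    rw [h2]
    exact h1

/-- `h⁻¹ k` fixes the gauge `A`. -/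
theorem eq_of_gaugeH_eq (hW : IsOpen W) (hA : IsGauge W A) {h k : E6 → H} (hh : SmoothH h W)
    (hk : SmoothH k W) (h1 : ∀ y ∈ W, gaugeH B h y = A y) (h2 : ∀ y ∈ W, gaugeH B k y = A y) {y : E6}
    (hy : y ∈ W) : h y = k y := by
  refine inv_mul_eq_one.1 (eq_one_of_gaugeH_eq hW hA (hh.inv.mul hk) (fun z hz => ?_) hy)
  have h3 := gaugeH_gaugeH B (hh.differentiableAt hW hz) ((hh.inv.mul hk).differentiableAt hW hz)
  simp only [mul_inv_cancel_left] at h3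
  rw [gaugeH_congr (h1 z hz).symm Filter.EventuallyEq.rfl, h3, h2 z hz]

end Pull

/-! ### Gauges of plane fields on manifolds -/

theorem mlieBracket_eq_lieBracket (V W : ∀ y : E6, TangentSpace 𝓘(ℝ, E6) y) (y : E6) :
    VectorField.mlieBracket 𝓘(ℝ, E6) V W y = VectorField.lieBracket ℝ V W y := by
  rw [← VectorField.mlieBracketWithin_univ, VectorField.mlieBracketWithin_eq_lieBracketWithin]
  exact congrFun (VectorField.lieBracketWithin_univ (𝕜 := ℝ) (V := (V : E6 → E6)) (W := (W : E6 → E6))) y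

section Linear

variable {V V' : Type*} [AddCommGroup V] [Module ℝ V] [AddCommGroup V'] [Module ℝ V'] (e : V ≃ₗ[ℝ] V')

theorem linearIndependent_six_map {a b c a' b' c' : V} (h : LinearIndependent ℝ ![a, b, c, a', b', c']) :
    LinearIndependent ℝ ![e a, e b, e c, e a', e b', e c'] := by
  have h1 := h.map' e.toLinearMap e.ker
  have h2 : e.toLinearMap ∘ ![a, b, c, a', b', c'] = ![e a, e b, e c, e a', e b', e c'] := by
    ext1 i
    fin_cases i <;> rfl
  rwa [h2] at h1

theorem map_mem_span_range_iff (f : Fin 3 → V) (x : V) :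
    e x ∈ Submodule.span ℝ (range fun i => e (f i)) ↔ x ∈ Submodule.span ℝ (range f) := by
  rw [show (fun i => e (f i)) = e.toLinearMap ∘ f from rfl, range_comp, Submodule.span_image]
  exact e.injective.mem_set_image

end Linear

section LocalGauge

variable {M : Type u} [TopologicalSpace M] [ChartedSpace (EuclideanSpace ℝ (Fin 6)) M]
  [IsManifold (𝓡 6) ∞ M] {D : ∀ x : M, Submodule ℝ (TangentSpace (𝓡 6) x)}

/-- The spanning fields are pulled back to a chart; brackets commute with pullback, so the six
fields stay independent and `exists_isGauge` applies. -/
theorem exists_local_gauge (hD : IsMaximallyNonintegrable D) (x : M) :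
    ∃ (μ : E6 → M) (ν : M → E6) (W : Set E6) (U : Set M) (A : E6 → E6 →L[ℝ] Mat),
      IsParam μ ν W U ∧ x ∈ U ∧ IsGauge W A ∧
      ∀ y ∈ W, ∀ v : E6, th (A y v) = 0 ↔ mfderiv 𝓘(ℝ, E6) (𝓡 6) μ y v ∈ D (μ y) := by
  have m1 : IsManifold (𝓡 6) 1 M := IsManifold.of_le (m := 1) (n := ∞) (by simp)
  have m2 : IsManifold (𝓡 6) (minSmoothness ℝ 2) M := IsManifold.of_le (n := ∞) two_le_smooth
  have m3 : IsManifold (𝓡 6) (minSmoothness ℝ 3) M := IsManifold.of_le (n := ∞) (by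
    simp only [minSmoothness_of_isRCLikeNormedField]
    exact WithTop.coe_le_coe.2 (le_top : (3 : ℕ∞) ≤ ⊤))
  obtain ⟨U, hU, hxU, X, hX, hXD⟩ := hD x
  have hμ := (isParam_extChartAt x).restrict hU
  set μ := (extChartAt (𝓡 6) x).symm
  set W := (extChartAt (𝓡 6) x).target ∩ μ ⁻¹' U
  have hW : IsOpen W := hμ.isOpen_dom
  have hinv : ∀ y ∈ W, (mfderiv 𝓘(ℝ, E6) (𝓡 6) μ y).IsInvertible := fun y hy => by
    have h := isInvertible_mfderivWithin_extChartAt_symm (I := 𝓡 6) hy.1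
    rwa [ModelWithCorners.range_eq_univ, mfderivWithin_univ] at h
  have hμy : ∀ y ∈ W, ContMDiffAt 𝓘(ℝ, E6) (𝓡 6) ∞ μ y := fun y hy =>
    hμ.smooth.contMDiffAt (hW.mem_nhds hy)
  have hXy : ∀ i, ∀ y ∈ W, ContMDiffAt (𝓡 6) (𝓡 6).tangent ∞
      (fun y => (⟨y, X i y⟩ : TangentBundle (𝓡 6) M)) (μ y) := fun i y hy =>
    (hX i).contMDiffAt (hU.mem_nhds hy.2)
  let Y : Fin 3 → E6 → E6 := fun i => VectorField.mpullback 𝓘(ℝ, E6) (𝓡 6) μ (X i)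
  have hY : ∀ i, ContDiffOn ℝ ∞ (Y i) W := fun i y hy => by
    have h1 := ContMDiffAt.mpullback_vectorField_preimage (hXy i y hy) (hμy y hy) (hinv y hy) (by simp)
    exact (contMDiffAt_vectorSpace_iff_contDiffAt.1 h1).contDiffWithinAt
  have hbr : ∀ i j, ∀ y ∈ W, VectorField.lieBracket ℝ (Y i) (Y j) y =
      (mfderiv 𝓘(ℝ, E6) (𝓡 6) μ y).inverse (VectorField.mlieBracket (𝓡 6) (X i) (X j) (μ y)) := by
    intro i j y hy
    have h1 := VectorField.mpullback_mlieBracket (n := ∞) ((hXy i y hy).mdifferentiableAt (by simp))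
      ((hXy j y hy).mdifferentiableAt (by simp)) (hμy y hy) two_le_smooth
    exact (mlieBracket_eq_lieBracket (Y i) (Y j) y).symm.trans h1.symm
  have hli : ∀ y ∈ W, LinearIndependent ℝ ![Y 0 y, Y 1 y, Y 2 y,
      VectorField.lieBracket ℝ (Y 1) (Y 2) y,
      VectorField.lieBracket ℝ (Y 2) (Y 0) y, VectorField.lieBracket ℝ (Y 0) (Y 1) y] := by
    intro y hy
    obtain ⟨e, he⟩ := hinv y hy
    rw [hbr 1 2 y hy, hbr 2 0 y hy, hbr 0 1 y hy]
    have h2 : ∀ i, Y i y = e.symm (X i (μ y)) := fun i => by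
      change (mfderiv 𝓘(ℝ, E6) (𝓡 6) μ y).inverse (X i (μ y)) = _
      rw [← he, ContinuousLinearMap.inverse_equiv]
      rfl
    rw [h2, h2, h2, ← he, ContinuousLinearMap.inverse_equiv]
    exact linearIndependent_six_map e.symm.toLinearEquiv (hXD (μ y) hy.2).2
  obtain ⟨A, hA, hAD⟩ := exists_isGauge hW hY hli
  refine ⟨μ, _, W, _, A, hμ, ⟨mem_extChartAt_source _, hxU⟩, hA, fun y hy v => ?_⟩
  rw [hAD y hy, (hXD (μ y) hy.2).1]
  obtain ⟨e, he⟩ := hinv y hy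
  have h2 : ∀ i, X i (μ y) = e (Y i y) := fun i => by
    change X i (μ y) = e ((mfderiv 𝓘(ℝ, E6) (𝓡 6) μ y).inverse (X i (μ y)))
    rw [← he, ContinuousLinearMap.inverse_equiv]
    exact (e.apply_symm_apply _).symm
  rw [funext h2, ← he]
  exact (map_mem_span_range_iff e.toLinearEquiv (fun i => Y i y) v).symm

/-- Local normal gauges of a plane field, with their transition functions. -/
structure GaugeAtlas (D : ∀ x : M, Submodule ℝ (TangentSpace (𝓡 6) x)) where
  μ : M → E6 → M
  ν : M → M → E6
  W : M → Set E6
  U : M → Set M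
  A : M → E6 → E6 →L[ℝ] Mat
  T : M → M → M → H
  param : ∀ i, IsParam (μ i) (ν i) (W i) (U i)
  mem : ∀ i, i ∈ U i
  gauge : ∀ i, IsGauge (W i) (A i)
  adapted : ∀ i, ∀ y ∈ W i, ∀ v : E6, th (A i y v) = 0 ↔ mfderiv 𝓘(ℝ, E6) (𝓡 6) (μ i) y v ∈ D (μ i y)
  smooth_T : ∀ i j, SmoothH (fun y => T i j (μ i y)) (W i ∩ μ i ⁻¹' U j)
  gauge_T : ∀ i j, ∀ y ∈ W i ∩ μ i ⁻¹' U j,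
    gaugeH (pullGauge (A j) fun y => ν j (μ i y)) (fun y => T i j (μ i y)) y = A i y

theorem IsParam.contDiffOn_transition {μ μ' : E6 → M} {ν ν' : M → E6} {W W' : Set E6} {U U' : Set M}
    (h : IsParam μ ν W U) (h' : IsParam μ' ν' W' U') :
    ContDiffOn ℝ ∞ (fun y => ν' (μ y)) (W ∩ μ ⁻¹' U') :=
  contMDiffOn_iff_contDiffOn.1 (h'.smooth_inv.comp (h.smooth.mono inter_subset_left) fun y hy => hy.2)

theorem IsParam.isOpen_inter {μ : E6 → M} {ν : M → E6} {W : Set E6} {U U' : Set M}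
    (h : IsParam μ ν W U) (hU' : IsOpen U') : IsOpen (W ∩ μ ⁻¹' U') :=
  h.smooth.continuousOn.isOpen_inter_preimage h.isOpen_dom hU'

theorem IsParam.injective_fderiv_transition {μ μ' : E6 → M} {ν ν' : M → E6} {W W' : Set E6}
    {U U' : Set M} (h : IsParam μ ν W U) (h' : IsParam μ' ν' W' U') {y : E6} (hy : y ∈ W ∩ μ ⁻¹' U') :
    Function.Injective (fderiv ℝ (fun y => ν' (μ y)) y) := by
  have ho := h.isOpen_inter h'.isOpen_im
  have h1 : (fun y => ν (μ' (ν' (μ y)))) =ᶠ[𝓝 y] id :=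
    Filter.eventuallyEq_of_mem (ho.mem_nhds hy) fun z hz => by
      rw [h'.right_inv _ hz.2, h.left_inv _ hz.1, id]
  have h2 : ν' (μ y) ∈ W' ∩ μ' ⁻¹' U := ⟨h'.mapsTo_inv hy.2, by
    rw [mem_preimage, h'.right_inv _ hy.2]; exact h.mapsTo hy.1⟩
  have h3 := fderiv_comp (g := fun y => ν (μ' y)) (f := fun y => ν' (μ y)) y
    (((h'.contDiffOn_transition h).contDiffAt ((h'.isOpen_inter h.isOpen_im).mem_nhds h2)).differentiableAt
      (by simp))
    (((h.contDiffOn_transition h').contDiffAt (ho.mem_nhds hy)).differentiableAt (by simp))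
  have h4 := h1.fderiv_eq (𝕜 := ℝ)
  rw [show (fun y => ν (μ' (ν' (μ y)))) = (fun y => ν (μ' y)) ∘ fun y => ν' (μ y) from rfl, h3,
    fderiv_id] at h4
  intro v w hvw
  have h5 : ∀ u : E6, fderiv ℝ (fun y => ν (μ' y)) (ν' (μ y)) (fderiv ℝ (fun y => ν' (μ y)) y u) = u :=
    fun u => congrArg (fun L : E6 →L[ℝ] E6 => L u) h4
  rw [← h5 v, ← h5 w, hvw]

theorem nonempty_gaugeAtlas (hD : IsMaximallyNonintegrable D) : Nonempty (GaugeAtlas D) := by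
  choose μ ν W U A hμ hm hA hAD using exists_local_gauge hD
  have hT : ∀ i j, ∃ h : E6 → H, SmoothH h (W i ∩ μ i ⁻¹' U j) ∧ ∀ y ∈ W i ∩ μ i ⁻¹' U j,
      gaugeH (pullGauge (A j) fun y => ν j (μ i y)) h y = A i y := fun i j => by
    have ho := (hμ i).isOpen_inter (hμ j).isOpen_im
    refine exists_gauge_eq ho ((hA i).mono inter_subset_left)
      ((hA j).pull (hμ j).isOpen_dom ho ((hμ i).contDiffOn_transition (hμ j))
        (fun y hy => (hμ j).mapsTo_inv hy.2)
        fun y hy => (hμ i).injective_fderiv_transition (hμ j) hy) fun y hy v => ?_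
    rw [hAD i y hy.1, pullGauge_apply, hAD j _ ((hμ j).mapsTo_inv hy.2)]
    have h2 : μ i =ᶠ[𝓝 y] μ j ∘ fun y => ν j (μ i y) :=
      Filter.eventuallyEq_of_mem (ho.mem_nhds hy) fun z hz => ((hμ j).right_inv _ hz.2).symm
    have h3 := h2.mfderiv_eq (I := 𝓘(ℝ, E6)) (I' := 𝓡 6)
    have hd : DifferentiableAt ℝ (fun y => ν j (μ i y)) y :=
      (((hμ i).contDiffOn_transition (hμ j)).contDiffAt (ho.mem_nhds hy)).differentiableAt (by simp)
    rw [mfderiv_comp (I := 𝓘(ℝ, E6)) (I' := 𝓘(ℝ, E6)) (I'' := 𝓡 6) y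
      (((hμ j).smooth.contMDiffAt ((hμ j).isOpen_dom.mem_nhds
        ((hμ j).mapsTo_inv hy.2))).mdifferentiableAt (by simp)) hd.mdifferentiableAt,
      mfderiv_eq_fderiv] at h3
    rw [h3]
    exact mem_congr_point h2.eq_of_nhds _
  choose h hh hg using hT
  have hinv : ∀ i j y, y ∈ W i ∩ μ i ⁻¹' U j → h i j (ν i (μ i y)) = h i j y := fun i j y hy => by
    rw [(hμ i).left_inv y hy.1]
  -- The transition maps are transferred from coordinates to points of `M`, so that the cocycle
  -- condition can be stated without coordinate changes.
  refine ⟨⟨μ, ν, W, U, A, fun i j x => h i j (ν i x), hμ, hm, hA, hAD,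
    fun i j => (hh i j).congr (hinv i j), fun i j y hy => ?_⟩⟩
  rw [← hg i j y hy]
  exact gaugeH_congr rfl (Filter.eventuallyEq_of_mem
    (((hμ i).isOpen_inter (hμ j).isOpen_im).mem_nhds hy) (hinv i j))

namespace GaugeAtlas

variable (G : GaugeAtlas D)

theorem isOpen_dom (i j : M) : IsOpen (G.W i ∩ G.μ i ⁻¹' G.U j) :=
  (G.param i).isOpen_inter (G.param j).isOpen_im

/-- Both sides transform the gauge indexed by `k`, pulled back to the chart `i`, into the gauge
indexed by `i`. Such a transformation is unique. -/
theorem T_mul {i j k x : M} (hi : x ∈ G.U i) (hj : x ∈ G.U j) (hk : x ∈ G.U k) :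
    G.T j k x * G.T i j x = G.T i k x := by
  set V := G.W i ∩ G.μ i ⁻¹' (G.U j ∩ G.U k)
  have hV : IsOpen V := (G.param i).isOpen_inter ((G.param j).isOpen_im.inter (G.param k).isOpen_im)
  have hVj : V ⊆ G.W i ∩ G.μ i ⁻¹' G.U j := fun y hy => ⟨hy.1, hy.2.1⟩
  have hVk : V ⊆ G.W i ∩ G.μ i ⁻¹' G.U k := fun y hy => ⟨hy.1, hy.2.2⟩
  have hy : G.ν i x ∈ V := ⟨(G.param i).mapsTo_inv hi, by
    rw [mem_preimage, (G.param i).right_inv x hi]; exact ⟨hj, hk⟩⟩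
  have hτ : ContDiffOn ℝ ∞ (fun y => G.ν j (G.μ i y)) V :=
    ((G.param i).contDiffOn_transition (G.param j)).mono hVj
  have hτV : MapsTo (fun y => G.ν j (G.μ i y)) V (G.W j ∩ G.μ j ⁻¹' G.U k) := fun y hy =>
    ⟨(G.param j).mapsTo_inv hy.2.1, by
      rw [mem_preimage, (G.param j).right_inv _ hy.2.1]; exact hy.2.2⟩
  have hjk : SmoothH (fun y => G.T j k (G.μ i y)) V :=
    ((G.smooth_T j k).comp hτ hτV).congr fun y hy => by rw [(G.param j).right_inv _ hy.2.1]
  have hij := (G.smooth_T i j).mono hVj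
  have h1 := eq_of_gaugeH_eq (B := pullGauge (G.A k) fun y => G.ν k (G.μ i y)) hV
    ((G.gauge i).mono inter_subset_left) (hjk.mul hij) ((G.smooth_T i k).mono hVk) (fun y hy => ?_)
    (fun y hy => G.gauge_T i k y (hVk hy)) hy
  · simp only [(G.param i).right_inv x hi] at h1
    exact h1
  · have hd : DifferentiableAt ℝ (fun y => G.ν j (G.μ i y)) y :=
      (hτ.contDiffAt (hV.mem_nhds hy)).differentiableAt (by simp)
    have h2 := gaugeH_pullGauge (pullGauge (G.A k) fun y => G.ν k (G.μ j y))
      (h := fun z => G.T j k (G.μ j z)) (f := fun y => G.ν j (G.μ i y)) (x := y)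
      ((G.smooth_T j k).differentiableAt (G.isOpen_dom j k) (hτV hy)) hd
    have h3 : pullGauge (gaugeH (pullGauge (G.A k) fun y => G.ν k (G.μ j y))
        fun z => G.T j k (G.μ j z)) (fun y => G.ν j (G.μ i y)) y =
        pullGauge (G.A j) (fun y => G.ν j (G.μ i y)) y := by
      rw [pullGauge, G.gauge_T j k _ (hτV hy)]; rfl
    rw [← gaugeH_gaugeH _ (hjk.differentiableAt hV hy) (hij.differentiableAt hV hy),
      ← G.gauge_T i j y (hVj hy), ← gaugeH_congr (h2.trans h3) Filter.EventuallyEq.rfl]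
    refine gaugeH_congr (gaugeH_congr ?_ ?_) Filter.EventuallyEq.rfl
    · rw [pullGauge_comp _ (f := fun y => G.ν j (G.μ i y)) (x := y) (((G.param j).contDiffOn_transition (G.param k)).contDiffAt
        ((G.isOpen_dom j k).mem_nhds (hτV hy)) |>.differentiableAt (by simp)) hd]
      refine (pullGauge_congr _ (Filter.eventuallyEq_of_mem (hV.mem_nhds hy) fun z hz => ?_)).symm
      rw [(G.param j).right_inv _ hz.2.1]
    · refine Filter.eventuallyEq_of_mem (hV.mem_nhds hy) fun z hz => ?_
      rw [(G.param j).right_inv _ hz.2.1]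

end GaugeAtlas

end LocalGauge

/-! ### Coordinates on `H` -/

abbrev HCoord : Type := (Fin 3 → Fin 3 → ℝ) × (Fin 3 → ℝ) × (Fin 3 → ℝ)

def coordOfMat (m : Mat) : HCoord := (al m, be m, tc m)

/-- Invertibility of `g` is the only constraint on `(g, b, t)`, so `H` becomes an open subset of a
space of dimension `9 + 3 + 3 = 15`. -/
def HCoord.dom : Set HCoord := {c | (Matrix.of c.1).det ≠ 0}

theorem contDiff_det_of {X : Type*} [NormedAddCommGroup X] [NormedSpace ℝ X]
    {f : X → Fin 3 → Fin 3 → ℝ} (hf : ∀ i j, ContDiff ℝ ∞ fun x => f x i j) :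
    ContDiff ℝ ∞ fun x => (Matrix.of (f x)).det := by
  simp only [Matrix.det_fin_three, Matrix.of_apply]
  fun_prop

theorem contDiff_fst_entry (i j : Fin 3) : ContDiff ℝ ∞ fun c : HCoord => c.1 i j :=
  ((contDiff_pi.1 ((contDiff_pi.1 contDiff_fst) i)) j)

theorem contDiff_snd_fst_entry (i : Fin 3) : ContDiff ℝ ∞ fun c : HCoord => c.2.1 i :=
  (contDiff_pi.1 (contDiff_fst.comp contDiff_snd)) i

theorem contDiff_snd_snd_entry (i : Fin 3) : ContDiff ℝ ∞ fun c : HCoord => c.2.2 i :=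
  (contDiff_pi.1 (contDiff_snd.comp contDiff_snd)) i

theorem isOpen_hCoord_dom : IsOpen HCoord.dom :=
  (contDiff_det_of contDiff_fst_entry).continuous.isOpen_preimage _ isOpen_ne

theorem contDiff_coordOfMat : ContDiff ℝ ∞ coordOfMat := by
  have he : ∀ i j, ContDiff ℝ ∞ fun m : Mat => m i j := fun i j => (entryL i j).contDiff
  have h1 : ∀ i j, ContDiff ℝ ∞ fun m : Mat => al m i j := fun i j => (alL i j).contDiff
  have h2 : ∀ i, ContDiff ℝ ∞ fun m : Mat => be m i := fun i => (beL i).contDiff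
  refine ContDiff.prodMk (contDiff_pi.2 fun i => contDiff_pi.2 (h1 i)) (ContDiff.prodMk
    (contDiff_pi.2 h2) (contDiff_pi.2 fun i => ?_))
  exact ((ContDiff.sum fun p _ => (he _ _).mul (he _ _)).sub
    (ContDiff.sum fun p _ => (he _ _).mul (he _ _))).div_const 2

open Classical in
/-- The element of `H` with given coordinates. -/
def ofHCoord (c : HCoord) : H :=
  if h : (Matrix.of c.1).det ≠ 0 then
    mkH (Matrix.of c.1) (Matrix.of c.1)⁻¹ c.2.1 c.2.2 (Matrix.mul_nonsing_inv _ (isUnit_iff_ne_zero.2 h))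
  else 1

theorem mat_ofHCoord {c : HCoord} (hc : c ∈ HCoord.dom) :
    H.mat (ofHCoord c) = hmat (Matrix.of c.1) (Matrix.of c.1)⁻¹ c.2.1 c.2.2 := by
  rw [ofHCoord, dif_pos (show (Matrix.of c.1).det ≠ 0 from hc), mat_mkH]

theorem coordOfMat_ofHCoord {c : HCoord} (hc : c ∈ HCoord.dom) :
    coordOfMat (H.mat (ofHCoord c)) = c := by
  have hg := Matrix.mul_nonsing_inv _ (isUnit_iff_ne_zero.2 hc)
  rw [mat_ofHCoord hc]
  refine Prod.ext ?_ (Prod.ext ?_ ?_)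
  · exact al_hmat ..
  · exact be_hmat ..
  · exact tc_hmat _ _ _ _ hg

theorem coordOfMat_mem (h : H) : coordOfMat (H.mat h) ∈ HCoord.dom := by
  have h1 := congrArg Matrix.det (gH_mul_inv h)
  rw [Matrix.det_mul, Matrix.det_one] at h1
  exact left_ne_zero_of_mul_eq_one h1

theorem ofHCoord_coordOfMat (h : H) : ofHCoord (coordOfMat (H.mat h)) = h := by
  have h1 := coordOfMat_ofHCoord (coordOfMat_mem h)
  refine H.ext_coord ?_ (congrArg (fun c : HCoord => c.2.1) h1) (congrArg (fun c : HCoord => c.2.2) h1)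
  exact congrArg (fun c : HCoord => (Matrix.of c.1 : Mat3)) h1

theorem smoothH_ofHCoord : SmoothH ofHCoord HCoord.dom := by
  have h0 : ∀ c ∈ HCoord.dom, H.mat (ofHCoord c) =
      hmat (Matrix.of c.1) (Matrix.of c.1)⁻¹ c.2.1 c.2.2 := fun c hc => mat_ofHCoord hc
  refine ContDiffOn.congr ?_ h0
  have h1 := fun i j => (contDiff_fst_entry i j).contDiffOn (s := HCoord.dom)
  have h2 := fun i => (contDiff_snd_fst_entry i).contDiffOn (s := HCoord.dom)
  have h3 := fun i => (contDiff_snd_snd_entry i).contDiffOn (s := HCoord.dom)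
  have hadj : ∀ i j, ContDiff ℝ ∞ fun c : HCoord => (Matrix.of c.1).adjugate i j := fun i j => by
    have h4 := contDiff_fst_entry
    simp only [Matrix.adjugate_fin_three, Matrix.of_apply]
    fin_cases i <;> fin_cases j <;> simp <;> fun_prop
  have h4 : ∀ i j, ContDiffOn ℝ ∞ (fun c : HCoord => (Matrix.of c.1)⁻¹ i j) HCoord.dom := fun i j => by
    simp only [Matrix.inv_def, Matrix.smul_apply, Ring.inverse_eq_inv', smul_eq_mul]
    exact ((contDiff_det_of contDiff_fst_entry).contDiffOn.inv fun c hc => hc).mul (hadj i j).contDiffOn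
  exact contDiffOn_hmat h1 h4 h2 h3

/-- Coordinates on the product of a chart of the base and `H`. -/
def totalEquiv : (E6 × HCoord) ≃L[ℝ] EuclideanSpace ℝ (Fin 21) :=
  ContinuousLinearEquiv.ofFinrankEq (by simp [Module.finrank_pi_fintype])

/-- The base coordinates. -/
def basePart : EuclideanSpace ℝ (Fin 21) →L[ℝ] E6 :=
  (ContinuousLinearMap.fst ℝ E6 HCoord).comp (totalEquiv.symm : _ →L[ℝ] _)

/-- The fibre coordinates. -/
def fibrePart : EuclideanSpace ℝ (Fin 21) →L[ℝ] HCoord :=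
  (ContinuousLinearMap.snd ℝ E6 HCoord).comp (totalEquiv.symm : _ →L[ℝ] _)

@[simp] theorem basePart_totalEquiv (p : E6 × HCoord) : basePart (totalEquiv p) = p.1 := by
  simp [basePart]

@[simp] theorem fibrePart_totalEquiv (p : E6 × HCoord) : fibrePart (totalEquiv p) = p.2 := by
  simp [fibrePart]

theorem totalEquiv_parts (z : EuclideanSpace ℝ (Fin 21)) :
    totalEquiv (basePart z, fibrePart z) = z := by
  simp [basePart, fibrePart]

/-- The element of `H` with the given fibre coordinates. -/
def fibreH (z : EuclideanSpace ℝ (Fin 21)) : H := ofHCoord (fibrePart z)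

/-- The coordinate domain over `W`. -/
def totalDom (W : Set E6) : Set (EuclideanSpace ℝ (Fin 21)) :=
  basePart ⁻¹' W ∩ fibrePart ⁻¹' HCoord.dom

theorem isOpen_totalDom {W : Set E6} (hW : IsOpen W) : IsOpen (totalDom W) :=
  (hW.preimage basePart.continuous).inter (isOpen_hCoord_dom.preimage fibrePart.continuous)

theorem smoothH_fibreH (W : Set E6) : SmoothH fibreH (totalDom W) :=
  smoothH_ofHCoord.comp fibrePart.contDiff.contDiffOn fun _ hz => hz.2

/-- The connection form in coordinates defined by the gauge `A`. -/
def totalGauge (A : E6 → E6 →L[ℝ] Mat) : EuclideanSpace ℝ (Fin 21) →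
    EuclideanSpace ℝ (Fin 21) →L[ℝ] Mat :=
  gaugeH (pullGauge A basePart) fibreH

section

variable {W : Set E6} {A : E6 → E6 →L[ℝ] Mat}

theorem totalGauge_apply (z v : EuclideanSpace ℝ (Fin 21)) : totalGauge A z v =
    conjₗ (fibreH z) (A (basePart z) (basePart v)) + maurerCartan fibreH z v := by
  rw [totalGauge, gaugeH_apply, pullGauge_apply, ContinuousLinearMap.fderiv]

theorem contDiffOn_totalGauge (hA : ContDiffOn ℝ ∞ A W) (hW : IsOpen W) :
    ContDiffOn ℝ ∞ (totalGauge A) (totalDom W) :=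
  contDiffOn_gaugeH (isOpen_totalDom hW) (contDiffOn_pullGauge hA (isOpen_totalDom hW)
    basePart.contDiff.contDiffOn fun _ hz => hz.1) (smoothH_fibreH W)

variable (hA : IsGauge W A) (hW : IsOpen W) {z : EuclideanSpace ℝ (Fin 21)} (hz : z ∈ totalDom W)
include hA hW hz

theorem totalGauge_mem (v : EuclideanSpace ℝ (Fin 21)) : totalGauge A z v ∈ so43 := by
  exact gaugeH_mem (hA.mem hz.1 _) ((smoothH_fibreH W).differentiableAt (isOpen_totalDom hW) hz)

theorem th_totalGauge_eq_zero_iff (v : EuclideanSpace ℝ (Fin 21)) :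
    th (totalGauge A z v) = 0 ↔ th (A (basePart z) (basePart v)) = 0 := by
  have hd := (smoothH_fibreH W).differentiableAt (isOpen_totalDom hW) hz
  rw [totalGauge_apply, th_add, th_maurerCartan hd, add_zero]
  exact th_conj_eq_zero_iff _ (hA.mem hz.1 _)

/-- The components `θ` and `ω` detect the base part of a vector. On the remaining vectors the form
is the Maurer–Cartan form of `fibreH`, which detects the fibre part because the coordinates are
smooth functions of the matrix. -/
theorem totalGauge_injective : Function.Injective (totalGauge A z) := by
  have hd := (smoothH_fibreH W).differentiableAt (isOpen_totalDom hW) hz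
  refine (injective_iff_map_eq_zero _).2 fun v hv => ?_
  have h1 : th (A (basePart z) (basePart v)) = 0 :=
    (th_totalGauge_eq_zero_iff hA hW hz v).1 (by rw [hv]; ext; simp [th])
  have h2 : om (A (basePart z) (basePart v)) = 0 := by
    refine om_conj_eq_zero_imp (fibreH z) (hA.mem hz.1 _) h1 ?_
    have h3 := congrArg om hv
    rw [totalGauge_apply, om_add, om_maurerCartan hd, add_zero] at h3
    exact h3.trans (by ext; simp [om])
  have h3 : basePart v = 0 := hA.inj _ hz.1 _ h1 h2
  rw [totalGauge_apply, h3, map_zero, map_zero, zero_add, maurerCartan] at hv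
  have h4 : fderiv ℝ (fun z => H.mat (fibreH z)) z v = 0 := by
    have := congrArg (fun m => H.mat (fibreH z) * m) hv
    simpa [← mul_assoc, H.mat_mul_inv] using this
  have h5 : fibrePart =ᶠ[𝓝 z] coordOfMat ∘ fun z => H.mat (fibreH z) :=
    Filter.eventuallyEq_of_mem ((isOpen_totalDom hW).mem_nhds hz) fun y hy =>
      (coordOfMat_ofHCoord hy.2).symm
  have h6 := h5.fderiv_eq (𝕜 := ℝ)
  rw [fderiv_comp z (contDiff_coordOfMat.differentiable (by simp)).differentiableAt hd,
    ContinuousLinearMap.fderiv] at h6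
  have h7 : fibrePart v = 0 := by
    rw [h6, ContinuousLinearMap.comp_apply, h4, map_zero]
  rw [← totalEquiv_parts v, h3, h7]
  exact map_zero totalEquiv

end

/-! ### The bundle of a gauge atlas -/

section Total

variable {M : Type u} [TopologicalSpace M] [ChartedSpace (EuclideanSpace ℝ (Fin 6)) M]
  [IsManifold (𝓡 6) ∞ M] {D : ∀ x : M, Submodule ℝ (TangentSpace (𝓡 6) x)}

/-- The total space of the bundle with transition functions `G.T`. The pair `(x, h)` stands for
the point `h` of the fibre over `x` in the local trivialization indexed by `x`. -/
def GaugeAtlas.Total (_ : GaugeAtlas D) : Type u := M × H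

namespace GaugeAtlas

variable {G : GaugeAtlas D}

def proj (b : G.Total) : M := b.1

def act (b : G.Total) (h : H) : G.Total := (b.1, b.2 * h)

/-- The fibre component in the local trivialization indexed by `i`. -/
def fibre (i : M) (b : G.Total) : H := G.T (proj b) i (proj b) * b.2

variable (G) in
/-- The point with given components in the local trivialization indexed by `i`. -/
def point (i : M) (y : E6) (h : H) : G.Total := (G.μ i y, (G.T (G.μ i y) i (G.μ i y))⁻¹ * h)

theorem proj_point (i : M) (y : E6) (h : H) : proj (G.point i y h) = G.μ i y := rfl

theorem fibre_point (i : M) (y : E6) (h : H) : fibre i (G.point i y h) = h :=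
  mul_inv_cancel_left _ _

theorem point_fibre {i : M} {b : G.Total} (hb : proj b ∈ G.U i) :
    G.point i (G.ν i (proj b)) (fibre i b) = b := by
  refine Prod.ext ((G.param i).right_inv _ hb) ?_
  change (G.T (G.μ i (G.ν i (proj b))) i (G.μ i (G.ν i (proj b))))⁻¹ * (G.T (proj b) i (proj b) * b.2) = b.2
  rw [(G.param i).right_inv _ hb, inv_mul_cancel_left]

theorem proj_act (b : G.Total) (h : H) : proj (act b h) = proj b := rfl

theorem fibre_act (i : M) (b : G.Total) (h : H) : fibre i (act b h) = fibre i b * h :=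
  (mul_assoc _ _ _).symm

theorem act_point (i : M) (y : E6) (h k : H) : act (G.point i y h) k = G.point i y (h * k) :=
  Prod.ext rfl (mul_assoc _ _ _)

theorem fibre_eq {i j : M} {b : G.Total} (hi : proj b ∈ G.U i) (hj : proj b ∈ G.U j) :
    fibre j b = G.T i j (proj b) * fibre i b := by
  rw [fibre, fibre, ← mul_assoc, G.T_mul (G.mem _) hi hj]

variable (G) in
/-- The chart indexed by `i`. -/
def coordChart (i : M) : PartialEquiv G.Total (EuclideanSpace ℝ (Fin 21)) where
  toFun b := totalEquiv (G.ν i (proj b), coordOfMat (H.mat (fibre i b)))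
  invFun z := G.point i (basePart z) (fibreH z)
  source := proj ⁻¹' G.U i
  target := totalDom (G.W i)
  map_source' b hb := ⟨by simpa using (G.param i).mapsTo_inv hb, by
    simpa using coordOfMat_mem _⟩
  map_target' z hz := (G.param i).mapsTo hz.1
  left_inv' b hb := by
    simp only [basePart_totalEquiv, fibreH, fibrePart_totalEquiv, ofHCoord_coordOfMat]
    exact point_fibre hb
  right_inv' z hz := by
    rw [proj_point, fibre_point, (G.param i).left_inv _ hz.1, fibreH, coordOfMat_ofHCoord hz.2,
      totalEquiv_parts]

theorem isOpen_transition (i j : M) :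
    IsOpen (totalDom (G.W i) ∩ basePart ⁻¹' (G.W i ∩ G.μ i ⁻¹' G.U j)) :=
  (isOpen_totalDom (G.param i).isOpen_dom).inter ((G.isOpen_dom i j).preimage basePart.continuous)

theorem coordChart_source (i j : M) : ((G.coordChart i).symm.trans (G.coordChart j)).source =
    totalDom (G.W i) ∩ basePart ⁻¹' (G.W i ∩ G.μ i ⁻¹' G.U j) := by
  ext z
  exact ⟨fun h => ⟨h.1, h.1.1, h.2⟩, fun h => ⟨h.1, h.2.2⟩⟩

theorem contDiffOn_coordChart (i j : M) :
    ContDiffOn ℝ ∞ ((G.coordChart i).symm.trans (G.coordChart j))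
      ((G.coordChart i).symm.trans (G.coordChart j)).source := by
  rw [coordChart_source]
  have h1 : ContDiffOn ℝ ∞ (fun z => (G.ν j (G.μ i (basePart z)),
      coordOfMat (H.mat (G.T i j (G.μ i (basePart z)) * fibreH z))))
      (totalDom (G.W i) ∩ basePart ⁻¹' (G.W i ∩ G.μ i ⁻¹' G.U j)) := by
    refine ContDiffOn.prodMk ?_ (contDiff_coordOfMat.comp_contDiffOn (SmoothH.mul ?_ ?_))
    · exact ((G.param i).contDiffOn_transition (G.param j)).comp basePart.contDiff.contDiffOn
        fun z hz => hz.2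
    · exact (G.smooth_T i j).comp basePart.contDiff.contDiffOn fun z hz => hz.2
    · exact (smoothH_fibreH _).mono inter_subset_left
  refine (totalEquiv.contDiff.comp_contDiffOn h1).congr fun z hz => ?_
  change totalEquiv (G.ν j (proj (G.point i _ _)), coordOfMat (H.mat (fibre j (G.point i _ _)))) = _
  rw [fibre_eq (i := i) (j := j) ((G.param i).mapsTo hz.2.1) hz.2.2, fibre_point]
  rfl

variable (G) in
def chartedSpaceCore : ChartedSpaceCore (EuclideanSpace ℝ (Fin 21)) G.Total where
  atlas := range G.coordChart
  chartAt b := G.coordChart (proj b)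
  mem_chart_source b := G.mem (proj b)
  chart_mem_atlas b := mem_range_self _
  open_source := by
    rintro _ _ ⟨i, rfl⟩ ⟨j, rfl⟩
    rw [coordChart_source]
    exact isOpen_transition i j
  continuousOn_toFun := by
    rintro _ _ ⟨i, rfl⟩ ⟨j, rfl⟩
    exact (contDiffOn_coordChart i j).continuousOn

instance : TopologicalSpace G.Total := G.chartedSpaceCore.toTopologicalSpace

instance : ChartedSpace (EuclideanSpace ℝ (Fin 21)) G.Total := G.chartedSpaceCore.toChartedSpace

variable (G) in
/-- The chart indexed by `i`, as a homeomorphism. -/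
def chart (i : M) : OpenPartialHomeomorph G.Total (EuclideanSpace ℝ (Fin 21)) :=
  G.chartedSpaceCore.openPartialHomeomorph (G.coordChart i) (mem_range_self i)

theorem chartAt_eq (b : G.Total) : chartAt (EuclideanSpace ℝ (Fin 21)) b = G.chart (proj b) := rfl

theorem chart_mem_atlas (i : M) : G.chart i ∈ atlas (EuclideanSpace ℝ (Fin 21)) G.Total :=
  mem_iUnion₂.2 ⟨G.coordChart i, mem_range_self i, rfl⟩

instance : IsManifold (𝓡 21) ∞ G.Total := by
  refine isManifold_of_contDiffOn (𝓡 21) ∞ G.Total fun e e' he he' => ?_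
  obtain ⟨_, ⟨i, rfl⟩, h1⟩ := mem_iUnion₂.1 he
  obtain ⟨_, ⟨j, rfl⟩, h2⟩ := mem_iUnion₂.1 he'
  rw [mem_singleton_iff] at h1 h2
  subst h1 h2
  exact (contDiffOn_coordChart i j).mono inter_subset_left

theorem chart_apply (i : M) (b : G.Total) :
    G.chart i b = totalEquiv (G.ν i (proj b), coordOfMat (H.mat (fibre i b))) := rfl

theorem chart_symm_apply (i : M) (z : EuclideanSpace ℝ (Fin 21)) :
    (G.chart i).symm z = G.point i (basePart z) (fibreH z) := rfl

theorem chart_source (i : M) : (G.chart i).source = proj ⁻¹' G.U i := rfl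

theorem chart_target (i : M) : (G.chart i).target = totalDom (G.W i) := rfl

theorem isOpen_proj_preimage_U (i : M) : IsOpen (proj ⁻¹' G.U i : Set G.Total) :=
  (G.chart i).open_source

theorem contMDiffOn_chart (i : M) :
    ContMDiffOn (𝓡 21) 𝓘(ℝ, EuclideanSpace ℝ (Fin 21)) ∞ (G.chart i) (proj ⁻¹' G.U i) :=
  contMDiffOn_of_mem_maximalAtlas (IsManifold.subset_maximalAtlas (chart_mem_atlas i))

theorem contMDiffOn_chart_symm (i : M) :
    ContMDiffOn 𝓘(ℝ, EuclideanSpace ℝ (Fin 21)) (𝓡 21) ∞ (G.chart i).symm (totalDom (G.W i)) :=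
  contMDiffOn_symm_of_mem_maximalAtlas (IsManifold.subset_maximalAtlas (chart_mem_atlas i))

theorem contMDiffOn_base (i : M) :
    ContMDiffOn (𝓡 21) 𝓘(ℝ, E6) ∞ (fun b : G.Total => G.ν i (proj b)) (proj ⁻¹' G.U i) :=
  (basePart.contDiff.contMDiff.comp_contMDiffOn (contMDiffOn_chart i)).congr fun b _ => by
    simp only [Function.comp_apply, chart_apply, basePart_totalEquiv]

theorem contMDiffOn_fibre (i : M) : ContMDiffOn (𝓡 21) 𝓘(ℝ, Idx → Idx → ℝ) ∞
    (fun b : G.Total => H.entries (fibre i b)) (proj ⁻¹' G.U i) := by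
  have h1 := (smoothH_iff_entries.1 (smoothH_fibreH (G.W i))).contMDiffOn
  refine (h1.comp (contMDiffOn_chart i) fun b hb => (G.chart i).map_source hb).congr fun b _ => ?_
  simp only [Function.comp_apply, chart_apply, fibreH, fibrePart_totalEquiv, ofHCoord_coordOfMat]

theorem contMDiff_proj : ContMDiff (𝓡 21) (𝓡 6) ∞ (proj : G.Total → M) := fun b => by
  have h1 := (G.param (proj b)).smooth.comp (contMDiffOn_base (proj b))
    fun b' hb' => (G.param _).mapsTo_inv hb'
  have hn := (isOpen_proj_preimage_U (G := G) (proj b)).mem_nhds (G.mem (proj b))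
  refine (h1.contMDiffAt hn).congr_of_eventuallyEq ?_
  filter_upwards [hn] with b' hb'
  exact ((G.param _).right_inv _ hb').symm

section

variable {E : Type*} [NormedAddCommGroup E] [NormedSpace ℝ E] {HE : Type*} [TopologicalSpace HE]
  {I : ModelWithCorners ℝ E HE} {N : Type*} [TopologicalSpace N] [ChartedSpace HE N]

/-- Smoothness of `chart.symm (y, p)`, where `p` is the matrix of the fibre component. -/
theorem contMDiffOn_point_mat (i : M) {y : N → E6} {p : N → Mat} {W : Set N}
    (hy : ContMDiffOn I 𝓘(ℝ, E6) ∞ y W) (hp : ContMDiffOn I 𝓘(ℝ, Mat) ∞ p W)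
    (hm : MapsTo y W (G.W i)) (hm' : ∀ x ∈ W, coordOfMat (p x) ∈ HCoord.dom) :
    ContMDiffOn I (𝓡 21) ∞ (fun x => (G.chart i).symm (totalEquiv (y x, coordOfMat (p x)))) W := by
  have h1 : ContMDiffOn I 𝓘(ℝ, EuclideanSpace ℝ (Fin 21)) ∞
      (fun x => totalEquiv (y x, coordOfMat (p x))) W :=
    totalEquiv.contDiff.contMDiff.comp_contMDiffOn
      (hy.prodMk_space (contDiff_coordOfMat.contMDiff.comp_contMDiffOn hp))
  refine (contMDiffOn_chart_symm i).comp h1 fun x hx => ⟨?_, ?_⟩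
  · simpa using hm hx
  · simpa using hm' x hx

theorem chart_symm_totalEquiv (i : M) (y : E6) (h : H) :
    (G.chart i).symm (totalEquiv (y, coordOfMat (H.mat h))) = G.point i y h := by
  simp only [chart_symm_apply, basePart_totalEquiv, fibreH, fibrePart_totalEquiv, ofHCoord_coordOfMat]

theorem contMDiffOn_mat {h : N → H} {W : Set N}
    (hh : ContMDiffOn I 𝓘(ℝ, Idx → Idx → ℝ) ∞ (fun x => H.entries (h x)) W) :
    ContMDiffOn I 𝓘(ℝ, Mat) ∞ (fun x => H.mat (h x)) W :=
  (matEntries.symm.contDiff.contMDiff.comp_contMDiffOn hh).congr fun x _ => by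
    simp [← matEntries_mat]

theorem contMDiffOn_point (i : M) {y : N → E6} {h : N → H} {W : Set N}
    (hy : ContMDiffOn I 𝓘(ℝ, E6) ∞ y W)
    (hh : ContMDiffOn I 𝓘(ℝ, Idx → Idx → ℝ) ∞ (fun x => H.entries (h x)) W)
    (hm : MapsTo y W (G.W i)) :
    ContMDiffOn I (𝓡 21) ∞ (fun x => G.point i (y x) (h x)) W :=
  (contMDiffOn_point_mat i hy (contMDiffOn_mat hh) hm fun _ _ => coordOfMat_mem _).congr
    fun _ _ => (chart_symm_totalEquiv i _ _).symm

end

open Classical in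
-- In the chart indexed by `i` the action is right multiplication of the fibre component, so
-- smoothness reduces to that of matrix multiplication, and the sections `point i · 1` trivialize
-- the bundle.
theorem isPrincipalBundle : IsPrincipalBundle (proj : G.Total → M) act where
  smooth_proj := contMDiff_proj
  act_one b := Prod.ext rfl (mul_one _)
  act_mul b g h := Prod.ext rfl (mul_assoc _ _ _)
  proj_act := proj_act
  free b h he := mul_eq_left.1 (congrArg Prod.snd he : b.2 * h = b.2)
  smooth_act := by
    -- Only the values on matrices of elements of `H` matter; elsewhere `F` returns its first
    -- argument.
    refine ⟨fun p => if hp : ∃ h, H.entries h = p.2 then act p.1 hp.choose else p.1, ?_, fun b h => ?_⟩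
    · rintro ⟨b, _⟩ ⟨-, h, rfl⟩
      set i := proj b
      have hU := isOpen_proj_preimage_U (G := G) i
      have h1 : ContMDiffOn ((𝓡 21).prod 𝓘(ℝ, Idx → Idx → ℝ)) 𝓘(ℝ, E6) ∞
          (fun p : G.Total × (Idx → Idx → ℝ) => G.ν i (proj p.1)) ((proj ⁻¹' G.U i) ×ˢ range H.entries) :=
        (contMDiffOn_base i).comp contMDiffOn_fst fun p hp => hp.1
      have h2 : ContMDiffOn ((𝓡 21).prod 𝓘(ℝ, Idx → Idx → ℝ)) 𝓘(ℝ, Mat) ∞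
          (fun p : G.Total × (Idx → Idx → ℝ) => H.mat (fibre i p.1) * matEntries.symm p.2)
          ((proj ⁻¹' G.U i) ×ˢ range H.entries) := by
        have h3 : ContMDiffOn ((𝓡 21).prod 𝓘(ℝ, Idx → Idx → ℝ)) 𝓘(ℝ, Mat) ∞
          (fun p : G.Total × (Idx → Idx → ℝ) => H.mat (fibre i p.1))
            ((proj ⁻¹' G.U i) ×ˢ range H.entries) :=
          (contMDiffOn_mat (contMDiffOn_fibre i)).comp contMDiffOn_fst fun p hp => hp.1
        have h4 : ContMDiffOn ((𝓡 21).prod 𝓘(ℝ, Idx → Idx → ℝ)) 𝓘(ℝ, Mat) ∞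
            (fun p : G.Total × (Idx → Idx → ℝ) => matEntries.symm p.2)
            ((proj ⁻¹' G.U i) ×ˢ range H.entries) :=
          matEntries.symm.contDiff.contMDiff.comp_contMDiffOn contMDiffOn_snd
        exact (contDiff_fst.mul contDiff_snd : ContDiff ℝ ∞ fun q : Mat × Mat =>
          q.1 * q.2).contMDiff.comp_contMDiffOn (h3.prodMk_space h4)
      have hmat : ∀ h, matEntries.symm (H.entries h) = H.mat h := fun h => by
        rw [← matEntries_mat, ContinuousLinearEquiv.symm_apply_apply]
      have h5 := contMDiffOn_point_mat i h1 h2 (fun p hp => (G.param i).mapsTo_inv hp.1) (by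
        rintro ⟨b', _⟩ ⟨-, h', rfl⟩
        simp only [hmat, ← H.mat_mul]
        exact coordOfMat_mem _)
      have h6 := h5 (b, H.entries h) ⟨G.mem i, h, rfl⟩
      have h7 : ContMDiffWithinAt ((𝓡 21).prod 𝓘(ℝ, Idx → Idx → ℝ)) (𝓡 21) ∞
          (fun p : G.Total × (Idx → Idx → ℝ) => if hp : ∃ h, H.entries h = p.2 then act p.1 hp.choose
            else p.1) ((proj ⁻¹' G.U i) ×ˢ range H.entries) (b, H.entries h) := by
        refine h6.congr_of_mem ?_ ⟨G.mem i, h, rfl⟩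
        rintro ⟨b', _⟩ ⟨hb', h', rfl⟩
        have hex : ∃ h, H.entries h = H.entries h' := ⟨h', rfl⟩
        have heq : hex.choose = h' := by
          refine H.mat_injective ?_
          rw [← hmat, ← hmat, hex.choose_spec]
        simp only [hmat, ← H.mat_mul, chart_symm_totalEquiv]
        rw [dif_pos hex, heq, ← fibre_act]
        exact (point_fibre (b := act b' h') hb').symm
      refine h7.mono_of_mem_nhdsWithin ?_
      have h8 : (proj ⁻¹' G.U i) ×ˢ (univ : Set (Idx → Idx → ℝ)) ∈ 𝓝 (b, H.entries h) :=
        (hU.prod isOpen_univ).mem_nhds ⟨G.mem i, mem_univ _⟩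
      filter_upwards [mem_nhdsWithin_of_mem_nhds h8, self_mem_nhdsWithin] with p hp hp'
      exact ⟨hp.1, hp'.2⟩
    · have hex : ∃ h', H.entries h' = H.entries h := ⟨h, rfl⟩
      simp only [dif_pos hex]
      congr 1
      refine H.mat_injective (matEntries.injective ?_)
      exact hex.choose_spec
  locally_trivial x := by
    refine ⟨G.U x, (G.param x).isOpen_im, G.mem x, fun y => G.point x (G.ν x y) 1, fibre x, ?_, ?_,
      contMDiffOn_fibre x, ?_⟩
    · exact contMDiffOn_point x (G.param x).smooth_inv contMDiffOn_const (G.param x).mapsTo_inv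
    · exact fun y hy => (G.param x).right_inv y hy
    · intro b hb
      rw [act_point, one_mul, point_fibre hb]

instance [T2Space M] : T2Space G.Total := by
  refine ⟨fun b b' hne => ?_⟩
  by_cases hp : proj b = proj b'
  · have hb : b ∈ (G.chart (proj b)).source := G.mem _
    have hb' : b' ∈ (G.chart (proj b)).source := by
      rw [chart_source, mem_preimage, ← hp]; exact G.mem _
    have hne' : G.chart (proj b) b ≠ G.chart (proj b) b' := fun h =>
      hne ((G.chart (proj b)).injOn hb hb' h)
    obtain ⟨u, v, hu, hv, hbu, hbv, huv⟩ := t2_separation hne'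
    refine ⟨_, _, (G.chart (proj b)).isOpen_inter_preimage hu, (G.chart (proj b)).isOpen_inter_preimage hv,
      ⟨hb, hbu⟩, ⟨hb', hbv⟩, ?_⟩
    exact (huv.preimage _).mono inter_subset_right inter_subset_right
  · obtain ⟨u, v, hu, hv, hbu, hbv, huv⟩ := t2_separation hp
    have hc := (contMDiff_proj (G := G)).continuous
    exact ⟨_, _, hu.preimage hc, hv.preimage hc, hbu, hbv, huv.preimage _⟩

instance [SecondCountableTopology M] : SecondCountableTopology G.Total := by
  obtain ⟨s, hs, hsU⟩ := TopologicalSpace.countable_cover_nhds fun x : M =>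
    (G.param x).isOpen_im.mem_nhds (G.mem x)
  -- The preferred chart at a point depends only on its projection, so `(x, 1)` represents the chart
  -- indexed by `x`, and countably many of these cover.
  refine ChartedSpace.secondCountable_of_countable_cover (EuclideanSpace ℝ (Fin 21))
    (s := (fun x : M => ((x, 1) : M × H)) '' s) ?_ (hs.image _)
  refine eq_univ_of_forall fun b => ?_
  obtain ⟨x, hx, hbx⟩ := mem_iUnion₂.1 (hsU.symm ▸ mem_univ (proj b) : proj b ∈ ⋃ x ∈ s, G.U x)
  exact mem_iUnion₂.2 ⟨(x, 1), mem_image_of_mem _ hx, hbx⟩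

end GaugeAtlas

end Total

/-! ### The connection form on the bundle of a gauge atlas -/

section PullTotal

variable {X : Type*} [NormedAddCommGroup X] [NormedSpace ℝ X] {A : E6 → E6 →L[ℝ] Mat}

theorem pullGauge_totalGauge {W : Set E6} (hW : IsOpen W) {f : X → EuclideanSpace ℝ (Fin 21)} {x : X}
    (hf : DifferentiableAt ℝ f x) (hx : f x ∈ totalDom W) :
    pullGauge (totalGauge A) f x =
      gaugeH (pullGauge A fun x => basePart (f x)) (fun x => fibreH (f x)) x := by
  rw [totalGauge, ← gaugeH_pullGauge _ ((smoothH_fibreH W).differentiableAt (isOpen_totalDom hW) hx) hf]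
  exact gaugeH_congr (pullGauge_comp A basePart.differentiableAt hf) Filter.EventuallyEq.rfl

end PullTotal

section Connection

variable {M : Type u} [TopologicalSpace M] [ChartedSpace (EuclideanSpace ℝ (Fin 6)) M]
  [IsManifold (𝓡 6) ∞ M] {D : ∀ x : M, Submodule ℝ (TangentSpace (𝓡 6) x)}

namespace GaugeAtlas

variable {G : GaugeAtlas D}

theorem contDiffOn_chart_chart_symm (i j : M) : ContDiffOn ℝ ∞ (fun z => G.chart j ((G.chart i).symm z))
    (totalDom (G.W i) ∩ basePart ⁻¹' (G.W i ∩ G.μ i ⁻¹' G.U j)) := by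
  rw [← coordChart_source]
  exact contDiffOn_coordChart i j

/-- A change of chart multiplies the fibre component on the left by `T i j`, and `T i j` carries the
gauge `j` to the gauge `i`. Hence the local connection forms agree on overlaps, and `connection` may
be computed in any chart. -/
theorem pullGauge_chart_chart_symm (i j : M) {z : EuclideanSpace ℝ (Fin 21)}
    (hz : z ∈ totalDom (G.W i) ∩ basePart ⁻¹' (G.W i ∩ G.μ i ⁻¹' G.U j)) :
    pullGauge (totalGauge (G.A j)) (fun z => G.chart j ((G.chart i).symm z)) z =
      totalGauge (G.A i) z := by
  have hO := isOpen_transition (G := G) i j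
  have hf := ((contDiffOn_chart_chart_symm i j).contDiffAt (hO.mem_nhds hz)).differentiableAt (by simp)
  have hfz : G.chart j ((G.chart i).symm z) ∈ totalDom (G.W j) := (G.chart j).map_source hz.2.2
  have hτ : DifferentiableAt ℝ (fun y => G.ν j (G.μ i y)) (basePart z) :=
    (((G.param i).contDiffOn_transition (G.param j)).contDiffAt
      ((G.isOpen_dom i j).mem_nhds hz.2)).differentiableAt (by simp)
  have hT : DifferentiableAt ℝ (fun y => H.mat (G.T i j (G.μ i y))) (basePart z) :=
    (G.smooth_T i j).differentiableAt (G.isOpen_dom i j) hz.2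
  have hT' : DifferentiableAt ℝ (fun z => H.mat (G.T i j (G.μ i (basePart z)))) z :=
    hT.comp (f := basePart) z basePart.differentiableAt
  have hb := basePart.differentiableAt (x := z)
  have hk := (smoothH_fibreH (G.W i)).differentiableAt (isOpen_totalDom (G.param i).isOpen_dom) hz.1
  rw [pullGauge_totalGauge (G.param j).isOpen_dom hf hfz]
  have h1 : (fun z => basePart (G.chart j ((G.chart i).symm z))) = fun z => G.ν j (G.μ i (basePart z)) := by
    funext z
    rw [chart_apply, basePart_totalEquiv]; rfl
  have h2 : (fun z => fibreH (G.chart j ((G.chart i).symm z))) =ᶠ[𝓝 z]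
      fun z => G.T i j (G.μ i (basePart z)) * fibreH z := by
    filter_upwards [hO.mem_nhds hz] with w hw
    rw [chart_apply, fibreH, fibrePart_totalEquiv, ofHCoord_coordOfMat,
      fibre_eq (i := i) (j := j) ((G.param i).mapsTo hw.2.1) hw.2.2]
    exact congrArg _ (fibre_point _ _ _)
  rw [h1, gaugeH_congr (pullGauge_comp (G.A j) hτ hb).symm h2, ← gaugeH_gaugeH _ hT' hk, totalGauge]
  refine gaugeH_congr ?_ Filter.EventuallyEq.rfl
  rw [gaugeH_pullGauge _ (h := fun y => G.T i j (G.μ i y)) (f := basePart) hT hb, pullGauge,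
    G.gauge_T i j _ hz.2]
  rfl

/-- The connection form. -/
def connection (b : G.Total) : TangentSpace (𝓡 21) b →L[ℝ] Mat :=
  (totalGauge (G.A (proj b)) (G.chart (proj b) b)).comp
    (mfderiv (𝓡 21) 𝓘(ℝ, EuclideanSpace ℝ (Fin 21)) (G.chart (proj b)) b)

theorem chart_mem_totalDom (b : G.Total) : G.chart (proj b) b ∈ totalDom (G.W (proj b)) :=
  (G.chart (proj b)).map_source (G.mem _)

theorem connection_mem (b : G.Total) (v : TangentSpace (𝓡 21) b) : connection b v ∈ so43 :=
  totalGauge_mem (G.gauge _) (G.param _).isOpen_dom (chart_mem_totalDom b) _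

variable (G) in
/-- The components of the connection form. -/
def forms : FormSystem G.Total where
  theta i b := (thL i).comp (connection b)
  omega i b := (omL i).comp (connection b)
  alpha i j b := (alL i j).comp (connection b)
  beta i b := (beL i).comp (connection b)
  tau i b := (taL i).comp (connection b)

theorem gamma_forms (b : G.Total) (v : TangentSpace (𝓡 21) b) : G.forms.gamma b v = connection b v :=
  (eq_gammaMatrix (connection_mem b v)).symm

theorem gaugeOf_chart_symm (i : M) {z : EuclideanSpace ℝ (Fin 21)} (hz : z ∈ totalDom (G.W i)) :
    gaugeOf G.forms (G.chart i).symm z = totalGauge (G.A i) z := by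
  ext1 v
  have hz' : z ∈ totalDom (G.W i) ∩
      basePart ⁻¹' (G.W i ∩ G.μ i ⁻¹' G.U (proj ((G.chart i).symm z))) :=
    ⟨hz, hz.1, G.mem _⟩
  have h1 : MDifferentiableAt 𝓘(ℝ, EuclideanSpace ℝ (Fin 21)) (𝓡 21) (G.chart i).symm z :=
    ((contMDiffOn_chart_symm i).contMDiffAt
      ((isOpen_totalDom (G.param i).isOpen_dom).mem_nhds hz)).mdifferentiableAt (by simp)
  -- The index used by `connection` is the projection of the point itself, so the identity is proved
  -- for every admissible index `j`.
  have key : ∀ j, z ∈ totalDom (G.W i) ∩ basePart ⁻¹' (G.W i ∩ G.μ i ⁻¹' G.U j) →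
      totalGauge (G.A j) (G.chart j ((G.chart i).symm z))
        (mfderiv (𝓡 21) 𝓘(ℝ, EuclideanSpace ℝ (Fin 21)) (G.chart j) ((G.chart i).symm z)
          (mfderiv 𝓘(ℝ, EuclideanSpace ℝ (Fin 21)) (𝓡 21) (G.chart i).symm z v)) =
      totalGauge (G.A i) z v := by
    intro j hj
    have h2 : MDifferentiableAt (𝓡 21) 𝓘(ℝ, EuclideanSpace ℝ (Fin 21)) (G.chart j)
        ((G.chart i).symm z) :=
      ((contMDiffOn_chart j).contMDiffAt
        ((isOpen_proj_preimage_U _).mem_nhds hj.2.2)).mdifferentiableAt (by simp)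
    have h3 := mfderiv_comp_apply (I := 𝓘(ℝ, EuclideanSpace ℝ (Fin 21))) (I' := 𝓡 21)
      (I'' := 𝓘(ℝ, EuclideanSpace ℝ (Fin 21))) z h2 h1 v
    rw [← pullGauge_chart_chart_symm i j hj, pullGauge_apply, ← mfderiv_eq_fderiv]
    exact congrArg (totalGauge (G.A j) (G.chart j ((G.chart i).symm z))) h3.symm
  rw [gaugeOf_apply, gamma_forms]
  exact key _ hz'

theorem gaugeOf_point {X : Type*} [NormedAddCommGroup X] [NormedSpace ℝ X] [FiniteDimensional ℝ X]
    (i : M) {y : X → E6} {h : X → H} {x : X} (hy : DifferentiableAt ℝ y x)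
    (hh : DifferentiableAt ℝ (fun x => H.mat (h x)) x) (hx : y x ∈ G.W i) :
    gaugeOf G.forms (fun x => G.point i (y x) (h x)) x = gaugeH (pullGauge (G.A i) y) h x := by
  set f : X → EuclideanSpace ℝ (Fin 21) := fun x => totalEquiv (y x, coordOfMat (H.mat (h x))) with hf
  have hfx : f x ∈ totalDom (G.W i) := ⟨by simpa [hf] using hx, by simpa [hf] using coordOfMat_mem _⟩
  have hfd : DifferentiableAt ℝ f x := totalEquiv.differentiableAt.comp x (hy.prodMk
    ((contDiff_coordOfMat.differentiable (by simp)).differentiableAt.comp x hh))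
  have h1 : MDifferentiableAt 𝓘(ℝ, EuclideanSpace ℝ (Fin 21)) (𝓡 21) (G.chart i).symm (f x) :=
    ((contMDiffOn_chart_symm i).contMDiffAt
      ((isOpen_totalDom (G.param i).isOpen_dom).mem_nhds hfx)).mdifferentiableAt (by simp)
  simp only [← chart_symm_totalEquiv]
  rw [gaugeOf_comp G.forms (f := f) h1 hfd, gaugeOf_chart_symm i hfx]
  refine (pullGauge_totalGauge (G.param i).isOpen_dom hfd hfx).trans ?_
  simp only [hf, basePart_totalEquiv, fibreH, fibrePart_totalEquiv, ofHCoord_coordOfMat]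

end GaugeAtlas

end Connection

section Connection

variable {M : Type u} [TopologicalSpace M] [ChartedSpace (EuclideanSpace ℝ (Fin 6)) M]
  [IsManifold (𝓡 6) ∞ M] {D : ∀ x : M, Submodule ℝ (TangentSpace (𝓡 6) x)}

namespace GaugeAtlas

variable {G : GaugeAtlas D}

theorem isSmooth_comp_connection (L : Mat →L[ℝ] ℝ) :
    OneForm.IsSmooth (fun b : G.Total => L.comp (connection b) : OneForm 21 G.Total) := by
  intro b₀
  have ht : (extChartAt (𝓡 21) b₀).target = totalDom (G.W (proj b₀)) := by
    rw [extChartAt_target, modelWithCornersSelf_coe_symm, preimage_id, modelWithCornersSelf_coe, range_id,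
      inter_univ, chartAt_eq, chart_target]
  rw [ht]
  refine ContDiffOn.congr (f := fun z => L.comp (totalGauge (G.A (proj b₀)) z))
    (contDiffOn_const.clm_comp
    (contDiffOn_totalGauge (G.gauge (proj b₀)).smooth (G.param _).isOpen_dom)) fun z hz => ?_
  have h1 := gaugeOf_chart_symm (proj b₀) hz
  ext1 v
  rw [ContinuousLinearMap.comp_apply, ← h1, gaugeOf_apply, gamma_forms]
  rfl

theorem gamma_chart_symm (i : M) {z : EuclideanSpace ℝ (Fin 21)} (hz : z ∈ totalDom (G.W i))
    (u : EuclideanSpace ℝ (Fin 21)) : G.forms.gamma ((G.chart i).symm z)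
      (mfderiv 𝓘(ℝ, EuclideanSpace ℝ (Fin 21)) (𝓡 21) (G.chart i).symm z u) =
      totalGauge (G.A i) z u := by
  rw [← gaugeOf_chart_symm i hz, gaugeOf_apply]

theorem connection_injective (b : G.Total) : Function.Injective (connection b) := by
  have m1 : IsManifold (𝓡 21) 1 G.Total := IsManifold.of_le (m := 1) (n := ∞) (by simp)
  have h1 : (mfderiv (𝓡 21) 𝓘(ℝ, EuclideanSpace ℝ (Fin 21)) (G.chart (proj b)) b).IsInvertible :=
    isInvertible_mfderiv_extChartAt (I := 𝓡 21) (mem_extChartAt_source b)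
  have h2 := totalGauge_injective (G.gauge _) (G.param _).isOpen_dom (chart_mem_totalDom b)
  obtain ⟨e, he⟩ := h1
  rw [connection, ← he]
  exact h2.comp e.injective

end GaugeAtlas

section Components

abbrev Components : Type :=
  (Fin 3 → ℝ) × (Fin 3 → ℝ) × (Fin 3 → Fin 3 → ℝ) × (Fin 3 → ℝ) × (Fin 3 → ℝ)

/-- The components of a matrix in `so(4,3)`. -/
def componentsₗ : Mat →ₗ[ℝ] Components :=
  (LinearMap.pi thₗ).prod ((LinearMap.pi omₗ).prod ((LinearMap.pi fun i => LinearMap.pi (alₗ i)).prod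
    ((LinearMap.pi beₗ).prod (LinearMap.pi taₗ))))

theorem componentsₗ_apply (m : Mat) : componentsₗ m = (th m, om m, al m, be m, ta m) := rfl

theorem bijective_components {V : Type*} [AddCommGroup V] [Module ℝ V] [FiniteDimensional ℝ V]
    (hV : Module.finrank ℝ V = 21) {a : V →ₗ[ℝ] Mat} (ha : Function.Injective a)
    (hm : ∀ v, a v ∈ so43) : Function.Bijective (componentsₗ ∘ₗ a) := by
  have hi : Function.Injective (componentsₗ ∘ₗ a) := fun v w h => by
    simp only [LinearMap.comp_apply, componentsₗ_apply, Prod.mk.injEq] at h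
    exact ha (so43_ext (hm v) (hm w) h.1 h.2.1 h.2.2.1 h.2.2.2.1 h.2.2.2.2)
  refine ⟨hi, (LinearMap.injective_iff_surjective_of_finrank_eq_finrank ?_).1 hi⟩
  rw [hV]
  simp [Module.finrank_pi_fintype]

end Components

namespace GaugeAtlas

variable {G : GaugeAtlas D}

theorem bijective_components_connection (b : G.Total) :
    Function.Bijective fun v => componentsₗ (connection b v) :=
  bijective_components (V := EuclideanSpace ℝ (Fin 21)) (a := (connection b).toLinearMap)
    (finrank_euclideanSpace_fin (𝕜 := ℝ) (n := 21))
    (connection_injective b) (connection_mem b)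

theorem exists_connection_eq (b : G.Total) {m : Mat} (hm : m ∈ so43) : ∃ v, connection b v = m := by
  obtain ⟨v, hv⟩ := (bijective_components_connection b).2 (componentsₗ m)
  simp only [componentsₗ_apply, Prod.mk.injEq] at hv
  exact ⟨v, so43_ext (connection_mem b v) hm hv.1 hv.2.1 hv.2.2.1 hv.2.2.2.1 hv.2.2.2.2⟩

theorem isCoframing_forms : G.forms.IsCoframing where
  smooth_theta i := isSmooth_comp_connection (thL i)
  smooth_omega i := isSmooth_comp_connection (omL i)
  smooth_alpha i j := isSmooth_comp_connection (alL i j)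
  smooth_beta i := isSmooth_comp_connection (beL i)
  smooth_tau i := isSmooth_comp_connection (taL i)
  bijective := bijective_components_connection

theorem gaugeOf_act_chart_symm (h : H) (i : M) {z : EuclideanSpace ℝ (Fin 21)}
    (hz : z ∈ totalDom (G.W i)) (u : EuclideanSpace ℝ (Fin 21)) :
    gaugeOf G.forms ((fun b => act b h) ∘ (G.chart i).symm) z u =
      conjₗ h (totalGauge (G.A i) z u) := by
  have h0 := (smoothH_fibreH (G.W i)).differentiableAt (isOpen_totalDom (G.param i).isOpen_dom) hz
  have h1 : (fun b => act b h) ∘ (G.chart i).symm =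
      fun z => G.point i (basePart z) (fibreH z * h) := by
    funext z
    rw [Function.comp_apply, chart_symm_apply, act_point]
  have h2 : DifferentiableAt ℝ (fun z => H.mat (fibreH z * h)) z := by
    simp only [H.mat_mul]
    exact h0.mul_const _
  rw [h1, gaugeOf_point i basePart.differentiableAt h2 hz.1, ← gaugeH_gaugeH _ h0
    (differentiableAt_const _), gaugeH_apply, maurerCartan]
  simp [totalGauge]

theorem gamma_act_chart_symm (h : H) (i : M) {z : EuclideanSpace ℝ (Fin 21)}
    (hz : z ∈ totalDom (G.W i))
    (hs : Function.Surjective (mfderiv 𝓘(ℝ, EuclideanSpace ℝ (Fin 21)) (𝓡 21) (G.chart i).symm z))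
    (v : TangentSpace (𝓡 21) ((G.chart i).symm z)) :
    G.forms.gamma (act ((G.chart i).symm z) h)
        (mfderiv (𝓡 21) (𝓡 21) (fun b : G.Total => act b h) ((G.chart i).symm z) v) =
      H.mat h⁻¹ * G.forms.gamma ((G.chart i).symm z) v * H.mat h := by
  obtain ⟨(u : EuclideanSpace ℝ (Fin 21)), rfl⟩ := hs v
  have h1 : MDifferentiableAt 𝓘(ℝ, EuclideanSpace ℝ (Fin 21)) (𝓡 21) (G.chart i).symm z :=
    ((contMDiffOn_chart_symm i).contMDiffAt
      ((isOpen_totalDom (G.param i).isOpen_dom).mem_nhds hz)).mdifferentiableAt (by simp)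
  have h2 : MDifferentiableAt (𝓡 21) (𝓡 21) (fun b : G.Total => act b h) ((G.chart i).symm z) :=
    ((isPrincipalBundle.contMDiffOn_act (I := 𝓡 21) (N := G.Total) (W := univ) (k := fun _ => h)
      contMDiffOn_id contMDiffOn_const).contMDiffAt Filter.univ_mem).mdifferentiableAt (by simp)
  have h3 := gaugeOf_act_chart_symm h i hz u
  rw [gaugeOf_apply, mfderiv_comp z h2 h1] at h3
  rw [gamma_chart_symm i hz]
  exact h3

theorem isCartanConnection_forms : G.forms.IsCartanConnection act where
  bijOn b := by
    refine ⟨fun v _ => G.forms.gamma_mem b v, fun v _ w _ h => connection_injective b ?_, fun m hm => ?_⟩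
    · rwa [gamma_forms, gamma_forms] at h
    · obtain ⟨v, hv⟩ := exists_connection_eq b hm
      exact ⟨v, mem_univ _, (gamma_forms b v).trans hv⟩
  equivariant h b v := by
    have h1 := gamma_act_chart_symm (G := G) h (proj b) (chart_mem_totalDom b)
      (surjective_mfderiv_chart_symm b (mem_extChartAt_target b))
    rw [(G.chart (proj b)).left_inv (G.mem _)] at h1
    exact h1 v
  vertical b k hk0 hk := by
    set i := proj b
    have hkd : DifferentiableAt ℝ (fun t => H.mat (k t)) 0 :=
      (smoothH_iff_entries.2 (contDiffOn_univ.2 hk)).differentiableAt isOpen_univ (mem_univ _)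
    have hkd' : DifferentiableAt ℝ (fun t => H.mat (fibre i b * k t)) 0 := by
      simp only [H.mat_mul]
      exact hkd.const_mul _
    have h1 : ∀ t, act b (k t) = G.point i (G.ν i (proj b)) (fibre i b * k t) := fun t => by
      rw [← act_point, point_fibre (G.mem _)]
    have h2 := gaugeOf_point (G := G) i (y := fun _ : ℝ => G.ν i (proj b))
      (h := fun t => fibre i b * k t) (x := 0) (differentiableAt_const _) hkd'
      ((G.param i).mapsTo_inv (G.mem _))
    simp only [← h1] at h2
    have h3 : gaugeOf G.forms (fun t => act b (k t)) 0 1 = Matrix.of (deriv (fun t => H.entries (k t)) 0) := by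
      have h4 : HasDerivAt (fun t => H.entries (k t)) (matEntries (fderiv ℝ (fun t => H.mat (k t)) 0 1)) 0 :=
        (matEntries : Mat →L[ℝ] (Idx → Idx → ℝ)).hasFDerivAt.comp_hasDerivAt (0 : ℝ)
          (by rw [fderiv_apply_one_eq_deriv]; exact hkd.hasDerivAt)
      have h5 : fderiv ℝ (fun t => H.mat (fibre i b * k t)) 0 1 =
          H.mat (fibre i b) * fderiv ℝ (fun t => H.mat (k t)) 0 1 := by
        simp only [H.mat_mul]
        rw [fderiv_const_mul hkd]
        rfl
      rw [h2, h4.deriv, gaugeH_apply, maurerCartan, h5, hk0, mul_one, ← mul_assoc, H.mat_inv_mul, one_mul,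
        pullGauge_apply]
      simp
      rfl
    exact h3

theorem mfderiv_proj_mem_iff (b : G.Total) (v : TangentSpace (𝓡 21) b) :
    mfderiv (𝓡 21) (𝓡 6) (proj : G.Total → M) b v ∈ D (proj b) ↔ ∀ i, G.forms.theta i b v = 0 := by
  have key : ∀ i, ∀ z ∈ totalDom (G.W i), ∀ v : TangentSpace (𝓡 21) ((G.chart i).symm z),
      Function.Surjective (mfderiv 𝓘(ℝ, EuclideanSpace ℝ (Fin 21)) (𝓡 21) (G.chart i).symm z) →
      (mfderiv (𝓡 21) (𝓡 6) (proj : G.Total → M) ((G.chart i).symm z) v ∈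
        D (proj ((G.chart i).symm z)) ↔ th (connection ((G.chart i).symm z) v) = 0) := by
    intro i z hz v hs
    obtain ⟨(u : EuclideanSpace ℝ (Fin 21)), rfl⟩ := hs v
    have hW := (G.param i).isOpen_dom
    have h1 : MDifferentiableAt 𝓘(ℝ, EuclideanSpace ℝ (Fin 21)) (𝓡 21) (G.chart i).symm z :=
      ((contMDiffOn_chart_symm i).contMDiffAt
        ((isOpen_totalDom hW).mem_nhds hz)).mdifferentiableAt (by simp)
    have h2 : MDifferentiableAt (𝓡 21) (𝓡 6) (proj : G.Total → M) ((G.chart i).symm z) :=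
      (contMDiff_proj _).mdifferentiableAt (by simp)
    have h3 := mfderiv_comp_apply (I := 𝓘(ℝ, EuclideanSpace ℝ (Fin 21))) (I' := 𝓡 21)
      (I'' := 𝓡 6) z h2 h1 u
    have h4 : MDifferentiableAt 𝓘(ℝ, E6) (𝓡 6) (G.μ i) (basePart z) :=
      ((G.param i).smooth.contMDiffAt (hW.mem_nhds hz.1)).mdifferentiableAt (by simp)
    have h5 := mfderiv_comp_apply (I := 𝓘(ℝ, EuclideanSpace ℝ (Fin 21))) (I' := 𝓘(ℝ, E6))
      (I'' := 𝓡 6) z h4 basePart.differentiableAt.mdifferentiableAt u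
    rw [mfderiv_eq_fderiv, ContinuousLinearMap.fderiv] at h5
    rw [← gamma_forms, gamma_chart_symm i hz,
      th_totalGauge_eq_zero_iff (G.gauge i) hW hz, G.adapted i _ hz.1]
    have h6 : mfderiv 𝓘(ℝ, EuclideanSpace ℝ (Fin 21)) (𝓡 6) ((proj : G.Total → M) ∘ (G.chart i).symm) z u =
      mfderiv 𝓘(ℝ, EuclideanSpace ℝ (Fin 21)) (𝓡 6) (G.μ i ∘ basePart) z u := rfl
    rw [← h3, h6, h5]
    rfl
  have h1 := key (proj b) _ (chart_mem_totalDom b)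
  rw [(G.chart (proj b)).left_inv (G.mem _)] at h1
  refine (h1 v (surjective_mfderiv_chart_symm b (mem_extChartAt_target b))).trans ?_
  exact funext_iff

end GaugeAtlas

end Connection

/-! ### Curvature coefficients in coordinates. -/

section Coefficients

/-- The elements of `so(4,3)` whose only component is the `l`-th basis vector as `θ`. -/
def frameTh (l : Fin 3) : Mat := gammaMatrix (δ l) 0 0 0 0

/-- The elements of `so(4,3)` whose only component is the `p`-th basis vector as `ω`. -/
def frameOm (p : Fin 3) : Mat := gammaMatrix 0 (δ p) 0 0 0

variable {S2 : Fin 3 → Fin 3 → ℝ} {S3 : Fin 3 → Fin 3 → Fin 3 → ℝ}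
  {S4 : Fin 3 → Fin 3 → Fin 3 → Fin 3 → ℝ} {k : Mat}

/-- The coefficients are values of the curvature on vectors with prescribed `γ`. They are therefore
unique, and smooth because such vectors can be chosen smoothly. -/
theorem HasCurvCoeff.s4_eq {m l : Fin 3} (h : HasCurvCoeff S2 S3 S4 (frameTh m) (frameOm l) k)
    (i j : Fin 3) : S4 i m j l = al k i j := by
  rw [h.al_eq]
  simp [curvAl, frameTh, frameOm, δ]

theorem HasCurvCoeff.s3_eq {m : Fin 3}
    (h : HasCurvCoeff S2 S3 S4 (frameTh (m + 1)) (frameTh (m + 2)) k) (i j : Fin 3) :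
    S3 i j m = al k i j / 2 := by
  rw [h.al_eq]
  fin_cases m <;> simp [curvAl, frameTh, δ, ε, Fin.sum_univ_three] <;> ring

theorem HasCurvCoeff.s2_eq {m : Fin 3}
    (h : HasCurvCoeff S2 S3 S4 (frameTh (m + 1)) (frameTh (m + 2)) k) (i : Fin 3) :
    S2 i m = be k i / 2 := by
  rw [h.be_eq]
  fin_cases m <;> simp [curvBe, frameTh, δ, ε, Fin.sum_univ_three] <;> ring

theorem NormalAt.exists_hasCurvCoeff {V : Type*} [AddCommGroup V] [Module ℝ V] {a : V →ₗ[ℝ] Mat}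
    {k : V → V → Mat} (h : NormalAt a k) {e f : Fin 3 → V} (hf : IsFrame a e f) (v w : V) :
    HasCurvCoeff (coeff2 k e) (coeff3 k e) (coeff4 k e f) (a v) (a w) (k v w) :=
  ⟨h.th_eq v w, h.om_eq v w, h.al_eq hf v w, h.be_eq hf v w⟩

theorem HasCurvCoeff.congr {x y x' y' : Mat} (h : HasCurvCoeff S2 S3 S4 x y k) (hx : th x' = th x)
    (hx' : om x' = om x) (hy : th y' = th y) (hy' : om y' = om y) : HasCurvCoeff S2 S3 S4 x' y' k :=
  ⟨h.th_eq, h.om_eq, fun i j => by rw [h.al_eq, curvAl, curvAl, hx, hx', hy, hy'],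
    fun i => by rw [h.be_eq, curvBe, curvBe, hx, hx', hy, hy']⟩

/-- The curvature of the total form is the conjugated curvature of `A` evaluated on base parts, so
`NormalAt.conj` provides the coefficients with respect to a frame for the conjugated gauge. -/
theorem exists_curvCoeff_totalGauge {W : Set E6} {A : E6 → E6 →L[ℝ] Mat} (hA : IsGauge W A)
    (hW : IsOpen W) {z : EuclideanSpace ℝ (Fin 21)} (hz : z ∈ totalDom W) :
    ∃ S2 S3 S4, CurvSymm S2 S3 S4 ∧ ∀ v w, HasCurvCoeff S2 S3 S4 (totalGauge A z v) (totalGauge A z w)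
      (curv (totalGauge A) z v w) := by
  have hd := (smoothH_fibreH W).differentiableAt (isOpen_totalDom hW) hz
  obtain ⟨e, f, hf⟩ := exists_isFrame_of_inj (a := (A (basePart z) : E6 →ₗ[ℝ] Mat)) (hA.inj _ hz.1)
  have hn := (hA.normal _ hz.1).conj hf (fibreH z)
  obtain ⟨e', f', hf'⟩ := exists_isFrame_of_inj
    (a := conjₗ (fibreH z) ∘ₗ (A (basePart z) : E6 →ₗ[ℝ] Mat)) fun v h1 h2 => by
      have h3 : th (A (basePart z) v) = 0 := (th_conj_eq_zero_iff _ (hA.mem hz.1 _)).1 h1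
      exact hA.inj _ hz.1 v h3 (om_conj_eq_zero_imp _ (hA.mem hz.1 _) h3 h2)
  refine ⟨_, _, _, hn.curvSymm hf', fun v w => ?_⟩
  have h1 : curv (totalGauge A) z v w =
      conjₗ (fibreH z) (curv A (basePart z) (basePart v) (basePart w)) := by
    rw [totalGauge, curv_gaugeH (isOpen_totalDom hW) (contDiffOn_pullGauge hA.smooth (isOpen_totalDom hW)
      basePart.contDiff.contDiffOn fun _ hz => hz.1) (smoothH_fibreH W) hz]
    have h2 := curv_pullback (f := basePart) (y := z) ((hA.smooth.contDiffAt
      (hW.mem_nhds hz.1)).differentiableAt (by simp)) basePart.contDiff.contDiffAt v w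
    rw [ContinuousLinearMap.fderiv] at h2
    exact congrArg _ h2
  rw [h1]
  refine (hn.exists_hasCurvCoeff hf' (basePart v) (basePart w)).congr ?_ ?_ ?_ ?_
  all_goals
    rw [totalGauge_apply]
    simp only [th_add, om_add, th_maurerCartan hd, om_maurerCartan hd, add_zero]
    rfl

theorem exists_smooth_totalGauge_eq {W : Set E6} {A : E6 → E6 →L[ℝ] Mat} (hA : IsGauge W A)
    (hW : IsOpen W) {m : Mat} (hm : m ∈ so43) :
    ∃ s : EuclideanSpace ℝ (Fin 21) → EuclideanSpace ℝ (Fin 21), ContDiffOn ℝ ∞ s (totalDom W) ∧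
      ∀ z ∈ totalDom W, totalGauge A z (s z) = m := by
  obtain ⟨s, hs, h⟩ := exists_smooth_preimage (P := fun z => (LinearMap.toContinuousLinearMap
      componentsₗ).comp (totalGauge A z)) (W := totalDom W)
    (contDiffOn_const.clm_comp (contDiffOn_totalGauge hA.smooth hW))
    (fun z hz => bijective_components (finrank_euclideanSpace_fin (𝕜 := ℝ) (n := 21))
      (a := (totalGauge A z : EuclideanSpace ℝ (Fin 21) →ₗ[ℝ] Mat))
      (totalGauge_injective hA hW hz) (totalGauge_mem hA hW hz)) (componentsₗ m)
  refine ⟨s, hs, fun z hz => ?_⟩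
  have h1 : componentsₗ (totalGauge A z (s z)) = componentsₗ m := h z hz
  simp only [componentsₗ_apply, Prod.mk.injEq] at h1
  exact so43_ext (totalGauge_mem hA hW hz _) hm h1.1 h1.2.1 h1.2.2.1 h1.2.2.2.1 h1.2.2.2.2

end Coefficients

section Connection

variable {M : Type u} [TopologicalSpace M] [ChartedSpace (EuclideanSpace ℝ (Fin 6)) M]
  [IsManifold (𝓡 6) ∞ M] {D : ∀ x : M, Submodule ℝ (TangentSpace (𝓡 6) x)}

namespace GaugeAtlas

variable {G : GaugeAtlas D}

theorem curvature_chart_symm (i : M) {z : EuclideanSpace ℝ (Fin 21)} (hz : z ∈ totalDom (G.W i))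
    (v w : EuclideanSpace ℝ (Fin 21)) : G.forms.curvature ((G.chart i).symm z)
      (mfderiv 𝓘(ℝ, EuclideanSpace ℝ (Fin 21)) (𝓡 21) (G.chart i).symm z v)
      (mfderiv 𝓘(ℝ, EuclideanSpace ℝ (Fin 21)) (𝓡 21) (G.chart i).symm z w) =
      curv (totalGauge (G.A i)) z v w := by
  have hO := isOpen_totalDom (G.param i).isOpen_dom
  rw [← curv_gaugeOf isCoframing_forms hO (contMDiffOn_chart_symm i) hz v w]
  have h1 : gaugeOf G.forms (G.chart i).symm =ᶠ[𝓝 z] totalGauge (G.A i) :=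
    Filter.eventuallyEq_of_mem (hO.mem_nhds hz) fun z hz => gaugeOf_chart_symm i hz
  rw [curv_congr h1]

theorem exists_curvCoeff (b : G.Total) : ∃ S2 S3 S4, CurvSymm S2 S3 S4 ∧
    ∀ v w, HasCurvCoeff S2 S3 S4 (G.forms.gamma b v) (G.forms.gamma b w) (G.forms.curvature b v w) := by
  have key : ∀ i, ∀ z ∈ totalDom (G.W i),
      Function.Surjective (mfderiv 𝓘(ℝ, EuclideanSpace ℝ (Fin 21)) (𝓡 21) (G.chart i).symm z) →
      ∃ S2 S3 S4, CurvSymm S2 S3 S4 ∧ ∀ v w : TangentSpace (𝓡 21) ((G.chart i).symm z),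
        HasCurvCoeff S2 S3 S4 (G.forms.gamma ((G.chart i).symm z) v)
          (G.forms.gamma ((G.chart i).symm z) w) (G.forms.curvature ((G.chart i).symm z) v w) := by
    intro i z hz hs
    obtain ⟨S2, S3, S4, hS, h⟩ := exists_curvCoeff_totalGauge (G.gauge i) (G.param i).isOpen_dom hz
    refine ⟨S2, S3, S4, hS, fun v w => ?_⟩
    obtain ⟨(v : EuclideanSpace ℝ (Fin 21)), rfl⟩ := hs v
    obtain ⟨(w : EuclideanSpace ℝ (Fin 21)), rfl⟩ := hs w
    rw [curvature_chart_symm i hz, gamma_chart_symm i hz, gamma_chart_symm i hz]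
    exact h v w
  have h1 := key (proj b) _ (chart_mem_totalDom b)
    (surjective_mfderiv_chart_symm b (mem_extChartAt_target b))
  rwa [(G.chart (proj b)).left_inv (G.mem _)] at h1

/-- A function that expresses a component of the curvature on vectors with fixed values under the
connection is smooth. -/
theorem contMDiff_of_curvature_eq {g : G.Total → ℝ} {x y : Mat} (hx : x ∈ so43) (hy : y ∈ so43)
    (L : Mat →L[ℝ] ℝ) (h : ∀ b v w, G.forms.gamma b v = x → G.forms.gamma b w = y →
      g b = L (G.forms.curvature b v w)) : ContMDiff (𝓡 21) 𝓘(ℝ, ℝ) ∞ g := by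
  intro b
  have hO := isOpen_totalDom (G.param (proj b)).isOpen_dom
  obtain ⟨s, hs, hsx⟩ := exists_smooth_totalGauge_eq (G.gauge (proj b)) (G.param _).isOpen_dom hx
  obtain ⟨t, ht, hty⟩ := exists_smooth_totalGauge_eq (G.gauge (proj b)) (G.param _).isOpen_dom hy
  have h1 := contDiffOn_curv_component hO
    (contDiffOn_totalGauge (G.gauge (proj b)).smooth (G.param _).isOpen_dom) hs ht L
  have h2 := h1.contMDiffOn.comp (contMDiffOn_chart (proj b)) fun b' hb' =>
    (G.chart (proj b)).map_source hb'
  have hU := (isOpen_proj_preimage_U (G := G) (proj b)).mem_nhds (G.mem (proj b))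
  refine (h2.contMDiffAt hU).congr_of_eventuallyEq ?_
  filter_upwards [hU] with b' hb'
  have hz : G.chart (proj b) b' ∈ totalDom (G.W (proj b)) := (G.chart (proj b)).map_source hb'
  have h3 := h ((G.chart (proj b)).symm (G.chart (proj b) b')) _ _
    ((gamma_chart_symm _ hz _).trans (hsx _ hz)) ((gamma_chart_symm _ hz _).trans (hty _ hz))
  rw [curvature_chart_symm _ hz, (G.chart (proj b)).left_inv hb'] at h3
  exact h3

/-- The coefficients are chosen point by point; each is a component of the curvature on vectors with
constant values under the connection, and this makes them smooth. -/
theorem structureEquations_forms : G.forms.StructureEquations := by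
  choose S2 S3 S4 hS h using exists_curvCoeff (G := G)
  rw [FormSystem.structureEquations_iff]
  have hth : ∀ l, frameTh l ∈ so43 := fun l => gammaMatrix_mem_so43 _ _ _ _ _
  have hom : ∀ l, frameOm l ∈ so43 := fun l => gammaMatrix_mem_so43 _ _ _ _ _
  have h' : ∀ {x y : Mat} b v w, G.forms.gamma b v = x → G.forms.gamma b w = y →
      HasCurvCoeff (S2 b) (S3 b) (S4 b) x y (G.forms.curvature b v w) := by
    rintro x y b v w rfl rfl
    exact h b v w
  refine ⟨fun i j b => S2 b i j, fun i j k b => S3 b i j k, fun i k j l b => S4 b i k j l,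
    fun i j => ?_, fun i j k => ?_, fun i k j l => ?_, hS, h⟩
  · refine contMDiff_of_curvature_eq (hth (j + 1)) (hth (j + 2)) ((2 : ℝ)⁻¹ • beL i)
      fun b v w hv hw => ?_
    refine ((h' b v w hv hw).s2_eq i).trans ?_
    simp
    ring
  · refine contMDiff_of_curvature_eq (hth (k + 1)) (hth (k + 2)) ((2 : ℝ)⁻¹ • alL i j)
      fun b v w hv hw => ?_
    refine ((h' b v w hv hw).s3_eq i j).trans ?_
    simp
    ring
  · refine contMDiff_of_curvature_eq (hth k) (hom l) (alL i j) fun b v w hv hw => ?_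
    exact (h' b v w hv hw).s4_eq i j

end GaugeAtlas

theorem nonempty_adaptedBundle [T2Space M] [SecondCountableTopology M]
    (hD : IsMaximallyNonintegrable D) : Nonempty (AdaptedBundle D) := by
  obtain ⟨G⟩ := nonempty_gaugeAtlas hD
  exact ⟨{
    carrier := G.Total
    proj := GaugeAtlas.proj
    act := GaugeAtlas.act
    forms := G.forms
    principal := GaugeAtlas.isPrincipalBundle
    coframing := GaugeAtlas.isCoframing_forms
    cartan := GaugeAtlas.isCartanConnection_forms
    structureEquations := GaugeAtlas.structureEquations_forms
    adapted := GaugeAtlas.mfderiv_proj_mem_iff }⟩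

end Connection

end ThreePlane

end

theorem mainTheorem2 {M M' : Type u}
    [TopologicalSpace M] [ChartedSpace (EuclideanSpace ℝ (Fin 6)) M]
    [IsManifold (𝓡 6) ∞ M] [T2Space M] [SecondCountableTopology M]
    [TopologicalSpace M'] [ChartedSpace (EuclideanSpace ℝ (Fin 6)) M']
    [IsManifold (𝓡 6) ∞ M'] [T2Space M'] [SecondCountableTopology M']
    (D : ∀ x : M, Submodule ℝ (TangentSpace (𝓡 6) x))
    (hD : ThreePlane.IsMaximallyNonintegrable D)
    (D' : ∀ x : M', Submodule ℝ (TangentSpace (𝓡 6) x))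
    (hD' : ThreePlane.IsMaximallyNonintegrable D') :
    Nonempty (ThreePlane.AdaptedBundle D) ∧
    ∀ (P : ThreePlane.AdaptedBundle D) (P' : ThreePlane.AdaptedBundle D'),
      (∀ φ : M ≃ₘ⟮𝓡 6, 𝓡 6⟯ M', ThreePlane.PreservesPlanes D D' φ →
        ∃ Φ : P.carrier ≃ₘ⟮𝓡 21, 𝓡 21⟯ P'.carrier,
          (∀ b, P'.proj (Φ b) = φ (P.proj b)) ∧
          P.forms.PreservedBy P'.forms Φ ∧
          (∀ b h, Φ (P.act b h) = P'.act (Φ b) h) ∧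
          ∀ Ψ : P.carrier ≃ₘ⟮𝓡 21, 𝓡 21⟯ P'.carrier,
            (∀ b, P'.proj (Ψ b) = φ (P.proj b)) → P.forms.PreservedBy P'.forms Ψ → Ψ = Φ) ∧
      (∀ Φ : P.carrier ≃ₘ⟮𝓡 21, 𝓡 21⟯ P'.carrier,
        (∀ b h, Φ (P.act b h) = P'.act (Φ b) h) → P.forms.PreservedBy P'.forms Φ →
        ∃! φ : M ≃ₘ⟮𝓡 6, 𝓡 6⟯ M', ThreePlane.PreservesPlanes D D' φ ∧
          ∀ b, P'.proj (Φ b) = φ (P.proj b)) :=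
  ⟨ThreePlane.nonempty_adaptedBundle hD, fun P P' =>
    ⟨fun φ hφ => ThreePlane.exists_lift_diffeomorph P P' φ hφ,
      fun Φ he hf => ThreePlane.existsUnique_descended_diffeomorph Φ he hf⟩⟩
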